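/- **Setting.** Let $D_4=\{n\in\mathbb Z^4: |n|^2 \text{ even}\}$. A rotation $R\in SO(4)$ is a coincidence rotation of $D_4$ if $D_4\cap RD_4$ has finite index in $D_4$; this index is its coincidence index $\Sigma_F(R)$. Let $G_F$ be the group of the rotations $R$ with $RD_4=D_4$. Coincidence rotations $R,R'$ (and the corresponding CSLs) are F-equivalent if $R=QR'Q'$ with $Q,Q'\in G_F$. For primitive integral quaternions $p,q$ such that $|p|^2|q|^2$ is a square (an admissible pair), $R(p,q)x=px\bar q/|pq|$; integral quaternions are identified with vectors of $\mathbb Z^4$. Call $q\sim q'$ if, after normalization to length 1, $q'=sqs'$ with $s,s'$ in the group of the 48 quaternions obtained by permuting the coordinates of $(\pm1,0,0,0)$, $\frac1{\sqrt2}(\pm1,\pm1,0,0)$, $\frac12(\pm1,\pm1,\pm1,\pm1)$. A primitive quaternion has type $0$ if it is $\sim(1,0,0,0)$; type $1$ if $\sim(0,1,1,1)$; otherwise type $2$, $3$, $4$ if it is equivalent to a primitive quaternion of the form $(m,n,n,n)$, $(m,n,0,0)$, $(m,n,n,0)$, respectively, and type $5$ (general) in all remaining cases. $R$ has type $(i,j)$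 if $R=R(p,q)$ for an admissible pair with $p$ of type $i$ and $q$ of type $j$. For an integer $\Sigma\ge1$ let $n_{Fij}=n_{Fij}(\Sigma)$ be the number of F-equivalence classes of coincidence rotations of type $(i,j)$ with $\Sigma_F(R)=\Sigma$ (the number of F-inequivalent CSLs of that type), and let $f_F(\Sigma)$ be the number of classes $RG_F$ of coincidence rotations with $\Sigma_F(R)=\Sigma$. Let $(g_{Fij})_{0\le i,j\le5}$ be the symmetric matrix with rows $(1,0,8,6,12,24)$, $(0,16,32,24,48,96)$, $(8,32,32,48,96,96)$, $(6,24,48,36,72,144)$, $(12,48,96,72,144,288)$, $(24,96,96,144,288,288)$. Write $\Sigma=\prod_{p\mid\Sigma}p^{t_p}$, let $\omega(n)$ be the number of different prime factors of $n$, and put $f(\Sigma)=\prod_{p\mid\Sigma}(p+1)p^{t_p-1}$ if $\Sigma$ is odd and $f(\Sigma)=0$ otherwise. **Claim.** All these sets are finite, $n_{Fij}=n_{Fji}$, and every double coset $G_FRG_F$ of type $(i,j)$ consists of $576\,g_{Fij}$ rotations. Moreover the following formulas hold; whenever the condition stated with a formula fails, the number is $0$. 1. $n_{F00}=1$ if $\Sigma=1$;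 $n_{F11}=1$ if $\Sigma=3$; $n_{F01}=n_{F13}=0$ always. 2. $n_{F02},n_{F03},n_{F04}=2^{\omega(\Sigma)-1}$ if $\Sigma>1$ is a square and all its prime factors are, respectively, $\equiv1\ (6)$, $\equiv1\ (4)$, $\equiv1$ or $3\ (8)$. 3. $n_{F12}=2^{\omega(a)-1}$ if $\Sigma=3a^2$, $a>1$, all prime factors of $a$ being $\equiv1\ (6)$. $n_{F14}=2^{\omega(\Sigma)-1}$ if $\Sigma=3a^2$, $a>1$, all prime factors of $\Sigma$ being $\equiv1$ or $3\ (8)$. 4. $n_{F22}=2\cdot4^{k-1}\prod_{p\mid a}t_p-\delta2^k$ if $\Sigma=3^ra$ with $r\in\{0,1\}$, $a>1$, all prime factors of $a$ being $\equiv1\ (6)$; $k=\omega(a)$, and $\delta=1$ if $a$ is a square, $\delta=0$ otherwise. 5. $n_{F23}=2^{k_1+k_2}4^{k_3-1}\prod_{p\in K_3}t_p-\delta_12^{k_2+k_3-2}-\delta_22^{k_1+k_3-2}$ if $\Sigma>1$, every prime factor is $\equiv1\ (4)$ or $\equiv1\ (6)$, and those satisfying only one of the congruences have even exponents. Here $K_1$,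 $K_2$, $K_3$ are the sets of prime factors that are $\equiv1\ (4)$ only, $\equiv1\ (6)$ only, and both, $k_i=|K_i|$; for $i=1,2$, $\delta_i=1$ if $k_i=0$ and all $t_p$, $p\in K_3$, are even, and $\delta_i=0$ otherwise. 6. $n_{F24}=2^{k_1+k_2}4^{k_3-1}\prod_{p\in K_3}t_p-\frac12(n_{F02}+2n_{F12}+n_{F04}+n_{F14})$ if every prime factor of $\Sigma$ is $\equiv1\ (6)$ or $\equiv1,3\ (8)$, there is at least one of either kind, and the prime factors other than $3$ that are of only one kind have even exponents. Here $K_1$, $K_2$, $K_3$ are the sets of prime factors that are $\equiv1\ (6)$ only, $\equiv1,3\ (8)$ only (this includes the prime $3$ if $3\mid\Sigma$), and both; $k_i=|K_i|$. 7. $n_{F33}=4^{k-1}\prod_{p\mid\Sigma}t_p-\delta2^{k-1}$ if $\Sigma>1$ and all prime factors are $\equiv1\ (4)$; $k=\omega(\Sigma)$, $\delta=1$ if $\Sigma$ is a square, $\delta=0$ otherwise. 8. $n_{F34}=2^{k_1+k_2}4^{k_3-1}\prod_{p\in K_3}t_p-\frac12(n_{F03}+n_{F04})$ if every prime factor of $\Sigma$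 is $\equiv1\ (4)$ or $\equiv1,3\ (8)$, there is at least one of either kind, and those of only one kind have even exponents. Here $K_1$, $K_2$, $K_3$ are the sets of prime factors that are $\equiv5$, $\equiv3$, $\equiv1\ (8)$; $k_i=|K_i|$. 9. $n_{F44}=4^{k-1}\prod_{p\mid\Sigma}t_p-\delta2^{k-1}$ if $\Sigma\ne1,3$ and all prime factors are $\equiv1,3\ (8)$; $k=\omega(\Sigma)$, $\delta=1$ if $\Sigma=a^2$, $\delta=2$ if $\Sigma=3a^2$, $\delta=0$ otherwise. 10. $n_{F05}=0$ unless $\Sigma$ is a square, $n_{F15}=0$ unless $\Sigma=3a^2$, and $$n_{Fi5}=\frac1{g_{Fi5}}\Bigl(m_{Fi}-\sum_{j=0}^4g_{Fij}n_{Fij}\Bigr)\qquad(0\le i\le4),$$ in particular $n_{F25}=\frac1{96}\bigl(m_{F2}-\sum_{j=0}^4g_{F2j}n_{F2j}\bigr)$. The numbers $m_{Fi}$ are as follows, with $A_p=(t_p+1)(p+1)p^{t_p-1}+2\frac{p^{t_p-1}-1}{p-1}$ and $B_p=(p+1)p^{t_p-1}$. $m_{F0}=f(\Sigma)$ if $\Sigma$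 is a square and $0$ otherwise; $m_{F1}=4f(\Sigma)$ if $\Sigma=3a^2$ and $0$ otherwise. For $i=2,3,4$, $m_{Fi}=0$ if $\Sigma$ is even or if some $t_p$, $p\in J$, is odd; in all other cases - $m_{F2}=4\,[4\cdot3^{r-1}]\bigl(\prod_{p\in I}A_p-\delta\prod_{p\in I}B_p\bigr)\prod_{p\in J}B_p$, where $3^r$ is the exact power of $3$ in $\Sigma$, $[x]$ is the integer part of $x$, $I$ is the set of prime factors of $\Sigma$ that are $\equiv1\ (6)$, and $J$ the set of those that are $\not\equiv1\ (6)$ and $\ne3$; - $m_{F3}=3\bigl(\prod_{p\in I}A_p-\delta\prod_{p\in I}B_p\bigr)\prod_{p\in J}B_p$, where $I$ and $J$ are the sets of prime factors of $\Sigma$ that are $\equiv1\ (4)$ and $\not\equiv1\ (4)$; - $m_{F4}=6\prod_{p\in I}A_p\prod_{p\in J}B_p-6\varepsilon f(\Sigma)$, where $I$ and $J$ are the sets of prime factors of $\Sigma$ that are $\equiv1,3\ (8)$ and $\not\equiv1,3\ (8)$, and $\varepsilon=1$ if $\Sigma=a^2$, $\varepsilon=2$ if $\Sigma=3a^2$,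 $\varepsilon=0$ otherwise; here $\delta=1$ if all $t_p$, $p\in I$, are even, and $\delta=0$ otherwise. 11. $f_F(\Sigma)=0$ if $\Sigma$ is even, and $f_F(\Sigma)=\prod_{p\mid\Sigma}\frac{p+1}{p-1}p^{t_p-1}\bigl(p^{t_p+1}+p^{t_p-1}-2\bigr)$ if $\Sigma$ is odd. Furthermore $$f_F(\Sigma)=\sum_{i,j=0}^5g_{Fij}\,n_{Fij}(\Sigma),$$ which determines $n_{F55}$ since $g_{F55}=288\neq0$. -/

import Mathlib

open scoped Quaternion

namespace HypercubicCSL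

/-! ### The lattice `D₄`, its rotations and coincidence rotations -/

/-- The group of rotations of `ℝ⁴`. -/
abbrev SO4 : Type := Matrix.specialOrthogonalGroup (Fin 4) ℝ

/-- The centred hypercubic lattice `D₄`: all integer vectors `n` with `|n|²` even. -/
def D4 : AddSubgroup (Fin 4 → ℝ) where
  carrier := {x | ∃ n : Fin 4 → ℤ, (∀ i, x i = n i) ∧ Even (∑ i, n i ^ 2)}
  zero_mem' := ⟨0, by simp, by simp⟩
  add_mem' := by
    rintro x y ⟨m, hm, hm2⟩ ⟨n, hn, hn2⟩
    refine ⟨m + n, fun i => by simp [hm i, hn i], ?_⟩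
    have h : ∑ i, (m + n) i ^ 2 = ∑ i, m i ^ 2 + ∑ i, n i ^ 2 + 2 * ∑ i, m i * n i := by
      rw [Finset.mul_sum, ← Finset.sum_add_distrib, ← Finset.sum_add_distrib]
      exact Finset.sum_congr rfl fun i _ => by simp only [Pi.add_apply]; ring
    rw [h]
    exact (hm2.add hn2).add (even_two_mul _)
  neg_mem' := by
    rintro x ⟨m, hm, hm2⟩
    exact ⟨-m, fun i => by simp [hm i], by simpa using hm2⟩

/-- The rotated lattice `R L`. -/
def rotate (R : SO4) (L : AddSubgroup (Fin 4 → ℝ)) : AddSubgroup (Fin 4 → ℝ) :=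
  L.map (Matrix.mulVecLin R.1).toAddMonoidHom

/-- `L(R) = L ∩ R L` for `L = D₄`. -/
def csl (R : SO4) : AddSubgroup (Fin 4 → ℝ) := D4 ⊓ rotate R D4

/-- `R` is a coincidence rotation of `D₄`: the subgroup `L(R)` has finite index in `L = D₄`. -/
def IsCoincidence (R : SO4) : Prop := (csl R).IsFiniteRelIndex D4

/-- The coincidence index `Σ_F(R)`: the index of `L(R)` in `L = D₄`. -/
noncomputable def coincidenceIndex (R : SO4) : ℕ := (csl R).relIndex D4

theorem rotate_one (L : AddSubgroup (Fin 4 → ℝ)) : rotate 1 L = L := by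
  ext x
  simp [rotate, AddSubgroup.mem_map]

theorem rotate_mul (R S : SO4) (L : AddSubgroup (Fin 4 → ℝ)) :
    rotate (R * S) L = rotate R (rotate S L) := by
  ext x
  simp [rotate, AddSubgroup.mem_map, Matrix.mulVec_mulVec]

/-- The group `G_F` of symmetry rotations of `D₄`. -/
def GF : Subgroup SO4 where
  carrier := {Q | rotate Q D4 = D4}
  one_mem' := rotate_one D4
  mul_mem' := by
    intro Q Q' hQ hQ'
    change rotate (Q * Q') D4 = D4
    rw [rotate_mul, show rotate Q' D4 = D4 from hQ', show rotate Q D4 = D4 from hQ]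
  inv_mem' := by
    intro Q hQ
    change rotate Q⁻¹ D4 = D4
    conv_lhs => rw [← show rotate Q D4 = D4 from hQ]
    rw [← rotate_mul, inv_mul_cancel, rotate_one]

/-! ### Quaternions -/

/-- An integral quaternion is primitive if its four coefficients have no common divisor
other than `±1`. -/
def IsPrimitive (q : ℍ[ℤ]) : Prop :=
  ∀ d : ℤ, d ∣ q.re → d ∣ q.imI → d ∣ q.imJ → d ∣ q.imK → IsUnit d

/-- The normalized quaternion `q / |q|`. -/
noncomputable def normalize (q : ℍ[ℤ]) : ℍ[ℝ] :=
  (1 / √((Quaternion.normSq q : ℤ) : ℝ)) • (⟨q.re, q.imI, q.imJ, q.imK⟩ : ℍ[ℝ])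

/-- The group of the 48 unit quaternions `(±1,0,0,0)`, `(±1,±1,0,0)/√2`, `(±1,±1,±1,±1)/2` and
their permutations. These are exactly the normalizations of the primitive integral quaternions
of squared norm `1`, `2` and `4`, respectively. -/
def cubicGroup : Set ℍ[ℝ] :=
  {x | ∃ s : ℍ[ℤ], IsPrimitive s ∧
    (Quaternion.normSq s = 1 ∨ Quaternion.normSq s = 2 ∨ Quaternion.normSq s = 4) ∧
    x = normalize s}

/-- Equivalence of quaternions: `q' = s q s'` (after normalization) with `s`, `s'` in the
group of order 48. -/
def QuatEquiv (q q' : ℍ[ℤ]) : Prop :=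
  ∃ s ∈ cubicGroup, ∃ s' ∈ cubicGroup, normalize q' = s * normalize q * s'

/-- `q` is equivalent to a primitive quaternion `(m,n,n,n)`. -/
def EquivMNNN (q : ℍ[ℤ]) : Prop :=
  ∃ m n : ℤ, IsPrimitive ⟨m, n, n, n⟩ ∧ QuatEquiv q ⟨m, n, n, n⟩

/-- `q` is equivalent to a primitive quaternion `(m,n,0,0)`. -/
def EquivMN00 (q : ℍ[ℤ]) : Prop :=
  ∃ m n : ℤ, IsPrimitive ⟨m, n, 0, 0⟩ ∧ QuatEquiv q ⟨m, n, 0, 0⟩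

/-- `q` is equivalent to a primitive quaternion `(m,n,n,0)`. -/
def EquivMNN0 (q : ℍ[ℤ]) : Prop :=
  ∃ m n : ℤ, IsPrimitive ⟨m, n, n, 0⟩ ∧ QuatEquiv q ⟨m, n, n, 0⟩

/-- The two exceptional classes, those of `(1,0,0,0)` and `(0,1,1,1)`. -/
def IsExceptional (q : ℍ[ℤ]) : Prop :=
  QuatEquiv q ⟨1, 0, 0, 0⟩ ∨ QuatEquiv q ⟨0, 1, 1, 1⟩

/-- The six types of quaternions:
`0`: `(1,0,0,0)`, `1`: `(0,1,1,1)`, `2`: `(m,n,n,n)`, `3`: `(m,n,0,0)`, `4`: `(m,n,n,0)`,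
`5`: general, where each of the types `2`, `3`, `4` excludes the two exceptional classes and
the general type consists of what is left. -/
def HasType : Fin 6 → ℍ[ℤ] → Prop :=
  ![fun q => QuatEquiv q ⟨1, 0, 0, 0⟩,
    fun q => QuatEquiv q ⟨0, 1, 1, 1⟩,
    fun q => EquivMNNN q ∧ ¬ IsExceptional q,
    fun q => EquivMN00 q ∧ ¬ IsExceptional q,
    fun q => EquivMNN0 q ∧ ¬ IsExceptional q,
    fun q => ¬ IsExceptional q ∧ ¬ EquivMNNN q ∧ ¬ EquivMN00 q ∧ ¬ EquivMNN0 q]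

/-- The unit quaternions `u₀ = 1`, `u₁ = i`, `u₂ = j`, `u₃ = k`. -/
def unitQuat : Fin 4 → ℍ[ℤ] :=
  ![⟨1, 0, 0, 0⟩, ⟨0, 1, 0, 0⟩, ⟨0, 0, 1, 0⟩, ⟨0, 0, 0, 1⟩]

/-- The integer matrix `M(p,q)` of the map `x ↦ p x q̄`. -/
def intMatrix (p q : ℍ[ℤ]) : Matrix (Fin 4) (Fin 4) ℤ :=
  Matrix.of fun r c =>
    let x := p * unitQuat c * star q
    ![x.re, x.imI, x.imJ, x.imK] r

/-- The matrix `R(p,q) = M(p,q) / |p q|`. -/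
noncomputable def rotMatrix (p q : ℍ[ℤ]) : Matrix (Fin 4) (Fin 4) ℝ :=
  (1 / √((Quaternion.normSq (p * q) : ℤ) : ℝ)) • (intMatrix p q).map (fun n : ℤ => (n : ℝ))

/-- An admissible pair of primitive quaternions: `|p q|` is an integer. -/
def IsAdmissible (p q : ℍ[ℤ]) : Prop :=
  IsPrimitive p ∧ IsPrimitive q ∧ IsSquare (Quaternion.normSq (p * q))

/-- `R = R(p,q)` for an admissible pair with `p` of type `i` and `q` of type `j`. -/
def RotHasType (i j : Fin 6) (R : SO4) : Prop :=
  ∃ p q : ℍ[ℤ], IsAdmissible p q ∧ HasType i p ∧ HasType j q ∧ R.1 = rotMatrix p q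

/-! ### The numbers that are counted -/

/-- The `F`-equivalence classes (double cosets `G_F R G_F`) of coincidence rotations of type
`(i,j)` and coincidence index `S`. -/
def classes (i j : Fin 6) (S : ℕ) : Set (DoubleCoset.Quotient (GF : Set SO4) (GF : Set SO4)) :=
  {c | ∃ R : SO4, IsCoincidence R ∧ coincidenceIndex R = S ∧ RotHasType i j R ∧
    c = DoubleCoset.mk GF GF R}

/-- `n_{Fij}`: the number of `F`-inequivalent CSLs of type `(i,j)` and index `S`. -/
noncomputable def nF (i j : Fin 6) (S : ℕ) : ℚ := ((classes i j S).ncard : ℚ)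

/-- The classes `R G_F` of coincidence rotations of index `S`. -/
def rotationClasses (S : ℕ) : Set (SO4 ⧸ GF) :=
  {c | ∃ R : SO4, IsCoincidence R ∧ coincidenceIndex R = S ∧ c = (R : SO4 ⧸ GF)}

/-- The numbers `g_{Fij} = |G_F R G_F| / 576` for `R` of type `(i,j)`. No coincidence rotation has
type `(0,1)` or `(1,0)`; the entry is then `0`. -/
def gF : Matrix (Fin 6) (Fin 6) ℚ :=
  !![1, 0, 8, 6, 12, 24;
     0, 16, 32, 24, 48, 96;
     8, 32, 32, 48, 96, 96;
     6, 24, 48, 36, 72, 144;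
     12, 48, 96, 72, 144, 288;
     24, 96, 96, 144, 288, 288]

/-! ### Arithmetic functions of the index -/

/-- The prime divisors of `S` that satisfy `P`. -/
def primesWith (S : ℕ) (P : ℕ → Prop) [DecidablePred P] : Finset ℕ := S.primeFactors.filter P

/-- `p ≡ 1` or `3 (mod 8)`. -/
abbrev OneThreeModEight (p : ℕ) : Prop := p % 8 = 1 ∨ p % 8 = 3

/-- `∏ t_p` over the primes in `A`, where `p ^ t_p` is the exact power of `p` in `S`. -/
def expProd (S : ℕ) (A : Finset ℕ) : ℚ := ∏ p ∈ A, (S.factorization p : ℚ)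

/-- All exponents `t_p`, `p ∈ A`, are even. -/
abbrev AllEven (S : ℕ) (A : Finset ℕ) : Prop := ∀ p ∈ A, Even (S.factorization p)

/-- `∏ (p + 1) p ^ (t_p - 1)` over the primes in `A`. -/
def cubicProd (S : ℕ) (A : Finset ℕ) : ℚ :=
  ∏ p ∈ A, ((p : ℚ) + 1) * (p : ℚ) ^ (S.factorization p - 1)

/-- The three-dimensional counting function: multiplicative, `f(2^r) = 0` and
`f(p^r) = (p + 1) p ^ (r - 1)` for odd primes `p` and `r ≥ 1`. -/
def cubicCount (S : ℕ) : ℚ := if Odd S then cubicProd S S.primeFactors else 0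

/-- The total number `f_F`: multiplicative, `f_F(2^r) = 0` and
`f_F(p^r) = (p + 1) / (p - 1) * p ^ (r - 1) * (p ^ (r + 1) + p ^ (r - 1) - 2)` for odd primes `p`
and `r ≥ 1`. -/
def fF (S : ℕ) : ℚ :=
  if Odd S then ∏ p ∈ S.primeFactors, ((p : ℚ) + 1) / ((p : ℚ) - 1) *
    (p : ℚ) ^ (S.factorization p - 1) *
    ((p : ℚ) ^ (S.factorization p + 1) + (p : ℚ) ^ (S.factorization p - 1) - 2)
  else 0

/-- `∏ ((t_p + 1) (p + 1) p ^ (t_p - 1) + 2 (p ^ (t_p - 1) - 1) / (p - 1))` over the primes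
in `A`. -/
def pairProd (S : ℕ) (A : Finset ℕ) : ℚ :=
  ∏ p ∈ A, (((S.factorization p : ℚ) + 1) * ((p : ℚ) + 1) * (p : ℚ) ^ (S.factorization p - 1) +
    2 * ((p : ℚ) ^ (S.factorization p - 1) - 1) / ((p : ℚ) - 1))

/-- The total number of classes `R(p,q) G_F` of index `S` with `p ∼ (1,0,0,0)`. -/
def mF0 (S : ℕ) : ℚ := if IsSquare S then cubicCount S else 0

/-- The total number of classes `R(p,q) G_F` of index `S` with `p ∼ (0,1,1,1)`. -/
def mF1 (S : ℕ) : ℚ := if 3 ∣ S ∧ IsSquare (S / 3) then 4 * cubicCount S else 0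

/-- The total number of classes `R(p,q) G_F` of index `S` with `p` of type `(m,n,n,n)`. The factor
`if … then 1 else 4 * 3 ^ (r - 1)` is the integer part of `4 * 3 ^ (r - 1)`, where `3 ^ r` is the
exact power of `3` in `S`. -/
def mF2 (S : ℕ) : ℚ :=
  let I := primesWith S (fun p => p % 6 = 1)
  let J := primesWith S (fun p => p % 6 ≠ 1 ∧ p ≠ 3)
  if Odd S ∧ AllEven S J then
    4 * (if S.factorization 3 = 0 then 1 else 4 * 3 ^ (S.factorization 3 - 1)) *
      (pairProd S I - (if AllEven S I then cubicProd S I else 0)) * cubicProd S J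
  else 0

/-- The total number of classes `R(p,q) G_F` of index `S` with `p` of type `(m,n,0,0)`. -/
def mF3 (S : ℕ) : ℚ :=
  let I := primesWith S (fun p => p % 4 = 1)
  let J := primesWith S (fun p => p % 4 ≠ 1)
  if Odd S ∧ AllEven S J then
    3 * (pairProd S I - (if AllEven S I then cubicProd S I else 0)) * cubicProd S J
  else 0

/-- The total number of classes `R(p,q) G_F` of index `S` with `p` of type `(m,n,n,0)`. -/
def mF4 (S : ℕ) : ℚ :=
  let I := primesWith S OneThreeModEight
  let J := primesWith S (fun p => ¬ OneThreeModEight p)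
  if Odd S ∧ AllEven S J then
    6 * pairProd S I * cubicProd S J - (if IsSquare S then 6 * cubicCount S else 0)
      - (if 3 ∣ S ∧ IsSquare (S / 3) then 12 * cubicCount S else 0)
  else 0

/-! ### The closed formulas

In all of them the value is `0` if the stated condition on the index `S` is violated. -/

/-- `2 ^ (k - 1)`, `k` the number of prime divisors of the square `S > 1`, all of which have to
satisfy `P`. -/
def squareFormula (P : ℕ → Prop) [DecidablePred P] (S : ℕ) : ℚ :=
  if 1 < S ∧ IsSquare S ∧ ∀ p ∈ S.primeFactors, P p then 2 ^ (S.primeFactors.card - 1) else 0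

/-- Type `(0,1,1,1)`, `(m,n,n,n)`; `S = 3 a²` with `a > 1`, and `k` counts the primes of `a`. -/
def formula12 (S : ℕ) : ℚ :=
  if 3 < S ∧ 3 ∣ S ∧ IsSquare (S / 3) ∧ ∀ p ∈ (S / 3).primeFactors, p % 6 = 1 then
    2 ^ ((S / 3).primeFactors.card - 1)
  else 0

/-- Type `(0,1,1,1)`, `(m,n,n,0)`; `S = 3 a²` with `a > 1`, and `k` counts the primes of `S`. -/
def formula14 (S : ℕ) : ℚ :=
  if 3 < S ∧ 3 ∣ S ∧ IsSquare (S / 3) ∧ ∀ p ∈ S.primeFactors, OneThreeModEight p then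
    2 ^ (S.primeFactors.card - 1)
  else 0

/-- Type `(m,n,n,n)`, `(m',n',n',n')`; `S = 3 ^ r a`, `r ≤ 1`, and `A` is the set of primes
of `a > 1`. -/
def formula22 (S : ℕ) : ℚ :=
  let A := primesWith S (fun p => p ≠ 3)
  if S.factorization 3 ≤ 1 ∧ A.Nonempty ∧ ∀ p ∈ A, p % 6 = 1 then
    2 * 4 ^ (A.card - 1) * expProd S A - (if AllEven S A then 2 ^ A.card else 0)
  else 0

/-- Type `(m,n,n,n)`, `(m',n',0,0)`. -/
def formula23 (S : ℕ) : ℚ :=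
  let K₁ := primesWith S (fun p => p % 4 = 1 ∧ p % 6 ≠ 1)
  let K₂ := primesWith S (fun p => p % 6 = 1 ∧ p % 4 ≠ 1)
  let K₃ := primesWith S (fun p => p % 4 = 1 ∧ p % 6 = 1)
  if 1 < S ∧ (∀ p ∈ S.primeFactors, p % 4 = 1 ∨ p % 6 = 1) ∧ AllEven S K₁ ∧ AllEven S K₂ then
    2 ^ (K₁.card + K₂.card) * 4 ^ ((K₃.card : ℤ) - 1) * expProd S K₃
      - (if AllEven S K₃ ∧ K₁.card = 0 then 2 ^ ((K₂.card : ℤ) + K₃.card - 2) else 0)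
      - (if AllEven S K₃ ∧ K₂.card = 0 then 2 ^ ((K₁.card : ℤ) + K₃.card - 2) else 0)
  else 0

/-- Type `(m,n,n,n)`, `(m',n',n',0)`. Here `K₂` contains the prime `3` if `3 ∣ S`; no condition is
imposed on the exponent of `3`. -/
def formula24 (S : ℕ) : ℚ :=
  let K₁ := primesWith S (fun p => p % 6 = 1 ∧ ¬ OneThreeModEight p)
  let K₂ := primesWith S (fun p => OneThreeModEight p ∧ p % 6 ≠ 1)
  let K₃ := primesWith S (fun p => p % 6 = 1 ∧ OneThreeModEight p)
  if (∀ p ∈ S.primeFactors, p % 6 = 1 ∨ OneThreeModEight p) ∧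
      AllEven S K₁ ∧ AllEven S (K₂.erase 3) ∧
      (∃ p ∈ S.primeFactors, p % 6 = 1) ∧ (∃ p ∈ S.primeFactors, OneThreeModEight p) then
    2 ^ (K₁.card + K₂.card) * 4 ^ ((K₃.card : ℤ) - 1) * expProd S K₃
      - 1 / 2 * (squareFormula (fun p => p % 6 = 1) S + 2 * formula12 S
          + squareFormula OneThreeModEight S + formula14 S)
  else 0

/-- Type `(m,n,0,0)`, `(m',n',0,0)`. -/
def formula33 (S : ℕ) : ℚ :=
  let A := S.primeFactors
  if 1 < S ∧ ∀ p ∈ A, p % 4 = 1 then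
    4 ^ (A.card - 1) * expProd S A - (if IsSquare S then 2 ^ (A.card - 1) else 0)
  else 0

/-- Type `(m,n,0,0)`, `(m',n',n',0)`. -/
def formula34 (S : ℕ) : ℚ :=
  let K₁ := primesWith S (fun p => p % 4 = 1 ∧ ¬ OneThreeModEight p)
  let K₂ := primesWith S (fun p => p % 8 = 3)
  let K₃ := primesWith S (fun p => p % 8 = 1)
  if (∀ p ∈ S.primeFactors, p % 4 = 1 ∨ OneThreeModEight p) ∧
      AllEven S K₁ ∧ AllEven S K₂ ∧
      (∃ p ∈ S.primeFactors, p % 4 = 1) ∧ (∃ p ∈ S.primeFactors, OneThreeModEight p) then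
    2 ^ (K₁.card + K₂.card) * 4 ^ ((K₃.card : ℤ) - 1) * expProd S K₃
      - 1 / 2 * (squareFormula (fun p => p % 4 = 1) S + squareFormula OneThreeModEight S)
  else 0

/-- Type `(m,n,n,0)`, `(m',n',n',0)`. -/
def formula44 (S : ℕ) : ℚ :=
  let A := S.primeFactors
  if 1 < S ∧ S ≠ 3 ∧ ∀ p ∈ A, OneThreeModEight p then
    4 ^ (A.card - 1) * expProd S A
      - (if IsSquare S then 1 else if 3 ∣ S ∧ IsSquare (S / 3) then 2 else 0) * 2 ^ (A.card - 1)
  else 0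

end HypercubicCSL

/-! The count reduces to linear algebra modulo odd integers. A coincidence rotation is rational.
Composed with a left multiplication that makes it fix 1, it sends i, j, k to multiples of a frame
that obeys the quaternion relations up to a scalar. A Skolem–Noether average then conjugates this
frame to i, j, k. Hence every coincidence rotation is some R(p,q) with (p,q) admissible
(`IsCoincidence.exists_rotMatrix`), and the pair is unique up to a common sign
(`rotMatrix_injective`).

Modulo an odd m the integral quaternions become the 2 × 2 matrices (`nonempty_splitting`), with norm
as determinant and conjugation as adjugate. A primitive quaternion becomes a matrix equivalent to
diag(1, det) (`UnitContent.exists_diagonal`). The lattice D₄ ∩ R D₄ is the kernel of x ↦ p̄xq modulo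
the odd part c of |pq|. The size of the image of this map shows that the index is the lcm of the odd
parts of |p|² and |q|² (`relIndex_csl`).

Rotations of index 1 come from pairs of cubic quaternions. So the coset R G_F is determined by the
classes of p and q modulo right multiplication by the cubic group, that is, by two right ideals
(`mk_eq_mk_iff`). Ideals of odd norm m correspond to points of the projective line over ℤ/m, and
there are m ∏ (1 + 1/p) of them (`ncard_idealSet`).

The type of p is read off from its axes: pure v of squared length d ∈ {1, 2, 3} such that left
multiplication by v preserves the ideal of p (`exists_quatEquiv_iff_hasAxis`). This says that the
line of p is an eigenline of v. Since v² = -d, the eigenvalues are the square roots of -d modulo m,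
with one eigenline for each (`ncard_fixedIdeals`). Two non-parallel axes would make the odd norm
divide the norm of their commutator, which forces it to be 1 or 3 (`eq_or_eq_neg_or_oddNorm_dvd`).
So outside the exceptional classes the axis is unique up to sign. This gives the number of ideals of
each type, and also the stabilizers in the cubic group and, by orbit counting, the numbers g
(`ncard_cosetOrbit`).

Consequently g_ij n_ij(S) is the sum of T_i(m) T_j(n) over all m, n with lcm S and mn a square,
where T_i counts ideals of type i (`gF_mul_nF`). Up to corrections at m = 1 and m = 3, T_2, T_3, T_4
are multiples of multiplicative root-counting functions. The lcm convolution preserves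
multiplicativity (`isMult_lcmSum`), so evaluation at prime powers yields every formula. Convolution
with the function counting all ideals gives the totals m_Fi and f_F, and these determine the general
type. -/

namespace HypercubicCSL

/-! ### Splitting the quaternions modulo an odd integer -/

/-- The integral quaternion with the given coordinates. -/
def quat {R : Type*} [CommRing R] (a b c d : R) : ℍ[R] := ⟨a, b, c, d⟩

section
variable {R : Type*} [CommRing R] (a b c d : R)
@[simp] theorem quat_re : (quat a b c d).re = a := rfl
@[simp] theorem quat_imI : (quat a b c d).imI = b := rfl
@[simp] theorem quat_imJ : (quat a b c d).imJ = c := rfl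
@[simp] theorem quat_imK : (quat a b c d).imK = d := rfl
end

theorem natCast_dvd_iff (m : ℕ) (x : ℍ[ℤ]) : (m : ℍ[ℤ]) ∣ x ↔
    (m : ℤ) ∣ x.re ∧ (m : ℤ) ∣ x.imI ∧ (m : ℤ) ∣ x.imJ ∧ (m : ℤ) ∣ x.imK := by
  constructor
  · rintro ⟨y, rfl⟩
    simp
  · rintro ⟨⟨a, ha⟩, ⟨b, hb⟩, ⟨c, hc⟩, ⟨d, hd⟩⟩
    exact ⟨quat a b c d, by ext <;> simp [ha, hb, hc, hd]⟩

theorem natCast_dvd_mul_of_dvd_right {m : ℕ} {x : ℍ[ℤ]} (y : ℍ[ℤ]) (h : (m : ℍ[ℤ]) ∣ x) :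
    (m : ℍ[ℤ]) ∣ y * x := by
  obtain ⟨z, rfl⟩ := h
  exact ⟨y * z, by rw [← mul_assoc, ← mul_assoc, (Nat.cast_commute m y).eq]⟩

/-- Dirichlet's theorem provides a prime ≡ 1 (mod 4) and ≡ -1 (mod m); writing it as a sum of two
squares solves the congruence. -/
theorem exists_sq_add_sq_eq_neg_one {m : ℕ} (hm : Odd m) :
    ∃ a b : ZMod m, a ^ 2 + b ^ 2 = -1 := by
  have hm0 : m ≠ 0 := by rintro rfl; simp at hm
  have hcop : Nat.Coprime 4 m := by
    rw [show 4 = 2 ^ 2 by norm_num]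
    exact Nat.Coprime.pow_left 2 (Nat.coprime_two_left.mpr hm)
  obtain ⟨k, hk1, hk2⟩ := Nat.chineseRemainder hcop 1 (m - 1)
  have : NeZero (4 * m) := ⟨by positivity⟩
  have hu : IsUnit ((k : ℕ) : ZMod (4 * m)) := by
    rw [ZMod.isUnit_iff_coprime]
    refine Nat.Coprime.mul_right ?_ ?_
    · rw [Nat.coprime_iff_gcd_eq_one, hk1.gcd_eq]; norm_num
    · rw [Nat.coprime_iff_gcd_eq_one, hk2.gcd_eq]
      have := Nat.coprime_self_sub_left (m := 1) (n := m) (by omega)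
      simpa using this
  obtain ⟨p, -, hp, hpk⟩ := Nat.forall_exists_prime_gt_and_eq_mod hu 0
  rw [ZMod.natCast_eq_natCast_iff] at hpk
  have h4 : p % 4 = 1 := ((hpk.of_mul_right m).trans hk1)
  have hpm : p ≡ m - 1 [MOD m] := (hpk.of_mul_left 4).trans hk2
  have : Fact p.Prime := ⟨hp⟩
  obtain ⟨a, b, hab⟩ := Nat.Prime.sq_add_sq (p := p) (by omega)
  refine ⟨a, b, ?_⟩
  have h1 : ((a ^ 2 + b ^ 2 : ℕ) : ZMod m) = ((m - 1 : ℕ) : ZMod m) := by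
    rw [hab, ZMod.natCast_eq_natCast_iff]; exact hpm
  rw [Nat.cast_sub (by omega)] at h1
  push_cast at h1
  rw [h1]; simp

/-- An isomorphism of the quaternions over `ZMod m` with the ring of `2 × 2`-matrices. -/
structure Splitting (m : ℕ) where
  hom : ℍ[ℤ] →+* Matrix (Fin 2) (Fin 2) (ZMod m)
  hom_eq_zero : ∀ x, hom x = 0 ↔ (m : ℍ[ℤ]) ∣ x
  surjective : Function.Surjective hom
  det_hom : ∀ x, (hom x).det = (Quaternion.normSq x : ℤ)
  hom_star : ∀ x, hom (star x) = (hom x).adjugate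

theorem exists_half {m : ℕ} (hm : Odd m) : ∃ h : ZMod m, 2 * h = 1 := by
  obtain ⟨k, rfl⟩ := hm
  refine ⟨k + 1, ?_⟩
  have : ((2 * k + 1 : ℕ) : ZMod (2 * k + 1)) = 0 := ZMod.natCast_self _
  push_cast at this
  linear_combination this

/-- With a² + b² = -1, the matrices assigned to i and j satisfy the quaternion relations over ℤ/m.
Since 2 is invertible, the coordinates can be recovered linearly from the four matrix entries, which
gives both the kernel and surjectivity. -/
theorem nonempty_splitting {m : ℕ} (hm : Odd m) : Nonempty (Splitting m) := by
  obtain ⟨a, b, hab⟩ := exists_sq_add_sq_eq_neg_one hm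
  obtain ⟨h, hh⟩ := exists_half hm
  let B : QuaternionAlgebra.Basis (Matrix (Fin 2) (Fin 2) (ZMod m)) (-1 : ℤ) 0 (-1) :=
    { i := !![0, -1; 1, 0]
      j := !![a, b; b, -a]
      k := !![-b, a; a, b]
      i_mul_i := by ext i j; fin_cases i <;> fin_cases j <;> simp [Matrix.mul_apply]
      j_mul_j := by
        ext i j
        fin_cases i <;> fin_cases j <;> simp [Matrix.mul_apply, Fin.sum_univ_two]
        · linear_combination hab
        · ring
        · ring
        · linear_combination hab
      i_mul_j := by
        ext i j; fin_cases i <;> fin_cases j <;> simp [Matrix.mul_apply, Fin.sum_univ_two]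
      j_mul_i := by
        ext i j; fin_cases i <;> fin_cases j <;> simp [Matrix.mul_apply, Fin.sum_univ_two] }
  let f : ℍ[ℤ] →+* Matrix (Fin 2) (Fin 2) (ZMod m) := (QuaternionAlgebra.lift B).toRingHom
  have hf : ∀ x : ℍ[ℤ], f x = !![(x.re : ZMod m) + x.imJ * a - x.imK * b,
      -x.imI + x.imJ * b + x.imK * a; x.imI + x.imJ * b + x.imK * a,
      x.re - x.imJ * a + x.imK * b] := by
    intro x
    change B.lift x = _
    ext i j
    fin_cases i <;> fin_cases j <;>
      simp [QuaternionAlgebra.Basis.lift, B, Matrix.intCast_apply] <;> ring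
  have hz : ∀ z w : ZMod m, 2 * z = 2 * w → z = w := fun z w e => by
    linear_combination h * e + (w - z) * hh
  refine ⟨⟨f, ?_, ?_, ?_, ?_⟩⟩
  · intro x
    rw [natCast_dvd_iff, hf]
    simp only [← ZMod.intCast_zmod_eq_zero_iff_dvd]
    constructor
    · intro e
      have e00 := congrFun (congrFun e 0) 0
      have e01 := congrFun (congrFun e 0) 1
      have e10 := congrFun (congrFun e 1) 0
      have e11 := congrFun (congrFun e 1) 1
      simp at e00 e01 e10 e11
      refine ⟨hz _ _ ?_, hz _ _ ?_, hz _ _ ?_, hz _ _ ?_⟩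
      · linear_combination e00 + e11
      · linear_combination e10 - e01
      · linear_combination -a * (e00 - e11) - b * (e01 + e10) + 2 * x.imJ * hab
      · linear_combination b * (e00 - e11) - a * (e01 + e10) + 2 * x.imK * hab
    · rintro ⟨h1, h2, h3, h4⟩
      rw [h1, h2, h3, h4]
      ext i j; fin_cases i <;> fin_cases j <;> simp
  · intro A
    have hs : ∀ z : ZMod m, ∃ n : ℤ, (n : ZMod m) = z := ZMod.intCast_surjective
    obtain ⟨t, ht⟩ := hs (h * (A 0 0 + A 1 1))
    obtain ⟨x, hx⟩ := hs (h * (A 1 0 - A 0 1))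
    obtain ⟨y, hy⟩ := hs (-(h * (a * (A 0 0 - A 1 1) + b * (A 0 1 + A 1 0))))
    obtain ⟨z, hz'⟩ := hs (-(h * (-b * (A 0 0 - A 1 1) + a * (A 0 1 + A 1 0))))
    refine ⟨quat t x y z, ?_⟩
    rw [hf]
    ext i j
    fin_cases i <;> fin_cases j <;> simp [ht, hx, hy, hz']
    · linear_combination A 0 0 * hh - h * (A 0 0 - A 1 1) * hab
    · linear_combination A 0 1 * hh - h * (A 0 1 + A 1 0) * hab
    · linear_combination A 1 0 * hh - h * (A 0 1 + A 1 0) * hab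
    · linear_combination A 1 1 * hh + h * (A 0 0 - A 1 1) * hab
  · intro x
    rw [hf, Matrix.det_fin_two_of, Quaternion.normSq_def']
    push_cast
    linear_combination -((x.imJ : ZMod m) ^ 2 + (x.imK : ZMod m) ^ 2) * hab
  · intro x
    rw [hf, hf, Matrix.adjugate_fin_two_of]
    ext i j
    fin_cases i <;> fin_cases j <;> simp <;> ring

/-! ### Diagonalization of matrices of unit content -/

/-- The hypothesis makes gcd(x, y) prime to m, so a Bézout relation over ℤ can be divided by it
modulo m. -/
theorem isCoprime_zmod_of_forall_prime {m : ℕ} {x y : ℤ}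
    (h : ∀ l : ℕ, l.Prime → l ∣ m → (l : ℤ) ∣ x → ¬ (l : ℤ) ∣ y) :
    IsCoprime (x : ZMod m) (y : ZMod m) := by
  have hg : Nat.Coprime (Int.gcd x y) m := by
    refine Nat.coprime_of_dvd fun l hl h1 h2 => ?_
    exact h l hl h2 ((Int.natCast_dvd_natCast.mpr h1).trans (Int.gcd_dvd_left ..))
      ((Int.natCast_dvd_natCast.mpr h1).trans (Int.gcd_dvd_right ..))
  obtain ⟨u, v, huv⟩ := Nat.isCoprime_iff_coprime.mpr hg
  have hb := Int.gcd_eq_gcd_ab x y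
  refine ⟨u * Int.gcdA x y, u * Int.gcdB x y, ?_⟩
  have h1 := congrArg (Int.cast : ℤ → ZMod m) huv
  have h2 := congrArg (Int.cast : ℤ → ZMod m) hb
  push_cast at h1 h2
  rw [ZMod.natCast_self] at h1
  linear_combination h1 - u * h2

/-- A matrix whose entries generate the unit ideal. -/
def UnitContent {m : ℕ} (A : Matrix (Fin 2) (Fin 2) (ZMod m)) : Prop :=
  ∃ B : Matrix (Fin 2) (Fin 2) (ZMod m), (B * A).trace = 1

/-- Some combination "first column + t · second column" is unimodular. At a prime of m dividing the
whole first column t has to be a unit; at any other prime t ≡ 0 keeps the first column. The product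
`T` of the primes of the second sort does both. -/
theorem UnitContent.exists_isCoprime {m : ℕ} (hm : m ≠ 0) {A : Matrix (Fin 2) (Fin 2) (ZMod m)}
    (hA : UnitContent A) : ∃ t : ZMod m, IsCoprime (A 0 0 + A 0 1 * t) (A 1 0 + A 1 1 * t) := by
  classical
  obtain ⟨B, hB⟩ := hA
  obtain ⟨a, ha⟩ := ZMod.intCast_surjective (A 0 0)
  obtain ⟨b, hb⟩ := ZMod.intCast_surjective (A 0 1)
  obtain ⟨c, hc⟩ := ZMod.intCast_surjective (A 1 0)
  obtain ⟨d, hd⟩ := ZMod.intCast_surjective (A 1 1)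
  simp only [Matrix.trace_fin_two, Matrix.mul_apply, Fin.sum_univ_two] at hB
  let T : ℕ := ∏ l ∈ m.primeFactors.filter (fun l : ℕ => ¬ ((l : ℤ) ∣ a ∧ (l : ℤ) ∣ c)), l
  refine ⟨(T : ℤ), ?_⟩
  rw [← ha, ← hb, ← hc, ← hd]
  norm_cast
  refine isCoprime_zmod_of_forall_prime fun l hl hlm h1 h2 => ?_
  have : Fact l.Prime := ⟨hl⟩
  have hcast : ∀ (x : ZMod m) (n : ℤ), (n : ZMod m) = x → (l : ℤ) ∣ n →
      ZMod.castHom hlm (ZMod l) x = 0 := by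
    rintro x n rfl h
    rw [map_intCast, ZMod.intCast_zmod_eq_zero_iff_dvd]; exact h
  have hnot : ¬ ((l : ℤ) ∣ a ∧ (l : ℤ) ∣ b ∧ (l : ℤ) ∣ c ∧ (l : ℤ) ∣ d) := by
    rintro ⟨h1, h2, h3, h4⟩
    have := congrArg (ZMod.castHom hlm (ZMod l)) hB
    simp only [map_add, map_mul, map_one, hcast _ _ ha h1, hcast _ _ hb h2, hcast _ _ hc h3,
      hcast _ _ hd h4] at this
    simp at this
  by_cases hac : (l : ℤ) ∣ a ∧ (l : ℤ) ∣ c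
  · have hT : ¬ (l : ℤ) ∣ (T : ℤ) := by
      rw [Int.natCast_dvd_natCast, Prime.dvd_finsetProd_iff hl.prime]
      rintro ⟨k, hk, hlk⟩
      rw [Finset.mem_filter, Nat.mem_primeFactors] at hk
      rw [(Nat.prime_dvd_prime_iff_eq hl hk.1.1).mp hlk] at hac
      exact hk.2 hac
    have hp : Prime (l : ℤ) := Nat.prime_iff_prime_int.mp hl
    have h1' := (hp.dvd_or_dvd ((dvd_add_right hac.1).mp h1)).resolve_right hT
    have h2' := (hp.dvd_or_dvd ((dvd_add_right hac.2).mp h2)).resolve_right hT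
    exact hnot ⟨hac.1, h1', hac.2, h2'⟩
  · have hT : (l : ℤ) ∣ (T : ℤ) := by
      rw [Int.natCast_dvd_natCast]
      exact Finset.dvd_prod_of_mem _ (Finset.mem_filter.mpr
        ⟨Nat.mem_primeFactors.mpr ⟨hl, hlm, hm⟩, hac⟩)
    exact hac ⟨(dvd_add_left (hT.mul_left b)).mp h1, (dvd_add_left (hT.mul_left d)).mp h2⟩

/-- This is a Smith normal form. The ring ℤ/m need not be a domain, but one unimodular column
suffices to clear everything except the determinant. -/
theorem UnitContent.exists_diagonal {m : ℕ} (hm : m ≠ 0) {A : Matrix (Fin 2) (Fin 2) (ZMod m)}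
    (hA : UnitContent A) : ∃ P Q : Matrix (Fin 2) (Fin 2) (ZMod m), P.det = 1 ∧ Q.det = 1 ∧
      P * A * Q = !![1, 0; 0, A.det] := by
  obtain ⟨t, x, y, hxy⟩ := hA.exists_isCoprime hm
  have hA' := Matrix.eta_fin_two A
  generalize A 0 0 = a, A 0 1 = b, A 1 0 = c, A 1 1 = d at hxy hA'
  subst hA'
  set e := x * b + y * d with he
  -- `P` sends the unimodular column (a + bt, c + dt) to (1, 0). `Q` first adds t times the second
  -- column to the first and then clears `e`, the upper right entry of `P * A`.
  refine ⟨!![x, y; -(c + d * t), a + b * t], !![1, -e; t, 1 - t * e], ?_, ?_, ?_⟩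
  · rw [Matrix.det_fin_two_of]; linear_combination hxy
  · rw [Matrix.det_fin_two_of]; ring
  · rw [Matrix.det_fin_two_of, Matrix.mul_fin_two, Matrix.mul_fin_two]
    ext i j
    fin_cases i <;> fin_cases j <;> simp
    · linear_combination hxy
    · rw [he]; linear_combination -(x * b + y * d) * hxy
    · ring
    · ring

/-! ### Primitive quaternions -/

theorem IsPrimitive.exists_re_eq_one {p : ℍ[ℤ]} (hp : IsPrimitive p) :
    ∃ c : ℍ[ℤ], (c * p).re = 1 := by
  let I : Ideal ℤ := Ideal.span {p.re, p.imI, p.imJ, p.imK}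
  have hI : I = ⊤ := by
    obtain ⟨d, hd⟩ := (IsPrincipalIdealRing.principal I).principal
    have hd' : I = Ideal.span {d} := hd
    rw [hd', Ideal.span_singleton_eq_top]
    have h : ∀ x ∈ ({p.re, p.imI, p.imJ, p.imK} : Set ℤ), d ∣ x := fun x hx => by
      rw [← Ideal.mem_span_singleton, ← hd']; exact Ideal.subset_span hx
    exact hp d (h _ (by simp)) (h _ (by simp)) (h _ (by simp)) (h _ (by simp))
  have h1 : (1 : ℤ) ∈ I := by rw [hI]; trivial
  rw [Ideal.mem_span_insert] at h1
  obtain ⟨a, z, hz, h1⟩ := h1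
  rw [Ideal.mem_span_insert] at hz
  obtain ⟨b, w, hw, rfl⟩ := hz
  rw [Ideal.mem_span_pair] at hw
  obtain ⟨c, d, rfl⟩ := hw
  -- The signs compensate for those in the real part of a product, so that it becomes the Bézout
  -- combination of the coordinates of `p`.
  refine ⟨quat a (-b) (-c) (-d), ?_⟩
  simp
  linear_combination -h1

theorem Splitting.trace_hom {m : ℕ} (φ : Splitting m) (x : ℍ[ℤ]) :
    (φ.hom x).trace = ((2 * x.re : ℤ) : ZMod m) := by
  have h : x + star x = ((x.re : ℤ) : ℍ[ℤ]) + ((x.re : ℤ) : ℍ[ℤ]) := by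
    ext <;> simp
  have h2 := congrArg φ.hom h
  rw [map_add, φ.hom_star, map_add, map_intCast, Matrix.adjugate_fin_two] at h2
  have := congrFun (congrFun h2 0) 0
  rw [Matrix.trace_fin_two]
  simpa [Matrix.intCast_apply, two_mul] using this

/-- The matrix of `c * p` has trace twice the real part, that is 2; halving `c` modulo m gives trace
1. -/
theorem Splitting.unitContent_hom {m : ℕ} (hm : Odd m) (φ : Splitting m) {p : ℍ[ℤ]} {c : ℍ[ℤ]}
    (hc : (c * p).re = 1) : UnitContent (φ.hom p) := by
  obtain ⟨h, hh⟩ := exists_half hm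
  refine ⟨h • φ.hom c, ?_⟩
  rw [Matrix.smul_mul, Matrix.trace_smul, ← map_mul, φ.trace_hom, hc]
  simpa [mul_comm] using hh

theorem IsPrimitive.neg {p : ℍ[ℤ]} (hp : IsPrimitive p) : IsPrimitive (-p) := by
  intro d; simpa using hp d

theorem IsPrimitive.star {p : ℍ[ℤ]} (hp : IsPrimitive p) : IsPrimitive (star p) := by
  intro d; simpa using hp d

theorem IsPrimitive.ne_zero {p : ℍ[ℤ]} (hp : IsPrimitive p) : p ≠ 0 := by
  rintro rfl
  have := hp 0 (by simp) (by simp) (by simp) (by simp)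
  simp at this

/-- Multiplying by a quaternion `c` with Re(cp) = 1 and taking real parts turns the divisibility
into one between integers. -/
theorem natCast_dvd_of_isPrimitive {m n : ℕ} {p : ℍ[ℤ]} (hp : IsPrimitive p)
    (h : (m : ℍ[ℤ]) ∣ (n : ℍ[ℤ]) * p) : m ∣ n := by
  obtain ⟨c, hc⟩ := hp.exists_re_eq_one
  have h2 := natCast_dvd_mul_of_dvd_right c h
  rw [← mul_assoc, ← (Nat.cast_commute n c).eq, mul_assoc, natCast_dvd_iff] at h2
  have := h2.1
  rw [show ((n : ℍ[ℤ]) * (c * p)).re = n * (c * p).re by simp, hc, mul_one] at this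
  exact_mod_cast this

theorem exists_eq_mul_isPrimitive {x : ℍ[ℤ]} (hx : x ≠ 0) :
    ∃ (k : ℕ) (p : ℍ[ℤ]), k ≠ 0 ∧ IsPrimitive p ∧ x = (k : ℍ[ℤ]) * p := by
  let k : ℕ := Nat.gcd (Nat.gcd x.re.natAbs x.imI.natAbs) (Nat.gcd x.imJ.natAbs x.imK.natAbs)
  have hk : k ≠ 0 := by
    intro h
    apply hx
    rw [Nat.gcd_eq_zero_iff, Nat.gcd_eq_zero_iff, Nat.gcd_eq_zero_iff] at h
    ext <;> simp <;> omega
  have h1 : (k : ℍ[ℤ]) ∣ x := by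
    rw [natCast_dvd_iff]
    simp only [Int.natCast_dvd]
    exact ⟨(Nat.gcd_dvd_left _ _).trans (Nat.gcd_dvd_left _ _),
      (Nat.gcd_dvd_left _ _).trans (Nat.gcd_dvd_right _ _),
      (Nat.gcd_dvd_right _ _).trans (Nat.gcd_dvd_left _ _),
      (Nat.gcd_dvd_right _ _).trans (Nat.gcd_dvd_right _ _)⟩
  obtain ⟨p, hp⟩ := h1
  refine ⟨k, p, hk, fun d h1 h2 h3 h4 => ?_, hp⟩
  have hd : (k * d.natAbs) ∣ k := by
    have e : x.re = k * p.re ∧ x.imI = k * p.imI ∧ x.imJ = k * p.imJ ∧ x.imK = k * p.imK := by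
      rw [hp]; simp
    refine Nat.dvd_gcd (Nat.dvd_gcd ?_ ?_) (Nat.dvd_gcd ?_ ?_)
    · rw [e.1, Int.natAbs_mul]; exact mul_dvd_mul (by simp) (Int.natAbs_dvd_natAbs.mpr h1)
    · rw [e.2.1, Int.natAbs_mul]; exact mul_dvd_mul (by simp) (Int.natAbs_dvd_natAbs.mpr h2)
    · rw [e.2.2.1, Int.natAbs_mul]; exact mul_dvd_mul (by simp) (Int.natAbs_dvd_natAbs.mpr h3)
    · rw [e.2.2.2, Int.natAbs_mul]; exact mul_dvd_mul (by simp) (Int.natAbs_dvd_natAbs.mpr h4)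
  have : d.natAbs ∣ 1 := by
    apply Nat.dvd_of_mul_dvd_mul_left (Nat.pos_of_ne_zero hk)
    simpa using hd
  exact Int.isUnit_iff_natAbs_eq.mpr (Nat.dvd_one.mp this)

/-! ### The odd part of the norm -/

/-- The odd part of the norm of a quaternion. -/
def oddNorm (p : ℍ[ℤ]) : ℕ := ordCompl[2] (Quaternion.normSq p : ℤ).natAbs

theorem normSq_pos {p : ℍ[ℤ]} (hp : p ≠ 0) : 0 < (Quaternion.normSq p : ℤ) :=
  lt_of_le_of_ne Quaternion.normSq_nonneg (Ne.symm (Quaternion.normSq_ne_zero.mpr hp))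

theorem odd_oddNorm {p : ℍ[ℤ]} (hp : p ≠ 0) : Odd (oddNorm p) := by
  have h := Nat.coprime_ordCompl Nat.prime_two
    (Int.natAbs_ne_zero.mpr (Quaternion.normSq_ne_zero.mpr hp))
  exact Nat.coprime_two_left.mp h

theorem exists_normSq_eq (p : ℍ[ℤ]) : ∃ k : ℕ,
    (Quaternion.normSq p : ℤ) = 2 ^ k * (oddNorm p : ℕ) := by
  have h := Nat.ordProj_mul_ordCompl_eq_self (Quaternion.normSq p : ℤ).natAbs 2
  refine ⟨(Quaternion.normSq p : ℤ).natAbs.factorization 2, ?_⟩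
  conv_lhs => rw [← Int.natAbs_of_nonneg (Quaternion.normSq_nonneg (a := p))]
  exact_mod_cast h.symm

theorem oddNorm_eq {p : ℍ[ℤ]} {k m : ℕ} (hm : Odd m)
    (h : (Quaternion.normSq p : ℤ) = 2 ^ k * m) : oddNorm p = m := by
  have h' : (Quaternion.normSq p : ℤ).natAbs = 2 ^ k * m := by
    rw [h]
    exact Int.natAbs_natCast (2 ^ k * m)
  have h0 : m ≠ 0 := by rintro rfl; simp at hm
  have : m.factorization 2 = 0 :=
    Nat.factorization_eq_zero_of_not_dvd (by rwa [← even_iff_two_dvd, Nat.not_even_iff_odd])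
  rw [oddNorm, h', Nat.ordCompl_mul, Nat.ordCompl_self_pow Nat.prime_two, one_mul, this]
  simp

theorem oddNorm_mul (p q : ℍ[ℤ]) : oddNorm (p * q) = oddNorm p * oddNorm q := by
  rw [oddNorm, map_mul, Int.natAbs_mul, Nat.ordCompl_mul]; rfl

@[simp] theorem oddNorm_star (p : ℍ[ℤ]) : oddNorm (star p) = oddNorm p := by
  rw [oddNorm, Quaternion.normSq_star]; rfl

@[simp] theorem oddNorm_neg (p : ℍ[ℤ]) : oddNorm (-p) = oddNorm p := by
  rw [oddNorm, Quaternion.normSq_neg]; rfl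

theorem oddNorm_dvd (p : ℍ[ℤ]) : ((oddNorm p : ℕ) : ℤ) ∣ (Quaternion.normSq p : ℤ) := by
  obtain ⟨k, hk⟩ := exists_normSq_eq p
  exact ⟨2 ^ k, by rw [hk, mul_comm]⟩

/-- Four squares with sum 0 modulo 8 are all even, which is a finite check. Hence the norm of a
primitive quaternion contains at most the factor 4. -/
theorem two_dvd_of_eight_dvd {x : ℍ[ℤ]} (h : (8 : ℤ) ∣ Quaternion.normSq x) :
    ((2 : ℕ) : ℍ[ℤ]) ∣ x := by
  rw [Quaternion.normSq_def'] at h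
  have key : ∀ a b c d : ZMod 8, a ^ 2 + b ^ 2 + c ^ 2 + d ^ 2 = 0 →
      4 * a = 0 ∧ 4 * b = 0 ∧ 4 * c = 0 ∧ 4 * d = 0 := by decide
  have h8 := (ZMod.intCast_zmod_eq_zero_iff_dvd _ 8).mpr (by exact_mod_cast h)
  push_cast at h8
  have hk := key _ _ _ _ h8
  rw [natCast_dvd_iff]
  have e : ∀ a : ℤ, 4 * (a : ZMod 8) = 0 → ((2 : ℕ) : ℤ) ∣ a := fun a ha => by
    have : ((4 * a : ℤ) : ZMod 8) = 0 := by push_cast; exact ha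
    rw [ZMod.intCast_zmod_eq_zero_iff_dvd] at this
    push_cast at this ⊢
    omega
  exact ⟨e _ hk.1, e _ hk.2.1, e _ hk.2.2.1, e _ hk.2.2.2⟩

/-- The surplus factor 2 in the hypothesis survives as the evenness of the norm of `y`, that is, as
membership of `y` in D₄. -/
theorem exists_eq_two_pow_mul (k : ℕ) {x : ℍ[ℤ]} (h : (2 : ℤ) ^ (2 * k + 1) ∣ Quaternion.normSq x) :
    ∃ y : ℍ[ℤ], x = ((2 ^ k : ℕ) : ℍ[ℤ]) * y ∧ Even (Quaternion.normSq y : ℤ) := by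
  induction k generalizing x with
  | zero => exact ⟨x, by simp, by simpa [even_iff_two_dvd] using h⟩
  | succ k ih =>
    obtain ⟨y, rfl⟩ := two_dvd_of_eight_dvd (x := x) (dvd_trans
      (by rw [show (8 : ℤ) = 2 ^ 3 by norm_num]; exact pow_dvd_pow 2 (by omega)) h)
    rw [map_mul, Quaternion.normSq_natCast, show 2 * (k + 1) + 1 = 2 + (2 * k + 1) by ring,
      pow_add] at h
    push_cast at h
    obtain ⟨z, rfl, hz⟩ := ih ((mul_dvd_mul_iff_left (by norm_num)).mp h)
    exact ⟨z, by rw [← mul_assoc, pow_succ']; push_cast; rfl, hz⟩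

theorem IsPrimitive.exists_normSq_eq {p : ℍ[ℤ]} (hp : IsPrimitive p) : ∃ k ≤ 2,
    (Quaternion.normSq p : ℤ) = 2 ^ k * (oddNorm p : ℕ) := by
  obtain ⟨k, hk⟩ := HypercubicCSL.exists_normSq_eq p
  refine ⟨k, ?_, hk⟩
  by_contra! hlt
  have : ((2 : ℕ) : ℍ[ℤ]) ∣ p := two_dvd_of_eight_dvd (by
    rw [hk, show (8 : ℤ) = 2 ^ 3 by norm_num]
    exact (pow_dvd_pow 2 hlt).mul_right _)
  rw [natCast_dvd_iff] at this
  have := hp 2 this.1 this.2.1 this.2.2.1 this.2.2.2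
  norm_num [Int.isUnit_iff] at this

/-! ### The rotations `x ↦ p x q̄ / |p q|` -/

/-- The coordinate vector of a quaternion. -/
def coords (x : ℍ[ℤ]) : Fin 4 → ℤ := ![x.re, x.imI, x.imJ, x.imK]

theorem coords_injective : Function.Injective coords := by
  intro x y h
  have h0 := congrFun h 0
  have h1 := congrFun h 1
  have h2 := congrFun h 2
  have h3 := congrFun h 3
  simp [coords] at h0 h1 h2 h3
  ext <;> assumption

theorem coords_surjective : Function.Surjective coords := fun v =>
  ⟨quat (v 0) (v 1) (v 2) (v 3), by ext i; fin_cases i <;> simp [coords]⟩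

@[simp] theorem unitQuat_zero : unitQuat 0 = quat 1 0 0 0 := rfl
@[simp] theorem unitQuat_one : unitQuat 1 = quat 0 1 0 0 := rfl
@[simp] theorem unitQuat_two : unitQuat 2 = quat 0 0 1 0 := rfl
@[simp] theorem unitQuat_three : unitQuat 3 = quat 0 0 0 1 := rfl

theorem intMatrix_mulVec_coords (p q x : ℍ[ℤ]) :
    (intMatrix p q).mulVec (coords x) = coords (p * x * star q) := by
  ext r
  fin_cases r <;> simp [Matrix.mulVec, dotProduct, intMatrix, coords, Fin.sum_univ_four] <;> ring

theorem intMatrix_eq_iff {A B : Matrix (Fin 4) (Fin 4) ℤ}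
    (h : ∀ x, A.mulVec (coords x) = B.mulVec (coords x)) : A = B := by
  apply Matrix.mulVec_injective
  ext1 v
  obtain ⟨x, rfl⟩ := coords_surjective v
  exact h x

theorem intMatrix_mul (p q p' q' : ℍ[ℤ]) :
    intMatrix p q * intMatrix p' q' = intMatrix (p * p') (q * q') := by
  refine intMatrix_eq_iff fun x => ?_
  rw [← Matrix.mulVec_mulVec, intMatrix_mulVec_coords, intMatrix_mulVec_coords,
    intMatrix_mulVec_coords, star_mul]
  simp only [mul_assoc]

set_option maxHeartbeats 1000000 in
theorem intMatrix_transpose (p q : ℍ[ℤ]) :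
    (intMatrix p q).transpose = intMatrix (star p) (star q) := by
  ext r c
  fin_cases r <;> fin_cases c <;> simp [intMatrix] <;> ring

theorem det_intMatrix_left (p : ℍ[ℤ]) : (intMatrix p 1).det = Quaternion.normSq p ^ 2 := by
  rw [Quaternion.normSq_def', Matrix.det_succ_row_zero]
  simp [Fin.sum_univ_four, Matrix.det_fin_three, intMatrix, Fin.succAbove]
  ring

theorem det_intMatrix_right (p : ℍ[ℤ]) : (intMatrix 1 p).det = Quaternion.normSq p ^ 2 := by
  rw [Quaternion.normSq_def', Matrix.det_succ_row_zero]
  simp [Fin.sum_univ_four, Matrix.det_fin_three, intMatrix, Fin.succAbove]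
  ring

theorem det_intMatrix (p q : ℍ[ℤ]) : (intMatrix p q).det = (Quaternion.normSq (p * q)) ^ 2 := by
  have : intMatrix p q = intMatrix p 1 * intMatrix 1 q := by rw [intMatrix_mul]; simp
  rw [this, Matrix.det_mul, det_intMatrix_left, det_intMatrix_right, map_mul, mul_pow]

theorem intMatrix_intCast (m n : ℤ) : intMatrix (m : ℍ[ℤ]) (n : ℍ[ℤ]) = (m * n) • 1 := by
  refine intMatrix_eq_iff fun x => ?_
  rw [intMatrix_mulVec_coords, Matrix.smul_mulVec, Matrix.one_mulVec]
  ext r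
  fin_cases r <;> simp [coords] <;> ring

theorem intMatrix_intCast_mul (m n : ℤ) (p q : ℍ[ℤ]) :
    intMatrix ((m : ℍ[ℤ]) * p) ((n : ℍ[ℤ]) * q) = (m * n) • intMatrix p q := by
  rw [← intMatrix_mul, intMatrix_intCast, Matrix.smul_mul, Matrix.one_mul]

theorem rotMatrix_mul (p q p' q' : ℍ[ℤ]) :
    rotMatrix p q * rotMatrix p' q' = rotMatrix (p * p') (q * q') := by
  have hn : (Quaternion.normSq (p * p' * (q * q')) : ℤ) =
      Quaternion.normSq (p * q) * Quaternion.normSq (p' * q') := by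
    simp only [map_mul]; ring
  rw [rotMatrix, rotMatrix, rotMatrix, Matrix.smul_mul, Matrix.mul_smul, smul_smul, hn,
    ← intMatrix_mul, Int.cast_mul, Real.sqrt_mul (by exact_mod_cast Quaternion.normSq_nonneg),
    one_div_mul_one_div]
  congr 1
  exact (Matrix.map_mul (f := Int.castRingHom ℝ)).symm

theorem rotMatrix_transpose (p q : ℍ[ℤ]) :
    (rotMatrix p q).transpose = rotMatrix (star p) (star q) := by
  rw [rotMatrix, rotMatrix, Matrix.transpose_smul, ← Matrix.transpose_map, intMatrix_transpose]
  simp only [map_mul, Quaternion.normSq_star]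

theorem rotMatrix_intCast_mul {m n : ℤ} (h : 0 < m * n) (p q : ℍ[ℤ]) :
    rotMatrix ((m : ℍ[ℤ]) * p) ((n : ℍ[ℤ]) * q) = rotMatrix p q := by
  have hn : (Quaternion.normSq ((m : ℍ[ℤ]) * p * ((n : ℍ[ℤ]) * q)) : ℤ) =
      (m * n) ^ 2 * Quaternion.normSq (p * q) := by
    simp only [map_mul, Quaternion.normSq_intCast]; push_cast; ring
  have h' : (0 : ℝ) < ((m * n : ℤ) : ℝ) := by exact_mod_cast h
  rw [rotMatrix, rotMatrix, hn, intMatrix_intCast_mul]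
  push_cast at h' ⊢
  rw [Real.sqrt_mul (by positivity), Real.sqrt_sq h'.le]
  ext i j
  simp only [Matrix.smul_apply, Matrix.map_apply, smul_eq_mul, Int.cast_mul]
  have h1 : (m : ℝ) ≠ 0 := left_ne_zero_of_mul h'.ne'
  have h2 : (n : ℝ) ≠ 0 := right_ne_zero_of_mul h'.ne'
  field_simp

theorem rotMatrix_intCast {m n : ℤ} (h : 0 < m * n) : rotMatrix (m : ℍ[ℤ]) (n : ℍ[ℤ]) = 1 := by
  have h1 : rotMatrix (1 : ℍ[ℤ]) 1 = 1 := by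
    rw [rotMatrix]
    have := intMatrix_intCast 1 1
    simp only [Int.cast_one] at this
    rw [this]
    simp
  have := rotMatrix_intCast_mul h 1 1
  rwa [mul_one, mul_one, h1] at this

theorem rotMatrix_mem {p q : ℍ[ℤ]} (hp : p ≠ 0) (hq : q ≠ 0) :
    rotMatrix p q ∈ Matrix.specialOrthogonalGroup (Fin 4) ℝ := by
  have h0 : (0 : ℤ) < Quaternion.normSq (p * q) := normSq_pos (mul_ne_zero hp hq)
  have h0' : (0 : ℝ) < ((Quaternion.normSq (p * q) : ℤ) : ℝ) := by exact_mod_cast h0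
  rw [Matrix.mem_specialOrthogonalGroup_iff]
  constructor
  · rw [Matrix.mem_orthogonalGroup_iff, rotMatrix_transpose, rotMatrix_mul,
      Quaternion.self_mul_star, Quaternion.self_mul_star]
    rw [map_mul] at h0
    exact rotMatrix_intCast h0
  · rw [rotMatrix, Matrix.det_smul]
    have : ((intMatrix p q).map fun n : ℤ => (n : ℝ)).det = (((intMatrix p q).det : ℤ) : ℝ) :=
      (Int.cast_det _).symm
    rw [this, det_intMatrix, Fintype.card_fin, div_pow, one_pow,
      show √((Quaternion.normSq (p * q) : ℤ) : ℝ) ^ 4 =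
        (√((Quaternion.normSq (p * q) : ℤ) : ℝ) ^ 2) ^ 2 by ring, Real.sq_sqrt h0'.le]
    push_cast
    field_simp

/-- The rotation `R(p,q)`. -/
noncomputable def rot {p q : ℍ[ℤ]} (hp : p ≠ 0) (hq : q ≠ 0) : SO4 :=
  ⟨rotMatrix p q, rotMatrix_mem hp hq⟩

/-- The embedding of the integral quaternions in `ℝ⁴`. -/
def toVec (x : ℍ[ℤ]) : Fin 4 → ℝ := fun i => (coords x i : ℝ)

theorem toVec_injective : Function.Injective toVec := by
  intro x y h
  refine coords_injective (funext fun i => ?_)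
  have := congrFun h i
  simpa [toVec] using this

theorem rotMatrix_mulVec_toVec (p q x : ℍ[ℤ]) : (rotMatrix p q).mulVec (toVec x) =
    (1 / √((Quaternion.normSq (p * q) : ℤ) : ℝ)) • toVec (p * x * star q) := by
  rw [rotMatrix, Matrix.smul_mulVec]
  congr 1
  have h := intMatrix_mulVec_coords p q x
  ext r
  have := congrFun h r
  simp only [toVec, ← this, Matrix.mulVec, dotProduct, Matrix.map_apply]
  push_cast; rfl

theorem toVec_natCast_mul (c : ℕ) (x : ℍ[ℤ]) : toVec ((c : ℍ[ℤ]) * x) = (c : ℝ) • toVec x := by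
  ext i
  fin_cases i <;> simp [toVec, coords]

theorem toVec_add (x y : ℍ[ℤ]) : toVec (x + y) = toVec x + toVec y := by
  ext i
  fin_cases i <;> simp [toVec, coords]

theorem mem_D4_iff {v : Fin 4 → ℝ} :
    v ∈ D4 ↔ ∃ x : ℍ[ℤ], v = toVec x ∧ Even (Quaternion.normSq x : ℤ) := by
  have key : ∀ x : ℍ[ℤ], (Quaternion.normSq x : ℤ) = ∑ i, coords x i ^ 2 := fun x => by
    rw [Quaternion.normSq_def']; simp [coords, Fin.sum_univ_four]
  constructor
  · rintro ⟨n, h1, h2⟩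
    obtain ⟨x, rfl⟩ := coords_surjective n
    exact ⟨x, funext h1, by rwa [key]⟩
  · rintro ⟨x, rfl, h⟩
    exact ⟨coords x, fun _ => rfl, by rwa [← key]⟩

theorem toVec_mem_D4_iff {x : ℍ[ℤ]} : toVec x ∈ D4 ↔ Even (Quaternion.normSq x : ℤ) := by
  rw [mem_D4_iff]
  constructor
  · rintro ⟨y, h, hy⟩
    rwa [toVec_injective h]
  · exact fun h => ⟨x, rfl, h⟩

theorem mem_rotate_iff {R : SO4} {L : AddSubgroup (Fin 4 → ℝ)} {v : Fin 4 → ℝ} :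
    v ∈ rotate R L ↔ (R⁻¹ : SO4).1.mulVec v ∈ L := by
  rw [rotate, AddSubgroup.mem_map]
  have h1 : (R⁻¹ : SO4).1 * R.1 = 1 := congrArg Subtype.val (inv_mul_cancel R)
  have h2 : R.1 * (R⁻¹ : SO4).1 = 1 := congrArg Subtype.val (mul_inv_cancel R)
  constructor
  · rintro ⟨w, hw, rfl⟩
    change (R⁻¹ : SO4).1.mulVec (R.1.mulVec w) ∈ L
    rwa [Matrix.mulVec_mulVec, h1, Matrix.one_mulVec]
  · intro h
    refine ⟨_, h, ?_⟩
    change R.1.mulVec ((R⁻¹ : SO4).1.mulVec v) = v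
    rw [Matrix.mulVec_mulVec, h2, Matrix.one_mulVec]

/-! ### The coincidence index -/

theorem IsAdmissible.exists_sq {p q : ℍ[ℤ]} (h : IsAdmissible p q) : ∃ k c : ℕ, Odd c ∧
    c ^ 2 = oddNorm p * oddNorm q ∧ (Quaternion.normSq (p * q) : ℤ) = ((2 ^ k * c : ℕ) : ℤ) ^ 2 := by
  obtain ⟨hp, hq, r, hr⟩ := h
  have hpq : p * q ≠ 0 := mul_ne_zero hp.ne_zero hq.ne_zero
  have h0 := normSq_pos hpq
  have hr0 : r.natAbs ≠ 0 := by
    rw [Int.natAbs_ne_zero]; rintro rfl; omega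
  have hc : Odd (ordCompl[2] r.natAbs) :=
    Nat.coprime_two_left.mp (Nat.coprime_ordCompl Nat.prime_two hr0)
  have hN : (Quaternion.normSq (p * q) : ℤ) =
      ((2 ^ (r.natAbs.factorization 2) * ordCompl[2] r.natAbs : ℕ) : ℤ) ^ 2 := by
    rw [Nat.ordProj_mul_ordCompl_eq_self, hr, Int.natCast_natAbs, sq_abs, sq]
  refine ⟨r.natAbs.factorization 2, ordCompl[2] r.natAbs, hc, ?_, hN⟩
  rw [← oddNorm_mul]
  refine (oddNorm_eq (k := r.natAbs.factorization 2 * 2) hc.pow ?_).symm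
  rw [hN]
  push_cast
  rw [mul_pow, pow_mul]

theorem natCast_dvd_natCast_mul {m k : ℕ} (h : Nat.Coprime m k) {x : ℍ[ℤ]} :
    (m : ℍ[ℤ]) ∣ (k : ℍ[ℤ]) * x ↔ (m : ℍ[ℤ]) ∣ x := by
  refine ⟨fun h1 => ?_, natCast_dvd_mul_of_dvd_right _⟩
  have hc : IsCoprime (m : ℤ) (k : ℤ) := Nat.isCoprime_iff_coprime.mpr h
  rw [natCast_dvd_iff] at h1 ⊢
  simp at h1
  exact ⟨hc.dvd_of_dvd_mul_left h1.1, hc.dvd_of_dvd_mul_left h1.2.1,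
    hc.dvd_of_dvd_mul_left h1.2.2.1, hc.dvd_of_dvd_mul_left h1.2.2.2⟩

/-- The power of 2 in the denominator imposes no condition: enough powers of 2 in the norm already
make x divisible by it with a quotient in D₄. Only the odd part `c` remains. -/
theorem smul_toVec_mem_D4_iff {k c : ℕ} (hc : Odd c) {x : ℍ[ℤ]}
    (h : (2 : ℤ) ^ (2 * k + 1) ∣ Quaternion.normSq x) :
    (1 / ((2 ^ k * c : ℕ) : ℝ)) • toVec x ∈ D4 ↔ (c : ℍ[ℤ]) ∣ x := by
  obtain ⟨y, rfl, hy⟩ := exists_eq_two_pow_mul k h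
  have hc0 : (c : ℝ) ≠ 0 := by
    rintro h; rw [Nat.cast_eq_zero] at h; subst h; simp at hc
  have hcop : Nat.Coprime c (2 ^ k) := (Nat.coprime_two_right.mpr hc).pow_right k
  rw [natCast_dvd_natCast_mul hcop, toVec_natCast_mul, smul_smul]
  have e : 1 / ((2 ^ k * c : ℕ) : ℝ) * ((2 ^ k : ℕ) : ℝ) = 1 / c := by push_cast; field_simp
  rw [e]
  constructor
  · intro h
    obtain ⟨z, hz, -⟩ := mem_D4_iff.mp h
    refine ⟨z, toVec_injective ?_⟩
    rw [toVec_natCast_mul, ← hz, smul_smul, mul_one_div_cancel hc0, one_smul]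
  · rintro ⟨z, rfl⟩
    rw [toVec_natCast_mul, smul_smul, one_div_mul_cancel hc0, one_smul, toVec_mem_D4_iff]
    rw [map_mul, Quaternion.normSq_natCast, Int.even_mul] at hy
    refine hy.resolve_left ?_
    rw [Int.even_pow]
    push Not
    intro h
    exact absurd ((Int.even_coe_nat c).mp h) (Nat.not_even_iff_odd.mpr hc)

theorem mem_csl_iff {p q : ℍ[ℤ]} {R : SO4} (hR : R.1 = rotMatrix p q)
    {k c : ℕ} (hc : Odd c) (hk : (Quaternion.normSq (p * q) : ℤ) = ((2 ^ k * c : ℕ) : ℤ) ^ 2)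
    {x : ℍ[ℤ]} (hx : Even (Quaternion.normSq x : ℤ)) :
    toVec x ∈ csl R ↔ (c : ℍ[ℤ]) ∣ star p * x * q := by
  have hRinv : (R⁻¹ : SO4).1 = rotMatrix (star p) (star q) := by
    rw [← rotMatrix_transpose, ← hR]; rfl
  have hs : (Quaternion.normSq (star p * star q) : ℤ) = ((2 ^ k * c : ℕ) : ℤ) ^ 2 := by
    rw [← hk]; simp only [map_mul, Quaternion.normSq_star]
  have hs' : √((Quaternion.normSq (star p * star q) : ℤ) : ℝ) = ((2 ^ k * c : ℕ) : ℝ) := by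
    rw [hs, Int.cast_pow, Int.cast_natCast, Real.sqrt_sq (by positivity)]
  rw [csl, AddSubgroup.mem_inf, mem_rotate_iff, hRinv, rotMatrix_mulVec_toVec, hs', star_star,
    and_iff_right (toVec_mem_D4_iff.mpr hx), smul_toVec_mem_D4_iff hc]
  have : (Quaternion.normSq (star p * x * q) : ℤ) =
      Quaternion.normSq (p * q) * Quaternion.normSq x := by
    simp only [map_mul, Quaternion.normSq_star]; ring
  -- The factor 2^(2k) comes from |pq|² and the additional 2 from the even norm of x, exactly as
  -- `smul_toVec_mem_D4_iff` requires.
  rw [this, hk, pow_succ]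
  refine mul_dvd_mul ?_ (even_iff_two_dvd.mp hx)
  push_cast
  rw [mul_pow, ← pow_mul, mul_comm 2 k]
  exact dvd_mul_right _ _

theorem ncard_range_mul (c n : ℕ) [NeZero c] :
    (Set.range fun x : ZMod c => (n : ZMod c) * x).ncard = c / c.gcd n := by
  have : (Set.range fun x : ZMod c => (n : ZMod c) * x) =
      (AddSubgroup.zmultiples (n : ZMod c) : Set (ZMod c)) := by
    ext y
    simp only [Set.mem_range, SetLike.mem_coe, AddSubgroup.mem_zmultiples_iff]
    constructor
    · rintro ⟨x, rfl⟩
      obtain ⟨k, rfl⟩ := ZMod.intCast_surjective x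
      exact ⟨k, by rw [zsmul_eq_mul, mul_comm]⟩
    · rintro ⟨k, rfl⟩
      exact ⟨k, by rw [zsmul_eq_mul, mul_comm]⟩
  rw [this, ← Nat.card_coe_set_eq]
  change Nat.card (AddSubgroup.zmultiples (n : ZMod c)) = _
  rw [Nat.card_zmultiples, ZMod.addOrderOf_coe n (NeZero.ne c)]

/-- The map multiplies the four entries of X independently by 1, b, a and ab, so its image is a
product of four cyclic groups. -/
theorem ncard_range_diagonal (c a b : ℕ) [NeZero c] :
    (Set.range fun X : Matrix (Fin 2) (Fin 2) (ZMod c) =>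
      !![1, 0; 0, (a : ZMod c)] * X * !![1, 0; 0, (b : ZMod c)]).ncard =
    c * (c / c.gcd b) * (c / c.gcd a * (c / c.gcd (a * b))) := by
  let e : (ZMod c × ZMod c) × (ZMod c × ZMod c) → Matrix (Fin 2) (Fin 2) (ZMod c) :=
    fun x => !![x.1.1, x.1.2; x.2.1, x.2.2]
  have he : Function.Injective e := by
    rintro ⟨⟨x, y⟩, z, w⟩ ⟨⟨x', y'⟩, z', w'⟩ h
    have h0 := congrFun (congrFun h 0) 0
    have h1 := congrFun (congrFun h 0) 1
    have h2 := congrFun (congrFun h 1) 0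
    have h3 := congrFun (congrFun h 1) 1
    simp [e] at h0 h1 h2 h3
    simp [h0, h1, h2, h3]
  have : (Set.range fun X : Matrix (Fin 2) (Fin 2) (ZMod c) =>
      !![1, 0; 0, (a : ZMod c)] * X * !![1, 0; 0, (b : ZMod c)]) =
      e '' (((Set.univ : Set (ZMod c)) ×ˢ (Set.range fun x : ZMod c => (b : ZMod c) * x)) ×ˢ
        ((Set.range fun x : ZMod c => (a : ZMod c) * x) ×ˢ
          (Set.range fun x : ZMod c => ((a * b : ℕ) : ZMod c) * x))) := by
    ext Y
    simp only [Set.mem_range, Set.mem_image, Set.mem_prod, Prod.exists, Set.mem_univ, true_and]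
    constructor
    · rintro ⟨X, rfl⟩
      refine ⟨X 0 0, b * X 0 1, a * X 1 0, ((a * b : ℕ) : ZMod c) * X 1 1,
        ⟨⟨_, rfl⟩, ⟨_, rfl⟩, ⟨_, rfl⟩⟩, ?_⟩
      rw [Matrix.eta_fin_two X, Matrix.mul_fin_two, Matrix.mul_fin_two]
      simp [e, mul_comm, mul_left_comm, mul_assoc]
    · rintro ⟨x, _, _, _, ⟨⟨y, rfl⟩, ⟨z, rfl⟩, ⟨w, rfl⟩⟩, rfl⟩
      refine ⟨!![x, y; z, w], ?_⟩
      rw [Matrix.mul_fin_two, Matrix.mul_fin_two]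
      simp [e, mul_comm, mul_assoc]
  rw [this, Set.ncard_image_of_injective _ he, Set.ncard_prod, Set.ncard_prod, Set.ncard_prod,
    ncard_range_mul, ncard_range_mul, ncard_range_mul, Set.ncard_univ, Nat.card_zmod]

/-- Passing to the normal forms of A and B changes X and the result only by invertible factors. -/
theorem ncard_range_mul_mul {c a b : ℕ} [NeZero c] {A B : Matrix (Fin 2) (Fin 2) (ZMod c)}
    (hA : UnitContent A) (hB : UnitContent B) (ha : A.det = a) (hb : B.det = b) :
    (Set.range fun X : Matrix (Fin 2) (Fin 2) (ZMod c) => A * X * B).ncard =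
    c * (c / c.gcd b) * (c / c.gcd a * (c / c.gcd (a * b))) := by
  obtain ⟨P, Q, hP, hQ, hPQ⟩ := hA.exists_diagonal (NeZero.ne c)
  obtain ⟨P', Q', hP', hQ', hPQ'⟩ := hB.exists_diagonal (NeZero.ne c)
  rw [ha] at hPQ
  rw [hb] at hPQ'
  rw [← ncard_range_diagonal c a b]
  have inv : ∀ {M : Matrix (Fin 2) (Fin 2) (ZMod c)}, M.det = 1 →
      M * M⁻¹ = 1 ∧ M⁻¹ * M = 1 := fun {M} h =>
    ⟨Matrix.mul_nonsing_inv _ (by simp [h]), Matrix.nonsing_inv_mul _ (by simp [h])⟩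
  have hf : Function.Injective fun Y : Matrix (Fin 2) (Fin 2) (ZMod c) => P * Y * Q' := by
    intro Y Z h
    have h' : P⁻¹ * (P * Y * Q') * Q'⁻¹ = P⁻¹ * (P * Z * Q') * Q'⁻¹ := by
      simp only at h; rw [h]
    simpa only [mul_assoc, (inv hQ').1, mul_one, ← mul_assoc P⁻¹, (inv hP).2, one_mul] using h'
  rw [← Set.ncard_image_of_injective _ hf]
  congr 1
  ext Y
  simp only [Set.mem_image, Set.mem_range, exists_exists_eq_and]
  rw [← hPQ, ← hPQ']
  constructor
  · rintro ⟨X, rfl⟩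
    refine ⟨Q⁻¹ * X * P'⁻¹, ?_⟩
    calc _ = P * A * (Q * Q⁻¹) * X * (P'⁻¹ * P') * B * Q' := by simp only [mul_assoc]
      _ = _ := by rw [(inv hQ).1, (inv hP').2]; simp only [mul_one, mul_assoc]
  · rintro ⟨X, rfl⟩
    exact ⟨Q * X * P', by simp only [mul_assoc]⟩

theorem index_arith {c a b : ℕ} (hc : 0 < c) (h : c ^ 2 = a * b) :
    c * (c / c.gcd b) * (c / c.gcd a * (c / c.gcd (a * b))) = a.lcm b := by
  have hab : c.gcd (a * b) = c := by rw [← h]; exact Nat.gcd_eq_left (dvd_pow_self c two_ne_zero)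
  rw [hab, Nat.div_self hc, mul_one]
  have ha0 : 0 < a := Nat.pos_of_ne_zero (by rintro rfl; simp at h; omega)
  have hb0 : 0 < b := Nat.pos_of_ne_zero (by rintro rfl; simp at h; omega)
  -- With G = gcd(a, b), the coprime cofactors have a square product and are therefore squares u²,
  -- v². So c = Guv, gcd(c, a) = Gu, gcd(c, b) = Gv and lcm(a, b) = Gu²v².
  obtain ⟨g, a', b', hg, hcop, rfl, rfl⟩ := Nat.exists_coprime' (Nat.gcd_pos_of_pos_left b ha0)
  generalize hG : g = G at *
  have hG0 : 0 < G := hg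
  have ha' : 0 < a' := Nat.pos_of_mul_pos_right ha0
  have hb' : 0 < b' := Nat.pos_of_mul_pos_right hb0
  have hGc : G ∣ c := by
    rw [← Nat.pow_dvd_pow_iff two_ne_zero, h]
    exact ⟨a' * b', by ring⟩
  obtain ⟨d, rfl⟩ := hGc
  have hd : a' * b' = d ^ 2 := by
    have : G ^ 2 * (a' * b') = G ^ 2 * d ^ 2 := by linear_combination -h
    exact Nat.eq_of_mul_eq_mul_left (by positivity) this
  obtain ⟨u, hu⟩ : ∃ u, a' = u ^ 2 := exists_eq_pow_of_mul_eq_pow (Nat.isUnit_iff.mpr hcop) hd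
  obtain ⟨v, hv⟩ : ∃ v, b' = v ^ 2 := exists_eq_pow_of_mul_eq_pow (Nat.isUnit_iff.mpr hcop.symm) (by rw [mul_comm]; exact hd)
  subst hu hv
  have hd' : d = u * v := by
    have : (u * v) ^ 2 = d ^ 2 := by rw [← hd]; ring
    exact (Nat.pow_left_injective two_ne_zero this).symm
  subst hd'
  have hu0 : 0 < u := Nat.pos_of_ne_zero (by rintro rfl; simp at ha')
  have hv0 : 0 < v := Nat.pos_of_ne_zero (by rintro rfl; simp at hb')
  have huv : Nat.Coprime u v := by
    rw [Nat.coprime_pow_left_iff two_pos, Nat.coprime_pow_right_iff two_pos] at hcop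
    exact hcop
  have e1 : (G * (u * v)).gcd (v ^ 2 * G) = G * v := by
    rw [show G * (u * v) = G * v * u by ring, show v ^ 2 * G = G * v * v by ring,
      Nat.gcd_mul_left, huv, mul_one]
  have e2 : (G * (u * v)).gcd (u ^ 2 * G) = G * u := by
    rw [show G * (u * v) = G * u * v by ring, show u ^ 2 * G = G * u * u by ring,
      Nat.gcd_mul_left, huv.symm, mul_one]
  have e3 : (u ^ 2 * G).lcm (v ^ 2 * G) = u ^ 2 * v ^ 2 * G := by
    rw [Nat.lcm_mul_right, hcop.lcm_eq_mul]
  rw [e1, e2, e3, show G * (u * v) = G * v * u by ring, Nat.mul_div_cancel_left _ (by positivity),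
    show G * v * u = G * u * v by ring, Nat.mul_div_cancel_left _ (by positivity)]
  ring

/-- The map x ↦ p̄xq into matrices modulo c has kernel D₄ ∩ R D₄, so the index is the size of its
image, which `ncard_range_mul_mul` and `index_arith` evaluate. -/
theorem relIndex_csl {p q : ℍ[ℤ]} (h : IsAdmissible p q) {R : SO4} (hR : R.1 = rotMatrix p q) :
    (csl R).relIndex D4 = (oddNorm p).lcm (oddNorm q) := by
  obtain ⟨k, c, hc, hcpq, hk⟩ := h.exists_sq
  have : NeZero c := ⟨by rintro rfl; simp at hc⟩
  obtain ⟨φ⟩ := nonempty_splitting hc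
  have toQ : ∀ v : D4, ∃ x : ℍ[ℤ], v.1 = toVec x ∧ Even (Quaternion.normSq x : ℤ) :=
    fun v => mem_D4_iff.mp v.2
  choose f hf hfe using toQ
  have hfadd : ∀ v w, f (v + w) = f v + f w := fun v w => toVec_injective (by
    rw [toVec_add, ← hf, ← hf, ← hf]; rfl)
  let ψ : D4 →+ Matrix (Fin 2) (Fin 2) (ZMod c) :=
    AddMonoidHom.mk' (fun v => φ.hom (star p) * φ.hom (f v) * φ.hom q) fun v w => by
      rw [hfadd, map_add, mul_add, add_mul]
  have hker : (csl R).addSubgroupOf D4 = ψ.ker := by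
    ext v
    rw [AddSubgroup.mem_addSubgroupOf, AddMonoidHom.mem_ker]
    change _ ↔ φ.hom (star p) * φ.hom (f v) * φ.hom q = 0
    rw [← map_mul, ← map_mul, φ.hom_eq_zero, ← mem_csl_iff hR hc hk (hfe v), ← hf]
  rw [AddSubgroup.relIndex, hker, AddSubgroup.index_ker]
  have hrange : (ψ.range : Set (Matrix (Fin 2) (Fin 2) (ZMod c))) =
      Set.range fun X => φ.hom (star p) * X * φ.hom q := by
    ext Y
    rw [AddMonoidHom.coe_range]
    constructor
    · rintro ⟨v, rfl⟩
      exact ⟨_, rfl⟩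
    · rintro ⟨X, rfl⟩
      -- Restricting from all integral quaternions to D₄ does not shrink the image: X is reached
      -- from twice a lift of X/2, and a doubled quaternion has even norm.
      obtain ⟨t, ht⟩ := exists_half hc
      obtain ⟨x, hx⟩ := φ.surjective (t • X)
      have h2 : φ.hom (((2 : ℕ) : ℍ[ℤ]) * x) = X := by
        rw [map_mul, map_natCast, hx, Nat.cast_ofNat, Matrix.mul_smul, ← Matrix.smul_mul,
          show t • (2 : Matrix (Fin 2) (Fin 2) (ZMod c)) = 1 by
            rw [show (2 : Matrix (Fin 2) (Fin 2) (ZMod c)) = (2 : ZMod c) • 1 by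
              ext i j; fin_cases i <;> fin_cases j <;> simp [Matrix.ofNat_apply], smul_smul, mul_comm t, ht, one_smul], one_mul]
      have he : Even (Quaternion.normSq (((2 : ℕ) : ℍ[ℤ]) * x) : ℤ) := by
        rw [map_mul, Quaternion.normSq_natCast]
        exact Even.mul_right (by decide) _
      let v : D4 := ⟨toVec (((2 : ℕ) : ℍ[ℤ]) * x), toVec_mem_D4_iff.mpr he⟩
      refine ⟨v, ?_⟩
      change φ.hom (star p) * φ.hom (f v) * φ.hom q = _
      rw [← toVec_injective (hf v), h2]
  have hcard : Nat.card ψ.range = (Set.range fun X => φ.hom (star p) * X * φ.hom q).ncard := by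
    rw [← hrange, ← Nat.card_coe_set_eq]; rfl
  obtain ⟨u, hu⟩ := h.1.star.exists_re_eq_one
  obtain ⟨w, hw⟩ := h.2.1.exists_re_eq_one
  obtain ⟨a, ha⟩ : ∃ a : ℕ, a = (Quaternion.normSq p : ℤ).natAbs := ⟨_, rfl⟩
  obtain ⟨b, hb⟩ : ∃ b : ℕ, b = (Quaternion.normSq q : ℤ).natAbs := ⟨_, rfl⟩
  have ha' : (Quaternion.normSq p : ℤ) = a := by
    rw [ha, Int.natAbs_of_nonneg Quaternion.normSq_nonneg]
  have hb' : (Quaternion.normSq q : ℤ) = b := by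
    rw [hb, Int.natAbs_of_nonneg Quaternion.normSq_nonneg]
  rw [hcard, ncard_range_mul_mul (a := a) (b := b) (φ.unitContent_hom hc hu)
    (φ.unitContent_hom hc hw) (by rw [φ.det_hom, Quaternion.normSq_star, ha', Int.cast_natCast])
    (by rw [φ.det_hom, hb', Int.cast_natCast])]
  rw [← index_arith (Nat.pos_of_ne_zero (NeZero.ne c)) hcpq]
  -- The determinants are the full norms; as c is odd, their powers of 2 do not affect the gcds.
  have hgcd : ∀ (s : ℕ) (n m : ℕ), n = 2 ^ s * m → c.gcd n = c.gcd m := by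
    rintro s n m rfl
    exact Nat.Coprime.gcd_mul_left_cancel_right _ ((Nat.coprime_two_right.mpr hc).pow_right s).symm
  obtain ⟨s, hs⟩ := exists_normSq_eq p
  obtain ⟨r, hr⟩ := exists_normSq_eq q
  have hs' : a = 2 ^ s * oddNorm p := by rw [ha'] at hs; exact_mod_cast hs
  have hr' : b = 2 ^ r * oddNorm q := by rw [hb'] at hr; exact_mod_cast hr
  rw [hgcd s _ _ hs', hgcd r _ _ hr', hgcd (s + r) (a * b) (oddNorm p * oddNorm q)
    (by rw [hs', hr']; ring)]

/-! ### Coincidence rotations are given by admissible pairs -/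

/-- This is the Skolem–Noether average: u, v, w satisfy the relations of i, j, k scaled by the
central element c, and summing over the basis turns an arbitrary x into an element that carries i to
u and j to v. -/
theorem exists_intertwiner {A : Type*} [Ring A] {c u v w i j k : A} (hc : ∀ y, c * y = y * c)
    (huu : u * u = -(c * c)) (hvv : v * v = -(c * c)) (huv : u * v = c * w) (hvu : v * u = -(c * w))
    (huw : u * w = -(c * v)) (hvw : v * w = c * u) (hii : i * i = -1) (hjj : j * j = -1)
    (hij : i * j = k) (hji : j * i = -k) (hki : k * i = j) (hkj : k * j = -i) (x : A) :
    u * (c * x - u * x * i - v * x * j - w * x * k) =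
      c * (c * x - u * x * i - v * x * j - w * x * k) * i ∧
    v * (c * x - u * x * i - v * x * j - w * x * k) =
      c * (c * x - u * x * i - v * x * j - w * x * k) * j := by
  constructor
  · linear_combination (norm := noncomm_ring) -(hc u) * x - huu * x * i - huv * x * j
      - huw * x * k + c * u * x * hii + c * v * x * hji + c * w * x * hki
  · linear_combination (norm := noncomm_ring) -(hc v) * x - hvu * x * i - hvv * x * j
      - hvw * x * k + c * u * x * hij + c * v * x * hjj + c * w * x * hkj

/-- The unit vector in the first row and column isolates a 3 × 3 block of determinant 1. Its
adjugate equals its transpose, so the last column is the cross product of the other two. -/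
theorem cross_product_of_specialOrthogonal {S : Matrix (Fin 4) (Fin 4) ℝ}
    (hS : S ∈ Matrix.specialOrthogonalGroup (Fin 4) ℝ) (h0 : S 0 0 = 1) :
    S 0 1 = 0 ∧ S 0 2 = 0 ∧ S 0 3 = 0 ∧ S 1 0 = 0 ∧ S 2 0 = 0 ∧ S 3 0 = 0 ∧
    S 1 3 = S 2 1 * S 3 2 - S 3 1 * S 2 2 ∧ S 2 3 = S 3 1 * S 1 2 - S 1 1 * S 3 2 ∧
    S 3 3 = S 1 1 * S 2 2 - S 2 1 * S 1 2 := by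
  rw [Matrix.mem_specialOrthogonalGroup_iff, Matrix.mem_orthogonalGroup_iff] at hS
  obtain ⟨h1, hdet⟩ := hS
  have h2 : S.transpose * S = 1 := mul_eq_one_comm.mp h1
  have hrow := congrFun (congrFun h1 0) 0
  have hcol := congrFun (congrFun h2 0) 0
  simp [Matrix.mul_apply, Fin.sum_univ_four, h0] at hrow hcol
  have r1 : S 0 1 = 0 := by nlinarith [sq_nonneg (S 0 1), sq_nonneg (S 0 2), sq_nonneg (S 0 3)]
  have r2 : S 0 2 = 0 := by nlinarith [sq_nonneg (S 0 1), sq_nonneg (S 0 2), sq_nonneg (S 0 3)]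
  have r3 : S 0 3 = 0 := by nlinarith [sq_nonneg (S 0 1), sq_nonneg (S 0 2), sq_nonneg (S 0 3)]
  have c1 : S 1 0 = 0 := by nlinarith [sq_nonneg (S 1 0), sq_nonneg (S 2 0), sq_nonneg (S 3 0)]
  have c2 : S 2 0 = 0 := by nlinarith [sq_nonneg (S 1 0), sq_nonneg (S 2 0), sq_nonneg (S 3 0)]
  have c3 : S 3 0 = 0 := by nlinarith [sq_nonneg (S 1 0), sq_nonneg (S 2 0), sq_nonneg (S 3 0)]
  let N : Matrix (Fin 3) (Fin 3) ℝ := S.submatrix Fin.succ Fin.succ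
  have hN : N * N.transpose = 1 := by
    ext i j
    have := congrFun (congrFun h1 i.succ) j.succ
    rw [Matrix.mul_apply, Fin.sum_univ_succ] at this
    have hi : S i.succ 0 = 0 := by fin_cases i <;> assumption
    rw [hi, zero_mul, zero_add] at this
    rw [Matrix.mul_apply]
    simpa [N, Matrix.one_apply] using this
  have hNdet : N.det = 1 := by
    rw [Matrix.det_succ_row_zero, Fin.sum_univ_four, h0, r1, r2, r3] at hdet
    simpa [N, Fin.succAbove_zero] using hdet
  have hadj : N.adjugate = N.transpose := by
    calc N.adjugate = N.adjugate * (N * N.transpose) := by rw [hN, mul_one]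
      _ = N.transpose := by rw [← mul_assoc, Matrix.adjugate_mul, hNdet, one_smul, one_mul]
  have a0 := congrFun (congrFun hadj 2) 0
  have a1 := congrFun (congrFun hadj 2) 1
  have a2 := congrFun (congrFun hadj 2) 2
  rw [Matrix.adjugate_fin_three] at a0 a1 a2
  simp [N] at a0 a1 a2
  refine ⟨r1, r2, r3, c1, c2, c3, ?_, ?_, ?_⟩
  · linear_combination -a0
  · linear_combination -a1
  · linear_combination -a2

theorem toVec_unitQuat (c : Fin 4) : toVec (unitQuat c) = Pi.single c 1 := by
  ext r
  fin_cases c <;> fin_cases r <;> simp [toVec, coords]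

theorem matrix_eq_of_mulVec_unitQuat {A B : Matrix (Fin 4) (Fin 4) ℝ}
    (h : ∀ c, A.mulVec (toVec (unitQuat c)) = B.mulVec (toVec (unitQuat c))) : A = B := by
  ext r c
  have := congrFun (h c) r
  simpa [toVec_unitQuat] using this

/-- The four products of the intertwiner with the unit quaternions cannot all vanish. -/
theorem exists_intertwiner_ne_zero {C : ℤ} (hC : C ≠ 0) (u v w : ℍ[ℤ]) : ∃ x : ℍ[ℤ],
    (C : ℍ[ℤ]) * x - u * x * quat 0 1 0 0 - v * x * quat 0 0 1 0 - w * x * quat 0 0 0 1 ≠ 0 := by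
  by_contra! h
  have h0 := congrArg QuaternionAlgebra.re (h (quat 1 0 0 0))
  have h1 := congrArg QuaternionAlgebra.imI (h (quat 0 1 0 0))
  have h2 := congrArg QuaternionAlgebra.imJ (h (quat 0 0 1 0))
  have h3 := congrArg QuaternionAlgebra.imK (h (quat 0 0 0 1))
  have e0 := (QuaternionAlgebra.re_zero : (0 : ℍ[ℤ,-1,0,-1]).re = 0)
  simp at h0 h1 h2 h3
  omega

theorem intCast_ne_zero {C : ℤ} (hC : C ≠ 0) : (C : ℍ[ℤ]) ≠ 0 := fun h => hC (by
  simpa using congrArg QuaternionAlgebra.re h)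

/-- The missing relations for uw and vw follow from the given ones by cancelling C. The average is
non-zero for a suitable starting quaternion. -/
theorem exists_conjugator {C : ℤ} (hC : C ≠ 0) {u v w : ℍ[ℤ]} (huu : u * u = -((C : ℍ[ℤ]) * C))
    (hvv : v * v = -((C : ℍ[ℤ]) * C)) (huv : u * v = C * w) (hvu : v * u = -(C * w)) :
    ∃ g : ℍ[ℤ], g ≠ 0 ∧ u * g = (C : ℍ[ℤ]) * g * (quat 0 1 0 0 : ℍ[ℤ]) ∧
      v * g = (C : ℍ[ℤ]) * g * (quat 0 0 1 0 : ℍ[ℤ]) ∧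
      w * g = (C : ℍ[ℤ]) * g * (quat 0 0 0 1 : ℍ[ℤ]) := by
  have hc : ∀ y : ℍ[ℤ], (C : ℍ[ℤ]) * y = y * C := fun y => (Int.cast_commute C y).eq
  have hC' : (C : ℍ[ℤ]) ≠ 0 := intCast_ne_zero hC
  have huw : u * w = -(C * v) := mul_left_cancel₀ hC' (by
    calc (C : ℍ[ℤ]) * (u * w) = u * (C * w) := by rw [← mul_assoc, hc, mul_assoc]
      _ = _ := by rw [← huv, ← mul_assoc, huu]; noncomm_ring)
  have hvw : v * w = C * u := mul_left_cancel₀ hC' (by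
    calc (C : ℍ[ℤ]) * (v * w) = v * (C * w) := by rw [← mul_assoc, hc, mul_assoc]
      _ = -(v * v * u) := by rw [← neg_eq_iff_eq_neg.mpr hvu]; noncomm_ring
      _ = _ := by rw [hvv]; noncomm_ring)
  obtain ⟨x, hx⟩ := exists_intertwiner_ne_zero hC u v w
  have hij : (quat 0 1 0 0 : ℍ[ℤ]) * quat 0 0 1 0 = quat 0 0 0 1 := by ext <;> simp
  obtain ⟨h1, h2⟩ := exists_intertwiner hc huu hvv huv hvu huw hvw
    (i := quat 0 1 0 0) (j := quat 0 0 1 0) (k := quat 0 0 0 1) (by ext <;> simp)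
    (by ext <;> simp) hij (by ext <;> simp)
    (by ext <;> simp) (by ext <;> simp) x
  refine ⟨_, hx, h1, h2, mul_left_cancel₀ hC' ?_⟩
  generalize (C : ℍ[ℤ]) * x - u * x * quat 0 1 0 0 - v * x * quat 0 0 1 0
    - w * x * quat 0 0 0 1 = g at h1 h2
  rw [← mul_assoc, ← huv, mul_assoc, h2, ← mul_assoc, ← mul_assoc, ← hc u, mul_assoc (C : ℍ[ℤ]) u,
    h1, ← hij]
  noncomm_ring

/-- Left multiplication by the conjugate of a₀ = M·R(1) turns R into a rotation fixing 1. The images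
of i, j, k form an oriented orthonormal frame, hence satisfy the quaternion relations, and are
conjugates of i, j, k by some g. So R is x ↦ a₀ g x ḡ up to a scalar, and removing contents makes
the pair (a₀g, g) primitive. -/
theorem exists_rotMatrix_of_mulVec {R : SO4} {M : ℕ} (hM : M ≠ 0) {a : Fin 4 → ℍ[ℤ]}
    (h : ∀ c, R.1.mulVec (toVec (unitQuat c)) = (1 / (M : ℝ)) • toVec (a c)) :
    ∃ p q : ℍ[ℤ], IsAdmissible p q ∧ R.1 = rotMatrix p q := by
  have hM' : (M : ℝ) ≠ 0 := by exact_mod_cast hM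
  have hR : ∀ r c, R.1 r c = coords (a c) r / M := fun r c => by
    have := congrFun (h c) r
    rw [toVec_unitQuat, Matrix.mulVec_single_one] at this
    simpa [toVec, div_eq_inv_mul] using this
  have orth : ∀ {S : Matrix (Fin 4) (Fin 4) ℝ}, S ∈ Matrix.specialOrthogonalGroup (Fin 4) ℝ →
      S.transpose * S = 1 := fun {S} hS => by
    rw [Matrix.mem_specialOrthogonalGroup_iff, Matrix.mem_orthogonalGroup_iff] at hS
    exact mul_eq_one_comm.mp hS.1
  have hN : ∀ c, (Quaternion.normSq (a c) : ℤ) = (M : ℤ) ^ 2 := fun c => by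
    have := congrFun (congrFun (orth R.2) c) c
    simp only [Matrix.mul_apply, Fin.sum_univ_four, Matrix.transpose_apply, hR,
      Matrix.one_apply_eq] at this
    field_simp at this
    rw [Quaternion.normSq_def']
    simp [coords] at this
    exact_mod_cast this
  have ha0 : a 0 ≠ 0 := by
    intro e
    have := hN 0
    rw [e, map_zero] at this
    exact hM (by simpa using this.symm)
  set s : Fin 4 → ℍ[ℤ] := fun c => star (a 0) * a c with hs
  set C : ℤ := (M : ℤ) ^ 2 with hCdef
  have hC : C ≠ 0 := by positivity
  have hC' : (C : ℝ) ≠ 0 := by exact_mod_cast hC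
  let S : SO4 := rot (star_ne_zero.mpr ha0) one_ne_zero * R
  have hS : ∀ r c, S.1 r c = coords (s c) r / C := fun r c => by
    have h1 : S.1.mulVec (toVec (unitQuat c)) =
        (rotMatrix (star (a 0)) 1).mulVec ((1 / (M : ℝ)) • toVec (a c)) := by
      rw [← h c, Matrix.mulVec_mulVec]; rfl
    rw [Matrix.mulVec_smul, rotMatrix_mulVec_toVec, star_one, mul_one, mul_one,
      Quaternion.normSq_star, hN, Int.cast_pow, Int.cast_natCast, Real.sqrt_sq (by positivity),
      smul_smul] at h1
    have := congrFun h1 r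
    rw [toVec_unitQuat, Matrix.mulVec_single_one] at this
    simp only [Matrix.col_apply, Pi.smul_apply, smul_eq_mul] at this
    rw [this, hCdef, hs, toVec]
    push_cast
    field_simp
  have hs0 : s 0 = (C : ℍ[ℤ]) := by
    rw [hs]; simp only; rw [Quaternion.star_mul_self, hN]; rfl
  have hs00 : S.1 0 0 = 1 := by
    rw [hS, hs0]
    simp [coords, hC']
  obtain ⟨e1, e2, e3, -, -, -, e4, e5, e6⟩ := cross_product_of_specialOrthogonal S.2 hs00
  have o11 := congrFun (congrFun (orth S.2) 1) 1
  have o12 := congrFun (congrFun (orth S.2) 1) 2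
  have o22 := congrFun (congrFun (orth S.2) 2) 2
  simp only [Matrix.mul_apply, Fin.sum_univ_four, Matrix.transpose_apply, e1, e2] at o11 o12 o22
  rw [Matrix.one_apply_eq] at o11 o22
  rw [Matrix.one_apply_ne (by decide)] at o12
  simp only [hS] at e1 e2 e3 e4 e5 e6 o11 o12 o22
  field_simp at e1 e2 e3 e4 e5 e6 o11 o12 o22
  simp [coords] at e1 e2 e3 e4 e5 e6 o11 o12 o22
  have huu : s 1 * s 1 = -((C : ℍ[ℤ]) * C) := by
    ext <;> simp [e1]
    · norm_cast at o11; linear_combination -o11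
    all_goals ring
  have hvv : s 2 * s 2 = -((C : ℍ[ℤ]) * C) := by
    ext <;> simp [e2]
    · norm_cast at o22; linear_combination -o22
    all_goals ring
  norm_cast at o12 e4 e5 e6
  have huv : s 1 * s 2 = C * s 3 := by
    ext <;> simp [e1, e2, e3]
    · linear_combination -o12
    · linear_combination -e4
    · linear_combination -e5
    · linear_combination -e6
  have hvu : s 2 * s 1 = -(C * s 3) := by
    ext <;> simp [e1, e2, e3]
    · linear_combination -o12
    · linear_combination e4
    · linear_combination e5
    · linear_combination e6
  obtain ⟨g, hg, g1, g2, g3⟩ := exists_conjugator hC huu hvv huv hvu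
  have hconj : ∀ c, s c * g = C * g * unitQuat c := by
    intro c
    fin_cases c
    · change s 0 * g = _
      rw [hs0]
      change _ = _ * quat 1 0 0 0
      rw [show (quat 1 0 0 0 : ℍ[ℤ]) = 1 by ext <;> simp, mul_one]
    · exact g1
    · exact g2
    · exact g3
  have hcom : ∀ y : ℍ[ℤ], (C : ℍ[ℤ]) * y = y * C := fun y => (Int.cast_commute C y).eq
  have hCq : (C : ℍ[ℤ]) ≠ 0 := intCast_ne_zero hC
  -- This undoes the left multiplication by `star (a 0)` and moves g to the other side by means of
  -- gḡ = |g|².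
  have hconj2 : ∀ c, a c * (((Quaternion.normSq g : ℤ)) : ℍ[ℤ]) =
      a 0 * g * unitQuat c * star g := by
    intro c
    have h1 : a c * g = a 0 * g * unitQuat c := mul_left_cancel₀ hCq (by
      have hself : a 0 * star (a 0) = (C : ℍ[ℤ]) := by
        rw [Quaternion.self_mul_star, hN]; rfl
      calc (C : ℍ[ℤ]) * (a c * g) = a 0 * (s c * g) := by
            rw [← hself, hs]; simp only [mul_assoc]
        _ = C * (a 0 * g * unitQuat c) := by
            rw [hconj, ← mul_assoc, ← mul_assoc, ← hcom]
            simp only [mul_assoc])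
    rw [← h1, mul_assoc, Quaternion.self_mul_star]; rfl
  have hfin : R.1 = rotMatrix (a 0 * g) g := by
    refine matrix_eq_of_mulVec_unitQuat fun c => ?_
    have hg0 := normSq_pos hg
    have hg0' : (0 : ℝ) < ((Quaternion.normSq g : ℤ) : ℝ) := by exact_mod_cast hg0
    have hNg : (Quaternion.normSq (a 0 * g * g) : ℤ) = ((M : ℤ) * Quaternion.normSq g) ^ 2 := by
      rw [map_mul, map_mul, hN]; ring
    rw [h, rotMatrix_mulVec_toVec, ← hconj2, hNg, Int.cast_pow, Real.sqrt_sq (by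
      push_cast; positivity)]
    ext r
    have : toVec (a c * (((Quaternion.normSq g : ℤ)) : ℍ[ℤ])) =
        ((Quaternion.normSq g : ℤ) : ℝ) • toVec (a c) := by
      ext i; fin_cases i <;> simp [toVec, coords, mul_comm]
    rw [this]
    simp only [Pi.smul_apply, smul_eq_mul]
    push_cast
    field_simp
  obtain ⟨k, p, hk, hp, hkp⟩ := exists_eq_mul_isPrimitive (mul_ne_zero ha0 hg)
  obtain ⟨l, q, hl, hq, hlq⟩ := exists_eq_mul_isPrimitive hg
  refine ⟨p, q, ⟨hp, hq, ?_⟩, ?_⟩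
  · have h1 : ((k * l : ℕ) : ℤ) ^ 2 * Quaternion.normSq (p * q) =
        ((M : ℤ) * Quaternion.normSq g) ^ 2 := by
      have : (Quaternion.normSq (a 0 * g * g) : ℤ) = ((M : ℤ) * Quaternion.normSq g) ^ 2 := by
        rw [map_mul, map_mul, hN]; ring
      rw [← this, hkp]
      conv_rhs => rw [hlq]
      simp only [map_mul, Quaternion.normSq_natCast]
      push_cast; ring
    -- Over ℤ, divisibility of squares implies divisibility of the roots; the quotient is an integer
    -- whose square is |pq|².
    obtain ⟨r, hr⟩ : ((k * l : ℕ) : ℤ) ∣ (M : ℤ) * Quaternion.normSq g :=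
      (Int.pow_dvd_pow_iff two_ne_zero).mp ⟨_, h1.symm⟩
    refine ⟨r, ?_⟩
    rw [hr, mul_pow] at h1
    have hkl : ((k * l : ℕ) : ℤ) ^ 2 ≠ 0 := by positivity
    rw [mul_left_cancel₀ hkl h1, sq]
  · rw [hfin, hkp]
    conv_lhs => rw [hlq]
    have := rotMatrix_intCast_mul (m := k) (n := l) (by positivity) p q
    exact_mod_cast this

/-- Finite index makes some multiple n D₄ lie in R D₄, so R⁻¹ has rational entries and is given by
an admissible pair; transposition returns to R. -/
theorem IsCoincidence.exists_rotMatrix {R : SO4} (hR : IsCoincidence R) :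
    ∃ p q : ℍ[ℤ], IsAdmissible p q ∧ R.1 = rotMatrix p q := by
  have hfin : (csl R).relIndex D4 ≠ 0 := hR.relIndex_ne_zero
  have h1 : ∀ v ∈ D4, (((csl R).relIndex D4).factorial) • v ∈ csl R := fun v hv =>
    (AddSubgroup.nsmul_mem_of_relIndex_ne_zero_of_dvd hfin hv
      fun m h0 hm => Nat.dvd_factorial h0 hm).1
  obtain ⟨n, hn, h1⟩ : ∃ n : ℕ, n ≠ 0 ∧ ∀ v ∈ D4, n • v ∈ csl R :=
    ⟨_, Nat.factorial_ne_zero _, h1⟩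
  have h2 : ∀ c, ∃ x : ℍ[ℤ], (R⁻¹ : SO4).1.mulVec (toVec (unitQuat c)) =
      (1 / ((2 * n : ℕ) : ℝ)) • toVec x := by
    intro c
    -- The unit vectors have odd norm and are not in D₄, but their doubles are; this accounts for
    -- the denominator 2n.
    have hD : toVec (((2 : ℕ) : ℍ[ℤ]) * unitQuat c) ∈ D4 := by
      rw [toVec_mem_D4_iff, map_mul, Quaternion.normSq_natCast]
      exact Even.mul_right (by decide) _
    have h3 := (AddSubgroup.mem_inf.mp (h1 _ hD)).2
    rw [mem_rotate_iff, toVec_natCast_mul, ← Nat.cast_smul_eq_nsmul ℝ, smul_smul,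
      Matrix.mulVec_smul] at h3
    obtain ⟨x, hx, -⟩ := mem_D4_iff.mp h3
    refine ⟨x, ?_⟩
    have hn' : (n : ℝ) ≠ 0 := by exact_mod_cast hn
    rw [← hx, smul_smul, show 1 / ((2 * n : ℕ) : ℝ) * ((n : ℝ) * ((2 : ℕ) : ℝ)) = 1 by
      push_cast; field_simp, one_smul]
  choose a ha using h2
  obtain ⟨p, q, hpq, hRpq⟩ := exists_rotMatrix_of_mulVec (M := 2 * n) (by omega) ha
  refine ⟨star p, star q, ⟨hpq.1.star, hpq.2.1.star, ?_⟩, ?_⟩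
  · have := hpq.2.2
    simpa only [map_mul, Quaternion.normSq_star] using this
  · rw [← rotMatrix_transpose, ← hRpq]
    exact (Matrix.transpose_transpose _).symm

/-! ### Right ideals and lines -/

/-- The right ideal attached to a quaternion; it determines a primitive quaternion up to
multiplication from the right by the 48 quaternions of the cubic group. -/
def rightIdeal (p : ℍ[ℤ]) : Set ℍ[ℤ] := {x | (oddNorm p : ℍ[ℤ]) ∣ star p * x}

theorem natCast_mul_quat (k : ℕ) (a b c d : ℤ) :
    (k : ℍ[ℤ]) * quat a b c d = quat (k * a) (k * b) (k * c) (k * d) := by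
  ext <;> simp

theorem intCast_mul_quat (k a b c d : ℤ) :
    (k : ℍ[ℤ]) * quat a b c d = quat (k * a) (k * b) (k * c) (k * d) := by
  ext <;> simp

theorem exists_rounding {n : ℤ} (hn : 0 < n) (y : ℤ) : ∃ h r : ℤ, y = n * h + r ∧
    -n ≤ 2 * r ∧ 2 * r ≤ n := by
  refine ⟨(2 * y + n) / (2 * n), y - n * ((2 * y + n) / (2 * n)), by ring, ?_, ?_⟩
  · have := Int.emod_nonneg (2 * y + n) (b := 2 * n) (by omega)
    rw [Int.emod_def] at this
    linarith
  · have := Int.emod_lt_of_pos (2 * y + n) (b := 2 * n) (by omega)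
    rw [Int.emod_def] at this
    linarith

/-- Rounding the coordinates of p̄x / |p|² leaves remainders of absolute value at most 1/2. Division
fails to reduce the norm only if all four equal 1/2 in absolute value, and then 2x is a right
multiple of p. -/
theorem euclidean_step {p : ℍ[ℤ]} (hp : p ≠ 0) (x : ℍ[ℤ]) :
    (∃ h, (Quaternion.normSq (x - p * h) : ℤ) < Quaternion.normSq p) ∨
    ∃ h, ((2 : ℕ) : ℍ[ℤ]) * x = p * h := by
  have hn := normSq_pos hp
  set n : ℤ := Quaternion.normSq p with hndef
  obtain ⟨h0, r0, e0, l0, u0⟩ := exists_rounding hn (star p * x).re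
  obtain ⟨h1, r1, e1, l1, u1⟩ := exists_rounding hn (star p * x).imI
  obtain ⟨h2, r2, e2, l2, u2⟩ := exists_rounding hn (star p * x).imJ
  obtain ⟨h3, r3, e3, l3, u3⟩ := exists_rounding hn (star p * x).imK
  have hsp : star p * p = (n : ℍ[ℤ]) := Quaternion.star_mul_self p
  have hr : star p * (x - p * quat h0 h1 h2 h3) = quat r0 r1 r2 r3 := by
    rw [mul_sub, ← mul_assoc, hsp]
    generalize star p * x = y at e0 e1 e2 e3
    ext <;> simp [e0, e1, e2, e3]
  have hN : n * Quaternion.normSq (x - p * quat h0 h1 h2 h3) =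
      r0 ^ 2 + r1 ^ 2 + r2 ^ 2 + r3 ^ 2 := by
    rw [hndef, ← Quaternion.normSq_star, ← map_mul, hr, Quaternion.normSq_def']; simp
  have sq : ∀ {r : ℤ}, -n ≤ 2 * r → 2 * r ≤ n → 4 * r ^ 2 ≤ n ^ 2 := fun {r} hl hu => by
    nlinarith
  by_cases hlt : (Quaternion.normSq (x - p * quat h0 h1 h2 h3) : ℤ) < n
  · exact Or.inl ⟨_, hlt⟩
  · right
    have hge : n ^ 2 ≤ r0 ^ 2 + r1 ^ 2 + r2 ^ 2 + r3 ^ 2 := by rw [← hN]; nlinarith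
    have s0 := sq l0 u0
    have s1 := sq l1 u1
    have s2 := sq l2 u2
    have s3 := sq l3 u3
    have ext : ∀ {r : ℤ}, 4 * r ^ 2 = n ^ 2 → ∃ e : ℤ, 2 * r = n * e := fun {r} h => by
      have : (2 * r) ^ 2 = n ^ 2 := by rw [← h]; ring
      rcases sq_eq_sq_iff_eq_or_eq_neg.mp this with h | h
      · exact ⟨1, by rw [h]; ring⟩
      · exact ⟨-1, by rw [h]; ring⟩
    obtain ⟨f0, hf0⟩ := ext (show 4 * r0 ^ 2 = n ^ 2 by linarith)
    obtain ⟨f1, hf1⟩ := ext (show 4 * r1 ^ 2 = n ^ 2 by linarith)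
    obtain ⟨f2, hf2⟩ := ext (show 4 * r2 ^ 2 = n ^ 2 by linarith)
    obtain ⟨f3, hf3⟩ := ext (show 4 * r3 ^ 2 = n ^ 2 by linarith)
    refine ⟨((2 : ℕ) : ℍ[ℤ]) * quat h0 h1 h2 h3 + quat f0 f1 f2 f3,
      mul_left_cancel₀ (star_ne_zero.mpr hp) ?_⟩
    have hx : star p * x = (n : ℍ[ℤ]) * quat h0 h1 h2 h3 + quat r0 r1 r2 r3 := by
      rw [← hr, ← hsp]; noncomm_ring
    have h2r : ((2 : ℕ) : ℍ[ℤ]) * quat r0 r1 r2 r3 = (n : ℍ[ℤ]) * quat f0 f1 f2 f3 := by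
      rw [natCast_mul_quat, intCast_mul_quat, ← hf0, ← hf1, ← hf2, ← hf3]; rfl
    rw [← mul_assoc (star p) p, hsp, ← mul_assoc, ← (Nat.cast_commute 2 (star p)).eq, mul_assoc,
      hx, mul_add, h2r, mul_add, ← mul_assoc, ← mul_assoc, (Nat.cast_commute 2 (n : ℍ[ℤ])).eq]

/-- The integral quaternions do not have division with remainder, but an element of least norm in a
right ideal generates it up to a factor 2, which is harmless for odd m. -/
theorem exists_generator {I : Set ℍ[ℤ]} (hadd : ∀ x ∈ I, ∀ y ∈ I, x - y ∈ I)
    (hmul : ∀ x ∈ I, ∀ h, x * h ∈ I) (hne : ∃ x ∈ I, x ≠ 0) :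
    ∃ p ∈ I, p ≠ 0 ∧ ∀ x ∈ I, ∃ h, ((2 : ℕ) : ℍ[ℤ]) * x = p * h := by
  obtain ⟨p, ⟨hpI, hp0⟩, hmin⟩ := WellFounded.has_min
    (measure fun x : ℍ[ℤ] => (Quaternion.normSq x : ℤ).natAbs).wf {x | x ∈ I ∧ x ≠ 0} hne
  refine ⟨p, hpI, hp0, fun x hx => ?_⟩
  rcases euclidean_step hp0 x with ⟨h, hh⟩ | h
  · have hz : x - p * h = 0 := by
      by_contra h0
      refine hmin _ ⟨hadd _ hx _ (hmul _ hpI h), h0⟩ ?_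
      change (Quaternion.normSq (x - p * h) : ℤ).natAbs < (Quaternion.normSq p : ℤ).natAbs
      have := Quaternion.normSq_nonneg (a := x - p * h)
      omega
    refine ⟨((2 : ℕ) : ℍ[ℤ]) * h, ?_⟩
    rw [sub_eq_zero.mp hz, ← mul_assoc, (Nat.cast_commute 2 p).eq, mul_assoc]
  · exact h

variable {m : ℕ} (φ : Splitting m)

/-- The columns of the matrix of `x` are multiples of `u`. -/
def OnLine (u : ZMod m × ZMod m) (x : ℍ[ℤ]) : Prop :=
  ∀ j, u.1 * φ.hom x 1 j = u.2 * φ.hom x 0 j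

/-- The right ideal of a line. -/
def lineIdeal (u : ZMod m × ZMod m) : Set ℍ[ℤ] := {x | OnLine φ u x}

variable {φ}

theorem OnLine.exists_eq {u : ZMod m × ZMod m} (hu : IsCoprime u.1 u.2) {x : ℍ[ℤ]}
    (h : OnLine φ u x) : ∃ w : Fin 2 → ZMod m, ∀ j, φ.hom x 0 j = u.1 * w j ∧
      φ.hom x 1 j = u.2 * w j := by
  obtain ⟨a, b, hab⟩ := hu
  refine ⟨fun j => a * φ.hom x 0 j + b * φ.hom x 1 j, fun j => ⟨?_, ?_⟩⟩
  · linear_combination -(φ.hom x 0 j) * hab - b * h j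
  · linear_combination -(φ.hom x 1 j) * hab + a * h j

theorem exists_unit_smul {u v : ZMod m × ZMod m} (hu : IsCoprime u.1 u.2)
    (h : u.1 * v.2 = u.2 * v.1) : ∃ c : ZMod m, v = (c * u.1, c * u.2) := by
  obtain ⟨a, b, hab⟩ := hu
  refine ⟨a * v.1 + b * v.2, Prod.ext ?_ ?_⟩
  · linear_combination -v.1 * hab - b * h
  · linear_combination -v.2 * hab + a * h

/-- On the line u the matrix of p is the rank-one product u wᵀ, and unit content makes w unimodular.
Its adjugate annihilates a column exactly when that column has vanishing determinant with u. -/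
theorem mem_rightIdeal_iff_onLine (hm : Odd m) {u : ZMod m × ZMod m} (hu : IsCoprime u.1 u.2)
    {p : ℍ[ℤ]} (hp : IsPrimitive p) (hpm : oddNorm p = m) (h : OnLine φ u p) {x : ℍ[ℤ]} :
    x ∈ rightIdeal p ↔ OnLine φ u x := by
  obtain ⟨w, hw⟩ := h.exists_eq hu
  obtain ⟨c, hc⟩ := hp.exists_re_eq_one
  obtain ⟨B, hB⟩ := φ.unitContent_hom hm hc
  rw [rightIdeal, Set.mem_ofPred_eq, hpm, ← φ.hom_eq_zero, map_mul, φ.hom_star,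
    Matrix.adjugate_fin_two]
  simp only [Matrix.trace_fin_two, Matrix.mul_apply, Fin.sum_univ_two, hw] at hB
  constructor
  · intro h0 j
    have h1 := congrFun (congrFun h0 0) j
    have h2 := congrFun (congrFun h0 1) j
    simp [Matrix.mul_apply, Fin.sum_univ_two, hw] at h1 h2
    linear_combination (φ.hom x 0 j * u.2 - φ.hom x 1 j * u.1) * hB
      + (B 0 0 * u.1 + B 0 1 * u.2) * h2 - (B 1 0 * u.1 + B 1 1 * u.2) * h1
  · intro h0
    ext i j
    have := h0 j
    fin_cases i <;> simp [Matrix.mul_apply, Fin.sum_univ_two, hw]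
    · linear_combination -w 1 * this
    · linear_combination w 0 * this

theorem rightIdeal_eq_lineIdeal (hm : Odd m) {u : ZMod m × ZMod m} (hu : IsCoprime u.1 u.2)
    {p : ℍ[ℤ]} (hp : IsPrimitive p) (hpm : oddNorm p = m) (h : OnLine φ u p) :
    rightIdeal p = lineIdeal φ u :=
  Set.ext fun _ => mem_rightIdeal_iff_onLine hm hu hp hpm h

/-- Modulo m = `oddNorm p` the determinant vanishes and the normal form is diag(1, 0). The second
row of `P` therefore annihilates the matrix of p, and the vector orthogonal to that row spans the
line. -/
theorem exists_onLine (hm : Odd m) {p : ℍ[ℤ]} (hp : IsPrimitive p) (hpm : oddNorm p = m) :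
    ∃ u : ZMod m × ZMod m, IsCoprime u.1 u.2 ∧ OnLine φ u p := by
  have hm0 : m ≠ 0 := by rintro rfl; simp at hm
  obtain ⟨c, hc⟩ := hp.exists_re_eq_one
  obtain ⟨P, Q, hP, hQ, h⟩ := (φ.unitContent_hom hm hc).exists_diagonal hm0
  have hdet : (φ.hom p).det = 0 := by
    rw [φ.det_hom, ZMod.intCast_zmod_eq_zero_iff_dvd]
    exact hpm ▸ oddNorm_dvd p
  rw [hdet] at h
  have h2 : P * φ.hom p = !![1, 0; 0, 0] * Q.adjugate := by
    rw [← h, mul_assoc, Matrix.mul_adjugate, hQ, one_smul, mul_one]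
  rw [Matrix.det_fin_two] at hP
  refine ⟨(P 1 1, -P 1 0), ⟨P 0 0, P 0 1, by linear_combination hP⟩, fun j => ?_⟩
  have := congrFun (congrFun h2 1) j
  simp [Matrix.mul_apply, Fin.sum_univ_two] at this
  linear_combination this

theorem exists_hom_eq_column (u : ZMod m × ZMod m) : ∃ x, φ.hom x = !![u.1, 0; u.2, 0] :=
  φ.surjective _

theorem onLine_natCast_mul {u : ZMod m × ZMod m} {k : ℕ} (hk : Nat.Coprime k m) {x : ℍ[ℤ]} :
    OnLine φ u ((k : ℍ[ℤ]) * x) ↔ OnLine φ u x := by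
  have hu : IsUnit (k : ZMod m) := (ZMod.isUnit_iff_coprime k m).mpr hk
  refine forall_congr' fun j => ?_
  rw [map_mul, map_natCast, ← nsmul_eq_mul]
  simp only [Matrix.smul_apply, nsmul_eq_mul]
  rw [mul_left_comm, mul_left_comm u.2]
  exact hu.mul_right_inj

/-- The primitive part q of a generator of the line ideal is the required quaternion. Its odd norm
divides m because 2m is a right multiple of the generator, and m divides it because the matrix of q
has rank one, hence determinant 0. -/
theorem exists_primitive_onLine (hm : Odd m) {u : ZMod m × ZMod m} (hu : IsCoprime u.1 u.2) :
    ∃ p, IsPrimitive p ∧ oddNorm p = m ∧ OnLine φ u p := by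
  have hm0 : m ≠ 0 := by rintro rfl; simp at hm
  have hsub : ∀ x ∈ lineIdeal φ u, ∀ y ∈ lineIdeal φ u, x - y ∈ lineIdeal φ u := by
    intro x hx y hy j
    rw [map_sub]
    simp only [Matrix.sub_apply]
    linear_combination hx j - hy j
  have hmul : ∀ x ∈ lineIdeal φ u, ∀ h, x * h ∈ lineIdeal φ u := by
    intro x hx h j
    rw [map_mul]
    simp only [Matrix.mul_apply, Fin.sum_univ_two]
    linear_combination φ.hom h 0 j * hx 0 + φ.hom h 1 j * hx 1
  have hmI : (m : ℍ[ℤ]) ∈ lineIdeal φ u := by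
    intro j
    rw [(φ.hom_eq_zero _).mpr dvd_rfl]; simp
  have hmne : (m : ℍ[ℤ]) ≠ 0 := by
    have := intCast_ne_zero (C := m) (by exact_mod_cast hm0)
    rwa [Int.cast_natCast] at this
  obtain ⟨p, hpI, hp0, hgen⟩ := exists_generator hsub hmul ⟨_, hmI, hmne⟩
  obtain ⟨k, q, hk, hq, rfl⟩ := exists_eq_mul_isPrimitive hp0
  obtain ⟨h, hh⟩ := hgen _ hmI
  -- An odd prime l in the content would divide every element of the ideal: m itself, and an element
  -- whose matrix has first column u. Then l would be a unit modulo m by unimodularity of u,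
  -- although l divides m.
  have hk2 : ∃ j, k = 2 ^ j := by
    refine ⟨_, Nat.eq_prime_pow_of_unique_prime_dvd hk fun {l} hl hlk => ?_⟩
    by_contra hl2
    have hcop : Nat.Coprime l 2 := (Nat.coprime_primes hl Nat.prime_two).mpr hl2
    have hlk' : (l : ℍ[ℤ]) ∣ (k : ℍ[ℤ]) := Nat.cast_dvd_cast hlk
    have hlm : l ∣ m := by
      have : (l : ℍ[ℤ]) ∣ (m : ℍ[ℤ]) := by
        rw [← natCast_dvd_natCast_mul hcop, hh, mul_assoc]
        exact hlk'.mul_right _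
      rw [natCast_dvd_iff] at this
      simpa [Int.natCast_dvd_natCast] using this.1
    obtain ⟨x, hx⟩ := exists_hom_eq_column (φ := φ) u
    have hxI : x ∈ lineIdeal φ u := by
      intro j
      rw [hx]
      fin_cases j <;> simp [mul_comm]
    obtain ⟨h', hh'⟩ := hgen _ hxI
    obtain ⟨y, rfl⟩ : (l : ℍ[ℤ]) ∣ x := by
      rw [← natCast_dvd_natCast_mul hcop, hh', mul_assoc]
      exact hlk'.mul_right _
    rw [map_mul, map_natCast, ← nsmul_eq_mul] at hx
    have h0 := congrFun (congrFun hx 0) 0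
    have h1 := congrFun (congrFun hx 1) 0
    simp at h0 h1
    obtain ⟨a, b, hab⟩ := hu
    have hunit : IsUnit (l : ZMod m) := by
      refine IsUnit.of_mul_eq_one (a * φ.hom y 0 0 + b * φ.hom y 1 0) ?_
      rw [← hab, ← h0, ← h1]; ring
    have := (ZMod.isUnit_iff_coprime l m).mp hunit
    exact hl.one_lt.ne' (this.eq_one_of_dvd hlm)
  obtain ⟨j, rfl⟩ := hk2
  have hqI : OnLine φ u q :=
    (onLine_natCast_mul ((Nat.coprime_two_left.mpr hm).pow_left j)).mp hpI
  refine ⟨q, hq, ?_, hqI⟩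
  obtain ⟨s, hs⟩ := exists_normSq_eq q
  have hodd := odd_oddNorm hq.ne_zero
  apply Nat.dvd_antisymm
  · have hdvd : 2 ^ s * oddNorm q ∣ 2 * m := by
      refine natCast_dvd_of_isPrimitive hq.star ⟨((2 ^ j : ℕ) : ℍ[ℤ]) * h, ?_⟩
      have hn : ((2 ^ s * oddNorm q : ℕ) : ℍ[ℤ]) = star q * q := by
        rw [Quaternion.star_mul_self, hs]; push_cast; rfl
      rw [hn, (Nat.cast_commute (2 * m) (star q)).eq, Nat.cast_mul, hh, mul_assoc (star q),
        ← mul_assoc q, ← (Nat.cast_commute (2 ^ j) q).eq]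
    exact ((Nat.coprime_two_right.mpr hodd).dvd_of_dvd_mul_left
      ((dvd_mul_left _ _).trans hdvd))
  · obtain ⟨w, hw⟩ := hqI.exists_eq hu
    have hdet : (φ.hom q).det = 0 := by
      rw [Matrix.det_fin_two, (hw 0).1, (hw 1).1, (hw 0).2, (hw 1).2]; ring
    rw [φ.det_hom, ZMod.intCast_zmod_eq_zero_iff_dvd, hs] at hdet
    have h2 : m ∣ 2 ^ s * oddNorm q := by exact_mod_cast hdet
    exact ((Nat.coprime_two_right.mpr hm).pow_right s).dvd_of_dvd_mul_left h2

/-! ### Counting ideals -/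

/-- The right ideals of primitive quaternions whose norm has odd part `m`. -/
def idealSet (m : ℕ) : Set (Set ℍ[ℤ]) :=
  {A | ∃ p, IsPrimitive p ∧ oddNorm p = m ∧ A = rightIdeal p}

/-- Pairs that generate the unit ideal. -/
def unimodular (m : ℕ) : Set (ZMod m × ZMod m) := {u | IsCoprime u.1 u.2}

/-- The number of square roots of `-d` modulo `m`. -/
noncomputable def rootCount (d m : ℕ) : ℕ := {x : ZMod m | x ^ 2 = -(d : ZMod m)}.ncard

theorem ncard_eq_mul_ncard_image {α β : Type*} {f : α → β} {V : Set α} (hV : V.Finite) {k : ℕ}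
    (h : ∀ u ∈ V, {v | v ∈ V ∧ f v = f u}.ncard = k) : V.ncard = k * (f '' V).ncard := by
  classical
  rw [Set.ncard_eq_toFinset_card V hV, Set.ncard_eq_toFinset_card _ (hV.image f),
    Finset.card_eq_sum_card_fiberwise (f := f) (t := (hV.image f).toFinset)
      (fun u hu => by
        simp only [Set.Finite.coe_toFinset] at hu ⊢
        exact Set.mem_image_of_mem _ hu), mul_comm]
  refine Finset.sum_const_nat fun y hy => ?_
  obtain ⟨u, hu, rfl⟩ := (Set.Finite.mem_toFinset _).mp hy
  rw [← h u hu, ← Set.ncard_coe_finset]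
  congr 1
  ext v
  simp

section
variable {m : ℕ} {φ : Splitting m}

/-- Some quaternion has v as the first column of its matrix and zero as the second. It lies in the
ideal of v, and its membership in the ideal of u forces v to be a multiple of u. -/
theorem lineIdeal_eq_iff {u v : ZMod m × ZMod m} (hu : IsCoprime u.1 u.2)
    (hv : IsCoprime v.1 v.2) :
    lineIdeal φ u = lineIdeal φ v ↔ ∃ c : (ZMod m)ˣ, v = (c * u.1, c * u.2) := by
  constructor
  · intro h
    obtain ⟨x, hx⟩ := exists_hom_eq_column (φ := φ) v
    have hxv : x ∈ lineIdeal φ v := by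
      intro j
      rw [hx]
      fin_cases j <;> simp [mul_comm]
    rw [← h] at hxv
    have h0 := hxv 0
    rw [hx] at h0
    obtain ⟨c, hc⟩ := exists_unit_smul hu (v := v) (by simpa using h0)
    obtain ⟨a, b, hab⟩ := hv
    have hcu : IsUnit c := by
      refine IsUnit.of_mul_eq_one (a * u.1 + b * u.2) ?_
      rw [← hab, hc]; ring
    exact ⟨hcu.unit, hc⟩
  · rintro ⟨c, rfl⟩
    ext x
    refine forall_congr' fun j => ?_
    simp only [mul_assoc]
    exact (Units.mul_right_inj c).symm

theorem image_lineIdeal (hm : Odd m) : lineIdeal φ '' unimodular m = idealSet m := by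
  ext A
  constructor
  · rintro ⟨u, hu, rfl⟩
    obtain ⟨p, hp, hpm, h⟩ := exists_primitive_onLine (φ := φ) hm hu
    exact ⟨p, hp, hpm, (rightIdeal_eq_lineIdeal hm hu hp hpm h).symm⟩
  · rintro ⟨p, hp, hpm, rfl⟩
    obtain ⟨u, hu, h⟩ := exists_onLine (φ := φ) hm hp hpm
    exact ⟨u, hu, (rightIdeal_eq_lineIdeal hm hu hp hpm h).symm⟩

theorem isCoprime_unit_mul {u : ZMod m × ZMod m} (hu : IsCoprime u.1 u.2) (c : (ZMod m)ˣ) :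
    IsCoprime (c * u.1) (c * u.2) :=
  (isCoprime_mul_unit_left_left c.isUnit _ _).mpr
    ((isCoprime_mul_unit_left_right c.isUnit _ _).mpr hu)

/-- The units of ℤ/m act freely on unimodular vectors, and the orbits are the fibres of `lineIdeal`.
-/
theorem ncard_eq_totient_mul [NeZero m] {V : Set (ZMod m × ZMod m)} (hV : V ⊆ unimodular m)
    (hc : ∀ u ∈ V, ∀ c : (ZMod m)ˣ, (c * u.1, c * u.2) ∈ V) :
    V.ncard = m.totient * (lineIdeal φ '' V).ncard := by
  refine ncard_eq_mul_ncard_image (Set.toFinite V) fun u hu => ?_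
  have hcop := hV hu
  have h : {v | v ∈ V ∧ lineIdeal φ v = lineIdeal φ u} =
      Set.range fun c : (ZMod m)ˣ => ((c * u.1, c * u.2) : ZMod m × ZMod m) := by
    ext v
    constructor
    · rintro ⟨hv, h⟩
      obtain ⟨c, rfl⟩ := (lineIdeal_eq_iff hcop (hV hv)).mp h.symm
      exact ⟨c, rfl⟩
    · rintro ⟨c, rfl⟩
      exact ⟨hc u hu c, ((lineIdeal_eq_iff hcop (isCoprime_unit_mul hcop c)).mpr ⟨c, rfl⟩).symm⟩
  have hinj : Function.Injective fun c : (ZMod m)ˣ => ((c * u.1, c * u.2) : ZMod m × ZMod m) := by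
    obtain ⟨a, b, hab⟩ := hcop
    intro c c' h
    simp only [Prod.mk.injEq] at h
    ext1
    linear_combination (c' - c : ZMod m) * hab + a * h.1 + b * h.2
  rw [h, ← Set.image_univ, Set.ncard_image_of_injective _ hinj, Set.ncard_univ, Nat.card_eq_fintype_card,
    ZMod.card_units_eq_totient]

/-- Writing the matrix of p as u wᵀ with w unimodular, that of v p is (v u) wᵀ; it lies on the line
of u exactly when u is an eigenvector of v. -/
theorem mul_mem_rightIdeal_iff (hm : Odd m) {u : ZMod m × ZMod m} (hu : IsCoprime u.1 u.2)
    {p : ℍ[ℤ]} (hp : IsPrimitive p) (hpm : oddNorm p = m) (h : OnLine φ u p) {v : ℍ[ℤ]} :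
    v * p ∈ rightIdeal p ↔ ∃ l : ZMod m, φ.hom v 0 0 * u.1 + φ.hom v 0 1 * u.2 = l * u.1 ∧
      φ.hom v 1 0 * u.1 + φ.hom v 1 1 * u.2 = l * u.2 := by
  rw [mem_rightIdeal_iff_onLine hm hu hp hpm h]
  obtain ⟨w, hw⟩ := h.exists_eq hu
  obtain ⟨c, hc⟩ := hp.exists_re_eq_one
  obtain ⟨B, hB⟩ := φ.unitContent_hom hm hc
  simp only [Matrix.trace_fin_two, Matrix.mul_apply, Fin.sum_univ_two, hw] at hB
  constructor
  · intro h0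
    have h1 : ∀ j, u.1 * (φ.hom v 1 0 * u.1 + φ.hom v 1 1 * u.2) * w j =
        u.2 * (φ.hom v 0 0 * u.1 + φ.hom v 0 1 * u.2) * w j := fun j => by
      have := h0 j
      rw [map_mul] at this
      simp only [Matrix.mul_apply, Fin.sum_univ_two, hw] at this
      linear_combination this
    have h2 : u.1 * (φ.hom v 1 0 * u.1 + φ.hom v 1 1 * u.2) =
        u.2 * (φ.hom v 0 0 * u.1 + φ.hom v 0 1 * u.2) := by
      linear_combination (B 0 0 * u.1 + B 0 1 * u.2) * h1 0 + (B 1 0 * u.1 + B 1 1 * u.2) * h1 1 -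
        (u.1 * (φ.hom v 1 0 * u.1 + φ.hom v 1 1 * u.2) -
        u.2 * (φ.hom v 0 0 * u.1 + φ.hom v 0 1 * u.2)) * hB
    obtain ⟨l, hl⟩ := exists_unit_smul hu (v := (φ.hom v 0 0 * u.1 + φ.hom v 0 1 * u.2,
      φ.hom v 1 0 * u.1 + φ.hom v 1 1 * u.2)) h2
    exact ⟨l, congrArg Prod.fst hl, congrArg Prod.snd hl⟩
  · rintro ⟨l, h1, h2⟩ j
    rw [map_mul]
    simp only [Matrix.mul_apply, Fin.sum_univ_two, hw]
    linear_combination u.1 * w j * h2 - u.2 * w j * h1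

end

/-- The eigenvector condition involves only the line, so being preserved by v is a property of the
ideal and not of its generator. -/
theorem mul_mem_rightIdeal_congr {p q v : ℍ[ℤ]} (hp : IsPrimitive p) (hq : IsPrimitive q)
    (hpq : oddNorm p = oddNorm q) (h : rightIdeal p = rightIdeal q) :
    v * p ∈ rightIdeal p ↔ v * q ∈ rightIdeal q := by
  have hm := odd_oddNorm hq.ne_zero
  obtain ⟨φ⟩ := nonempty_splitting hm
  obtain ⟨u, hu, hup⟩ := exists_onLine (φ := φ) hm hp hpq
  have hqI : OnLine φ u q := by
    rw [← mem_rightIdeal_iff_onLine hm hu hp hpq hup, h]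
    rw [rightIdeal, Set.mem_ofPred_eq, Quaternion.star_mul_self]
    obtain ⟨k, hk⟩ := oddNorm_dvd q
    exact ⟨(k : ℍ[ℤ]), by rw [hk]; push_cast; rfl⟩
  rw [mul_mem_rightIdeal_iff hm hu hp hpq hup, mul_mem_rightIdeal_iff hm hu hq rfl hqI]

/-- The ideals in `idealSet m` that are fixed by `v`. -/
def fixedIdeals (v : ℍ[ℤ]) (m : ℕ) : Set (Set ℍ[ℤ]) :=
  {A | ∃ p, IsPrimitive p ∧ oddNorm p = m ∧ A = rightIdeal p ∧ v * p ∈ rightIdeal p}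

/-- By the normal form diag(1, 0) the kernel is free of rank one, spanned by the second column of
`Q`; its unimodular elements are the unit multiples of that column. -/
theorem ncard_eigenvectors {m : ℕ} [NeZero m] {A : Matrix (Fin 2) (Fin 2) (ZMod m)}
    (hA : UnitContent A) (hdet : A.det = 0) :
    {u : ZMod m × ZMod m | IsCoprime u.1 u.2 ∧ A 0 0 * u.1 + A 0 1 * u.2 = 0 ∧
      A 1 0 * u.1 + A 1 1 * u.2 = 0}.ncard = m.totient := by
  obtain ⟨P, Q, hP, hQ, h⟩ := hA.exists_diagonal (NeZero.ne m)
  rw [hdet] at h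
  have hQ' := hQ
  have hP' := hP
  rw [Matrix.det_fin_two] at hQ' hP'
  have h1 : A * Q = P.adjugate * !![1, 0; 0, 0] := by
    rw [← h, ← mul_assoc, ← mul_assoc, Matrix.adjugate_mul, hP, one_smul, one_mul]
  have h2 : P * A = !![1, 0; 0, 0] * Q.adjugate := by
    rw [← h, mul_assoc, Matrix.mul_adjugate, hQ, one_smul, mul_one]
  have a0 := congrFun (congrFun h1 0) 1
  have a1 := congrFun (congrFun h1 1) 1
  have b0 := congrFun (congrFun h2 0) 0
  have b1 := congrFun (congrFun h2 0) 1
  simp [Matrix.mul_apply, Fin.sum_univ_two, Matrix.adjugate_fin_two] at a0 a1 b0 b1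
  have key : {u : ZMod m × ZMod m | IsCoprime u.1 u.2 ∧ A 0 0 * u.1 + A 0 1 * u.2 = 0 ∧
      A 1 0 * u.1 + A 1 1 * u.2 = 0} =
      Set.range fun c : (ZMod m)ˣ => ((c * Q 0 1, c * Q 1 1) : ZMod m × ZMod m) := by
    ext u
    constructor
    · rintro ⟨⟨a, b, hab⟩, e0, e1⟩
      have e2 : Q 1 1 * u.1 - Q 0 1 * u.2 = 0 := by
        linear_combination P 0 0 * e0 + P 0 1 * e1 - u.1 * b0 - u.2 * b1
      have hcu : IsUnit (Q 0 0 * u.2 - Q 1 0 * u.1) := by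
        refine IsUnit.of_mul_eq_one (a * Q 0 1 + b * Q 1 1) ?_
        linear_combination hab - (a * Q 0 0 + b * Q 1 0) * e2 + (a * u.1 + b * u.2) * hQ'
      refine ⟨hcu.unit, Prod.ext ?_ ?_⟩
      · change (Q 0 0 * u.2 - Q 1 0 * u.1) * Q 0 1 = u.1
        linear_combination u.1 * hQ' - Q 0 0 * e2
      · change (Q 0 0 * u.2 - Q 1 0 * u.1) * Q 1 1 = u.2
        linear_combination u.2 * hQ' - Q 1 0 * e2
    · rintro ⟨c, rfl⟩
      refine ⟨isCoprime_unit_mul (u := (Q 0 1, Q 1 1)) ⟨-Q 1 0, Q 0 0, ?_⟩ c, ?_, ?_⟩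
      · linear_combination hQ'
      · linear_combination (c : ZMod m) * a0
      · linear_combination (c : ZMod m) * a1
  have hinj : Function.Injective
      fun c : (ZMod m)ˣ => ((c * Q 0 1, c * Q 1 1) : ZMod m × ZMod m) := by
    intro c c' e
    simp only [Prod.mk.injEq] at e
    ext1
    linear_combination (c' - c : ZMod m) * hQ' - Q 1 0 * e.1 + Q 0 0 * e.2
  rw [key, ← Set.image_univ, Set.ncard_image_of_injective _ hinj, Set.ncard_univ,
    Nat.card_eq_fintype_card, ZMod.card_units_eq_totient]

theorem isPrimitive_sub_intCast {v : ℍ[ℤ]} (hv : IsPrimitive v) (hre : v.re = 0) (l : ℤ) :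
    IsPrimitive (v - (l : ℍ[ℤ])) := by
  intro d _ h2 h3 h4
  simp at h2 h3 h4
  exact hv d (by simp [hre]) h2 h3 h4

/-- A pure quaternion v of norm d has trace 0 and determinant d, so every eigenvalue on a unimodular
vector is a square root of -d. Conversely, for a root l the quaternion v - l is still primitive and
has determinant 0 modulo m, which gives exactly φ(m) eigenvectors, that is, one line. Different
roots share no unimodular eigenvector. -/
theorem ncard_fixedIdeals {m : ℕ} (hm : Odd m) {v : ℍ[ℤ]} (hv : IsPrimitive v) (hre : v.re = 0)
    {d : ℕ} (hd : (Quaternion.normSq v : ℤ) = d) : (fixedIdeals v m).ncard = rootCount d m := by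
  have : NeZero m := ⟨by rintro rfl; simp at hm⟩
  obtain ⟨φ⟩ := nonempty_splitting hm
  have htr := φ.trace_hom v
  have hdet := φ.det_hom v
  rw [hre, Matrix.trace_fin_two] at htr
  rw [hd, Matrix.det_fin_two] at hdet
  push_cast at htr hdet
  let E : ZMod m → Set (ZMod m × ZMod m) := fun l => {u | IsCoprime u.1 u.2 ∧
    φ.hom v 0 0 * u.1 + φ.hom v 0 1 * u.2 = l * u.1 ∧
      φ.hom v 1 0 * u.1 + φ.hom v 1 1 * u.2 = l * u.2}
  let V : Set (ZMod m × ZMod m) := {u | ∃ l, u ∈ E l}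
  have hroot : ∀ l, ∀ u ∈ E l, l ^ 2 = -(d : ZMod m) := by
    rintro l u ⟨⟨a, b, hab⟩, h0, h1⟩
    have e0 : (l ^ 2 + d) * u.1 = 0 := by
      linear_combination (φ.hom v 1 1 - l) * h0 - φ.hom v 0 1 * h1 - u.1 * hdet + l * u.1 * htr
    have e1 : (l ^ 2 + d) * u.2 = 0 := by
      linear_combination -φ.hom v 1 0 * h0 + (φ.hom v 0 0 - l) * h1 - u.2 * hdet + l * u.2 * htr
    linear_combination a * e0 + b * e1 - (l ^ 2 + d) * hab
  have hcard : ∀ l, l ^ 2 = -(d : ZMod m) → (E l).ncard = m.totient := by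
    intro l hl
    obtain ⟨n, rfl⟩ := ZMod.intCast_surjective l
    obtain ⟨c, hc⟩ := (isPrimitive_sub_intCast hv hre n).exists_re_eq_one
    have hc' := φ.unitContent_hom hm hc
    have hA : φ.hom (v - (n : ℍ[ℤ])) = φ.hom v - (n : Matrix (Fin 2) (Fin 2) (ZMod m)) := by
      rw [map_sub, map_intCast]
    rw [hA] at hc'
    rw [← ncard_eigenvectors hc' ?_]
    · congr 1
      ext u
      simp only [E, Set.mem_ofPred_eq, Matrix.sub_apply, Matrix.intCast_apply]
      simp only [Fin.isValue, ↓reduceIte, zero_ne_one, one_ne_zero]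
      refine and_congr_right fun _ => and_congr ?_ ?_
      · constructor <;> intro h <;> linear_combination h
      · constructor <;> intro h <;> linear_combination h
    · rw [Matrix.det_fin_two]
      simp only [Matrix.sub_apply, Matrix.intCast_apply]
      simp only [Fin.isValue, ↓reduceIte, zero_ne_one, one_ne_zero]
      linear_combination hdet - (n : ZMod m) * htr + hl
  have himg : lineIdeal φ '' V = fixedIdeals v m := by
    ext A
    constructor
    · rintro ⟨u, ⟨l, hu, h⟩, rfl⟩
      obtain ⟨p, hp, hpm, hl⟩ := exists_primitive_onLine (φ := φ) hm hu
      exact ⟨p, hp, hpm, (rightIdeal_eq_lineIdeal hm hu hp hpm hl).symm,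
        (mul_mem_rightIdeal_iff hm hu hp hpm hl).mpr ⟨l, h⟩⟩
    · rintro ⟨p, hp, hpm, rfl, h⟩
      obtain ⟨u, hu, hl⟩ := exists_onLine (φ := φ) hm hp hpm
      obtain ⟨l, h⟩ := (mul_mem_rightIdeal_iff hm hu hp hpm hl).mp h
      exact ⟨u, ⟨l, hu, h⟩, (rightIdeal_eq_lineIdeal hm hu hp hpm hl).symm⟩
  have h1 : V.ncard = m.totient * (fixedIdeals v m).ncard := by
    rw [← himg]
    refine ncard_eq_totient_mul (fun u ⟨l, hu, _⟩ => hu) ?_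
    rintro u ⟨l, hu, e0, e1⟩ c
    exact ⟨l, isCoprime_unit_mul hu c, by linear_combination (c : ZMod m) * e0,
      by linear_combination (c : ZMod m) * e1⟩
  have huniq : ∀ l l' u, u ∈ E l → u ∈ E l' → l = l' := by
    rintro l l' u ⟨⟨a, b, hab⟩, e0, e1⟩ ⟨_, f0, f1⟩
    linear_combination (l' - l) * hab + a * (f0 - e0) + b * (f1 - e1)
  choose! ev hev using (show ∀ u ∈ V, ∃ l, u ∈ E l from fun u hu => hu)
  have h2 : V.ncard = m.totient * (ev '' V).ncard := by
    refine ncard_eq_mul_ncard_image (Set.toFinite V) fun u hu => ?_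
    rw [← hcard (ev u) (hroot _ _ (hev u hu))]
    congr 1
    ext w
    constructor
    · rintro ⟨hw, h⟩
      rw [← h]; exact hev w hw
    · intro hw
      have hwV : w ∈ V := ⟨_, hw⟩
      exact ⟨hwV, huniq _ _ _ (hev w hwV) hw⟩
  have h3 : ev '' V = {x : ZMod m | x ^ 2 = -(d : ZMod m)} := by
    ext l
    constructor
    · rintro ⟨u, hu, rfl⟩
      exact hroot _ _ (hev u hu)
    · intro hl
      have hne : (E l).Nonempty := by
        rw [← Set.ncard_pos, hcard l hl]
        exact Nat.totient_pos.mpr (Nat.pos_of_ne_zero (NeZero.ne m))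
      obtain ⟨u, hu⟩ := hne
      exact ⟨u, ⟨l, hu⟩, huniq _ _ _ (hev u ⟨l, hu⟩) hu⟩
  rw [h3, h1] at h2
  exact Nat.eq_of_mul_eq_mul_left
    (Nat.totient_pos.mpr (Nat.pos_of_ne_zero (NeZero.ne m))) h2

/-! ### The number of all ideals -/

theorem isUnit_or_isUnit_of_isCoprime {p k : ℕ} (hp : p.Prime) {x y : ZMod (p ^ (k + 1))}
    (h : IsCoprime x y) : IsUnit x ∨ IsUnit y := by
  have : NeZero (p ^ (k + 1)) := ⟨pow_ne_zero _ hp.ne_zero⟩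
  have key : ∀ z : ZMod (p ^ (k + 1)), ¬ IsUnit z → p ∣ z.val := fun z hz => by
    rw [← ZMod.natCast_zmod_val z, ZMod.isUnit_iff_coprime,
      Nat.coprime_pow_right_iff (Nat.succ_pos k), Nat.coprime_comm, hp.coprime_iff_not_dvd,
      not_not] at hz
    exact hz
  by_contra! hxy
  obtain ⟨a, b, hab⟩ := h
  have hd : p ∣ p ^ (k + 1) := dvd_pow_self p (Nat.succ_ne_zero k)
  have : Fact p.Prime := ⟨hp⟩
  have h0 : ∀ z : ZMod (p ^ (k + 1)), ¬ IsUnit z → ZMod.castHom hd (ZMod p) z = 0 := fun z hz => by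
    rw [← ZMod.natCast_zmod_val z, map_natCast, ZMod.natCast_eq_zero_iff]
    exact key z hz
  have := congrArg (ZMod.castHom hd (ZMod p)) hab
  rw [map_add, map_mul, map_mul, h0 x hxy.1, h0 y hxy.2, map_one] at this
  simp at this

/-- The ring is local with p^k non-units, and a pair is unimodular unless both entries are
non-units. -/
theorem ncard_unimodular_prime_pow {p k : ℕ} (hp : p.Prime) :
    (unimodular (p ^ (k + 1))).ncard = (p ^ (k + 1)) ^ 2 - (p ^ k) ^ 2 := by
  have : NeZero (p ^ (k + 1)) := ⟨pow_ne_zero _ hp.ne_zero⟩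
  have hunits : {x : ZMod (p ^ (k + 1)) | IsUnit x}.ncard = (p ^ (k + 1)).totient := by
    have : {x : ZMod (p ^ (k + 1)) | IsUnit x} =
        Units.val '' (Set.univ : Set (ZMod (p ^ (k + 1)))ˣ) := by
      ext x; simp [IsUnit]
    rw [this, Set.ncard_image_of_injective _ Units.val_injective, Set.ncard_univ,
      Nat.card_eq_fintype_card, ZMod.card_units_eq_totient]
  have hnon : {x : ZMod (p ^ (k + 1)) | IsUnit x}ᶜ.ncard = p ^ k := by
    rw [Set.ncard_compl, hunits, Nat.card_zmod, Nat.totient_prime_pow_succ hp]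
    obtain ⟨q, rfl⟩ := Nat.exists_eq_succ_of_ne_zero hp.ne_zero
    rw [Nat.succ_sub_one, pow_succ, Nat.succ_eq_add_one, mul_add, mul_one]
    omega
  have : unimodular (p ^ (k + 1)) = ({x : ZMod (p ^ (k + 1)) | IsUnit x}ᶜ ×ˢ
      {x : ZMod (p ^ (k + 1)) | IsUnit x}ᶜ)ᶜ := by
    ext u
    simp only [unimodular, Set.mem_compl_iff, Set.mem_prod, Set.mem_ofPred_eq]
    constructor
    · intro h h'
      exact (isUnit_or_isUnit_of_isCoprime hp h).elim h'.1 h'.2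
    · intro h
      rw [not_and_or, not_not, not_not] at h
      rcases h with h | h
      · exact ⟨(h.unit⁻¹ : (ZMod _)ˣ), 0, by rw [zero_mul, add_zero]; exact h.val_inv_mul⟩
      · exact ⟨0, (h.unit⁻¹ : (ZMod _)ˣ), by rw [zero_mul, zero_add]; exact h.val_inv_mul⟩
  rw [this, Set.ncard_compl, Set.ncard_prod, hnon, Nat.card_prod, Nat.card_zmod, sq, sq]

theorem ncard_unimodular_mul {m n : ℕ} (h : m.Coprime n) :
    (unimodular (m * n)).ncard = (unimodular m).ncard * (unimodular n).ncard := by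
  let e := ZMod.chineseRemainder h
  have : unimodular (m * n) = (fun w : (ZMod m × ZMod m) × (ZMod n × ZMod n) =>
      (e.symm (w.1.1, w.2.1), e.symm (w.1.2, w.2.2))) '' (unimodular m ×ˢ unimodular n) := by
    ext u
    constructor
    · rintro ⟨a, b, hab⟩
      refine ⟨(((e u.1).1, (e u.2).1), ((e u.1).2, (e u.2).2)), ⟨⟨(e a).1, (e b).1, ?_⟩,
        ⟨(e a).2, (e b).2, ?_⟩⟩, ?_⟩
      · have := congrArg (fun z => (e z).1) hab
        simpa using this
      · have := congrArg (fun z => (e z).2) hab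
        simpa using this
      · simp
    · rintro ⟨w, ⟨⟨a, b, hab⟩, ⟨c, d, hcd⟩⟩, rfl⟩
      refine ⟨e.symm (a, c), e.symm (b, d), ?_⟩
      simp only
      rw [← map_mul, ← map_mul, ← map_add, Prod.mk_mul_mk, Prod.mk_mul_mk, Prod.mk_add_mk, hab, hcd]
      exact map_one e.symm
  rw [this, Set.ncard_image_of_injective, Set.ncard_prod]
  rintro ⟨⟨a, b⟩, c, d⟩ ⟨⟨a', b'⟩, c', d'⟩ h
  simp at h
  simp [h]

theorem cubicProd_mul {m n : ℕ} (hm : m ≠ 0) (hn : n ≠ 0) (h : m.Coprime n) :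
    cubicProd (m * n) (m * n).primeFactors =
      cubicProd m m.primeFactors * cubicProd n n.primeFactors := by
  rw [cubicProd, h.primeFactors_mul, Finset.prod_union h.disjoint_primeFactors]
  congr 1
  · refine Finset.prod_congr rfl fun p hp => ?_
    rw [Nat.factorization_eq_of_coprime_left h (by simpa [hm] using hp)]
  · refine Finset.prod_congr rfl fun p hp => ?_
    rw [Nat.factorization_eq_of_coprime_right h (by simpa [hn] using hp)]

theorem cubicProd_prime_pow {p k : ℕ} (hp : p.Prime) :
    cubicProd (p ^ (k + 1)) (p ^ (k + 1)).primeFactors = (p + 1) * (p : ℚ) ^ k := by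
  rw [cubicProd, Nat.primeFactors_prime_pow (Nat.succ_ne_zero k) hp, Finset.prod_singleton,
    hp.factorization_pow]
  simp

theorem ncard_unimodular {m : ℕ} (hm : m ≠ 0) :
    ((unimodular m).ncard : ℚ) = m.totient * cubicProd m m.primeFactors := by
  induction m using Nat.recOnPosPrimePosCoprime with
  | zero => exact absurd rfl hm
  | one =>
    have : unimodular 1 = Set.univ := by
      ext u
      simp only [Set.mem_univ, iff_true]
      exact ⟨0, 0, Subsingleton.elim _ _⟩
    rw [this, Set.ncard_univ]
    simp [cubicProd]
  | prime_pow p k hp hk =>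
    obtain ⟨k, rfl⟩ := Nat.exists_eq_add_one_of_ne_zero hk.ne'
    rw [ncard_unimodular_prime_pow hp, cubicProd_prime_pow hp,
      Nat.totient_prime_pow_succ hp, Nat.cast_sub
        (Nat.pow_le_pow_left (Nat.pow_le_pow_right hp.pos (Nat.le_succ k)) 2), Nat.cast_mul,
      Nat.cast_sub hp.one_le, Nat.succ_eq_add_one]
    push_cast
    ring
  | coprime a b ha hb hab iha ihb =>
    rw [ncard_unimodular_mul hab, Nat.totient_mul hab, cubicProd_mul (by omega) (by omega) hab,
      Nat.cast_mul, iha (by omega), ihb (by omega)]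
    push_cast
    ring

theorem finite_idealSet {m : ℕ} (hm : Odd m) : (idealSet m).Finite := by
  have : NeZero m := ⟨by rintro rfl; simp at hm⟩
  obtain ⟨φ⟩ := nonempty_splitting hm
  rw [← image_lineIdeal (φ := φ) hm]
  exact (Set.toFinite _).image _

/-- The ideals are the points of the projective line over ℤ/m: unimodular pairs modulo units. -/
theorem ncard_idealSet {m : ℕ} (hm : Odd m) :
    ((idealSet m).ncard : ℚ) = cubicProd m m.primeFactors := by
  have : NeZero m := ⟨by rintro rfl; simp at hm⟩
  obtain ⟨φ⟩ := nonempty_splitting hm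
  have h1 : (unimodular m).ncard = m.totient * (idealSet m).ncard := by
    rw [← image_lineIdeal (φ := φ) hm]
    exact ncard_eq_totient_mul subset_rfl fun u hu c => isCoprime_unit_mul hu c
  have h2 := ncard_unimodular (NeZero.ne m)
  rw [h1, Nat.cast_mul] at h2
  refine mul_left_cancel₀ ?_ h2
  exact_mod_cast (Nat.totient_pos.mpr (Nat.pos_of_ne_zero (NeZero.ne m))).ne'

/-! ### Uniqueness of the parametrization and the symmetry group -/

theorem eq_or_eq_neg_of_intCast_mul_eq {p q : ℍ[ℤ]} (hp : IsPrimitive p) (hq : IsPrimitive q)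
    {k l : ℤ} (hk : k ≠ 0) (h : (k : ℍ[ℤ]) * p = (l : ℍ[ℤ]) * q) : q = p ∨ q = -p := by
  have key : ∀ {a : ℤ} {b : ℤ} {x y : ℍ[ℤ]}, IsPrimitive y → (a : ℍ[ℤ]) * x = (b : ℍ[ℤ]) * y →
      a.natAbs ∣ b.natAbs := by
    intro a b x y hy h
    refine natCast_dvd_of_isPrimitive hy ?_
    have ha : ((a.natAbs : ℕ) : ℍ[ℤ]) ∣ (a : ℍ[ℤ]) * x := by
      obtain ⟨c, hc⟩ : ((a.natAbs : ℕ) : ℤ) ∣ a := Int.natAbs_dvd.mpr dvd_rfl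
      exact ⟨(c : ℍ[ℤ]) * x, by
        conv_lhs => rw [hc]
        rw [Int.cast_mul, Int.cast_natCast, mul_assoc]⟩
    rw [h] at ha
    rcases Int.natAbs_eq b with hb | hb
    · rw [hb, Int.cast_natCast] at ha; exact ha
    · rw [hb, Int.cast_neg, Int.cast_natCast, neg_mul, dvd_neg] at ha; exact ha
  have hkl : k.natAbs = l.natAbs := Nat.dvd_antisymm (key hq h) (key hp h.symm)
  have hk' := intCast_ne_zero hk
  rcases Int.natAbs_eq_natAbs_iff.mp hkl with rfl | rfl
  · exact Or.inl (mul_left_cancel₀ hk' h).symm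
  · right
    rw [Int.cast_neg, neg_mul, neg_eq_iff_eq_neg, ← mul_neg] at h
    rw [Int.cast_neg] at hk'
    rw [mul_left_cancel₀ (neg_ne_zero.mp hk') h, neg_neg]

theorem rotMatrix_neg_left (p q : ℍ[ℤ]) : rotMatrix (-p) q = -rotMatrix p q := by
  have h := intMatrix_intCast_mul (-1) 1 p q
  simp only [Int.cast_neg, Int.cast_one, neg_mul, one_mul, mul_one] at h
  rw [rotMatrix, rotMatrix, h, neg_mul, Quaternion.normSq_neg, ← smul_neg]
  congr 1
  ext i j
  simp

theorem rotMatrix_neg_neg (p q : ℍ[ℤ]) : rotMatrix (-p) (-q) = rotMatrix p q := by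
  have h := rotMatrix_intCast_mul (m := -1) (n := -1) (by norm_num) p q
  simpa using h

/-- If a x b̄ = n x for all x, then comparing with x = 1 shows that b, and then a, commutes with
everything; the centre consists of the integers. -/
theorem eq_intCast_of_rotMatrix_eq_one {a b : ℍ[ℤ]} (ha : a ≠ 0) (hb : b ≠ 0)
    (h : rotMatrix a b = 1) : ∃ k l : ℤ, a = k ∧ b = l := by
  have h0 : (0 : ℤ) < Quaternion.normSq (a * b) := normSq_pos (mul_ne_zero ha hb)
  have h0' : (0 : ℝ) < ((Quaternion.normSq (a * b) : ℤ) : ℝ) := by exact_mod_cast h0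
  obtain ⟨c, hc0, hc⟩ : ∃ c : ℝ, c ≠ 0 ∧ ∀ x, toVec (a * x * star b) = c • toVec x := by
    refine ⟨√((Quaternion.normSq (a * b) : ℤ) : ℝ), (Real.sqrt_pos.mpr h0').ne', fun x => ?_⟩
    have := rotMatrix_mulVec_toVec a b x
    rw [h, Matrix.one_mulVec] at this
    rw [this, smul_smul, mul_one_div_cancel (Real.sqrt_pos.mpr h0').ne', one_smul]
  have e := hc 1
  rw [mul_one] at e
  have e0 := congrFun e 0
  have e1 := congrFun e 1
  have e2 := congrFun e 2
  have e3 := congrFun e 3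
  obtain ⟨n, hn⟩ : ∃ n : ℤ, n = (a * star b).re := ⟨_, rfl⟩
  generalize a * star b = y at e0 e1 e2 e3 hn
  simp [toVec, coords] at e0 e1 e2 e3
  have hcn : c = (n : ℝ) := by rw [hn, e0]
  have hx : ∀ x, a * x * star b = (n : ℍ[ℤ]) * x := by
    intro x
    apply toVec_injective
    rw [hc, hcn]
    ext i; fin_cases i <;> simp [toVec, coords]
  have hn0 : n ≠ 0 := by rintro rfl; simp at hcn; exact hc0 hcn
  have hN : (Quaternion.normSq b : ℤ) ≠ 0 := (normSq_pos hb).ne'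
  have hx2 : ∀ x, (((Quaternion.normSq b : ℤ)) : ℍ[ℤ]) * (a * x) = (n : ℍ[ℤ]) * (x * b) := by
    intro x
    rw [← mul_assoc (n : ℍ[ℤ]), ← hx x, mul_assoc _ (star b) b, Quaternion.star_mul_self]
    exact (Int.cast_commute _ (a * x)).eq
  have hb2 : ∀ x, x * b = b * x := fun x => mul_left_cancel₀ (intCast_ne_zero hn0) (by
    rw [← hx2 x, ← mul_assoc, ← mul_assoc]
    have := hx2 1
    rw [mul_one, one_mul] at this
    rw [this])
  have hcent : ∀ y : ℍ[ℤ], (∀ x, x * y = y * x) → y = (y.re : ℍ[ℤ]) := by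
    intro y hy
    have h1 := hy (quat 0 1 0 0)
    have h2 := hy (quat 0 0 1 0)
    have f1 := congrArg QuaternionAlgebra.imJ h1
    have f2 := congrArg QuaternionAlgebra.imK h1
    have f3 := congrArg QuaternionAlgebra.imK h2
    simp at f1 f2 f3
    ext <;> simp <;> omega
  have hb3 := hcent b hb2
  refine ⟨_, _, hcent a fun x => mul_left_cancel₀ (intCast_ne_zero hN) ?_, hb3⟩
  rw [hx2 x, ← mul_assoc, (Int.cast_commute _ x).eq, mul_assoc]
  have := hx2 1
  rw [mul_one, one_mul] at this
  rw [this, ← mul_assoc, ← (Int.cast_commute _ x).eq, mul_assoc]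

theorem rotMatrix_injective {p q p' q' : ℍ[ℤ]} (hp : IsPrimitive p) (hq : IsPrimitive q)
    (hp' : IsPrimitive p') (hq' : IsPrimitive q') (h : rotMatrix p q = rotMatrix p' q') :
    (p' = p ∧ q' = q) ∨ (p' = -p ∧ q' = -q) := by
  have h1 : rotMatrix (star p' * p) (star q' * q) = 1 := by
    rw [← rotMatrix_mul, h, rotMatrix_mul, Quaternion.star_mul_self, Quaternion.star_mul_self]
    exact rotMatrix_intCast (mul_pos (normSq_pos hp'.ne_zero) (normSq_pos hq'.ne_zero))
  obtain ⟨k, l, hk, hl⟩ := eq_intCast_of_rotMatrix_eq_one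
    (mul_ne_zero (star_ne_zero.mpr hp'.ne_zero) hp.ne_zero)
    (mul_ne_zero (star_ne_zero.mpr hq'.ne_zero) hq.ne_zero) h1
  have key : ∀ {x x' : ℍ[ℤ]} {k : ℤ}, IsPrimitive x → IsPrimitive x' → star x' * x = (k : ℍ[ℤ]) →
      x' = x ∨ x' = -x := by
    intro x x' k hx hx' hk
    refine eq_or_eq_neg_of_intCast_mul_eq hx hx' (normSq_pos hx'.ne_zero).ne' (l := k) ?_
    have h2 : x' * star x' * x = x' * k := by rw [mul_assoc, hk]
    rw [Quaternion.self_mul_star] at h2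
    rw [(Int.cast_commute k x').eq]
    exact h2
  -- Changing one sign only replaces R by -R ≠ R, which excludes the mixed cases.
  have hne : rotMatrix p q ≠ -rotMatrix p q := by
    intro e
    have h2 : rotMatrix p q = 0 := by
      ext i j
      have := congrFun (congrFun e i) j
      rw [Matrix.neg_apply] at this
      rw [Matrix.zero_apply]
      linarith
    have h3 := rotMatrix_mem hp.ne_zero hq.ne_zero
    rw [h2, Matrix.mem_specialOrthogonalGroup_iff, Matrix.det_zero] at h3
    exact zero_ne_one h3.2
  rcases key hp hp' hk with rfl | rfl <;> rcases key hq hq' hl with rfl | rfl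
  · exact Or.inl ⟨rfl, rfl⟩
  · rw [← neg_neg p', rotMatrix_neg_neg, neg_neg, rotMatrix_neg_left] at h
    exact absurd h hne
  · rw [rotMatrix_neg_left] at h
    exact absurd h hne
  · exact Or.inr ⟨rfl, rfl⟩

/-- `x` is a multiple of one of the 48 quaternions of the cubic group. -/
def IsCubicMul (x : ℍ[ℤ]) : Prop :=
  ∃ (k : ℕ) (t : ℍ[ℤ]), k ≠ 0 ∧ IsPrimitive t ∧ oddNorm t = 1 ∧ x = (k : ℍ[ℤ]) * t

theorem isCoincidence_of_isAdmissible {p q : ℍ[ℤ]} (h : IsAdmissible p q) {R : SO4}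
    (hR : R.1 = rotMatrix p q) : IsCoincidence R := by
  refine ⟨?_⟩
  rw [relIndex_csl h hR]
  exact Nat.lcm_ne_zero (odd_oddNorm h.1.ne_zero).pos.ne' (odd_oddNorm h.2.1.ne_zero).pos.ne'

theorem IsAdmissible.star {p q : ℍ[ℤ]} (h : IsAdmissible p q) : IsAdmissible (star p) (star q) :=
  ⟨h.1.star, h.2.1.star, by
    have := h.2.2
    simpa only [map_mul, Quaternion.normSq_star] using this⟩

/-- Index 1 gives D₄ ⊆ R D₄; the same for the inverse, which is R(p̄, q̄), gives equality. -/
theorem mem_GF_of_oddNorm_eq_one {p q : ℍ[ℤ]} (h : IsAdmissible p q) (hp : oddNorm p = 1)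
    (hq : oddNorm q = 1) {R : SO4} (hR : R.1 = rotMatrix p q) : R ∈ GF := by
  have key : ∀ {p q : ℍ[ℤ]} {R : SO4}, IsAdmissible p q → oddNorm p = 1 → oddNorm q = 1 →
      R.1 = rotMatrix p q → D4 ≤ rotate R D4 := by
    intro p q R h hp hq hR
    have := relIndex_csl h hR
    rw [hp, hq, Nat.lcm_self, AddSubgroup.relIndex_eq_one] at this
    exact this.trans inf_le_right
  refine le_antisymm ?_ (key h hp hq hR)
  have h2 : D4 ≤ rotate R⁻¹ D4 := key h.star (by simpa using hp) (by simpa using hq) (by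
    rw [← rotMatrix_transpose, ← hR]; rfl)
  intro v hv
  rw [mem_rotate_iff] at hv
  have h3 := h2 hv
  rw [mem_rotate_iff, inv_inv] at h3
  rw [Matrix.mulVec_mulVec, show R.1 * (R⁻¹ : SO4).1 = 1 from
    congrArg Subtype.val (mul_inv_cancel R), Matrix.one_mulVec] at h3
  exact h3

theorem exists_of_mem_GF {R : SO4} (hR : R ∈ GF) : ∃ p q : ℍ[ℤ], IsAdmissible p q ∧
    oddNorm p = 1 ∧ oddNorm q = 1 ∧ R.1 = rotMatrix p q := by
  have h1 : rotate R D4 = D4 := hR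
  have hcsl : csl R = D4 := by rw [csl, h1, inf_idem]
  have hidx : (csl R).relIndex D4 = 1 := by rw [hcsl, AddSubgroup.relIndex_self]
  have hco : IsCoincidence R := ⟨by rw [hidx]; exact one_ne_zero⟩
  obtain ⟨p, q, hpq, hRpq⟩ := hco.exists_rotMatrix
  rw [relIndex_csl hpq hRpq] at hidx
  exact ⟨p, q, hpq, Nat.dvd_one.mp (hidx ▸ Nat.dvd_lcm_left _ _),
    Nat.dvd_one.mp (hidx ▸ Nat.dvd_lcm_right _ _), hRpq⟩

theorem rotMatrix_natCast_mul {k l : ℕ} (hk : k ≠ 0) (hl : l ≠ 0) (p q : ℍ[ℤ]) :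
    rotMatrix ((k : ℍ[ℤ]) * p) ((l : ℍ[ℤ]) * q) = rotMatrix p q := by
  have := rotMatrix_intCast_mul (m := k) (n := l) (by positivity) p q
  simpa using this

theorem isSquare_of_isSquare_sq_mul {k n : ℤ} (hk : k ≠ 0) (h : IsSquare (k ^ 2 * n)) :
    IsSquare n := by
  obtain ⟨r, hr⟩ := h
  rw [← sq] at hr
  obtain ⟨s, rfl⟩ := (Int.pow_dvd_pow_iff two_ne_zero).mp ⟨n, hr.symm⟩
  rw [mul_pow] at hr
  exact ⟨s, by rw [mul_left_cancel₀ (pow_ne_zero 2 hk) hr, sq]⟩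

theorem normSq_natCast_mul_mul (k l : ℕ) (p q : ℍ[ℤ]) :
    (Quaternion.normSq ((k : ℍ[ℤ]) * p * ((l : ℍ[ℤ]) * q)) : ℤ) =
      ((k * l : ℕ) : ℤ) ^ 2 * Quaternion.normSq (p * q) := by
  simp only [map_mul, Quaternion.normSq_natCast]; push_cast; ring

theorem mem_GF_iff {x y : ℍ[ℤ]} {R : SO4} (hx : x ≠ 0) (hy : y ≠ 0) (hR : R.1 = rotMatrix x y) :
    R ∈ GF ↔ IsSquare (Quaternion.normSq (x * y) : ℤ) ∧ IsCubicMul x ∧ IsCubicMul y := by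
  constructor
  · intro h
    obtain ⟨k, p, hk, hp, rfl⟩ := exists_eq_mul_isPrimitive hx
    obtain ⟨l, q, hl, hq, rfl⟩ := exists_eq_mul_isPrimitive hy
    obtain ⟨p', q', hadm, hp', hq', h'⟩ := exists_of_mem_GF h
    rw [hR, rotMatrix_natCast_mul hk hl] at h'
    have hon : oddNorm p = 1 ∧ oddNorm q = 1 ∧ IsSquare (Quaternion.normSq (p * q) : ℤ) := by
      rcases rotMatrix_injective hp hq hadm.1 hadm.2.1 h' with ⟨rfl, rfl⟩ | ⟨rfl, rfl⟩
      · exact ⟨hp', hq', hadm.2.2⟩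
      · exact ⟨by simpa using hp', by simpa using hq', by simpa using hadm.2.2⟩
    refine ⟨?_, ⟨k, p, hk, hp, hon.1, rfl⟩, ⟨l, q, hl, hq, hon.2.1, rfl⟩⟩
    rw [normSq_natCast_mul_mul]
    exact (IsSquare.sq _).mul hon.2.2
  · rintro ⟨hsq, ⟨k, p, hk, hp, hp1, rfl⟩, ⟨l, q, hl, hq, hq1, rfl⟩⟩
    rw [rotMatrix_natCast_mul hk hl] at hR
    rw [normSq_natCast_mul_mul] at hsq
    refine mem_GF_of_oddNorm_eq_one ⟨hp, hq, isSquare_of_isSquare_sq_mul ?_ hsq⟩ hp1 hq1 hR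
    exact_mod_cast mul_ne_zero hk hl

theorem oddNorm_natCast_mul {k : ℕ} (x : ℍ[ℤ]) :
    oddNorm ((k : ℍ[ℤ]) * x) = (ordCompl[2] k) ^ 2 * oddNorm x := by
  rw [oddNorm_mul]
  congr 1
  rw [oddNorm, Quaternion.normSq_natCast]
  have : (((k : ℤ) ^ 2).natAbs) = k * k := by rw [Int.natAbs_pow, Int.natAbs_natCast, sq]
  rw [this, Nat.ordCompl_mul, sq]

/-- With m the common odd norm, p̄x has odd norm m². It is a multiple of a cubic quaternion exactly
when the odd part of its content is m, that is, when m divides it. -/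
theorem isCubicMul_star_mul_iff {p x : ℍ[ℤ]} (hp : p ≠ 0) (hx : x ≠ 0)
    (h : oddNorm p = oddNorm x) : IsCubicMul (star p * x) ↔ x ∈ rightIdeal p := by
  have hm := odd_oddNorm hp
  have hon : oddNorm (star p * x) = oddNorm p ^ 2 := by
    rw [oddNorm_mul, oddNorm_star, h, sq]
  rw [rightIdeal, Set.mem_ofPred_eq]
  constructor
  · rintro ⟨k, t, hk, ht, ht1, e⟩
    rw [e, oddNorm_natCast_mul, ht1, mul_one] at hon
    have : ordCompl[2] k = oddNorm p := Nat.pow_left_injective two_ne_zero hon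
    rw [e, ← this]
    exact (Nat.cast_dvd_cast (Nat.ordCompl_dvd k 2)).mul_right t
  · rintro ⟨y, hy⟩
    have hy0 : y ≠ 0 := by
      rintro rfl
      rw [mul_zero] at hy
      exact mul_ne_zero (star_ne_zero.mpr hp) hx hy
    have hy1 : oddNorm y = 1 := by
      have h2 : ¬ 2 ∣ oddNorm p := by rwa [← even_iff_two_dvd, Nat.not_even_iff_odd]
      rw [hy, oddNorm_natCast_mul, Nat.factorization_eq_zero_of_not_dvd h2, pow_zero,
        Nat.div_one] at hon
      exact Nat.eq_of_mul_eq_mul_left (pow_pos hm.pos 2) (by rw [hon, mul_one])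
    obtain ⟨k, t, hk, ht, rfl⟩ := exists_eq_mul_isPrimitive hy0
    rw [oddNorm_natCast_mul] at hy1
    exact ⟨oddNorm p * k, t, mul_ne_zero hm.pos.ne' hk, ht, Nat.eq_one_of_mul_eq_one_left hy1,
      by rw [hy, ← mul_assoc, Nat.cast_mul]⟩

/-- The integers contained in an ideal determine the odd norm of its generator, which lets ideals of
different norms be told apart. -/
theorem natCast_mem_rightIdeal_iff {p : ℍ[ℤ]} (hp : IsPrimitive p) {k : ℕ} :
    (k : ℍ[ℤ]) ∈ rightIdeal p ↔ oddNorm p ∣ k := by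
  rw [rightIdeal, Set.mem_ofPred_eq, ← (Nat.cast_commute k (star p)).eq]
  exact ⟨natCast_dvd_of_isPrimitive hp.star, fun h => (Nat.cast_dvd_cast h).mul_right _⟩

theorem oddNorm_eq_of_rightIdeal_eq {p q : ℍ[ℤ]} (hp : IsPrimitive p) (hq : IsPrimitive q)
    (h : rightIdeal p = rightIdeal q) : oddNorm p = oddNorm q := by
  apply Nat.dvd_antisymm
  · rw [← natCast_mem_rightIdeal_iff hp, h, natCast_mem_rightIdeal_iff hq]
  · rw [← natCast_mem_rightIdeal_iff hq, ← h, natCast_mem_rightIdeal_iff hp]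

theorem self_mem_rightIdeal (q : ℍ[ℤ]) : q ∈ rightIdeal q := by
  rw [rightIdeal, Set.mem_ofPred_eq, Quaternion.star_mul_self]
  obtain ⟨k, hk⟩ := oddNorm_dvd q
  exact ⟨(k : ℍ[ℤ]), by rw [hk]; push_cast; rfl⟩

theorem rightIdeal_eq_of_mem {p q : ℍ[ℤ]} (hp : IsPrimitive p) (hq : IsPrimitive q)
    (hpq : oddNorm p = oddNorm q) (h : q ∈ rightIdeal p) : rightIdeal p = rightIdeal q := by
  have hm := odd_oddNorm hq.ne_zero
  obtain ⟨φ⟩ := nonempty_splitting hm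
  obtain ⟨u, hu, hup⟩ := exists_onLine (φ := φ) hm hp hpq
  rw [mem_rightIdeal_iff_onLine hm hu hp hpq hup] at h
  rw [rightIdeal_eq_lineIdeal hm hu hp hpq hup, rightIdeal_eq_lineIdeal hm hu hq rfl h]

theorem isCubicMul_star_mul_iff_rightIdeal_eq {p q : ℍ[ℤ]} (hp : IsPrimitive p)
    (hq : IsPrimitive q) : IsCubicMul (star p * q) ↔ rightIdeal p = rightIdeal q := by
  constructor
  · intro h
    -- Multiplying p̄q = kt by p on the left, or by q̄ on the right, shows that k divides both
    -- norms. Since the product of the odd norms is the square of the odd part of k, both are equal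
    -- to that odd part.
    have hon : oddNorm p = oddNorm q := by
      obtain ⟨k, t, hk, ht, ht1, e⟩ := h
      have h1 : oddNorm p * oddNorm q = (ordCompl[2] k) ^ 2 := by
        rw [← oddNorm_star p, ← oddNorm_mul, e, oddNorm_natCast_mul, ht1, mul_one]
      have key : ∀ x : ℍ[ℤ], k ∣ (Quaternion.normSq x : ℤ).natAbs → ordCompl[2] k ∣ oddNorm x :=
        fun x h => Nat.ordCompl_dvd_ordCompl_of_dvd h 2
      have hcast : ∀ x : ℍ[ℤ], (((Quaternion.normSq x : ℤ).natAbs : ℕ) : ℍ[ℤ]) =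
          (((Quaternion.normSq x : ℤ)) : ℍ[ℤ]) := fun x => by
        rw [← Int.cast_natCast, Int.natAbs_of_nonneg Quaternion.normSq_nonneg]
      obtain ⟨a, ha⟩ := key p (natCast_dvd_of_isPrimitive hq ⟨p * t, by
        have h2 : p * (star p * q) = p * ((k : ℍ[ℤ]) * t) := by rw [e]
        rw [← mul_assoc, Quaternion.self_mul_star, ← mul_assoc, ← (Nat.cast_commute k p).eq,
          mul_assoc] at h2
        rw [hcast]
        exact h2⟩)
      obtain ⟨b, hb⟩ := key q (natCast_dvd_of_isPrimitive hp.star ⟨t * star q, by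
        have h2 : star p * q * star q = (k : ℍ[ℤ]) * t * star q := by rw [e]
        rw [mul_assoc, Quaternion.self_mul_star, mul_assoc] at h2
        rw [hcast, ← h2]
        exact (Int.cast_commute _ (star p)).eq⟩)
      have hk0 : 0 < ordCompl[2] k := Nat.ordCompl_pos 2 hk
      rw [ha, hb] at h1 ⊢
      have : a * b = 1 := Nat.eq_of_mul_eq_mul_left (pow_pos hk0 2) (by
        rw [mul_one]; linear_combination h1)
      rw [Nat.eq_one_of_mul_eq_one_right this, Nat.eq_one_of_mul_eq_one_left this]
    exact rightIdeal_eq_of_mem hp hq hon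
      ((isCubicMul_star_mul_iff hp.ne_zero hq.ne_zero hon).mp h)
  · intro h
    rw [isCubicMul_star_mul_iff hp.ne_zero hq.ne_zero (oddNorm_eq_of_rightIdeal_eq hp hq h), h]
    exact self_mem_rightIdeal q

/-- R⁻¹R' is given by the pair (p̄p', q̄q'), and belongs to G_F when both entries are multiples of
cubic quaternions. The condition that the norm product be a square holds automatically for two
admissible pairs. -/
theorem mk_eq_mk_iff {p q p' q' : ℍ[ℤ]} {R R' : SO4} (h : IsAdmissible p q)
    (h' : IsAdmissible p' q') (hR : R.1 = rotMatrix p q) (hR' : R'.1 = rotMatrix p' q') :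
    (R : SO4 ⧸ GF) = R' ↔ rightIdeal p = rightIdeal p' ∧ rightIdeal q = rightIdeal q' := by
  have e : (R⁻¹ * R').1 = rotMatrix (star p * p') (star q * q') := by
    rw [← rotMatrix_mul, ← rotMatrix_transpose, ← hR, ← hR']; rfl
  rw [QuotientGroup.eq, mem_GF_iff (mul_ne_zero (star_ne_zero.mpr h.1.ne_zero) h'.1.ne_zero)
    (mul_ne_zero (star_ne_zero.mpr h.2.1.ne_zero) h'.2.1.ne_zero) e,
    isCubicMul_star_mul_iff_rightIdeal_eq h.1 h'.1,
    isCubicMul_star_mul_iff_rightIdeal_eq h.2.1 h'.2.1]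
  refine and_iff_right ?_
  have : (Quaternion.normSq (star p * p' * (star q * q')) : ℤ) =
      Quaternion.normSq (p * q) * Quaternion.normSq (p' * q') := by
    simp only [map_mul, Quaternion.normSq_star]; ring
  rw [this]
  exact h.2.2.mul h'.2.2

/-! ### Equivalence of quaternions -/

theorem normalize_eq (x : ℍ[ℤ]) : normalize x = (1 / √((Quaternion.normSq x : ℤ) : ℝ)) •
    (quat (x.re : ℝ) x.imI x.imJ x.imK) := rfl

theorem normalize_mul (x y : ℍ[ℤ]) : normalize (x * y) = normalize x * normalize y := by
  have h : (quat ((x * y).re : ℝ) (x * y).imI (x * y).imJ (x * y).imK : ℍ[ℝ]) =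
      quat (x.re : ℝ) x.imI x.imJ x.imK * quat (y.re : ℝ) y.imI y.imJ y.imK := by
    ext <;> simp
  rw [normalize_eq, normalize_eq, normalize_eq, h, smul_mul_smul_comm, map_mul, Int.cast_mul,
    Real.sqrt_mul (by exact_mod_cast Quaternion.normSq_nonneg)]
  congr 1
  field_simp

theorem normalize_natCast_mul {k : ℕ} (hk : k ≠ 0) (x : ℍ[ℤ]) :
    normalize ((k : ℍ[ℤ]) * x) = normalize x := by
  have h : normalize (k : ℍ[ℤ]) = 1 := by
    rw [normalize_eq, Quaternion.normSq_natCast]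
    have : √(((k : ℤ) ^ 2 : ℤ) : ℝ) = k := by
      push_cast
      exact Real.sqrt_sq (Nat.cast_nonneg k)
    rw [this]
    have hk' : (k : ℝ) ≠ 0 := Nat.cast_ne_zero.mpr hk
    ext <;> simp [hk']
  rw [normalize_mul, h, one_mul]

theorem normalize_injective {x y : ℍ[ℤ]} (hx : IsPrimitive x) (hy : IsPrimitive y)
    (h : normalize x = normalize y) : x = y := by
  have hNx : (0 : ℝ) < ((Quaternion.normSq x : ℤ) : ℝ) := by exact_mod_cast normSq_pos hx.ne_zero
  have hNy : (0 : ℤ) < Quaternion.normSq y := normSq_pos hy.ne_zero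
  have hNy' : (0 : ℝ) < ((Quaternion.normSq y : ℤ) : ℝ) := by exact_mod_cast hNy
  obtain ⟨c, hc0, hc⟩ : ∃ c : ℝ, 0 < c ∧ (quat (x.re : ℝ) x.imI x.imJ x.imK : ℍ[ℝ]) =
      c • quat (y.re : ℝ) y.imI y.imJ y.imK := by
    refine ⟨√((Quaternion.normSq x : ℤ) : ℝ) * (1 / √((Quaternion.normSq y : ℤ) : ℝ)),
      mul_pos (Real.sqrt_pos.mpr hNx) (one_div_pos.mpr (Real.sqrt_pos.mpr hNy')), ?_⟩
    rw [normalize_eq, normalize_eq] at h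
    rw [← smul_smul, ← h, smul_smul, mul_one_div_cancel (Real.sqrt_pos.mpr hNx).ne', one_smul]
  have c0 := congrArg QuaternionAlgebra.re hc
  have c1 := congrArg QuaternionAlgebra.imI hc
  have c2 := congrArg QuaternionAlgebra.imJ hc
  have c3 := congrArg QuaternionAlgebra.imK hc
  simp at c0 c1 c2 c3
  obtain ⟨n, hn⟩ : ∃ n : ℤ, n = x.re * y.re + x.imI * y.imI + x.imJ * y.imJ + x.imK * y.imK :=
    ⟨_, rfl⟩
  have hN : (Quaternion.normSq y : ℤ) = y.re ^ 2 + y.imI ^ 2 + y.imJ ^ 2 + y.imK ^ 2 :=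
    Quaternion.normSq_def' _
  generalize (Quaternion.normSq y : ℤ) = N at *
  have hnc : (n : ℝ) = c * (N : ℝ) := by
    rw [hn, hN]
    push_cast
    rw [c0, c1, c2, c3]
    ring
  have e : (N : ℍ[ℤ]) * x = (n : ℍ[ℤ]) * y := by
    ext <;> simp <;> (rw [← Int.cast_inj (α := ℝ)]; push_cast; rw [hnc])
    · rw [c0]; ring
    · rw [c1]; ring
    · rw [c2]; ring
    · rw [c3]; ring
  have hn0 : 0 < n := by
    have : (0 : ℝ) < n := by rw [hnc]; positivity
    exact_mod_cast this
  rcases eq_or_eq_neg_of_intCast_mul_eq hx hy hNy.ne' e with h | h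
  · exact h.symm
  · exfalso
    rw [h, mul_neg, ← neg_mul, ← Int.cast_neg] at e
    have := mul_right_cancel₀ hx.ne_zero e
    have h2 : N = -n := by simpa using congrArg QuaternionAlgebra.re this
    linarith

/-- The primitive integral representatives of the cubic group. -/
def IsCubic (s : ℍ[ℤ]) : Prop := IsPrimitive s ∧ oddNorm s = 1

theorem isCubic_iff {s : ℍ[ℤ]} : IsCubic s ↔ IsPrimitive s ∧
    (Quaternion.normSq s = 1 ∨ Quaternion.normSq s = 2 ∨ Quaternion.normSq s = 4) := by
  refine and_congr_right fun hs => ⟨fun h => ?_, fun h => ?_⟩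
  · obtain ⟨k, hk, e⟩ := hs.exists_normSq_eq
    rw [h] at e
    interval_cases k <;> simp at e <;> simp [e]
  · rcases h with h | h | h
    · exact oddNorm_eq (k := 0) odd_one (by rw [h]; norm_num)
    · exact oddNorm_eq (k := 1) odd_one (by rw [h]; norm_num)
    · exact oddNorm_eq (k := 2) odd_one (by rw [h]; norm_num)

theorem IsCubic.star {s : ℍ[ℤ]} (h : IsCubic s) : IsCubic (star s) :=
  ⟨h.1.star, by rw [oddNorm_star, h.2]⟩

theorem quatEquiv_iff {q q' : ℍ[ℤ]} (hq : IsPrimitive q) (hq' : IsPrimitive q') :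
    QuatEquiv q q' ↔ ∃ (s s' : ℍ[ℤ]) (k : ℕ), IsCubic s ∧ IsCubic s' ∧ k ≠ 0 ∧
      s * q * s' = (k : ℍ[ℤ]) * q' := by
  constructor
  · rintro ⟨_, ⟨s, hs, hs1, rfl⟩, _, ⟨s', hs', hs1', rfl⟩, e⟩
    rw [← normalize_mul, ← normalize_mul] at e
    obtain ⟨k, r, hk, hr, e'⟩ := exists_eq_mul_isPrimitive
      (mul_ne_zero (mul_ne_zero hs.ne_zero hq.ne_zero) hs'.ne_zero)
    rw [e', normalize_natCast_mul hk] at e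
    rw [← normalize_injective hq' hr e] at e'
    exact ⟨s, s', k, isCubic_iff.mpr ⟨hs, hs1⟩, isCubic_iff.mpr ⟨hs', hs1'⟩, hk, e'⟩
  · rintro ⟨s, s', k, hs, hs', hk, e⟩
    rw [isCubic_iff] at hs hs'
    refine ⟨_, ⟨s, hs.1, hs.2, rfl⟩, _, ⟨s', hs'.1, hs'.2, rfl⟩, ?_⟩
    rw [← normalize_mul, ← normalize_mul, e, normalize_natCast_mul hk]

/-- The factor k is a power of 2, because k divides q times the norms of s and s', which are powers
of 2, and q is primitive. -/
theorem oddNorm_eq_of_mul_mul_eq {q q' s s' : ℍ[ℤ]} {k : ℕ} (hq : IsPrimitive q)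
    (hs : IsCubic s) (hs' : IsCubic s') (hk : k ≠ 0) (e : s * q * s' = (k : ℍ[ℤ]) * q') :
    oddNorm q = oddNorm q' := by
  have h1 := congrArg oddNorm e
  rw [oddNorm_mul, oddNorm_mul, hs.2, hs'.2, one_mul, mul_one, oddNorm_natCast_mul] at h1
  have hpow : ∀ x : ℍ[ℤ], IsCubic x → ∃ i : ℕ, (Quaternion.normSq x : ℤ) = 2 ^ i := by
    intro x hx
    obtain ⟨i, hi⟩ := exists_normSq_eq x
    exact ⟨i, by rw [hi, hx.2]; simp⟩
  obtain ⟨i, hi⟩ := hpow s hs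
  obtain ⟨j, hj⟩ := hpow s' hs'
  have h2 : k ∣ 2 ^ (i + j) := by
    refine natCast_dvd_of_isPrimitive hq ⟨star s * q' * star s', ?_⟩
    have h3 : star s * (s * q * s') * star s' = star s * ((k : ℍ[ℤ]) * q') * star s' := by rw [e]
    have h4 : star s * (s * q * s') * star s' = (star s * s) * (q * (s' * star s')) := by
      simp only [mul_assoc]
    rw [h4, Quaternion.star_mul_self, Quaternion.self_mul_star, hi, hj] at h3
    have h5 : q * (((2 : ℤ) ^ j : ℤ) : ℍ[ℤ]) = (((2 : ℤ) ^ j : ℤ) : ℍ[ℤ]) * q :=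
      (Int.cast_commute _ q).eq.symm
    have h6 : star s * ((k : ℍ[ℤ]) * q') = (k : ℍ[ℤ]) * (star s * q') := by
      rw [← mul_assoc, ← (Nat.cast_commute k (star s)).eq, mul_assoc]
    erw [h5] at h3
    rw [h6, ← mul_assoc] at h3
    rw [mul_assoc (k : ℍ[ℤ]) (star s * q')] at h3
    rw [← h3, ← Int.cast_natCast, Nat.cast_pow, Nat.cast_ofNat, pow_add, Int.cast_mul]
    rfl
  obtain ⟨a, -, rfl⟩ := (Nat.dvd_prime_pow Nat.prime_two).mp h2
  rw [Nat.prime_two.factorization_pow, Finsupp.single_eq_same, Nat.div_self (by positivity)] at h1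
  simpa using h1

/-! ### Axes of a quaternion -/

theorem star_mul_self_eq (p : ℍ[ℤ]) :
    star p * p = (Int.cast (Quaternion.normSq p : ℤ) : ℍ[ℤ]) := Quaternion.star_mul_self p

theorem natCast_mul_re (k : ℕ) (x : ℍ[ℤ]) : ((k : ℍ[ℤ]) * x).re = k * x.re := by simp

theorem natCast_ne_zero {k : ℕ} (hk : k ≠ 0) : (k : ℍ[ℤ]) ≠ 0 := fun h => hk (by
  simpa using congrArg QuaternionAlgebra.re h)

/-- A sum of three squares divisible by 4 has only even terms. For pure quaternions each factor 4 of
the norm therefore yields a factor 2. -/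
theorem two_dvd_of_four_dvd {y : ℍ[ℤ]} (hy : y.re = 0) (h : (4 : ℤ) ∣ Quaternion.normSq y) :
    ((2 : ℕ) : ℍ[ℤ]) ∣ y := by
  rw [Quaternion.normSq_def', hy] at h
  have key : ∀ a b c : ZMod 4, a ^ 2 + b ^ 2 + c ^ 2 = 0 →
      (a = 0 ∨ a = 2) ∧ (b = 0 ∨ b = 2) ∧ (c = 0 ∨ c = 2) := by decide
  have h2 := key y.imI y.imJ y.imK (by
    have := (ZMod.intCast_zmod_eq_zero_iff_dvd _ 4).mpr h
    push_cast at this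
    linear_combination this)
  have h3 : ∀ a : ℤ, ((a : ZMod 4) = 0 ∨ (a : ZMod 4) = 2) → ((2 : ℕ) : ℤ) ∣ a := by
    intro a ha
    rcases ha with ha | ha
    · have := (ZMod.intCast_zmod_eq_zero_iff_dvd _ 4).mp ha
      omega
    · have : ((a - 2 : ℤ) : ZMod 4) = 0 := by push_cast; rw [ha]; decide
      have := (ZMod.intCast_zmod_eq_zero_iff_dvd _ 4).mp this
      omega
  rw [natCast_dvd_iff]
  exact ⟨by rw [hy]; exact dvd_zero _, h3 _ h2.1, h3 _ h2.2.1, h3 _ h2.2.2⟩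

theorem exists_eq_two_pow_mul_of_re_eq_zero (k : ℕ) {y : ℍ[ℤ]} (hy : y.re = 0)
    (h : (2 : ℤ) ^ (2 * k) ∣ Quaternion.normSq y) :
    ∃ w : ℍ[ℤ], y = ((2 ^ k : ℕ) : ℍ[ℤ]) * w ∧ w.re = 0 := by
  induction k generalizing y with
  | zero => exact ⟨y, by simp, hy⟩
  | succ k ih =>
    obtain ⟨z, rfl⟩ := two_dvd_of_four_dvd hy (dvd_trans ⟨2 ^ (2 * k), by ring⟩ h)
    have hz : z.re = 0 := by
      rw [natCast_mul_re] at hy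
      push_cast at hy
      omega
    obtain ⟨w, hw, hw0⟩ := ih hz (by
      rw [map_mul, Quaternion.normSq_natCast] at h
      obtain ⟨c, hc⟩ := h
      refine ⟨c, ?_⟩
      rw [mul_add, pow_add] at hc
      push_cast at hc
      linarith)
    exact ⟨w, by rw [hw, ← mul_assoc, ← Nat.cast_mul, ← pow_succ'], hw0⟩

/-- The conjugate p⁻¹vp is integral. Membership removes the odd denominator: p̄vp = my with y pure
of norm 2^(2k)|v|², where |p|² = 2^k m. Purity then makes y divisible by 2^k. -/
theorem exists_mul_eq_mul_of_mem_rightIdeal {v p : ℍ[ℤ]} (hp : p ≠ 0) (hv : v.re = 0)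
    (h : v * p ∈ rightIdeal p) :
    ∃ w : ℍ[ℤ], w.re = 0 ∧ Quaternion.normSq w = (Quaternion.normSq v : ℤ) ∧ v * p = p * w := by
  obtain ⟨y, hy⟩ := h
  obtain ⟨k, hk⟩ := exists_normSq_eq p
  have hm : (oddNorm p : ℤ) ≠ 0 := by exact_mod_cast (odd_oddNorm hp).pos.ne'
  have hre : y.re = 0 := by
    have h1 := congrArg QuaternionAlgebra.re hy
    simp [hv] at h1
    have h2 : (oddNorm p : ℤ) * y.re = 0 := by linear_combination -h1
    exact (mul_eq_zero.mp h2).resolve_left hm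
  have hN := congrArg (fun x : ℍ[ℤ] => (Quaternion.normSq x : ℤ)) hy
  simp only [map_mul, Quaternion.normSq_star, Quaternion.normSq_natCast] at hN
  have hN' : (Quaternion.normSq y : ℤ) = 2 ^ (2 * k) * Quaternion.normSq v := by
    rw [hk] at hN
    refine mul_left_cancel₀ (pow_ne_zero 2 hm) ?_
    rw [← hN]
    ring
  obtain ⟨w, rfl, hw⟩ := exists_eq_two_pow_mul_of_re_eq_zero k hre ⟨_, hN'⟩
  refine ⟨w, hw, ?_, ?_⟩
  · rw [map_mul, Quaternion.normSq_natCast, Nat.cast_pow, ← pow_mul, mul_comm k] at hN'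
    exact mul_left_cancel₀ (by positivity) hN'
  · apply mul_left_cancel₀ (star_ne_zero.mpr hp)
    rw [hy, ← mul_assoc, ← mul_assoc, star_mul_self_eq, hk, ← Nat.cast_mul, ← Int.cast_natCast]
    congr 2
    push_cast
    ring

theorem mul_mem_rightIdeal_of_eq {v w p : ℍ[ℤ]} (h : v * p = p * w) : v * p ∈ rightIdeal p := by
  rw [rightIdeal, Set.mem_ofPred_eq, h, ← mul_assoc, star_mul_self_eq]
  obtain ⟨k, hk⟩ := oddNorm_dvd p
  refine Dvd.dvd.mul_right ⟨(k : ℍ[ℤ]), ?_⟩ w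
  rw [hk, Int.cast_mul, Int.cast_natCast]

theorem one_dvd_rightIdeal {s : ℍ[ℤ]} (hs : IsCubic s) (x : ℍ[ℤ]) : x ∈ rightIdeal s := by
  rw [rightIdeal, Set.mem_ofPred_eq, hs.2, Nat.cast_one]
  exact one_dvd _

theorem IsCubic.ne_zero {s : ℍ[ℤ]} (hs : IsCubic s) : s ≠ 0 := hs.1.ne_zero

/-- A quaternion of norm `1`, `2` or `4` with coordinates `0` and `±1` is cubic. -/
theorem isCubic_quat {a b c d : ℤ} (ha : a ∈ Finset.Icc (-1 : ℤ) 1) (hb : b ∈ Finset.Icc (-1 : ℤ) 1)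
    (hc : c ∈ Finset.Icc (-1 : ℤ) 1) (hd : d ∈ Finset.Icc (-1 : ℤ) 1)
    (h : a ^ 2 + b ^ 2 + c ^ 2 + d ^ 2 = 1 ∨ a ^ 2 + b ^ 2 + c ^ 2 + d ^ 2 = 2 ∨
      a ^ 2 + b ^ 2 + c ^ 2 + d ^ 2 = 4) : IsCubic (quat a b c d) := by
  rw [isCubic_iff]
  refine ⟨fun e h0 h1 h2 h3 => ?_, by rw [Quaternion.normSq_def']; exact h⟩
  simp only [quat_re, quat_imI, quat_imJ, quat_imK] at h0 h1 h2 h3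
  by_contra he
  have key : ∀ x : ℤ, x ∈ Finset.Icc (-1 : ℤ) 1 → e ∣ x → x = 0 := by
    intro x hx hex
    rw [Finset.mem_Icc] at hx
    have : x = -1 ∨ x = 0 ∨ x = 1 := by omega
    rcases this with rfl | rfl | rfl
    · exact absurd (isUnit_of_dvd_unit hex (by decide)) he
    · rfl
    · exact absurd (isUnit_of_dvd_unit hex isUnit_one) he
  rw [key a ha h0, key b hb h1, key c hc h2, key d hd h3] at h
  omega

theorem mem_Icc_of_sq_le {a : ℤ} (h : a ^ 2 ≤ 3) : a ∈ Finset.Icc (-1 : ℤ) 1 := by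
  rw [Finset.mem_Icc]
  constructor <;> nlinarith

/-- A finite check that the cubic group is transitive on vectors of each length with coordinates 0,
±1. The last four equations are the coordinates of s v = w s. -/
theorem exists_conj_coordinates : ∀ a ∈ Finset.Icc (-1 : ℤ) 1, ∀ b ∈ Finset.Icc (-1 : ℤ) 1,
    ∀ c ∈ Finset.Icc (-1 : ℤ) 1, ∀ a' ∈ Finset.Icc (-1 : ℤ) 1, ∀ b' ∈ Finset.Icc (-1 : ℤ) 1,
    ∀ c' ∈ Finset.Icc (-1 : ℤ) 1, a ^ 2 + b ^ 2 + c ^ 2 = a' ^ 2 + b' ^ 2 + c' ^ 2 →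
    ∃ s ∈ Finset.Icc (-1 : ℤ) 1, ∃ x ∈ Finset.Icc (-1 : ℤ) 1, ∃ y ∈ Finset.Icc (-1 : ℤ) 1,
    ∃ z ∈ Finset.Icc (-1 : ℤ) 1, (s ^ 2 + x ^ 2 + y ^ 2 + z ^ 2 = 1 ∨
      s ^ 2 + x ^ 2 + y ^ 2 + z ^ 2 = 2 ∨ s ^ 2 + x ^ 2 + y ^ 2 + z ^ 2 = 4) ∧
      x * a + y * b + z * c = a' * x + b' * y + c' * z ∧
      s * a + y * c - z * b = a' * s + b' * z - c' * y ∧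
      s * b + z * a - x * c = b' * s + c' * x - a' * z ∧
      s * c + x * b - y * a = c' * s + a' * y - b' * x := by decide +kernel

theorem exists_isCubic_conj {v w : ℍ[ℤ]} (hv : v.re = 0) (hw : w.re = 0)
    (h : (Quaternion.normSq v : ℤ) ≤ 3) (hvw : (Quaternion.normSq w : ℤ) = Quaternion.normSq v) :
    ∃ s, IsCubic s ∧ s * v = w * s := by
  rw [Quaternion.normSq_def', Quaternion.normSq_def', hw, hv] at hvw
  rw [Quaternion.normSq_def', hv] at h
  obtain ⟨s, hs, x, hx, y, hy, z, hz, hN, e0, e1, e2, e3⟩ := exists_conj_coordinates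
    v.imI (mem_Icc_of_sq_le (by nlinarith)) v.imJ (mem_Icc_of_sq_le (by nlinarith))
    v.imK (mem_Icc_of_sq_le (by nlinarith)) w.imI (mem_Icc_of_sq_le (by nlinarith))
    w.imJ (mem_Icc_of_sq_le (by nlinarith)) w.imK (mem_Icc_of_sq_le (by nlinarith))
    (by linarith)
  refine ⟨quat s x y z, isCubic_quat hs hx hy hz hN, ?_⟩
  ext
  · simp [hv, hw]; linarith
  · simp [hv, hw]; linarith
  · simp [hv, hw]; linarith
  · simp [hv, hw]; linarith

/-- `p` fixes an axis of squared length `d`. -/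
def HasAxis (d : ℕ) (p : ℍ[ℤ]) : Prop :=
  ∃ v : ℍ[ℤ], v.re = 0 ∧ (Quaternion.normSq v : ℤ) = d ∧ v * p ∈ rightIdeal p

/-- If s p s' is proportional to q and q commutes with w, then s⁻¹ws is an axis of p. Conversely,
for an axis v put u = p⁻¹vp; cubic quaternions rotate v to w on the left and w to u on the right,
and the resulting s p s' commutes with w. -/
theorem exists_quatEquiv_iff_hasAxis {w p : ℍ[ℤ]} {d : ℕ} (hw : w.re = 0)
    (hd : (Quaternion.normSq w : ℤ) = d) (hd3 : d ≤ 3) (hp : IsPrimitive p) :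
    (∃ q, IsPrimitive q ∧ w * q = q * w ∧ QuatEquiv p q) ↔ HasAxis d p := by
  constructor
  · rintro ⟨q, hq, hwq, h⟩
    obtain ⟨s, s', k, hs, hs', hk, e⟩ := (quatEquiv_iff hp hq).mp h
    obtain ⟨v, hv0, hvN, hv⟩ := exists_mul_eq_mul_of_mem_rightIdeal hs.ne_zero hw
      (one_dvd_rightIdeal hs (w * s))
    obtain ⟨v', -, -, hv'⟩ := exists_mul_eq_mul_of_mem_rightIdeal hs'.star.ne_zero
      (v := star w) (by simpa using hw) (one_dvd_rightIdeal hs'.star _)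
    have hv'' : s' * w = star v' * s' := by
      have := congrArg star hv'
      simpa only [star_mul, star_star] using this
    refine ⟨v, hv0, hvN.trans hd, mul_mem_rightIdeal_of_eq (w := star v') ?_⟩
    apply mul_left_cancel₀ hs.ne_zero
    apply mul_right_cancel₀ hs'.ne_zero
    calc s * (v * p) * s' = (w * s) * p * s' := by rw [hv]; simp only [mul_assoc]
      _ = w * (s * p * s') := by simp only [mul_assoc]
      _ = s * p * s' * w := by
        rw [e, ← mul_assoc, (Nat.cast_commute k w).eq.symm, mul_assoc, hwq, mul_assoc]
      _ = s * (p * star v') * s' := by rw [mul_assoc _ s' w, hv'']; simp only [mul_assoc]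
  · rintro ⟨v, hv0, hvN, hv⟩
    obtain ⟨u, hu0, huN, hu⟩ := exists_mul_eq_mul_of_mem_rightIdeal hp.ne_zero hv0 hv
    obtain ⟨s, hs, hsv⟩ := exists_isCubic_conj hv0 hw (by rw [hvN]; exact_mod_cast hd3)
      (by rw [hd, hvN])
    obtain ⟨s', hs', hsu⟩ := exists_isCubic_conj hw hu0 (by rw [hd]; exact_mod_cast hd3)
      (by rw [hd, huN, hvN])
    obtain ⟨k, q, hk, hq, e⟩ := exists_eq_mul_isPrimitive
      (mul_ne_zero (mul_ne_zero hs.ne_zero hp.ne_zero) hs'.ne_zero)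
    refine ⟨q, hq, ?_, (quatEquiv_iff hp hq).mpr ⟨s, s', k, hs, hs', hk, e⟩⟩
    apply mul_left_cancel₀ (natCast_ne_zero hk)
    calc (k : ℍ[ℤ]) * (w * q) = w * (s * p * s') := by
          rw [e, ← mul_assoc, (Nat.cast_commute k w).eq, mul_assoc]
      _ = (s * v) * p * s' := by rw [hsv]; simp only [mul_assoc]
      _ = s * (v * p) * s' := by simp only [mul_assoc]
      _ = s * p * (u * s') := by rw [hu]; simp only [mul_assoc]
      _ = (s * p * s') * w := by rw [← hsu]; simp only [mul_assoc]
      _ = (k : ℍ[ℤ]) * (q * w) := by rw [e, mul_assoc]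

/-- The centralizer of (0,1,1,1) in the integral quaternions consists of the quaternions (m,n,n,n).
-/
theorem equivMNNN_iff {p : ℍ[ℤ]} (hp : IsPrimitive p) : EquivMNNN p ↔ HasAxis 3 p := by
  rw [← exists_quatEquiv_iff_hasAxis (w := quat 0 1 1 1) rfl
    (by rw [Quaternion.normSq_def']; simp) le_rfl hp]
  constructor
  · rintro ⟨m, n, h, e⟩
    refine ⟨_, h, ?_, e⟩
    change quat 0 1 1 1 * quat m n n n = quat m n n n * quat 0 1 1 1
    ext <;> simp
  · rintro ⟨q, hq, hc, e⟩
    have h1 := congrArg QuaternionAlgebra.imI hc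
    have h2 := congrArg QuaternionAlgebra.imJ hc
    simp at h1 h2
    have : q = quat q.re q.imI q.imI q.imI := by ext <;> simp <;> omega
    rw [this] at hq e
    exact ⟨q.re, q.imI, hq, e⟩

theorem equivMN00_iff {p : ℍ[ℤ]} (hp : IsPrimitive p) : EquivMN00 p ↔ HasAxis 1 p := by
  rw [← exists_quatEquiv_iff_hasAxis (w := quat 0 1 0 0) rfl
    (by rw [Quaternion.normSq_def']; simp) (by norm_num) hp]
  constructor
  · rintro ⟨m, n, h, e⟩
    refine ⟨_, h, ?_, e⟩
    change quat 0 1 0 0 * quat m n 0 0 = quat m n 0 0 * quat 0 1 0 0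
    ext <;> simp
  · rintro ⟨q, hq, hc, e⟩
    have h1 := congrArg QuaternionAlgebra.imJ hc
    have h2 := congrArg QuaternionAlgebra.imK hc
    simp at h1 h2
    have : q = quat q.re q.imI 0 0 := by ext <;> simp <;> omega
    rw [this] at hq e
    exact ⟨q.re, q.imI, hq, e⟩

theorem equivMNN0_iff {p : ℍ[ℤ]} (hp : IsPrimitive p) : EquivMNN0 p ↔ HasAxis 2 p := by
  rw [← exists_quatEquiv_iff_hasAxis (w := quat 0 1 1 0) rfl
    (by rw [Quaternion.normSq_def']; simp) (by norm_num) hp]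
  constructor
  · rintro ⟨m, n, h, e⟩
    refine ⟨_, h, ?_, e⟩
    change quat 0 1 1 0 * quat m n n 0 = quat m n n 0 * quat 0 1 1 0
    ext <;> simp
  · rintro ⟨q, hq, hc, e⟩
    have h1 := congrArg QuaternionAlgebra.imI hc
    have h2 := congrArg QuaternionAlgebra.imK hc
    simp at h1 h2
    have : q = quat q.re q.imI q.imI 0 := by ext <;> simp <;> omega
    rw [this] at hq e
    exact ⟨q.re, q.imI, hq, e⟩

/-! ### Representatives of odd norm -/

theorem exists_sq_eq_four_mul_add (a : ℤ) : ∃ t, a ^ 2 = 4 * t + a % 2 := by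
  rcases Int.emod_two_eq a with h | h
  · exact ⟨(a / 2) ^ 2, by rw [h]; nth_rw 1 [← Int.mul_ediv_add_emod a 2, h]; ring⟩
  · exact ⟨(a / 2) ^ 2 + a / 2, by rw [h]; nth_rw 1 [← Int.mul_ediv_add_emod a 2, h]; ring⟩

/-- Let |q|² = 2^k · odd, where k ≤ 2. There is a cubic u of norm 2^k congruent to q modulo 2^k; if
q = u + 2^k r, then q = (1 + rū)u. Representatives of odd norm make the admissibility of a pair a
condition on the odd norms alone. -/
theorem exists_odd_representative {q : ℍ[ℤ]} (hq : IsPrimitive q) :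
    ∃ p u, IsPrimitive p ∧ (Quaternion.normSq p : ℤ) = oddNorm q ∧ IsCubic u ∧ p * u = q := by
  obtain ⟨k, hk, hN⟩ := hq.exists_normSq_eq
  have hodd : (oddNorm q : ℤ) % 2 = 1 := by
    have := Nat.odd_iff.mp (odd_oddNorm hq.ne_zero)
    omega
  have key : ∀ u r : ℍ[ℤ], IsCubic u → (Quaternion.normSq u : ℤ) = 2 ^ k →
      q = u + ((2 ^ k : ℤ) : ℍ[ℤ]) * r → ∃ p u, IsPrimitive p ∧
        (Quaternion.normSq p : ℤ) = oddNorm q ∧ IsCubic u ∧ p * u = q := by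
    intro u r hu hNu e
    have hpu : (1 + r * star u) * u = q := by
      rw [add_mul, one_mul, mul_assoc, star_mul_self_eq, hNu, e, (Int.cast_commute _ r).eq]
    refine ⟨1 + r * star u, u, ?_, ?_, hu, hpu⟩
    · generalize 1 + r * star u = p at hpu
      intro d h0 h1 h2 h3
      apply hq d <;> rw [← hpu] <;> simp only [Quaternion.re_mul, Quaternion.imI_mul,
        Quaternion.imJ_mul, Quaternion.imK_mul]
      · exact dvd_sub (dvd_sub (dvd_sub (h0.mul_right _) (h1.mul_right _)) (h2.mul_right _))
          (h3.mul_right _)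
      · exact dvd_sub (dvd_add (dvd_add (h0.mul_right _) (h1.mul_right _)) (h2.mul_right _))
          (h3.mul_right _)
      · exact dvd_add (dvd_add (dvd_sub (h0.mul_right _) (h1.mul_right _)) (h2.mul_right _))
          (h3.mul_right _)
      · exact dvd_add (dvd_sub (dvd_add (h0.mul_right _) (h1.mul_right _)) (h2.mul_right _))
          (h3.mul_right _)
    · have := congrArg (fun x : ℍ[ℤ] => (Quaternion.normSq x : ℤ)) hpu
      simp only [map_mul] at this
      rw [hNu, hN, mul_comm] at this
      exact mul_left_cancel₀ (by positivity) this
  have hN' := hN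
  rw [Quaternion.normSq_def'] at hN'
  obtain ⟨t0, e0⟩ := exists_sq_eq_four_mul_add q.re
  obtain ⟨t1, e1⟩ := exists_sq_eq_four_mul_add q.imI
  obtain ⟨t2, e2⟩ := exists_sq_eq_four_mul_add q.imJ
  obtain ⟨t3, e3⟩ := exists_sq_eq_four_mul_add q.imK
  rw [e0, e1, e2, e3] at hN'
  have hbin : ∀ x : ℤ, x % 2 ∈ Finset.Icc (-1 : ℤ) 1 := fun x => by
    rw [Finset.mem_Icc]; omega
  have hsq2 : ∀ x : ℤ, (x % 2) ^ 2 = x % 2 := fun x => by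
    rcases Int.emod_two_eq x with h | h <;> rw [h] <;> norm_num
  interval_cases k
  · refine key 1 (q - 1) ?_ (by simp) (by simp)
    exact isCubic_iff.mpr ⟨fun d h _ _ _ => isUnit_of_dvd_one (by simpa using h), by simp⟩
  -- The norm is 2 modulo 4, so exactly two coordinates are odd, and the residues modulo 2 form a
  -- cubic quaternion of norm 2.
  · have hsum : q.re % 2 + q.imI % 2 + q.imJ % 2 + q.imK % 2 = 2 := by omega
    have hNu : (q.re % 2) ^ 2 + (q.imI % 2) ^ 2 + (q.imJ % 2) ^ 2 + (q.imK % 2) ^ 2 = 2 := by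
      rw [hsq2, hsq2, hsq2, hsq2, hsum]
    refine key (quat (q.re % 2) (q.imI % 2) (q.imJ % 2) (q.imK % 2))
      (quat (q.re / 2) (q.imI / 2) (q.imJ / 2) (q.imK / 2))
      (isCubic_quat (hbin _) (hbin _) (hbin _) (hbin _) (Or.inr (Or.inl hNu)))
      (by rw [Quaternion.normSq_def']; simpa using hNu) ?_
    rw [intCast_mul_quat]
    ext <;> simp <;> omega
  · have hall : q.re % 2 = 1 ∧ q.imI % 2 = 1 ∧ q.imJ % 2 = 1 ∧ q.imK % 2 = 1 := by
      by_contra hcon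
      have : q.re % 2 = 0 ∧ q.imI % 2 = 0 ∧ q.imJ % 2 = 0 ∧ q.imK % 2 = 0 := by omega
      have := hq 2 (by omega) (by omega) (by omega) (by omega)
      exact absurd this (by decide)
    -- For odd x the number 2 - x % 4 is the representative ±1 of x modulo 4.
    have hr : ∀ x : ℤ, x % 2 = 1 → (2 - x % 4) ∈ Finset.Icc (-1 : ℤ) 1 ∧ (2 - x % 4) ^ 2 = 1 ∧
        x = 2 - x % 4 + 4 * ((x - (2 - x % 4)) / 4) := by
      intro x hx
      have : x % 4 = 1 ∨ x % 4 = 3 := by omega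
      rcases this with h | h <;> rw [h] <;> refine ⟨by decide, by norm_num, by omega⟩
    obtain ⟨a0, b0, c0⟩ := hr _ hall.1
    obtain ⟨a1, b1, c1⟩ := hr _ hall.2.1
    obtain ⟨a2, b2, c2⟩ := hr _ hall.2.2.1
    obtain ⟨a3, b3, c3⟩ := hr _ hall.2.2.2
    refine key (quat (2 - q.re % 4) (2 - q.imI % 4) (2 - q.imJ % 4) (2 - q.imK % 4))
      (quat ((q.re - (2 - q.re % 4)) / 4) ((q.imI - (2 - q.imI % 4)) / 4)
        ((q.imJ - (2 - q.imJ % 4)) / 4) ((q.imK - (2 - q.imK % 4)) / 4))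
      (isCubic_quat a0 a1 a2 a3 (Or.inr (Or.inr ?_)))
      (by rw [Quaternion.normSq_def', quat_re, quat_imI, quat_imJ, quat_imK, b0, b1, b2, b3]
          norm_num) ?_
    · rw [b0, b1, b2, b3]; norm_num
    · rw [intCast_mul_quat]
      ext
      · simpa using c0
      · simpa using c1
      · simpa using c2
      · simpa using c3

theorem rightIdeal_eq_of_mul_eq {p q u : ℍ[ℤ]} (hp : IsPrimitive p) (hq : IsPrimitive q)
    (hu : IsCubic u) (h : p * u = q) : rightIdeal p = rightIdeal q := by
  refine rightIdeal_eq_of_mem hp hq (by rw [← h, oddNorm_mul, hu.2, mul_one]) ?_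
  obtain ⟨y, hy⟩ := self_mem_rightIdeal p
  exact ⟨y * u, by rw [← h, ← mul_assoc, hy, mul_assoc]⟩

/-! ### Two axes -/

/-- Both v and w have the line of p as an eigenline, so their commutator annihilates it. Its
determinant, the norm, therefore vanishes modulo the odd norm of p. -/
theorem oddNorm_dvd_normSq_commutator {p v w : ℍ[ℤ]} (hp : IsPrimitive p)
    (hv : v * p ∈ rightIdeal p) (hw : w * p ∈ rightIdeal p) :
    (oddNorm p : ℤ) ∣ Quaternion.normSq (v * w - w * v) := by
  have hm := odd_oddNorm hp.ne_zero
  obtain ⟨φ⟩ := nonempty_splitting hm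
  obtain ⟨u, hu, hup⟩ := exists_onLine (φ := φ) hm hp rfl
  obtain ⟨l, a0, a1⟩ := (mul_mem_rightIdeal_iff hm hu hp rfl hup).mp hv
  obtain ⟨l', b0, b1⟩ := (mul_mem_rightIdeal_iff hm hu hp rfl hup).mp hw
  rw [← ZMod.intCast_zmod_eq_zero_iff_dvd, ← φ.det_hom, map_sub, map_mul, map_mul,
    Matrix.det_fin_two]
  simp only [Matrix.sub_apply, Matrix.mul_apply, Fin.sum_univ_two]
  obtain ⟨r, s, hrs⟩ := hu
  generalize φ.hom v 0 0 = v00, φ.hom v 0 1 = v01, φ.hom v 1 0 = v10, φ.hom v 1 1 = v11,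
    φ.hom w 0 0 = w00, φ.hom w 0 1 = w01, φ.hom w 1 0 = w10, φ.hom w 1 1 = w11 at *
  have h0 : (v00 * w00 + v01 * w10 - (w00 * v00 + w01 * v10)) * u.1 +
      (v00 * w01 + v01 * w11 - (w00 * v01 + w01 * v11)) * u.2 = 0 := by
    linear_combination v00 * b0 + v01 * b1 + l' * a0 - w00 * a0 - w01 * a1 - l * b0
  have h1 : (v10 * w00 + v11 * w10 - (w10 * v00 + w11 * v10)) * u.1 +
      (v10 * w01 + v11 * w11 - (w10 * v01 + w11 * v11)) * u.2 = 0 := by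
    linear_combination v10 * b0 + v11 * b1 + l' * a1 - w10 * a0 - w11 * a1 - l * b1
  generalize v00 * w00 + v01 * w10 - (w00 * v00 + w01 * v10) = x00,
    v00 * w01 + v01 * w11 - (w00 * v01 + w01 * v11) = x01,
    v10 * w00 + v11 * w10 - (w10 * v00 + w11 * v10) = x10,
    v10 * w01 + v11 * w11 - (w10 * v01 + w11 * v11) = x11 at *
  linear_combination (-(x00 * x11 - x01 * x10)) * hrs + r * (x11 * h0 - x01 * h1) +
    s * (x00 * h1 - x10 * h0)

/-- For pure v, w the norm of the commutator is 4|v × w|²; for short vectors that are not parallel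
it divides 96. -/
theorem commutator_coordinates : ∀ a ∈ Finset.Icc (-1 : ℤ) 1, ∀ b ∈ Finset.Icc (-1 : ℤ) 1,
    ∀ c ∈ Finset.Icc (-1 : ℤ) 1, ∀ a' ∈ Finset.Icc (-1 : ℤ) 1, ∀ b' ∈ Finset.Icc (-1 : ℤ) 1,
    ∀ c' ∈ Finset.Icc (-1 : ℤ) 1, a ^ 2 + b ^ 2 + c ^ 2 ≠ 0 → a' ^ 2 + b' ^ 2 + c' ^ 2 ≠ 0 →
    (a' = a ∧ b' = b ∧ c' = c) ∨ (a' = -a ∧ b' = -b ∧ c' = -c) ∨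
    4 * ((b * c' - c * b') ^ 2 + (c * a' - a * c') ^ 2 + (a * b' - b * a') ^ 2) ∣ 96 := by
  decide +kernel

/-- An odd divisor of 96 = 32 · 3 divides 3. Thus, outside the exceptional classes, a quaternion has
at most one axis up to sign. -/
theorem eq_or_eq_neg_or_oddNorm_dvd {p v w : ℍ[ℤ]} (hp : IsPrimitive p) (hv : v.re = 0)
    (hw : w.re = 0) (hv0 : v ≠ 0) (hw0 : w ≠ 0) (hv3 : (Quaternion.normSq v : ℤ) ≤ 3)
    (hw3 : (Quaternion.normSq w : ℤ) ≤ 3) (hvp : v * p ∈ rightIdeal p)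
    (hwp : w * p ∈ rightIdeal p) : w = v ∨ w = -v ∨ oddNorm p ∣ 3 := by
  have h := oddNorm_dvd_normSq_commutator hp hvp hwp
  have hv1 := (normSq_pos hv0).ne'
  have hw1 := (normSq_pos hw0).ne'
  have hN : (Quaternion.normSq (v * w - w * v) : ℤ) = 4 * ((v.imJ * w.imK - v.imK * w.imJ) ^ 2 +
      (v.imK * w.imI - v.imI * w.imK) ^ 2 + (v.imI * w.imJ - v.imJ * w.imI) ^ 2) := by
    rw [Quaternion.normSq_def']
    simp [hv, hw]
    ring
  rw [Quaternion.normSq_def', hv] at hv1 hv3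
  rw [Quaternion.normSq_def', hw] at hw1 hw3
  rcases commutator_coordinates
    v.imI (mem_Icc_of_sq_le (by nlinarith)) v.imJ (mem_Icc_of_sq_le (by nlinarith))
    v.imK (mem_Icc_of_sq_le (by nlinarith)) w.imI (mem_Icc_of_sq_le (by nlinarith))
    w.imJ (mem_Icc_of_sq_le (by nlinarith)) w.imK (mem_Icc_of_sq_le (by nlinarith))
    (by simpa using hv1) (by simpa using hw1) with ⟨h0, h1, h2⟩ | ⟨h0, h1, h2⟩ | h0
  · left; ext <;> simp [*]
  · right; left; ext <;> simp [*]
  · right; right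
    rw [← hN] at h0
    have h1 : oddNorm p ∣ 32 * 3 := by exact_mod_cast h.trans h0
    exact ((odd_oddNorm hp.ne_zero).coprime_two_right.pow_right 5).dvd_of_dvd_mul_left h1

/-! ### Exceptional quaternions -/

theorem quatEquiv_one_iff {p : ℍ[ℤ]} (hp : IsPrimitive p) :
    QuatEquiv p (quat 1 0 0 0) ↔ oddNorm p = 1 := by
  have h1 : (quat 1 0 0 0 : ℍ[ℤ]) = 1 := rfl
  have hc : IsCubic (1 : ℍ[ℤ]) :=
    isCubic_iff.mpr ⟨fun d h _ _ _ => isUnit_of_dvd_one (by simpa using h), by simp⟩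
  rw [h1, quatEquiv_iff hp hc.1]
  constructor
  · rintro ⟨s, s', k, hs, hs', hk, e⟩
    rw [oddNorm_eq_of_mul_mul_eq hp hs hs' hk e, hc.2]
  · intro h
    refine ⟨star p, 1, (Quaternion.normSq p : ℤ).natAbs, ⟨hp.star, by rwa [oddNorm_star]⟩, hc,
      by simpa using hp.ne_zero, ?_⟩
    rw [mul_one, mul_one, star_mul_self_eq, ← Int.cast_natCast,
      Int.natAbs_of_nonneg Quaternion.normSq_nonneg]

/-- A finite check: the units ±1, ±i, ±j, ±k, acting from both sides, carry every quaternion of norm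
3 to (0,1,1,1). -/
theorem exists_units_coordinates : ∀ a ∈ Finset.Icc (-1 : ℤ) 1, ∀ b ∈ Finset.Icc (-1 : ℤ) 1,
    ∀ c ∈ Finset.Icc (-1 : ℤ) 1, ∀ d ∈ Finset.Icc (-1 : ℤ) 1, a ^ 2 + b ^ 2 + c ^ 2 + d ^ 2 = 3 →
    ∃ s : Fin 4, ∃ t : Fin 4, ∃ e : Fin 2,
      let x := (-1) ^ (e : ℕ) * (unitQuat s * quat a b c d * unitQuat t)
      x.re = 0 ∧ x.imI = 1 ∧ x.imJ = 1 ∧ x.imK = 1 := by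
  decide +kernel

theorem isCubic_one : IsCubic 1 :=
  isCubic_iff.mpr ⟨fun d h _ _ _ => isUnit_of_dvd_one (by simpa using h), by simp⟩

theorem isCubic_unitQuat (i : Fin 4) : IsCubic (unitQuat i) := by
  fin_cases i
  · exact isCubic_quat (by decide) (by decide) (by decide) (by decide) (by norm_num)
  · exact isCubic_quat (by decide) (by decide) (by decide) (by decide) (by norm_num)
  · exact isCubic_quat (by decide) (by decide) (by decide) (by decide) (by norm_num)
  · exact isCubic_quat (by decide) (by decide) (by decide) (by decide) (by norm_num)

theorem IsCubic.neg {s : ℍ[ℤ]} (h : IsCubic s) : IsCubic (-s) :=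
  ⟨h.1.neg, by rw [oddNorm_neg, h.2]⟩

theorem isPrimitive_of_imI_eq_one {q : ℍ[ℤ]} (h : q.imI = 1) : IsPrimitive q :=
  fun _ _ hd _ _ => isUnit_of_dvd_one (h ▸ hd)

/-- The product of two cubic quaternions is a multiple of a cubic one. -/
theorem IsCubic.exists_mul {s t : ℍ[ℤ]} (hs : IsCubic s) (ht : IsCubic t) :
    ∃ (k : ℕ) (r : ℍ[ℤ]), k ≠ 0 ∧ IsCubic r ∧ s * t = (k : ℍ[ℤ]) * r := by
  obtain ⟨k, r, hk, hr, e⟩ := exists_eq_mul_isPrimitive (mul_ne_zero hs.ne_zero ht.ne_zero)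
  refine ⟨k, r, hk, ⟨hr, ?_⟩, e⟩
  have h := congrArg oddNorm e
  rw [oddNorm_mul, hs.2, ht.2, oddNorm_natCast_mul] at h
  exact Nat.eq_one_of_mul_eq_one_left h.symm

theorem coordinates_mem_of_normSq_le {p : ℍ[ℤ]} (h : (Quaternion.normSq p : ℤ) ≤ 3) :
    p.re ∈ Finset.Icc (-1 : ℤ) 1 ∧ p.imI ∈ Finset.Icc (-1 : ℤ) 1 ∧
      p.imJ ∈ Finset.Icc (-1 : ℤ) 1 ∧ p.imK ∈ Finset.Icc (-1 : ℤ) 1 := by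
  rw [Quaternion.normSq_def'] at h
  exact ⟨mem_Icc_of_sq_le (by nlinarith), mem_Icc_of_sq_le (by nlinarith),
    mem_Icc_of_sq_le (by nlinarith), mem_Icc_of_sq_le (by nlinarith)⟩

theorem quatEquiv_zero_one_one_one_iff {p : ℍ[ℤ]} (hp : IsPrimitive p) :
    QuatEquiv p (quat 0 1 1 1) ↔ oddNorm p = 3 := by
  have hw : IsPrimitive (quat 0 1 1 1 : ℍ[ℤ]) := isPrimitive_of_imI_eq_one rfl
  constructor
  · intro h
    obtain ⟨s, s', k, hs, hs', hk, e⟩ := (quatEquiv_iff hp hw).mp h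
    rw [oddNorm_eq_of_mul_mul_eq hp hs hs' hk e]
    exact oddNorm_eq (k := 0) (by decide) (by rw [Quaternion.normSq_def']; simp)
  · intro h
    obtain ⟨p', u, hp', hN, hu, e⟩ := exists_odd_representative hp
    rw [h] at hN
    obtain ⟨ha, hb, hc, hd⟩ := coordinates_mem_of_normSq_le (p := p') (by rw [hN]; norm_num)
    have hN' := hN
    rw [Quaternion.normSq_def'] at hN'
    obtain ⟨s, t, i, h0, h1, h2, h3⟩ := exists_units_coordinates _ ha _ hb _ hc _ hd
      (by exact_mod_cast hN')
    obtain ⟨k, r, hk, hr, hur⟩ := hu.star.exists_mul (isCubic_unitQuat t)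
    -- As p = p'u, the odd representative p' is proportional to pū with a positive factor, so the
    -- cubic quaternion ū can be absorbed into the right factor of the equivalence.
    have hp'' : normalize p' = normalize (p * star u) := by
      rw [← e, mul_assoc, Quaternion.self_mul_star]
      have h5 := (normSq_pos hu.ne_zero).le
      have h4 : p' * (Int.cast (Quaternion.normSq u : ℤ) : ℍ[ℤ]) =
          (((Quaternion.normSq u : ℤ).natAbs : ℕ) : ℍ[ℤ]) * p' := by
        rw [← (Int.cast_commute _ p').eq, ← Int.cast_natCast, Int.natAbs_of_nonneg h5]
      exact (h4 ▸ normalize_natCast_mul (by simpa using hu.ne_zero) p').symm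
    have key : ∀ s' : ℍ[ℤ], IsCubic s' → s' * p' * unitQuat t = quat 0 1 1 1 →
        QuatEquiv p (quat 0 1 1 1) := by
      intro s' hs' e'
      rw [isCubic_iff] at hs' hr
      refine ⟨_, ⟨s', hs'.1, hs'.2, rfl⟩, _, ⟨r, hr.1, hr.2, rfl⟩, ?_⟩
      rw [← e', normalize_mul, normalize_mul, hp'', normalize_mul, ← normalize_natCast_mul hk r,
        ← hur, normalize_mul]
      simp only [mul_assoc]
    have hpq : quat p'.re p'.imI p'.imJ p'.imK = p' := rfl
    rw [hpq] at h0 h1 h2 h3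
    have hx : (-1) ^ (i : ℕ) * (unitQuat s * p' * unitQuat t) = quat 0 1 1 1 := by
      ext
      exacts [h0, h1, h2, h3]
    fin_cases i
    · exact key _ (isCubic_unitQuat s) (by simpa using hx)
    · exact key _ (isCubic_unitQuat s).neg (by simpa using hx)

/-! ### Types -/

theorem hasAxis_congr {p q : ℍ[ℤ]} (hp : IsPrimitive p) (hq : IsPrimitive q)
    (h : rightIdeal p = rightIdeal q) (d : ℕ) : HasAxis d p ↔ HasAxis d q := by
  unfold HasAxis
  simp only [mul_mem_rightIdeal_congr hp hq (oddNorm_eq_of_rightIdeal_eq hp hq h) h]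

theorem isExceptional_iff {p : ℍ[ℤ]} (hp : IsPrimitive p) :
    IsExceptional p ↔ oddNorm p = 1 ∨ oddNorm p = 3 :=
  or_congr (quatEquiv_one_iff hp) (quatEquiv_zero_one_one_one_iff hp)

theorem hasType_zero_iff {p : ℍ[ℤ]} (hp : IsPrimitive p) : HasType 0 p ↔ oddNorm p = 1 :=
  quatEquiv_one_iff hp

theorem hasType_one_iff {p : ℍ[ℤ]} (hp : IsPrimitive p) : HasType 1 p ↔ oddNorm p = 3 :=
  quatEquiv_zero_one_one_one_iff hp

theorem hasType_two_iff {p : ℍ[ℤ]} (hp : IsPrimitive p) :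
    HasType 2 p ↔ HasAxis 3 p ∧ ¬ (oddNorm p = 1 ∨ oddNorm p = 3) :=
  and_congr (equivMNNN_iff hp) (not_congr (isExceptional_iff hp))

theorem hasType_three_iff {p : ℍ[ℤ]} (hp : IsPrimitive p) :
    HasType 3 p ↔ HasAxis 1 p ∧ ¬ (oddNorm p = 1 ∨ oddNorm p = 3) :=
  and_congr (equivMN00_iff hp) (not_congr (isExceptional_iff hp))

theorem hasType_four_iff {p : ℍ[ℤ]} (hp : IsPrimitive p) :
    HasType 4 p ↔ HasAxis 2 p ∧ ¬ (oddNorm p = 1 ∨ oddNorm p = 3) :=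
  and_congr (equivMNN0_iff hp) (not_congr (isExceptional_iff hp))

theorem hasType_five_iff {p : ℍ[ℤ]} (hp : IsPrimitive p) :
    HasType 5 p ↔ ¬ (oddNorm p = 1 ∨ oddNorm p = 3) ∧ ¬ HasAxis 3 p ∧ ¬ HasAxis 1 p ∧
      ¬ HasAxis 2 p :=
  and_congr (not_congr (isExceptional_iff hp)) (and_congr (not_congr (equivMNNN_iff hp))
    (and_congr (not_congr (equivMN00_iff hp)) (not_congr (equivMNN0_iff hp))))

theorem hasType_congr {p q : ℍ[ℤ]} (hp : IsPrimitive p) (hq : IsPrimitive q)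
    (h : rightIdeal p = rightIdeal q) (i : Fin 6) : HasType i p ↔ HasType i q := by
  have hN := oddNorm_eq_of_rightIdeal_eq hp hq h
  have hA := hasAxis_congr hp hq h
  fin_cases i
  · exact (hasType_zero_iff hp).trans (by rw [hN]; exact (hasType_zero_iff hq).symm)
  · exact (hasType_one_iff hp).trans (by rw [hN]; exact (hasType_one_iff hq).symm)
  · exact (hasType_two_iff hp).trans (by rw [hN, hA]; exact (hasType_two_iff hq).symm)
  · exact (hasType_three_iff hp).trans (by rw [hN, hA]; exact (hasType_three_iff hq).symm)
  · exact (hasType_four_iff hp).trans (by rw [hN, hA]; exact (hasType_four_iff hq).symm)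
  · exact (hasType_five_iff hp).trans
      (by rw [hN, hA, hA, hA]; exact (hasType_five_iff hq).symm)

theorem exists_hasType (p : ℍ[ℤ]) : ∃ i, HasType i p := by
  by_cases h0 : QuatEquiv p ⟨1, 0, 0, 0⟩
  · exact ⟨0, h0⟩
  by_cases h1 : QuatEquiv p ⟨0, 1, 1, 1⟩
  · exact ⟨1, h1⟩
  have h : ¬ IsExceptional p := not_or_intro h0 h1
  by_cases h2 : EquivMNNN p
  · exact ⟨2, h2, h⟩
  by_cases h3 : EquivMN00 p
  · exact ⟨3, h3, h⟩
  by_cases h4 : EquivMNN0 p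
  · exact ⟨4, h4, h⟩
  · exact ⟨5, h, h2, h3, h4⟩

theorem HasAxis.unique {p : ℍ[ℤ]} {d e : ℕ} (hp : IsPrimitive p) (hd : d = 1 ∨ d = 2 ∨ d = 3)
    (he : e = 1 ∨ e = 2 ∨ e = 3) (h : HasAxis d p) (h' : HasAxis e p)
    (hN : ¬ (oddNorm p = 1 ∨ oddNorm p = 3)) : d = e := by
  obtain ⟨v, hv, hvd, hvp⟩ := h
  obtain ⟨w, hw, hwd, hwp⟩ := h'
  have hv0 : v ≠ 0 := by rintro rfl; simp at hvd; omega
  have hw0 : w ≠ 0 := by rintro rfl; simp at hwd; omega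
  rcases eq_or_eq_neg_or_oddNorm_dvd hp hv hw hv0 hw0 (by omega) (by omega) hvp hwp with
    rfl | rfl | h3
  · omega
  · rw [Quaternion.normSq_neg] at hwd; omega
  · exact absurd ((Nat.dvd_prime Nat.prime_three).mp h3) hN

theorem hasType_unique {p : ℍ[ℤ]} (hp : IsPrimitive p) {i j : Fin 6} (hi : HasType i p)
    (hj : HasType j p) : i = j := by
  have h0 := hasType_zero_iff hp
  have h1 := hasType_one_iff hp
  have h2 := hasType_two_iff hp
  have h3 := hasType_three_iff hp
  have h4 := hasType_four_iff hp
  have h5 := hasType_five_iff hp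
  have u12 := HasAxis.unique (d := 1) (e := 2) hp (by omega) (by omega)
  have u13 := HasAxis.unique (d := 1) (e := 3) hp (by omega) (by omega)
  have u23 := HasAxis.unique (d := 2) (e := 3) hp (by omega) (by omega)
  fin_cases i <;> fin_cases j <;> first
    | rfl
    | (exfalso
       simp only [Fin.zero_eta, Fin.mk_one, Fin.reduceFinMk] at hi hj
       simp only [h0, h1, h2, h3, h4, h5] at hi hj
       clear h0 h1 h2 h3 h4 h5
       first
         | omega
         | tauto)

/-! ### Stabilizers in the cubic group -/

/-- The coordinates of the primitive representatives of the cubic group. -/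
noncomputable def cubicBox : Finset (ℤ × ℤ × ℤ × ℤ) :=
  (Finset.Icc (-1) 1 ×ˢ Finset.Icc (-1) 1 ×ˢ Finset.Icc (-1) 1 ×ˢ Finset.Icc (-1) 1).filter
    fun t => t.1 ^ 2 + t.2.1 ^ 2 + t.2.2.1 ^ 2 + t.2.2.2 ^ 2 ∈ ({1, 2, 4} : Finset ℤ)

theorem IsCubic.coordinates_mem {s : ℍ[ℤ]} (hs : IsCubic s) :
    s.re ∈ Finset.Icc (-1 : ℤ) 1 ∧ s.imI ∈ Finset.Icc (-1 : ℤ) 1 ∧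
      s.imJ ∈ Finset.Icc (-1 : ℤ) 1 ∧ s.imK ∈ Finset.Icc (-1 : ℤ) 1 := by
  obtain ⟨hp, h | h | h⟩ := isCubic_iff.mp hs
  · exact coordinates_mem_of_normSq_le (by rw [h]; norm_num)
  · exact coordinates_mem_of_normSq_le (by rw [h]; norm_num)
  · rw [Quaternion.normSq_def'] at h
    obtain ⟨t0, e0⟩ := exists_sq_eq_four_mul_add s.re
    obtain ⟨t1, e1⟩ := exists_sq_eq_four_mul_add s.imI
    obtain ⟨t2, e2⟩ := exists_sq_eq_four_mul_add s.imJ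
    obtain ⟨t3, e3⟩ := exists_sq_eq_four_mul_add s.imK
    -- Norm 4 leaves the number of odd coordinates at 0 or 4, and primitivity excludes 0.
    have hall : s.re % 2 = 1 ∧ s.imI % 2 = 1 ∧ s.imJ % 2 = 1 ∧ s.imK % 2 = 1 := by
      by_contra hcon
      have : s.re % 2 = 0 ∧ s.imI % 2 = 0 ∧ s.imJ % 2 = 0 ∧ s.imK % 2 = 0 := by omega
      have := hp 2 (by omega) (by omega) (by omega) (by omega)
      exact absurd this (by decide)
    have key : ∀ x : ℤ, x % 2 = 1 → 1 ≤ x ^ 2 := fun x hx => by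
      have : x ≠ 0 := by rintro rfl; simp at hx
      have := pow_pos (abs_pos.mpr this) 2
      rw [sq_abs] at this
      exact this
    have k0 := key _ hall.1
    have k1 := key _ hall.2.1
    have k2 := key _ hall.2.2.1
    have k3 := key _ hall.2.2.2
    exact ⟨mem_Icc_of_sq_le (by linarith), mem_Icc_of_sq_le (by linarith),
      mem_Icc_of_sq_le (by linarith), mem_Icc_of_sq_le (by linarith)⟩

/-- Transfers a count of cubic quaternions to a filter on an explicit finite set of coordinates,
where it can be decided. -/
theorem ncard_setOf_isCubic_and {Q : ℍ[ℤ] → Prop} (P : ℤ × ℤ × ℤ × ℤ → Prop) [DecidablePred P]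
    (h : ∀ a b c d, IsCubic (quat a b c d) → (Q (quat a b c d) ↔ P (a, b, c, d))) :
    {s | IsCubic s ∧ Q s}.ncard = (cubicBox.filter P).card := by
  have hinj : Function.Injective
      (fun t : ℤ × ℤ × ℤ × ℤ => (quat t.1 t.2.1 t.2.2.1 t.2.2.2 : ℍ[ℤ])) := by
    rintro ⟨a, b, c, d⟩ ⟨a', b', c', d'⟩ e
    have e0 := congrArg QuaternionAlgebra.re e
    have e1 := congrArg QuaternionAlgebra.imI e
    have e2 := congrArg QuaternionAlgebra.imJ e
    have e3 := congrArg QuaternionAlgebra.imK e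
    simp at e0 e1 e2 e3
    simp [*]
  rw [← Set.ncard_coe_finset, ← Set.ncard_image_of_injective _ hinj]
  congr 1
  ext s
  simp only [Set.mem_ofPred_eq, Set.mem_image, Finset.mem_coe, Finset.mem_filter, cubicBox,
    Finset.mem_product, Prod.exists]
  constructor
  · rintro ⟨hs, hQ⟩
    obtain ⟨h0, h1, h2, h3⟩ := hs.coordinates_mem
    refine ⟨s.re, s.imI, s.imJ, s.imK, ⟨⟨⟨h0, h1, h2, h3⟩, ?_⟩, ?_⟩, rfl⟩
    · have := (isCubic_iff.mp hs).2
      rw [Quaternion.normSq_def'] at this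
      simpa using this
    · exact (h _ _ _ _ hs).mp hQ
  · rintro ⟨a, b, c, d, ⟨⟨⟨h0, h1, h2, h3⟩, hN⟩, hP⟩, rfl⟩
    have hs := isCubic_quat h0 h1 h2 h3 (by simpa using hN)
    exact ⟨hs, (h _ _ _ _ hs).mpr hP⟩

/-- The even elements of the cubic group that stabilize the class of `p`. -/
def stabEven (p : ℍ[ℤ]) : Set ℍ[ℤ] :=
  {s | IsCubic s ∧ Quaternion.normSq s ≠ (2 : ℤ) ∧ s * p ∈ rightIdeal p}

/-- The odd elements of the cubic group that stabilize the class of `p`. -/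
def stabOdd (p : ℍ[ℤ]) : Set ℍ[ℤ] :=
  {s | IsCubic s ∧ Quaternion.normSq s = (2 : ℤ) ∧ s * p ∈ rightIdeal p}

theorem normSq_quat (a b c d : ℤ) :
    (Quaternion.normSq (quat a b c d) : ℤ) = a ^ 2 + b ^ 2 + c ^ 2 + d ^ 2 :=
  Quaternion.normSq_def' _

theorem card_cubicBox_even :
    (cubicBox.filter fun t => t.1 ^ 2 + t.2.1 ^ 2 + t.2.2.1 ^ 2 + t.2.2.2 ^ 2 ≠ 2).card = 24 := by
  decide +kernel

theorem card_cubicBox_odd :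
    (cubicBox.filter fun t => t.1 ^ 2 + t.2.1 ^ 2 + t.2.2.1 ^ 2 + t.2.2.2 ^ 2 = 2).card = 24 := by
  decide +kernel

theorem ncard_stabEven_of_forall_mem {p : ℍ[ℤ]} (h : ∀ s : ℍ[ℤ], s * p ∈ rightIdeal p) :
    (stabEven p).ncard = 24 := by
  rw [← card_cubicBox_even]
  exact ncard_setOf_isCubic_and _ fun a b c d _ => by
    rw [normSq_quat]
    exact and_iff_left (h _)

theorem ncard_stabOdd_of_forall_mem {p : ℍ[ℤ]} (h : ∀ s : ℍ[ℤ], s * p ∈ rightIdeal p) :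
    (stabOdd p).ncard = 24 := by
  rw [← card_cubicBox_odd]
  exact ncard_setOf_isCubic_and _ fun a b c d _ => by
    rw [normSq_quat]
    exact and_iff_left (h _)

/-- The condition `3 ∣ p̄ s p` in coordinates. -/
def StabThree (p s : ℤ × ℤ × ℤ × ℤ) : Prop :=
  let x := star (quat p.1 p.2.1 p.2.2.1 p.2.2.2) *
    (quat s.1 s.2.1 s.2.2.1 s.2.2.2 * quat p.1 p.2.1 p.2.2.1 p.2.2.2)
  (3 : ℤ) ∣ x.re ∧ (3 : ℤ) ∣ x.imI ∧ (3 : ℤ) ∣ x.imJ ∧ (3 : ℤ) ∣ x.imK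

instance (p s : ℤ × ℤ × ℤ × ℤ) : Decidable (StabThree p s) :=
  inferInstanceAs (Decidable (_ ∧ _ ∧ _ ∧ _))

theorem card_cubicBox_stabThree : ∀ a ∈ Finset.Icc (-1 : ℤ) 1, ∀ b ∈ Finset.Icc (-1 : ℤ) 1,
    ∀ c ∈ Finset.Icc (-1 : ℤ) 1, ∀ d ∈ Finset.Icc (-1 : ℤ) 1, a ^ 2 + b ^ 2 + c ^ 2 + d ^ 2 = 3 →
    (cubicBox.filter fun t => t.1 ^ 2 + t.2.1 ^ 2 + t.2.2.1 ^ 2 + t.2.2.2 ^ 2 ≠ 2 ∧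
      StabThree (a, b, c, d) t).card = 6 ∧
    (cubicBox.filter fun t => t.1 ^ 2 + t.2.1 ^ 2 + t.2.2.1 ^ 2 + t.2.2.2 ^ 2 = 2 ∧
      StabThree (a, b, c, d) t).card = 6 := by
  decide +kernel

theorem ncard_stab_of_oddNorm_eq_three {p : ℍ[ℤ]} (hp : IsPrimitive p) (h : oddNorm p = 3) :
    (stabEven p).ncard = 6 ∧ (stabOdd p).ncard = 6 := by
  obtain ⟨q, u, hq, hN, hu, e⟩ := exists_odd_representative hp
  have hI := rightIdeal_eq_of_mul_eq hq hp hu e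
  have hon : oddNorm q = oddNorm p := by rw [← e, oddNorm_mul, hu.2, mul_one]
  rw [h] at hN
  obtain ⟨ha, hb, hc, hd⟩ := coordinates_mem_of_normSq_le (p := q) (by rw [hN]; norm_num)
  have hN' := hN
  rw [Quaternion.normSq_def'] at hN'
  have key : ∀ a b c d, (quat a b c d * p ∈ rightIdeal p ↔
      StabThree (q.re, q.imI, q.imJ, q.imK) (a, b, c, d)) := by
    intro a b c d
    rw [← mul_mem_rightIdeal_congr hq hp hon hI, rightIdeal, Set.mem_ofPred_eq, hon, h,
      natCast_dvd_iff]
    rfl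
  obtain ⟨h1, h2⟩ := card_cubicBox_stabThree _ ha _ hb _ hc _ hd (by exact_mod_cast hN')
  constructor
  · rw [← h1]
    exact ncard_setOf_isCubic_and _ fun a b c d _ => by rw [normSq_quat, key]
  · rw [← h2]
    exact ncard_setOf_isCubic_and _ fun a b c d _ => by rw [normSq_quat, key]

/-- The real part of s contributes an integer multiple of p̄p, which the odd norm divides. Only the
imaginary part matters. -/
theorem mul_mem_rightIdeal_iff_im (s p : ℍ[ℤ]) :
    s * p ∈ rightIdeal p ↔ quat 0 s.imI s.imJ s.imK * p ∈ rightIdeal p := by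
  obtain ⟨n, hs⟩ : ∃ n : ℤ, s = (n : ℍ[ℤ]) + quat 0 s.imI s.imJ s.imK :=
    ⟨s.re, by ext <;> simp⟩
  rw [rightIdeal, Set.mem_ofPred_eq, Set.mem_ofPred_eq]
  nth_rw 1 [hs]
  rw [add_mul, mul_add]
  refine dvd_add_right ?_
  rw [(Int.cast_commute n p).eq, ← mul_assoc, star_mul_self_eq, ← Int.cast_natCast]
  obtain ⟨k, hk⟩ := oddNorm_dvd p
  rw [hk, Int.cast_mul, mul_assoc]
  exact dvd_mul_right _ _

/-- The two tables are indexed by the squared length of the axis v, with 0 for no axis. Always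
present are ±1. Length 1 adds ±v (even) and ±1 ± v (odd); length 2 adds ±v (odd); length 3 adds ±1 ±
v of norm 4 (even). -/
theorem card_cubicBox_axis : ∀ a ∈ Finset.Icc (-1 : ℤ) 1, ∀ b ∈ Finset.Icc (-1 : ℤ) 1,
    ∀ c ∈ Finset.Icc (-1 : ℤ) 1,
    (cubicBox.filter fun t => t.1 ^ 2 + t.2.1 ^ 2 + t.2.2.1 ^ 2 + t.2.2.2 ^ 2 ≠ 2 ∧
      (t.2 = (0, 0, 0) ∨ t.2 = (a, b, c) ∨ t.2 = (-a, -b, -c))).card =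
      ![2, 4, 2, 6] (Fin.ofNat 4 (a ^ 2 + b ^ 2 + c ^ 2).toNat) ∧
    (cubicBox.filter fun t => t.1 ^ 2 + t.2.1 ^ 2 + t.2.2.1 ^ 2 + t.2.2.2 ^ 2 = 2 ∧
      (t.2 = (0, 0, 0) ∨ t.2 = (a, b, c) ∨ t.2 = (-a, -b, -c))).card =
      ![0, 4, 2, 0] (Fin.ofNat 4 (a ^ 2 + b ^ 2 + c ^ 2).toNat) := by
  decide +kernel

/-- If all axes of `p` are equal to `±v`, the stabilizers depend on the length of `v` only. -/
theorem ncard_stab_of_axes {p v : ℍ[ℤ]} {d : ℕ} (hv : v.re = 0)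
    (hd : (Quaternion.normSq v : ℤ) = d) (hd3 : d ≤ 3) (hvp : v * p ∈ rightIdeal p)
    (h : ∀ w : ℍ[ℤ], w.re = 0 → w ≠ 0 → (Quaternion.normSq w : ℤ) ≤ 3 → w * p ∈ rightIdeal p →
      w = v ∨ w = -v) :
    (stabEven p).ncard = ![2, 4, 2, 6] (Fin.ofNat 4 d) ∧
      (stabOdd p).ncard = ![0, 4, 2, 0] (Fin.ofNat 4 d) := by
  obtain ⟨-, hb, hc, hd'⟩ := coordinates_mem_of_normSq_le (p := v)
    (by rw [hd]; exact_mod_cast hd3)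
  have hd'' : (v.imI ^ 2 + v.imJ ^ 2 + v.imK ^ 2).toNat = d := by
    have := hd
    rw [Quaternion.normSq_def', hv] at this
    have h2 : v.imI ^ 2 + v.imJ ^ 2 + v.imK ^ 2 = d := by linarith
    rw [h2, Int.toNat_natCast]
  have key : ∀ a b c e, IsCubic (quat a b c e) → (quat a b c e * p ∈ rightIdeal p ↔
      ((b, c, e) = (0, 0, 0) ∨ (b, c, e) = (v.imI, v.imJ, v.imK) ∨
        (b, c, e) = (-v.imI, -v.imJ, -v.imK))) := by
    intro a b c e hs
    rw [mul_mem_rightIdeal_iff_im]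
    simp only [quat_imI, quat_imJ, quat_imK, Prod.mk.injEq]
    constructor
    · intro hm
      by_cases h0 : (quat 0 b c e : ℍ[ℤ]) = 0
      · have e1 := congrArg QuaternionAlgebra.imI h0
        have e2 := congrArg QuaternionAlgebra.imJ h0
        have e3 := congrArg QuaternionAlgebra.imK h0
        simp at e1 e2 e3
        exact Or.inl ⟨e1, e2, e3⟩
      · obtain ⟨-, h1, h2, h3⟩ := hs.coordinates_mem
        simp only [quat_imI, quat_imJ, quat_imK, Finset.mem_Icc] at h1 h2 h3
        rcases h (quat 0 b c e) rfl h0 (by rw [normSq_quat]; nlinarith) hm with h4 | h4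
        · have e1 := congrArg QuaternionAlgebra.imI h4
          have e2 := congrArg QuaternionAlgebra.imJ h4
          have e3 := congrArg QuaternionAlgebra.imK h4
          simp at e1 e2 e3
          exact Or.inr (Or.inl ⟨e1, e2, e3⟩)
        · have e1 := congrArg QuaternionAlgebra.imI h4
          have e2 := congrArg QuaternionAlgebra.imJ h4
          have e3 := congrArg QuaternionAlgebra.imK h4
          simp at e1 e2 e3
          exact Or.inr (Or.inr ⟨e1, e2, e3⟩)
    · have hpos : quat 0 v.imI v.imJ v.imK = v := by ext <;> simp [hv]
      have hneg : quat 0 (-v.imI) (-v.imJ) (-v.imK) = -v := by ext <;> simp [hv]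
      rintro (⟨rfl, rfl, rfl⟩ | ⟨rfl, rfl, rfl⟩ | ⟨rfl, rfl, rfl⟩)
      · have : (quat 0 0 0 0 : ℍ[ℤ]) = 0 := rfl
        rw [this, zero_mul, rightIdeal, Set.mem_ofPred_eq, mul_zero]
        exact dvd_zero _
      · rwa [hpos]
      · rw [hneg, rightIdeal, Set.mem_ofPred_eq, neg_mul, mul_neg, dvd_neg]
        exact hvp
  obtain ⟨h1, h2⟩ := card_cubicBox_axis _ hb _ hc _ hd'
  rw [hd''] at h1 h2
  constructor
  · rw [← h1]
    exact ncard_setOf_isCubic_and _ fun a b c d hs => by rw [normSq_quat, key a b c d hs]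
  · rw [← h2]
    exact ncard_setOf_isCubic_and _ fun a b c d hs => by rw [normSq_quat, key a b c d hs]

theorem ncard_stab {p : ℍ[ℤ]} (hp : IsPrimitive p) {i : Fin 6} (hi : HasType i p) :
    (stabEven p).ncard = ![24, 6, 6, 4, 2, 2] i ∧ (stabOdd p).ncard = ![24, 6, 0, 4, 2, 0] i := by
  have haxis : ∀ d : ℕ, d = 1 ∨ d = 2 ∨ d = 3 → HasAxis d p → ¬ (oddNorm p = 1 ∨ oddNorm p = 3) →
      (stabEven p).ncard = ![2, 4, 2, 6] (Fin.ofNat 4 d) ∧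
      (stabOdd p).ncard = ![0, 4, 2, 0] (Fin.ofNat 4 d) := by
    rintro d hd ⟨v, hv, hvd, hvp⟩ hN
    have hv0 : v ≠ 0 := by rintro rfl; simp at hvd; omega
    refine ncard_stab_of_axes hv hvd (by omega) hvp fun w hw hw0 hw3 hwp => ?_
    rcases eq_or_eq_neg_or_oddNorm_dvd hp hv hw hv0 hw0 (by omega) hw3 hvp hwp with h | h | h3
    · exact Or.inl h
    · exact Or.inr h
    · exact absurd ((Nat.dvd_prime Nat.prime_three).mp h3) hN
  fin_cases i
  · have h := (hasType_zero_iff hp).mp hi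
    have hone : ∀ s : ℍ[ℤ], s * p ∈ rightIdeal p := fun s => by
      rw [rightIdeal, Set.mem_ofPred_eq, h, Nat.cast_one]
      exact one_dvd _
    exact ⟨ncard_stabEven_of_forall_mem hone, ncard_stabOdd_of_forall_mem hone⟩
  · exact ncard_stab_of_oddNorm_eq_three hp ((hasType_one_iff hp).mp hi)
  · have h := (hasType_two_iff hp).mp hi
    exact haxis 3 (by omega) h.1 h.2
  · have h := (hasType_three_iff hp).mp hi
    exact haxis 1 (by omega) h.1 h.2
  · have h := (hasType_four_iff hp).mp hi
    exact haxis 2 (by omega) h.1 h.2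
  · obtain ⟨hN, h3, h1, h2⟩ := (hasType_five_iff hp).mp hi
    -- Without an axis the count is run with v = 0, and only ±1 stabilize the class.
    refine ncard_stab_of_axes (v := 0) (d := 0) (by simp) (by simp) (by norm_num) (by
      rw [zero_mul, rightIdeal, Set.mem_ofPred_eq, mul_zero]; exact dvd_zero _)
      fun w hw hw0 hw3 hwp => ?_
    exfalso
    have := normSq_pos hw0
    have : (Quaternion.normSq w : ℤ) = 1 ∨ (Quaternion.normSq w : ℤ) = 2 ∨
      (Quaternion.normSq w : ℤ) = 3 := by omega
    rcases this with h | h | h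
    · exact h1 ⟨w, hw, h, hwp⟩
    · exact h2 ⟨w, hw, h, hwp⟩
    · exact h3 ⟨w, hw, h, hwp⟩

/-! ### Sizes of the double cosets -/

theorem finite_setOf_isCubic : {s : ℍ[ℤ] | IsCubic s}.Finite := by
  have h := ncard_setOf_isCubic_and (Q := fun _ => True) (fun _ => True)
    fun _ _ _ _ _ => Iff.rfl
  simp only [and_true] at h
  refine Set.finite_of_ncard_ne_zero ?_
  rw [h]
  decide +kernel

/-- The pairs of cubic quaternions that stabilize the classes of `p` and `q`. -/
def stabPairs (p q : ℍ[ℤ]) : Set (ℍ[ℤ] × ℍ[ℤ]) :=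
  stabEven p ×ˢ stabEven q ∪ stabOdd p ×ˢ stabOdd q

theorem finite_stabEven (p : ℍ[ℤ]) : (stabEven p).Finite :=
  finite_setOf_isCubic.subset fun _ h => h.1

theorem finite_stabOdd (p : ℍ[ℤ]) : (stabOdd p).Finite :=
  finite_setOf_isCubic.subset fun _ h => h.1

theorem finite_stabPairs (p q : ℍ[ℤ]) : (stabPairs p q).Finite :=
  ((finite_stabEven p).prod (finite_stabEven q)).union ((finite_stabOdd p).prod (finite_stabOdd q))

theorem ncard_stabPairs (p q : ℍ[ℤ]) : (stabPairs p q).ncard =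
    (stabEven p).ncard * (stabEven q).ncard + (stabOdd p).ncard * (stabOdd q).ncard := by
  rw [stabPairs, Set.ncard_union_eq ?_ ((finite_stabEven p).prod (finite_stabEven q))
    ((finite_stabOdd p).prod (finite_stabOdd q)), Set.ncard_prod, Set.ncard_prod]
  rw [Set.disjoint_left]
  rintro ⟨s, t⟩ h h'
  exact h.1.2.1 h'.1.2.1

/-- Cubic norms are 1, 2 and 4, so the product is a square exactly when both or neither equal 2.
This is the reason for separating even and odd stabilizers. -/
theorem isSquare_normSq_mul_iff {s t : ℍ[ℤ]} (hs : IsCubic s) (ht : IsCubic t) :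
    IsSquare (Quaternion.normSq (s * t) : ℤ) ↔
      (Quaternion.normSq s ≠ (2 : ℤ) ∧ Quaternion.normSq t ≠ (2 : ℤ)) ∨
      (Quaternion.normSq s = (2 : ℤ) ∧ Quaternion.normSq t = (2 : ℤ)) := by
  rw [map_mul]
  have s1 : IsSquare (1 : ℤ) := ⟨1, by norm_num⟩
  have s4 : IsSquare (4 : ℤ) := ⟨2, by norm_num⟩
  have s16 : IsSquare (16 : ℤ) := ⟨4, by norm_num⟩
  have s2 : ¬ IsSquare (2 : ℤ) := by decide +kernel
  have s8 : ¬ IsSquare (8 : ℤ) := by decide +kernel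
  rcases (isCubic_iff.mp hs).2 with h | h | h <;> rcases (isCubic_iff.mp ht).2 with h' | h' | h' <;>
    rw [h, h'] <;> norm_num [s1, s4, s16, s2, s8]

theorem mem_stabPairs_iff {p q s t : ℍ[ℤ]} : (s, t) ∈ stabPairs p q ↔ IsCubic s ∧ IsCubic t ∧
    IsSquare (Quaternion.normSq (s * t) : ℤ) ∧ s * p ∈ rightIdeal p ∧ t * q ∈ rightIdeal q := by
  constructor
  · rintro (⟨⟨hs, hs2, hsp⟩, ht, ht2, htq⟩ | ⟨⟨hs, hs2, hsp⟩, ht, ht2, htq⟩)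
    · exact ⟨hs, ht, (isSquare_normSq_mul_iff hs ht).mpr (Or.inl ⟨hs2, ht2⟩), hsp, htq⟩
    · exact ⟨hs, ht, (isSquare_normSq_mul_iff hs ht).mpr (Or.inr ⟨hs2, ht2⟩), hsp, htq⟩
  · rintro ⟨hs, ht, h, hsp, htq⟩
    rcases (isSquare_normSq_mul_iff hs ht).mp h with ⟨h1, h2⟩ | ⟨h1, h2⟩
    · exact Or.inl ⟨⟨hs, h1, hsp⟩, ht, h2, htq⟩
    · exact Or.inr ⟨⟨hs, h1, hsp⟩, ht, h2, htq⟩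

/-- The symmetry rotations that fix the class `R G_F`. -/
def cosetStab (R : SO4) : Set SO4 := {Q | Q ∈ GF ∧ R⁻¹ * Q * R ∈ GF}

theorem conj_mem_GF_iff {p q s t : ℍ[ℤ]} {R Q : SO4} (h : IsAdmissible p q)
    (hR : R.1 = rotMatrix p q) (hst : IsAdmissible s t) (hs : oddNorm s = 1) (ht : oddNorm t = 1)
    (hQ : Q.1 = rotMatrix s t) :
    R⁻¹ * Q * R ∈ GF ↔ s * p ∈ rightIdeal p ∧ t * q ∈ rightIdeal q := by
  have hp := h.1.ne_zero
  have hq := h.2.1.ne_zero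
  have hs0 := hst.1.ne_zero
  have ht0 := hst.2.1.ne_zero
  have e : (R⁻¹ * Q * R).1 = rotMatrix (star p * (s * p)) (star q * (t * q)) := by
    rw [← mul_assoc, ← mul_assoc, ← rotMatrix_mul, ← rotMatrix_mul, ← rotMatrix_transpose, ← hR,
      ← hQ]
    rfl
  rw [mem_GF_iff (mul_ne_zero (star_ne_zero.mpr hp) (mul_ne_zero hs0 hp))
    (mul_ne_zero (star_ne_zero.mpr hq) (mul_ne_zero ht0 hq)) e,
    isCubicMul_star_mul_iff hp (mul_ne_zero hs0 hp) (by rw [oddNorm_mul, hs, one_mul]),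
    isCubicMul_star_mul_iff hq (mul_ne_zero ht0 hq) (by rw [oddNorm_mul, ht, one_mul])]
  refine and_iff_right ?_
  have : (Quaternion.normSq (star p * (s * p) * (star q * (t * q))) : ℤ) =
      Quaternion.normSq (p * q) * Quaternion.normSq (p * q) * Quaternion.normSq (s * t) := by
    simp only [map_mul, Quaternion.normSq_star]; ring
  rw [this]
  exact (IsSquare.mul_self _).mul hst.2.2

theorem image_stabPairs {p q : ℍ[ℤ]} {R : SO4} (h : IsAdmissible p q) (hR : R.1 = rotMatrix p q) :
    (fun x : ℍ[ℤ] × ℍ[ℤ] => rotMatrix x.1 x.2) '' stabPairs p q =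
      Subtype.val '' cosetStab R := by
  ext A
  constructor
  · rintro ⟨⟨s, t⟩, hst, rfl⟩
    obtain ⟨hs, ht, hsq, hsp, htq⟩ := mem_stabPairs_iff.mp hst
    have hadm : IsAdmissible s t := ⟨hs.1, ht.1, hsq⟩
    refine ⟨rot hs.ne_zero ht.ne_zero, ⟨mem_GF_of_oddNorm_eq_one hadm hs.2 ht.2 rfl, ?_⟩, rfl⟩
    exact (conj_mem_GF_iff h hR hadm hs.2 ht.2 rfl).mpr ⟨hsp, htq⟩
  · rintro ⟨Q, ⟨hQ, hQR⟩, rfl⟩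
    obtain ⟨s, t, hadm, hs, ht, e⟩ := exists_of_mem_GF hQ
    refine ⟨(s, t), mem_stabPairs_iff.mpr ⟨⟨hadm.1, hs⟩, ⟨hadm.2.1, ht⟩, hadm.2.2, ?_⟩, e.symm⟩
    exact (conj_mem_GF_iff h hR hadm hs ht e).mp hQR

/-- The factor 2 reflects that (s,t) and (-s,-t) give the same rotation. -/
theorem ncard_stabPairs_eq {p q : ℍ[ℤ]} {R : SO4} (h : IsAdmissible p q)
    (hR : R.1 = rotMatrix p q) : (stabPairs p q).ncard = 2 * (cosetStab R).ncard := by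
  rw [← Set.ncard_image_of_injective _ Subtype.val_injective, ← image_stabPairs h hR]
  refine ncard_eq_mul_ncard_image (finite_stabPairs p q) ?_
  rintro ⟨s, t⟩ hst
  obtain ⟨hs, ht, hsq, hsp, htq⟩ := mem_stabPairs_iff.mp hst
  have : {v | v ∈ stabPairs p q ∧ rotMatrix v.1 v.2 = rotMatrix s t} = {(s, t), (-s, -t)} := by
    ext ⟨s', t'⟩
    simp only [Set.mem_ofPred_eq, Set.mem_insert_iff, Set.mem_singleton_iff, Prod.mk.injEq]
    constructor
    · rintro ⟨hst', e⟩
      obtain ⟨hs', ht', -⟩ := mem_stabPairs_iff.mp hst'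
      exact rotMatrix_injective hs.1 ht.1 hs'.1 ht'.1 e.symm
    · rintro (⟨rfl, rfl⟩ | ⟨rfl, rfl⟩)
      · exact ⟨hst, rfl⟩
      · refine ⟨mem_stabPairs_iff.mpr ⟨hs.neg, ht.neg, by rwa [neg_mul_neg], ?_, ?_⟩,
          rotMatrix_neg_neg s t⟩
        · rw [rightIdeal, Set.mem_ofPred_eq, neg_mul, mul_neg, dvd_neg]; exact hsp
        · rw [rightIdeal, Set.mem_ofPred_eq, neg_mul, mul_neg, dvd_neg]; exact htq
  rw [this, Set.ncard_pair]
  intro e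
  have e1 := congrArg Prod.fst e
  have := congrArg QuaternionAlgebra.re e1
  have h0 := congrArg QuaternionAlgebra.imI e1
  have h2 := congrArg QuaternionAlgebra.imJ e1
  have h3 := congrArg QuaternionAlgebra.imK e1
  simp only [Quaternion.re_neg, Quaternion.imI_neg, Quaternion.imJ_neg, Quaternion.imK_neg]
    at this h0 h2 h3
  apply hs.ne_zero
  ext <;> simp <;> omega

theorem isAdmissible_one : IsAdmissible 1 1 := ⟨isCubic_one.1, isCubic_one.1, by simp⟩

theorem rotMatrix_one : rotMatrix 1 1 = 1 := by
  have := rotMatrix_intCast (m := 1) (n := 1) (by norm_num)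
  simpa using this

theorem hasType_zero_one : HasType 0 1 := (hasType_zero_iff isCubic_one.1).mpr isCubic_one.2

theorem cosetStab_one : cosetStab 1 = (GF : Set SO4) := by
  ext Q
  simp [cosetStab]

/-- The stabilizer of the trivial class is everything: (24 · 24 + 24 · 24) / 2. -/
theorem ncard_GF : (GF : Set SO4).ncard = 576 := by
  have h := ncard_stabPairs_eq (R := 1) isAdmissible_one rotMatrix_one.symm
  have h' := ncard_stab isCubic_one.1 hasType_zero_one
  rw [cosetStab_one, ncard_stabPairs, h'.1, h'.2] at h
  simp at h
  omega

theorem finite_GF : (GF : Set SO4).Finite := Set.finite_of_ncard_ne_zero (by rw [ncard_GF]; simp)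

/-- The left cosets contained in the double coset of `R`. -/
def cosetOrbit (R : SO4) : Set (SO4 ⧸ GF) := (fun Q : SO4 => ((Q * R : SO4) : SO4 ⧸ GF)) '' GF

theorem finite_cosetOrbit (R : SO4) : (cosetOrbit R).Finite := finite_GF.image _

/-- Orbit–stabilizer for the action of G_F on its left cosets. -/
theorem ncard_cosetStab_mul (R : SO4) :
    576 = (cosetStab R).ncard * (cosetOrbit R).ncard := by
  rw [← ncard_GF]
  refine ncard_eq_mul_ncard_image finite_GF fun Q hQ => ?_
  rw [← Set.ncard_image_of_injective (cosetStab R) (mul_right_injective Q)]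
  congr 1
  ext Q'
  simp only [Set.mem_ofPred_eq, Set.mem_image, cosetStab]
  constructor
  · rintro ⟨hQ', e⟩
    refine ⟨Q⁻¹ * Q', ⟨GF.mul_mem (GF.inv_mem hQ) hQ', ?_⟩, by group⟩
    have := QuotientGroup.eq.mp e.symm
    convert this using 1
    group
  · rintro ⟨T, ⟨hT, hTR⟩, rfl⟩
    refine ⟨GF.mul_mem hQ hT, (QuotientGroup.eq.mpr ?_).symm⟩
    convert hTR using 1
    group

theorem mem_doubleCoset_iff {R T : SO4} :
    T ∈ DoubleCoset.doubleCoset R (GF : Set SO4) (GF : Set SO4) ↔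
      (T : SO4 ⧸ GF) ∈ cosetOrbit R := by
  rw [DoubleCoset.mem_doubleCoset]
  constructor
  · rintro ⟨Q, hQ, Q', hQ', rfl⟩
    refine ⟨Q, hQ, QuotientGroup.eq.mpr ?_⟩
    rw [show (Q * R)⁻¹ * (Q * R * Q') = Q' by group]
    exact hQ'
  · rintro ⟨Q, hQ, e⟩
    exact ⟨Q, hQ, _, QuotientGroup.eq.mp e, by group⟩

theorem ncard_preimage_mk {A : Set (SO4 ⧸ GF)} (hA : A.Finite) :
    (((↑) : SO4 → SO4 ⧸ GF) ⁻¹' A).Finite ∧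
      (((↑) : SO4 → SO4 ⧸ GF) ⁻¹' A).ncard = 576 * A.ncard := by
  have hfib : ∀ R : SO4, {T : SO4 | (T : SO4 ⧸ GF) = R} = (fun Q => R * Q) '' GF := by
    intro R
    ext T
    constructor
    · intro h
      exact ⟨R⁻¹ * T, QuotientGroup.eq.mp (Eq.symm h), by group⟩
    · rintro ⟨Q, hQ, rfl⟩
      exact (QuotientGroup.eq.mpr (by simpa using hQ)).symm
  have hfin : (((↑) : SO4 → SO4 ⧸ GF) ⁻¹' A).Finite := by
    refine hA.preimage' fun b _ => ?_
    obtain ⟨R, rfl⟩ := QuotientGroup.mk_surjective b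
    have h2 := finite_GF.image (fun Q => R * Q)
    rw [← hfib R] at h2
    exact h2
  refine ⟨hfin, ?_⟩
  conv_rhs => rw [← Set.image_preimage_eq A QuotientGroup.mk_surjective]
  refine ncard_eq_mul_ncard_image hfin fun R hR => ?_
  rw [← ncard_GF, ← Set.ncard_image_of_injective (GF : Set SO4) (mul_right_injective R),
    ← hfib R]
  congr 1
  ext T
  constructor
  · exact fun h => h.2
  · intro h
    refine ⟨?_, h⟩
    change (T : SO4 ⧸ GF) ∈ A
    rw [show (T : SO4 ⧸ GF) = R from h]
    exact hR

theorem ncard_doubleCoset (R : SO4) :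
    (DoubleCoset.doubleCoset R (GF : Set SO4) (GF : Set SO4)).ncard =
      576 * (cosetOrbit R).ncard := by
  rw [← (ncard_preimage_mk (finite_cosetOrbit R)).2]
  congr 1
  ext T
  exact mem_doubleCoset_iff

theorem not_isAdmissible_of_oddNorm {p q : ℍ[ℤ]} (hp : oddNorm p = 1) (hq : oddNorm q = 3) :
    ¬ IsAdmissible p q := by
  intro h
  obtain ⟨r, hr⟩ := h.2.2
  have h1 : oddNorm (p * q) = 3 := by rw [oddNorm_mul, hp, hq]
  have h2 : oddNorm (p * q) = (ordCompl[2] r.natAbs) ^ 2 := by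
    rw [oddNorm, hr, Int.natAbs_mul, Nat.ordCompl_mul, sq]
  rw [h1] at h2
  generalize ordCompl[2] r.natAbs = x at h2
  have : x < 2 := by nlinarith
  interval_cases x <;> omega

theorem ncard_cosetOrbit {p q : ℍ[ℤ]} {R : SO4} {i j : Fin 6} (h : IsAdmissible p q)
    (hi : HasType i p) (hj : HasType j q) (hR : R.1 = rotMatrix p q) :
    ((cosetOrbit R).ncard : ℚ) = gF i j := by
  have h1 := ncard_stabPairs_eq h hR
  obtain ⟨a, b⟩ := ncard_stab h.1 hi
  obtain ⟨c, d⟩ := ncard_stab h.2.1 hj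
  have h2 := ncard_cosetStab_mul R
  rw [ncard_stabPairs, a, b, c, d] at h1
  -- For (0,1) and (1,0) orbit counting would give 4 where the table has 0; these pairs are never
  -- admissible because 3 is not a square.
  have h01 : ¬ (i = 0 ∧ j = 1) := by
    rintro ⟨rfl, rfl⟩
    exact not_isAdmissible_of_oddNorm ((hasType_zero_iff h.1).mp hi)
      ((hasType_one_iff h.2.1).mp hj) h
  have h10 : ¬ (i = 1 ∧ j = 0) := by
    rintro ⟨rfl, rfl⟩
    refine not_isAdmissible_of_oddNorm ((hasType_zero_iff h.2.1).mp hj)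
      ((hasType_one_iff h.1).mp hi) ⟨h.2.1, h.1, ?_⟩
    have := h.2.2
    rwa [map_mul, mul_comm, ← map_mul] at this
  -- The orbit size is 1152 = 2 · 576 divided by e·e' + o·o', where e, o and e', o' are the even and
  -- odd stabilizer orders of p and q.
  have h3 : 2 * (cosetStab R).ncard * (cosetOrbit R).ncard = 1152 := by
    rw [mul_assoc, ← h2]; norm_num
  rw [← h1] at h3
  generalize (cosetOrbit R).ncard = x at h3
  clear a b c d hi hj hR h h1 h2
  fin_cases i <;> fin_cases j <;> simp at h3 h01 h10 <;> simp [gF] <;> norm_cast <;> omega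

/-! ### From double cosets to left cosets -/

/-- If v is an axis of p, then svs⁻¹ is an axis of sp; it is again integral because s is cubic. -/
theorem HasAxis.of_mul_eq {p p' s : ℍ[ℤ]} {k l : ℕ} {d : ℕ} (hk : k ≠ 0) (hp : p ≠ 0)
    (hs : IsCubic s) (e : (k : ℍ[ℤ]) * p' = (l : ℍ[ℤ]) * (s * p)) (h : HasAxis d p) :
    HasAxis d p' := by
  obtain ⟨v, hv, hvd, hvp⟩ := h
  obtain ⟨w, -, -, hw⟩ := exists_mul_eq_mul_of_mem_rightIdeal hp hv hvp
  obtain ⟨v', hv', hvN', hvs⟩ := exists_mul_eq_mul_of_mem_rightIdeal hs.star.ne_zero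
    (v := star v) (by simpa using hv) (one_dvd_rightIdeal hs.star _)
  have hsv : s * v = star v' * s := by
    have := congrArg star hvs
    simpa only [star_mul, star_star] using this
  refine ⟨star v', by simpa using hv', by simpa [hvd] using hvN',
    mul_mem_rightIdeal_of_eq (w := w) (mul_left_cancel₀ (natCast_ne_zero hk) ?_)⟩
  calc (k : ℍ[ℤ]) * (star v' * p') = star v' * ((k : ℍ[ℤ]) * p') := by
        rw [← mul_assoc, (Nat.cast_commute k _).eq, mul_assoc]
    _ = (l : ℍ[ℤ]) * (star v' * s * p) := by
        rw [e, ← mul_assoc, ← (Nat.cast_commute l _).eq]; simp only [mul_assoc]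
    _ = (l : ℍ[ℤ]) * (s * (v * p)) := by rw [← hsv]; simp only [mul_assoc]
    _ = (k : ℍ[ℤ]) * p' * w := by rw [hw, e]; simp only [mul_assoc]
    _ = (k : ℍ[ℤ]) * (p' * w) := mul_assoc _ _ _

theorem hasType_of_mul_eq {p p' s : ℍ[ℤ]} {k : ℕ} (hp : IsPrimitive p) (hp' : IsPrimitive p')
    (hk : k ≠ 0) (hs : IsCubic s) (e : s * p = (k : ℍ[ℤ]) * p') {i : Fin 6} (h : HasType i p) :
    HasType i p' := by
  have hN : oddNorm p = oddNorm p' :=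
    oddNorm_eq_of_mul_mul_eq hp hs isCubic_one hk (by rwa [mul_one])
  have hA : ∀ d, HasAxis d p ↔ HasAxis d p' := by
    intro d
    -- The reverse direction recovers a multiple of p from p' by multiplying with the cubic
    -- quaternion s̄.
    refine ⟨HasAxis.of_mul_eq (k := k) (l := 1) hk hp.ne_zero hs (by rw [e]; simp),
      HasAxis.of_mul_eq (k := (Quaternion.normSq s : ℤ).natAbs) (l := k)
        (by simpa using hs.ne_zero) hp'.ne_zero hs.star ?_⟩
    rw [← Int.cast_natCast, Int.natAbs_of_nonneg Quaternion.normSq_nonneg, ← star_mul_self_eq,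
      mul_assoc, e, ← mul_assoc, ← (Nat.cast_commute k _).eq, mul_assoc]
  fin_cases i
  · exact (hasType_zero_iff hp').mpr (hN ▸ (hasType_zero_iff hp).mp h)
  · exact (hasType_one_iff hp').mpr (hN ▸ (hasType_one_iff hp).mp h)
  · refine (hasType_two_iff hp').mpr ?_
    rw [← hN, ← hA]
    exact (hasType_two_iff hp).mp h
  · refine (hasType_three_iff hp').mpr ?_
    rw [← hN, ← hA]
    exact (hasType_three_iff hp).mp h
  · refine (hasType_four_iff hp').mpr ?_
    rw [← hN, ← hA]
    exact (hasType_four_iff hp).mp h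
  · refine (hasType_five_iff hp').mpr ?_
    rw [← hN, ← hA, ← hA, ← hA]
    exact (hasType_five_iff hp).mp h

theorem coincidenceIndex_eq {p q : ℍ[ℤ]} {R : SO4} (h : IsAdmissible p q)
    (hR : R.1 = rotMatrix p q) : coincidenceIndex R = Nat.lcm (oddNorm p) (oddNorm q) :=
  relIndex_csl h hR

/-- The left cosets of type `(i, j)` and index `S`. -/
def leftClasses (i j : Fin 6) (S : ℕ) : Set (SO4 ⧸ GF) :=
  {c | ∃ (p q : ℍ[ℤ]) (R : SO4), IsAdmissible p q ∧ R.1 = rotMatrix p q ∧ HasType i p ∧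
    HasType j q ∧ Nat.lcm (oddNorm p) (oddNorm q) = S ∧ c = (R : SO4 ⧸ GF)}

theorem mul_mem_leftClasses {i j : Fin 6} {S : ℕ} {R Q : SO4} (hQ : Q ∈ GF)
    {p q : ℍ[ℤ]} (hpq : IsAdmissible p q) (hR : R.1 = rotMatrix p q) (hi : HasType i p)
    (hj : HasType j q) (hS : Nat.lcm (oddNorm p) (oddNorm q) = S) :
    ((Q * R : SO4) : SO4 ⧸ GF) ∈ leftClasses i j S := by
  obtain ⟨s, t, hst, hs, ht, e⟩ := exists_of_mem_GF hQ
  have hs' : IsCubic s := ⟨hst.1, hs⟩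
  have ht' : IsCubic t := ⟨hst.2.1, ht⟩
  obtain ⟨k, p', hk, hp', e1⟩ := exists_eq_mul_isPrimitive (mul_ne_zero hs'.ne_zero hpq.1.ne_zero)
  obtain ⟨l, q', hl, hq', e2⟩ := exists_eq_mul_isPrimitive (mul_ne_zero ht'.ne_zero hpq.2.1.ne_zero)
  refine ⟨p', q', Q * R, ⟨hp', hq', ?_⟩, ?_, hasType_of_mul_eq hpq.1 hp' hk hs' e1 hi,
    hasType_of_mul_eq hpq.2.1 hq' hl ht' e2 hj, ?_, rfl⟩
  · refine isSquare_of_isSquare_sq_mul (k := ((k * l : ℕ) : ℤ))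
      (by exact_mod_cast mul_ne_zero hk hl) ?_
    rw [← normSq_natCast_mul_mul, ← e1, ← e2]
    have : (Quaternion.normSq (s * p * (t * q)) : ℤ) =
        Quaternion.normSq (s * t) * Quaternion.normSq (p * q) := by
      simp only [map_mul]; ring
    rw [this]
    exact hst.2.2.mul hpq.2.2
  · rw [← rotMatrix_natCast_mul hk hl, ← e1, ← e2, ← rotMatrix_mul, ← e, ← hR]
    rfl
  · rw [← oddNorm_eq_of_mul_mul_eq hpq.1 hs' isCubic_one hk ((mul_one _).trans e1),
      ← oddNorm_eq_of_mul_mul_eq hpq.2.1 ht' isCubic_one hl ((mul_one _).trans e2), hS]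

/-- The double coset that contains a left coset. -/
noncomputable def toDoubleCoset (c : SO4 ⧸ GF) :
    DoubleCoset.Quotient (GF : Set SO4) (GF : Set SO4) := DoubleCoset.mk GF GF c.out

theorem toDoubleCoset_mk (R : SO4) : toDoubleCoset (R : SO4 ⧸ GF) = DoubleCoset.mk GF GF R := by
  obtain ⟨Q, hQ⟩ := QuotientGroup.mk_out_eq_mul GF R
  rw [toDoubleCoset, hQ, eq_comm, DoubleCoset.eq]
  exact ⟨1, GF.one_mem, Q, Q.2, by rw [one_mul]⟩

theorem toDoubleCoset_eq_iff {R T : SO4} :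
    toDoubleCoset (T : SO4 ⧸ GF) = toDoubleCoset (R : SO4 ⧸ GF) ↔
      (T : SO4 ⧸ GF) ∈ cosetOrbit R := by
  rw [toDoubleCoset_mk, toDoubleCoset_mk, eq_comm, DoubleCoset.eq, ← mem_doubleCoset_iff,
    DoubleCoset.mem_doubleCoset]
  rfl

theorem classes_eq_image (i j : Fin 6) (S : ℕ) :
    classes i j S = toDoubleCoset '' leftClasses i j S := by
  ext c
  constructor
  · rintro ⟨R, -, hS, ⟨p, q, hpq, hi, hj, hR⟩, rfl⟩
    exact ⟨_, ⟨p, q, R, hpq, hR, hi, hj, by rw [← coincidenceIndex_eq hpq hR, hS], rfl⟩,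
      toDoubleCoset_mk R⟩
  · rintro ⟨_, ⟨p, q, R, hpq, hR, hi, hj, hS, rfl⟩, rfl⟩
    exact ⟨R, isCoincidence_of_isAdmissible hpq hR, by rw [coincidenceIndex_eq hpq hR, hS],
      ⟨p, q, hpq, hi, hj, hR⟩, toDoubleCoset_mk R⟩

/-- Left cosets of a type and index form whole double cosets, each containing the same number g of
left cosets. -/
theorem ncard_leftClasses {i j : Fin 6} {S : ℕ} (hfin : (leftClasses i j S).Finite) :
    ((leftClasses i j S).ncard : ℚ) = gF i j * nF i j S := by
  rw [nF, classes_eq_image]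
  rcases (leftClasses i j S).eq_empty_or_nonempty with h | ⟨c, p, q, R, hpq, hR, hi, hj, hS, rfl⟩
  · simp [h]
  · rw [← ncard_cosetOrbit hpq hi hj hR]
    norm_cast
    refine ncard_eq_mul_ncard_image hfin ?_
    rintro _ ⟨p', q', R', hpq', hR', hi', hj', hS', rfl⟩
    have h : ((cosetOrbit R').ncard : ℚ) = (cosetOrbit R).ncard := by
      rw [ncard_cosetOrbit hpq hi hj hR, ncard_cosetOrbit hpq' hi' hj' hR']
    rw [← Nat.cast_injective h]
    congr 1
    ext c
    obtain ⟨T, rfl⟩ := QuotientGroup.mk_surjective c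
    rw [Set.mem_ofPred_eq]
    rw [toDoubleCoset_eq_iff]
    refine and_iff_right_of_imp ?_
    rintro ⟨Q, hQ, e⟩
    rw [← e]
    exact mul_mem_leftClasses hQ hpq' hR' hi' hj' hS'

/-! ### Left cosets and pairs of ideals -/

/-- The classes of primitive quaternions of odd norm `m` and type `i`. -/
def typeIdeals (i : Fin 6) (m : ℕ) : Set (Set ℍ[ℤ]) :=
  {A | ∃ p, IsPrimitive p ∧ oddNorm p = m ∧ HasType i p ∧ A = rightIdeal p}

theorem typeIdeals_subset (i : Fin 6) (m : ℕ) : typeIdeals i m ⊆ idealSet m :=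
  fun _ ⟨p, hp, hm, _, e⟩ => ⟨p, hp, hm, e⟩

theorem typeIdeals_eq_empty {m : ℕ} (hm : ¬ Odd m) (i : Fin 6) : typeIdeals i m = ∅ := by
  rw [Set.eq_empty_iff_forall_notMem]
  rintro _ ⟨p, hp, rfl, -⟩
  exact hm (odd_oddNorm hp.ne_zero)

theorem finite_typeIdeals (i : Fin 6) (m : ℕ) : (typeIdeals i m).Finite := by
  by_cases hm : Odd m
  · exact (finite_idealSet hm).subset (typeIdeals_subset i m)
  · rw [typeIdeals_eq_empty hm]
    exact Set.finite_empty

/-- The pairs `(m, n)` with least common multiple `S` and `m n` a square. -/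
def lcmPairs (S : ℕ) : Finset (ℕ × ℕ) :=
  (S.divisors ×ˢ S.divisors).filter fun x => Nat.lcm x.1 x.2 = S ∧ IsSquare (x.1 * x.2)

theorem mem_lcmPairs {S m n : ℕ} (hS : S ≠ 0) :
    (m, n) ∈ lcmPairs S ↔ Nat.lcm m n = S ∧ IsSquare (m * n) := by
  rw [lcmPairs, Finset.mem_filter, Finset.mem_product, Nat.mem_divisors, Nat.mem_divisors]
  refine and_iff_right_of_imp ?_
  rintro ⟨rfl, -⟩
  exact ⟨⟨Nat.dvd_lcm_left m n, hS⟩, Nat.dvd_lcm_right m n, hS⟩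

/-- Two maps with the same fibres on X have images in bijection; it is applied to the coset of a
pair and to its pair of ideals. -/
theorem image_finite_and_ncard_eq {α β γ : Type*} {X : Set α} {f : α → β} {g : α → γ}
    (h : ∀ x ∈ X, ∀ y ∈ X, f x = f y ↔ g x = g y) (hg : (g '' X).Finite) :
    (f '' X).Finite ∧ (f '' X).ncard = (g '' X).ncard := by
  rcases X.eq_empty_or_nonempty with rfl | ⟨x₀, hx₀⟩
  · simp
  have : Nonempty α := ⟨x₀⟩
  have hinv : ∀ y ∈ g '' X, Function.invFunOn g X y ∈ X ∧ g (Function.invFunOn g X y) = y :=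
    fun y hy => ⟨Function.invFunOn_mem hy, Function.invFunOn_eq hy⟩
  have himg : (fun y => f (Function.invFunOn g X y)) '' (g '' X) = f '' X := by
    ext b
    constructor
    · rintro ⟨y, hy, rfl⟩
      exact ⟨_, (hinv y hy).1, rfl⟩
    · rintro ⟨x, hx, rfl⟩
      have := hinv (g x) ⟨x, hx, rfl⟩
      exact ⟨g x, ⟨x, hx, rfl⟩, (h _ this.1 _ hx).mpr this.2⟩
  rw [← himg]
  refine ⟨hg.image _, Set.InjOn.ncard_image ?_⟩
  intro y hy y' hy' e
  rw [← (hinv y hy).2, ← (hinv y' hy').2]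
  exact (h _ (hinv y hy).1 _ (hinv y' hy').1).mp e

/-- The rotation of a pair of non-zero quaternions. -/
noncomputable def rotOf (x : ℍ[ℤ] × ℍ[ℤ]) : SO4 :=
  open Classical in if h : x.1 ≠ 0 ∧ x.2 ≠ 0 then rot h.1 h.2 else 1

theorem rotOf_val {p q : ℍ[ℤ]} (h : IsAdmissible p q) : (rotOf (p, q)).1 = rotMatrix p q := by
  rw [rotOf, dif_pos ⟨h.1.ne_zero, h.2.1.ne_zero⟩]
  rfl

/-- The admissible pairs of type `(i, j)` and index `S`. -/
def admissiblePairs (i j : Fin 6) (S : ℕ) : Set (ℍ[ℤ] × ℍ[ℤ]) :=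
  {x | IsAdmissible x.1 x.2 ∧ HasType i x.1 ∧ HasType j x.2 ∧
    Nat.lcm (oddNorm x.1) (oddNorm x.2) = S}

theorem image_rotOf (i j : Fin 6) (S : ℕ) :
    (fun x => (rotOf x : SO4 ⧸ GF)) '' admissiblePairs i j S = leftClasses i j S := by
  ext c
  constructor
  · rintro ⟨⟨p, q⟩, ⟨h, hi, hj, hS⟩, rfl⟩
    exact ⟨p, q, _, h, rotOf_val h, hi, hj, hS, rfl⟩
  · rintro ⟨p, q, R, h, hR, hi, hj, hS, rfl⟩
    refine ⟨(p, q), ⟨h, hi, hj, hS⟩, ?_⟩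
    change (rotOf (p, q) : SO4 ⧸ GF) = R
    rw [show rotOf (p, q) = R from Subtype.ext ((rotOf_val h).trans hR.symm)]

theorem isSquare_oddNorm_mul {p q : ℍ[ℤ]} (h : IsAdmissible p q) :
    IsSquare (oddNorm p * oddNorm q) := by
  obtain ⟨r, hr⟩ := h.2.2
  refine ⟨ordCompl[2] r.natAbs, ?_⟩
  rw [← oddNorm_mul, oddNorm, hr, Int.natAbs_mul, Nat.ordCompl_mul]

theorem image_rightIdeal {S : ℕ} (hS : S ≠ 0) (i j : Fin 6) :
    (fun x : ℍ[ℤ] × ℍ[ℤ] => (rightIdeal x.1, rightIdeal x.2)) '' admissiblePairs i j S =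
      ⋃ x ∈ (lcmPairs S : Set (ℕ × ℕ)), typeIdeals i x.1 ×ˢ typeIdeals j x.2 := by
  ext ⟨A, B⟩
  simp only [Set.mem_image, Set.mem_iUnion, Set.mem_prod, Prod.exists, Prod.mk.injEq,
    Finset.mem_coe, mem_lcmPairs hS, exists_prop]
  constructor
  · rintro ⟨p, q, ⟨h, hi, hj, hl⟩, rfl, rfl⟩
    exact ⟨oddNorm p, oddNorm q, ⟨hl, isSquare_oddNorm_mul h⟩, ⟨p, h.1, rfl, hi, rfl⟩,
      ⟨q, h.2.1, rfl, hj, rfl⟩⟩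
  · rintro ⟨m, n, ⟨hl, hsq⟩, ⟨p, hp, rfl, hi, rfl⟩, ⟨q, hq, rfl, hj, rfl⟩⟩
    -- Arbitrary generators may have a norm product that is not a square. Representatives of odd
    -- norm have norm product exactly mn, so the pair becomes admissible without changing the
    -- ideals.
    obtain ⟨p', u, hp', hpN, hu, hpu⟩ := exists_odd_representative hp
    obtain ⟨q', v, hq', hqN, hv, hqv⟩ := exists_odd_representative hq
    have hpI := rightIdeal_eq_of_mul_eq hp' hp hu hpu
    have hqI := rightIdeal_eq_of_mul_eq hq' hq hv hqv
    refine ⟨p', q', ⟨⟨hp', hq', ?_⟩, (hasType_congr hp' hp hpI i).mpr hi,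
      (hasType_congr hq' hq hqI j).mpr hj, ?_⟩, hpI, hqI⟩
    · obtain ⟨r, hr⟩ := hsq
      exact ⟨r, by rw [map_mul, hpN, hqN]; exact_mod_cast hr⟩
    · change Nat.lcm (oddNorm p') (oddNorm q') = S
      rw [oddNorm_eq_of_rightIdeal_eq hp' hp hpI, oddNorm_eq_of_rightIdeal_eq hq' hq hqI, hl]

theorem finite_leftClasses_and_ncard {S : ℕ} (hS : S ≠ 0) (i j : Fin 6) :
    (leftClasses i j S).Finite ∧ (leftClasses i j S).ncard =
      ∑ x ∈ lcmPairs S, (typeIdeals i x.1).ncard * (typeIdeals j x.2).ncard := by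
  have hfin : (⋃ x ∈ (lcmPairs S : Set (ℕ × ℕ)), typeIdeals i x.1 ×ˢ typeIdeals j x.2).Finite :=
    (lcmPairs S).finite_toSet.biUnion fun x _ =>
      (finite_typeIdeals i x.1).prod (finite_typeIdeals j x.2)
  have h := image_finite_and_ncard_eq (X := admissiblePairs i j S)
    (f := fun x => (rotOf x : SO4 ⧸ GF)) (g := fun x => (rightIdeal x.1, rightIdeal x.2))
    (fun x hx y hy => by
      rw [Prod.mk.injEq]
      exact mk_eq_mk_iff hx.1 hy.1 (rotOf_val hx.1) (rotOf_val hy.1))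
    (by rw [image_rightIdeal hS]; exact hfin)
  rw [image_rotOf, image_rightIdeal hS] at h
  refine ⟨h.1, h.2.trans ?_⟩
  rw [(lcmPairs S).finite_toSet.ncard_biUnion (fun x _ =>
    (finite_typeIdeals i x.1).prod (finite_typeIdeals j x.2)), finsum_mem_coe_finset]
  · simp only [Set.ncard_prod]
  · rintro ⟨m, n⟩ - ⟨m', n'⟩ - hne
    rw [Function.onFun, Set.disjoint_left]
    rintro ⟨A, B⟩ ⟨⟨p, hp, rfl, -, rfl⟩, ⟨q, hq, rfl, -, rfl⟩⟩
      ⟨⟨p', hp', rfl, -, e⟩, ⟨q', hq', rfl, -, e'⟩⟩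
    exact hne (Prod.ext (oddNorm_eq_of_rightIdeal_eq hp hp' e)
      (oddNorm_eq_of_rightIdeal_eq hq hq' e'))

theorem rotationClasses_eq (S : ℕ) :
    rotationClasses S = ⋃ x : Fin 6 × Fin 6, leftClasses x.1 x.2 S := by
  ext c
  simp only [Set.mem_iUnion, Prod.exists]
  constructor
  · rintro ⟨R, hco, hS, rfl⟩
    obtain ⟨p, q, hpq, hR⟩ := hco.exists_rotMatrix
    obtain ⟨i, hi⟩ := exists_hasType p
    obtain ⟨j, hj⟩ := exists_hasType q
    exact ⟨i, j, p, q, R, hpq, hR, hi, hj, by rw [← coincidenceIndex_eq hpq hR, hS], rfl⟩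
  · rintro ⟨i, j, p, q, R, hpq, hR, -, -, hS, rfl⟩
    exact ⟨R, isCoincidence_of_isAdmissible hpq hR, by rw [coincidenceIndex_eq hpq hR, hS], rfl⟩

theorem ncard_rotationClasses {S : ℕ} (hS : S ≠ 0) : (rotationClasses S).ncard =
    ∑ i : Fin 6, ∑ j : Fin 6, (leftClasses i j S).ncard := by
  rw [rotationClasses_eq, Set.ncard_iUnion_of_finite (s := fun x : Fin 6 × Fin 6 =>
    leftClasses x.1 x.2 S) (fun x => (finite_leftClasses_and_ncard hS x.1 x.2).1), finsum_eq_sum_of_fintype,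
    Fintype.sum_prod_type]
  rintro ⟨i, j⟩ ⟨i', j'⟩ hne
  rw [Function.onFun, Set.disjoint_left]
  rintro c ⟨p, q, R, hpq, hR, hi, hj, -, rfl⟩ ⟨p', q', R', hpq', hR', hi', hj', -, e⟩
  obtain ⟨e1, e2⟩ := (mk_eq_mk_iff hpq hpq' hR hR').mp e
  exact hne (Prod.ext
    (hasType_unique hpq.1 hi ((hasType_congr hpq.1 hpq'.1 e1 i').mpr hi'))
    (hasType_unique hpq.2.1 hj ((hasType_congr hpq.2.1 hpq'.2.1 e2 j').mpr hj')))

/-! ### Counting ideals by type -/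

/-- The family `t` lists the axes of squared length d up to sign. Each fixes `rootCount d m` ideals,
and since m does not divide 3 no ideal is fixed by two of them. -/
theorem ncard_hasAxis {m n d : ℕ} (hm : Odd m) (hm1 : m ≠ 1) (hm3 : m ≠ 3) (hd : d ≤ 3)
    (hd0 : d ≠ 0) (t : Fin n → ℤ × ℤ × ℤ)
    (hnorm : ∀ i, (t i).1 ^ 2 + (t i).2.1 ^ 2 + (t i).2.2 ^ 2 = d)
    (hone : ∀ i, (t i).1 = 1 ∨ (t i).2.1 = 1 ∨ (t i).2.2 = 1)
    (hinj : ∀ i j, t j = t i ∨ t j = -t i → i = j)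
    (hall : ∀ a ∈ Finset.Icc (-1 : ℤ) 1, ∀ b ∈ Finset.Icc (-1 : ℤ) 1,
      ∀ c ∈ Finset.Icc (-1 : ℤ) 1, a ^ 2 + b ^ 2 + c ^ 2 = d →
        ∃ i, t i = (a, b, c) ∨ t i = (-a, -b, -c)) :
    {A | ∃ p, IsPrimitive p ∧ oddNorm p = m ∧ HasAxis d p ∧ A = rightIdeal p}.ncard =
      n * rootCount d m := by
  let v : Fin n → ℍ[ℤ] := fun i => quat 0 (t i).1 (t i).2.1 (t i).2.2
  have hvN : ∀ i, (Quaternion.normSq (v i) : ℤ) = d := fun i => by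
    rw [normSq_quat, ← hnorm i]; ring
  have hv0 : ∀ i, v i ≠ 0 := fun i h => by
    have := hvN i
    rw [h] at this
    simp at this
    omega
  have hvp : ∀ i, IsPrimitive (v i) := by
    intro i e _ h1 h2 h3
    rcases hone i with h | h | h
    · exact isUnit_of_dvd_one (h ▸ h1)
    · exact isUnit_of_dvd_one (h ▸ h2)
    · exact isUnit_of_dvd_one (h ▸ h3)
  have hset : {A | ∃ p, IsPrimitive p ∧ oddNorm p = m ∧ HasAxis d p ∧ A = rightIdeal p} =
      ⋃ i, fixedIdeals (v i) m := by
    ext A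
    simp only [Set.mem_iUnion]
    constructor
    · rintro ⟨p, hp, hpm, ⟨w, hw, hwd, hwp⟩, rfl⟩
      obtain ⟨-, h1, h2, h3⟩ := coordinates_mem_of_normSq_le (p := w)
        (by rw [hwd]; exact_mod_cast hd)
      have hwd' := hwd
      rw [Quaternion.normSq_def', hw] at hwd'
      obtain ⟨i, hi | hi⟩ := hall _ h1 _ h2 _ h3 (by rw [← hwd']; ring)
      · refine ⟨i, p, hp, hpm, rfl, ?_⟩
        have : v i = w := by ext <;> simp [v, hi, hw]
        rwa [this]
      · refine ⟨i, p, hp, hpm, rfl, ?_⟩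
        have : v i = -w := by ext <;> simp [v, hi, hw]
        rw [this, rightIdeal, Set.mem_ofPred_eq, neg_mul, mul_neg, dvd_neg]
        exact hwp
    · rintro ⟨i, p, hp, hpm, rfl, h⟩
      exact ⟨p, hp, hpm, ⟨v i, rfl, hvN i, h⟩, rfl⟩
  have hsub : ∀ i, fixedIdeals (v i) m ⊆ idealSet m :=
    fun i A ⟨p, hp, hpm, e, _⟩ => ⟨p, hp, hpm, e⟩
  rw [hset, Set.ncard_iUnion_of_finite (fun i => (finite_idealSet hm).subset (hsub i)),
    finsum_eq_sum_of_fintype]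
  · simp only [ncard_fixedIdeals hm (hvp _) rfl (hvN _)]
    simp
  · intro i j hij
    rw [Function.onFun, Set.disjoint_left]
    rintro _ ⟨p, hp, hpm, rfl, h⟩ ⟨q, hq, hqm, e, h'⟩
    rw [← mul_mem_rightIdeal_congr hp hq (hpm.trans hqm.symm) e] at h'
    have hvj : ∀ i, (Quaternion.normSq (v i) : ℤ) ≤ 3 := fun i => by
      rw [hvN]; exact_mod_cast hd
    rcases eq_or_eq_neg_or_oddNorm_dvd hp rfl rfl (hv0 i) (hv0 j) (hvj i) (hvj j) h h' with
      h1 | h1 | h1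
    · refine hij (hinj i j (Or.inl ?_))
      have e1 := congrArg QuaternionAlgebra.imI h1
      have e2 := congrArg QuaternionAlgebra.imJ h1
      have e3 := congrArg QuaternionAlgebra.imK h1
      exact Prod.ext e1 (Prod.ext e2 e3)
    · refine hij (hinj i j (Or.inr ?_))
      have e1 := congrArg QuaternionAlgebra.imI h1
      have e2 := congrArg QuaternionAlgebra.imJ h1
      have e3 := congrArg QuaternionAlgebra.imK h1
      exact Prod.ext e1 (Prod.ext e2 e3)
    · rw [hpm] at h1
      rcases (Nat.dvd_prime Nat.prime_three).mp h1 with h1 | h1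
      · exact hm1 h1
      · exact hm3 h1

theorem ncard_typeIdeals_eq_zero {i : Fin 6} {m : ℕ}
    (h : ∀ p, IsPrimitive p → HasType i p → oddNorm p ≠ m) : (typeIdeals i m).ncard = 0 := by
  have : typeIdeals i m = ∅ := by
    rw [Set.eq_empty_iff_forall_notMem]
    rintro _ ⟨p, hp, hpm, hi, -⟩
    exact h p hp hi hpm
  rw [this, Set.ncard_empty]

theorem ncard_typeIdeals_eq_of_forall {i : Fin 6} {m : ℕ} (hm : Odd m)
    (h : ∀ p, IsPrimitive p → oddNorm p = m → HasType i p) :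
    ((typeIdeals i m).ncard : ℚ) = cubicProd m m.primeFactors := by
  rw [← ncard_idealSet hm]
  congr 2
  exact Set.Subset.antisymm (typeIdeals_subset i m)
    fun A ⟨p, hp, hpm, e⟩ => ⟨p, hp, hpm, h p hp hpm, e⟩

theorem ncard_typeIdeals_zero (m : ℕ) :
    ((typeIdeals 0 m).ncard : ℚ) = if m = 1 then 1 else 0 := by
  split_ifs with h
  · rw [h, ncard_typeIdeals_eq_of_forall odd_one fun p hp h => (hasType_zero_iff hp).mpr h]
    simp [cubicProd]
  · rw [ncard_typeIdeals_eq_zero fun p hp hi hpm =>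
      h (hpm.symm.trans ((hasType_zero_iff hp).mp hi)), Nat.cast_zero]

theorem ncard_typeIdeals_one (m : ℕ) :
    ((typeIdeals 1 m).ncard : ℚ) = if m = 3 then 4 else 0 := by
  split_ifs with h
  · rw [h, ncard_typeIdeals_eq_of_forall (by decide) fun p hp h => (hasType_one_iff hp).mpr h]
    have := cubicProd_prime_pow (k := 0) Nat.prime_three
    rw [zero_add, pow_one] at this
    rw [this]
    norm_num
  · rw [ncard_typeIdeals_eq_zero fun p hp hi hpm =>
      h (hpm.symm.trans ((hasType_one_iff hp).mp hi)), Nat.cast_zero]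

theorem rootCount_one (d : ℕ) : rootCount d 1 = 1 := by
  rw [rootCount, Set.ncard_eq_one]
  exact ⟨0, Set.eq_singleton_iff_unique_mem.mpr ⟨Subsingleton.elim _ _, fun _ _ =>
    Subsingleton.elim _ _⟩⟩

theorem rootCount_eq_card (d m : ℕ) [NeZero m] :
    rootCount d m = (Finset.univ.filter fun x : ZMod m => x ^ 2 = -(d : ZMod m)).card := by
  rw [rootCount, Set.ncard_eq_toFinset_card', Set.toFinset_ofPred]

theorem rootCount_three : rootCount 1 3 = 0 ∧ rootCount 2 3 = 2 ∧ rootCount 3 3 = 1 := by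
  rw [rootCount_eq_card, rootCount_eq_card, rootCount_eq_card]
  decide

/-- There are four axes of length √3. At m = 1 and m = 3 the congruence has one root each, which
belongs to the exceptional classes and is subtracted. -/
theorem ncard_typeIdeals_two {m : ℕ} (hm : Odd m) : ((typeIdeals 2 m).ncard : ℚ) =
    4 * (rootCount 3 m - (if m = 1 then 1 else 0) - if m = 3 then 1 else 0) := by
  by_cases h1 : m = 1
  · rw [ncard_typeIdeals_eq_zero fun p hp hi hpm =>
      ((hasType_two_iff hp).mp hi).2 (Or.inl (hpm.trans h1)), h1, rootCount_one]
    norm_num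
  by_cases h3 : m = 3
  · rw [ncard_typeIdeals_eq_zero fun p hp hi hpm =>
      ((hasType_two_iff hp).mp hi).2 (Or.inr (hpm.trans h3)), h3, rootCount_three.2.2]
    norm_num
  have h := ncard_hasAxis (n := 4) (d := 3) hm h1 h3 le_rfl (by norm_num)
    ![(1, 1, 1), (1, 1, -1), (1, -1, 1), (1, -1, -1)] (by decide) (by decide) (by decide)
    (by decide +kernel)
  rw [if_neg h1, if_neg h3, sub_zero, sub_zero]
  have h2 : typeIdeals 2 m =
      {A | ∃ p, IsPrimitive p ∧ oddNorm p = m ∧ HasAxis 3 p ∧ A = rightIdeal p} := by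
    ext A
    refine exists_congr fun p => and_congr_right fun hp => and_congr_right fun hpm =>
      and_congr_left fun _ => (hasType_two_iff hp).trans (and_iff_left ?_)
    rw [hpm]
    exact not_or_intro h1 h3
  rw [h2, h]
  push_cast
  ring

theorem ncard_typeIdeals_three {m : ℕ} (hm : Odd m) : ((typeIdeals 3 m).ncard : ℚ) =
    3 * (rootCount 1 m - if m = 1 then 1 else 0) := by
  by_cases h1 : m = 1
  · rw [ncard_typeIdeals_eq_zero fun p hp hi hpm =>
      ((hasType_three_iff hp).mp hi).2 (Or.inl (hpm.trans h1)), h1, rootCount_one]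
    norm_num
  by_cases h3 : m = 3
  · rw [ncard_typeIdeals_eq_zero fun p hp hi hpm =>
      ((hasType_three_iff hp).mp hi).2 (Or.inr (hpm.trans h3)), h3, rootCount_three.1]
    norm_num
  have h := ncard_hasAxis (n := 3) (d := 1) hm h1 h3 (by norm_num) (by norm_num)
    ![(1, 0, 0), (0, 1, 0), (0, 0, 1)] (by decide) (by decide) (by decide)
    (by decide +kernel)
  rw [if_neg h1, sub_zero]
  have h2 : typeIdeals 3 m =
      {A | ∃ p, IsPrimitive p ∧ oddNorm p = m ∧ HasAxis 1 p ∧ A = rightIdeal p} := by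
    ext A
    refine exists_congr fun p => and_congr_right fun hp => and_congr_right fun hpm =>
      and_congr_left fun _ => (hasType_three_iff hp).trans (and_iff_left ?_)
    rw [hpm]
    exact not_or_intro h1 h3
  rw [h2, h]
  push_cast
  ring

/-- There are six axes of length √2. Modulo 3 the number -2 has two square roots, which explains the
coefficient 2 of the correction. -/
theorem ncard_typeIdeals_four {m : ℕ} (hm : Odd m) : ((typeIdeals 4 m).ncard : ℚ) =
    6 * (rootCount 2 m - (if m = 1 then 1 else 0) - 2 * if m = 3 then 1 else 0) := by
  by_cases h1 : m = 1
  · rw [ncard_typeIdeals_eq_zero fun p hp hi hpm =>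
      ((hasType_four_iff hp).mp hi).2 (Or.inl (hpm.trans h1)), h1, rootCount_one]
    norm_num
  by_cases h3 : m = 3
  · rw [ncard_typeIdeals_eq_zero fun p hp hi hpm =>
      ((hasType_four_iff hp).mp hi).2 (Or.inr (hpm.trans h3)), h3, rootCount_three.2.1]
    norm_num
  have h := ncard_hasAxis (n := 6) (d := 2) hm h1 h3 (by norm_num) (by norm_num)
    ![(1, 1, 0), (1, -1, 0), (1, 0, 1), (1, 0, -1), (0, 1, 1), (0, 1, -1)] (by decide) (by decide)
    (by decide) (by decide +kernel)
  rw [if_neg h1, if_neg h3, mul_zero, sub_zero, sub_zero]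
  have h2 : typeIdeals 4 m =
      {A | ∃ p, IsPrimitive p ∧ oddNorm p = m ∧ HasAxis 2 p ∧ A = rightIdeal p} := by
    ext A
    refine exists_congr fun p => and_congr_right fun hp => and_congr_right fun hpm =>
      and_congr_left fun _ => (hasType_four_iff hp).trans (and_iff_left ?_)
    rw [hpm]
    exact not_or_intro h1 h3
  rw [h2, h]
  push_cast
  ring

theorem sum_ncard_typeIdeals {m : ℕ} (hm : Odd m) :
    ∑ i : Fin 6, ((typeIdeals i m).ncard : ℚ) = cubicProd m m.primeFactors := by
  have h : idealSet m = ⋃ i, typeIdeals i m := by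
    ext A
    rw [Set.mem_iUnion]
    constructor
    · rintro ⟨p, hp, hpm, e⟩
      obtain ⟨i, hi⟩ := exists_hasType p
      exact ⟨i, p, hp, hpm, hi, e⟩
    · rintro ⟨i, h⟩
      exact typeIdeals_subset i m h
  rw [← ncard_idealSet hm, h, Set.ncard_iUnion_of_finite (fun i => finite_typeIdeals i m),
    finsum_eq_sum_of_fintype, Nat.cast_sum]
  intro i j hij
  rw [Function.onFun, Set.disjoint_left]
  rintro _ ⟨p, hp, hpm, hi, rfl⟩ ⟨q, hq, hqm, hj, e⟩
  exact hij (hasType_unique hp hi ((hasType_congr hp hq e j).mpr hj))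

/-! ### Sums over pairs with given least common multiple -/

theorem isSquare_iff_even_factorization {n : ℕ} (hn : n ≠ 0) :
    IsSquare n ↔ ∀ p, Even (n.factorization p) := by
  constructor
  · rintro ⟨r, rfl⟩ p
    have hr : r ≠ 0 := by rintro rfl; exact hn rfl
    rw [Nat.factorization_mul hr hr]
    exact ⟨_, rfl⟩
  · intro h
    refine ⟨∏ p ∈ n.primeFactors, p ^ (n.factorization p / 2), ?_⟩
    rw [← Finset.prod_mul_distrib]
    conv_lhs => rw [← Nat.prod_factorization_pow_eq_self hn]
    refine Finset.prod_congr rfl fun p _ => ?_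
    rw [← pow_add]
    congr 1
    obtain ⟨k, hk⟩ := h p
    omega

theorem isSquare_mul_iff_of_coprime {m n : ℕ} (hm : m ≠ 0) (hn : n ≠ 0) (h : m.Coprime n) :
    IsSquare (m * n) ↔ IsSquare m ∧ IsSquare n := by
  refine ⟨fun hs => ?_, fun hs => hs.1.mul hs.2⟩
  rw [isSquare_iff_even_factorization (mul_ne_zero hm hn), Nat.factorization_mul hm hn] at hs
  rw [isSquare_iff_even_factorization hm, isSquare_iff_even_factorization hn]
  have key : ∀ p, m.factorization p = 0 ∨ n.factorization p = 0 := by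
    intro p
    by_contra! hcon
    have h1 := Nat.dvd_of_factorization_pos hcon.1
    have h2 := Nat.dvd_of_factorization_pos hcon.2
    have h3 := Nat.dvd_gcd h1 h2
    rw [h] at h3
    rw [Nat.dvd_one.mp h3] at hcon
    simp at hcon
  constructor <;> intro p <;> have h1 := hs p <;> rw [Finsupp.add_apply] at h1 <;>
    rcases key p with h2 | h2 <;> first
      | (rw [h2]; exact Even.zero)
      | (rw [h2] at h1; simpa using h1)

/-- The sum of `u m * v n` over all pairs with `lcm (m, n) = S` and `m n` a square. -/
def lcmSum (u v : ℕ → ℚ) (S : ℕ) : ℚ := ∑ x ∈ lcmPairs S, u x.1 * v x.2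

theorem lcmSum_congr {u u' v v' : ℕ → ℚ} {S : ℕ} (hu : ∀ m, m ∣ S → u m = u' m)
    (hv : ∀ m, m ∣ S → v m = v' m) : lcmSum u v S = lcmSum u' v' S := by
  refine Finset.sum_congr rfl fun x hx => ?_
  rw [lcmPairs, Finset.mem_filter, Finset.mem_product] at hx
  rw [hu _ (Nat.dvd_of_mem_divisors hx.1.1), hv _ (Nat.dvd_of_mem_divisors hx.1.2)]

theorem lcmSum_comm (u v : ℕ → ℚ) (S : ℕ) : lcmSum u v S = lcmSum v u S := by
  refine Finset.sum_nbij' Prod.swap Prod.swap ?_ ?_ (fun _ _ => rfl) (fun _ _ => rfl)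
    (fun _ _ => mul_comm _ _) <;>
  · rintro ⟨m, n⟩ h
    simp only [lcmPairs, Finset.mem_filter, Finset.mem_product, Prod.swap] at h ⊢
    exact ⟨h.1.symm, by rw [Nat.lcm_comm, h.2.1], by rw [mul_comm]; exact h.2.2⟩

theorem lcmSum_sub (u v w : ℕ → ℚ) (S : ℕ) :
    lcmSum u (fun n => v n - w n) S = lcmSum u v S - lcmSum u w S := by
  simp only [lcmSum, mul_sub, Finset.sum_sub_distrib]

theorem lcmSum_const_mul (c : ℚ) (u v : ℕ → ℚ) (S : ℕ) :
    lcmSum u (fun n => c * v n) S = c * lcmSum u v S := by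
  simp only [lcmSum, Finset.mul_sum]
  exact Finset.sum_congr rfl fun x _ => by ring

/-- Convolution with the indicator of a keeps at most the pair (a, S), so it is evaluation at S
under a condition on S. -/
theorem lcmSum_single {a S : ℕ} (v : ℕ → ℚ) (P : Prop) [Decidable P]
    (h : ∀ n, (a, n) ∈ lcmPairs S ↔ n = S ∧ P) :
    lcmSum v (fun m => if m = a then 1 else 0) S = if P then v S else 0 := by
  rw [lcmSum_comm, lcmSum]
  split_ifs with hP
  · rw [Finset.sum_eq_single (a, S)]
    · simp
    · rintro ⟨m, n⟩ hmn hne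
      split_ifs with h1
      · simp only at h1
        subst h1
        exact absurd (show (m, n) = (m, S) by rw [((h n).mp hmn).1]) hne
      · rw [zero_mul]
    · intro hmem
      exact absurd ((h S).mpr ⟨rfl, hP⟩) hmem
  · refine Finset.sum_eq_zero ?_
    rintro ⟨m, n⟩ hmn
    split_ifs with h1
    · simp only at h1
      subst h1
      exact absurd ((h n).mp hmn).2 hP
    · rw [zero_mul]

theorem lcmSum_ite_one {S : ℕ} (hS : S ≠ 0) (v : ℕ → ℚ) :
    lcmSum v (fun m => if m = 1 then 1 else 0) S = if IsSquare S then v S else 0 := by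
  refine lcmSum_single v _ fun n => ?_
  rw [mem_lcmPairs hS, Nat.lcm_one_left, one_mul]
  constructor
  · rintro ⟨rfl, h⟩; exact ⟨rfl, h⟩
  · rintro ⟨rfl, h⟩; exact ⟨rfl, h⟩

theorem isSquare_three_mul_iff {n : ℕ} : IsSquare (3 * n) ↔ 3 ∣ n ∧ IsSquare (n / 3) := by
  constructor
  · rintro ⟨r, hr⟩
    have h3 : 3 ∣ r := by
      have : 3 ∣ r * r := ⟨n, hr.symm⟩
      exact (Nat.prime_three.dvd_mul.mp this).elim id id
    obtain ⟨s, rfl⟩ := h3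
    have : n = 3 * (s * s) := by nlinarith
    rw [this]
    exact ⟨dvd_mul_right _ _, s, by rw [Nat.mul_div_cancel_left _ (by norm_num)]⟩
  · rintro ⟨⟨m, rfl⟩, h⟩
    rw [Nat.mul_div_cancel_left _ (by norm_num)] at h
    obtain ⟨s, rfl⟩ := h
    exact ⟨3 * s, by ring⟩

theorem lcmSum_ite_three {S : ℕ} (hS : S ≠ 0) (v : ℕ → ℚ) :
    lcmSum v (fun m => if m = 3 then 1 else 0) S =
      if 3 ∣ S ∧ IsSquare (S / 3) then v S else 0 := by
  refine lcmSum_single v _ fun n => ?_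
  rw [mem_lcmPairs hS, isSquare_three_mul_iff]
  constructor
  · rintro ⟨h, h3, hs⟩
    have : n = S := by
      rw [← h]
      exact (Nat.lcm_eq_right_iff_dvd.mpr h3).symm
    subst this
    exact ⟨rfl, h3, hs⟩
  · rintro ⟨rfl, h3, hs⟩
    exact ⟨Nat.lcm_eq_right_iff_dvd.mpr h3, h3, hs⟩

/-- Multiplicative functions on the positive integers. -/
structure IsMult (u : ℕ → ℚ) : Prop where
  map_one : u 1 = 1
  map_mul : ∀ m n, m ≠ 0 → n ≠ 0 → m.Coprime n → u (m * n) = u m * u n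

theorem IsMult.eq_prod {u : ℕ → ℚ} (hu : IsMult u) {n : ℕ} (hn : n ≠ 0) :
    u n = ∏ p ∈ n.primeFactors, u (p ^ n.factorization p) := by
  induction n using Nat.recOnPosPrimePosCoprime with
  | prime_pow p k hp hk =>
    rw [Nat.primeFactors_prime_pow hk.ne' hp, Finset.prod_singleton, hp.factorization_pow,
      Finsupp.single_eq_same]
  | zero => exact absurd rfl hn
  | one => simp [hu.map_one]
  | coprime a b ha hb h iha ihb =>
    have ha0 : a ≠ 0 := by omega
    have hb0 : b ≠ 0 := by omega
    rw [hu.map_mul a b ha0 hb0 h, iha ha0, ihb hb0, h.primeFactors_mul,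
      Finset.prod_union h.disjoint_primeFactors]
    congr 1
    · refine Finset.prod_congr rfl fun p hp => ?_
      rw [Nat.factorization_eq_of_coprime_left h 
        (Nat.mem_primeFactors_iff_mem_primeFactorsList.mp hp)]
    · refine Finset.prod_congr rfl fun p hp => ?_
      rw [Nat.factorization_eq_of_coprime_right h 
        (Nat.mem_primeFactors_iff_mem_primeFactorsList.mp hp)]

theorem lcm_mul_of_coprime {a b m n m' n' : ℕ} (h : a.Coprime b) (hm : m ∣ a) (hn : n ∣ a)
    (hm' : m' ∣ b) (hn' : n' ∣ b) :
    Nat.lcm (m * m') (n * n') = Nat.lcm m n * Nat.lcm m' n' := by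
  have hc : ∀ {x y}, x ∣ a → y ∣ b → x.Coprime y := fun hx hy =>
    (h.coprime_dvd_left hx).coprime_dvd_right hy
  apply Nat.dvd_antisymm
  · exact Nat.lcm_dvd (mul_dvd_mul (Nat.dvd_lcm_left _ _) (Nat.dvd_lcm_left _ _))
      (mul_dvd_mul (Nat.dvd_lcm_right _ _) (Nat.dvd_lcm_right _ _))
  · refine (hc (Nat.lcm_dvd hm hn) (Nat.lcm_dvd hm' hn')).mul_dvd_of_dvd_of_dvd ?_ ?_
    · exact Nat.lcm_dvd ((dvd_mul_right _ _).trans (Nat.dvd_lcm_left _ _))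
        ((dvd_mul_right _ _).trans (Nat.dvd_lcm_right _ _))
    · exact Nat.lcm_dvd ((dvd_mul_left _ _).trans (Nat.dvd_lcm_left _ _))
        ((dvd_mul_left _ _).trans (Nat.dvd_lcm_right _ _))

theorem gcd_mul_of_coprime {a b m m' : ℕ} (h : a.Coprime b) (hm : m ∣ a) (hm' : m' ∣ b) :
    Nat.gcd (m * m') a = m ∧ Nat.gcd (m * m') b = m' := by
  constructor
  · rw [Nat.Coprime.gcd_mul_right_cancel m (h.symm.coprime_dvd_left hm')]
    exact Nat.gcd_eq_left hm
  · rw [Nat.Coprime.gcd_mul_left_cancel m' (h.coprime_dvd_left hm)]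
    exact Nat.gcd_eq_left hm'

/-- For coprime a, b the divisors of ab split uniquely into divisors of a and of b by taking gcds.
Both the lcm and the square condition split accordingly. -/
theorem isMult_lcmSum {u v : ℕ → ℚ} (hu : IsMult u) (hv : IsMult v) : IsMult (lcmSum u v) := by
  constructor
  · have : lcmPairs 1 = {(1, 1)} := by decide +kernel
    rw [lcmSum, this, Finset.sum_singleton, hu.map_one, hv.map_one, one_mul]
  · intro a b ha hb h
    rw [lcmSum, lcmSum, lcmSum, Finset.sum_mul_sum, ← Finset.sum_product']
    symm
    have hab := mul_ne_zero ha hb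
    have hdvd : ∀ {S m n : ℕ}, Nat.lcm m n = S → m ∣ S ∧ n ∣ S := by
      rintro S m n rfl
      exact ⟨Nat.dvd_lcm_left m n, Nat.dvd_lcm_right m n⟩
    refine Finset.sum_nbij' (fun x => (x.1.1 * x.2.1, x.1.2 * x.2.2))
      (fun y => ((Nat.gcd y.1 a, Nat.gcd y.2 a), (Nat.gcd y.1 b, Nat.gcd y.2 b))) ?_ ?_ ?_ ?_ ?_
    · rintro ⟨⟨m, n⟩, m', n'⟩ hx
      rw [Finset.mem_product, mem_lcmPairs ha, mem_lcmPairs hb] at hx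
      obtain ⟨⟨h1, h2⟩, h3, h4⟩ := hx
      rw [mem_lcmPairs hab, lcm_mul_of_coprime h (hdvd h1).1 (hdvd h1).2 (hdvd h3).1 (hdvd h3).2,
        h1, h3, mul_mul_mul_comm]
      exact ⟨rfl, h2.mul h4⟩
    · rintro ⟨m, n⟩ hx
      rw [mem_lcmPairs hab] at hx
      obtain ⟨h1, h2⟩ := hx
      obtain ⟨hm, hn⟩ := hdvd h1
      have em : m = Nat.gcd m a * Nat.gcd m b := by
        rw [← Nat.Coprime.gcd_mul m h, Nat.gcd_eq_left hm]
      have en : n = Nat.gcd n a * Nat.gcd n b := by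
        rw [← Nat.Coprime.gcd_mul n h, Nat.gcd_eq_left hn]
      have hma := Nat.gcd_dvd_right m a
      have hmb := Nat.gcd_dvd_right m b
      have hna := Nat.gcd_dvd_right n a
      have hnb := Nat.gcd_dvd_right n b
      generalize Nat.gcd m a = m1, Nat.gcd m b = m2, Nat.gcd n a = n1, Nat.gcd n b = n2 at *
      subst em en
      rw [lcm_mul_of_coprime h hma hna hmb hnb] at h1
      have hla := Nat.lcm_dvd hma hna
      have hlb := Nat.lcm_dvd hmb hnb
      have e1 : Nat.lcm m1 n1 = a := by
        have := (gcd_mul_of_coprime h hla hlb).1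
        rw [h1, Nat.gcd_mul_right_left] at this
        exact this.symm
      have e2 : Nat.lcm m2 n2 = b := by
        have := (gcd_mul_of_coprime h hla hlb).2
        rw [h1, Nat.gcd_mul_left_left] at this
        exact this.symm
      have h0 : ∀ {x y}, x ∣ y → y ≠ 0 → x ≠ 0 := fun hxy hy hx => by
        subst hx; exact hy (zero_dvd_iff.mp hxy)
      rw [mul_mul_mul_comm, isSquare_mul_iff_of_coprime
        (mul_ne_zero (h0 hma ha) (h0 hna ha)) (mul_ne_zero (h0 hmb hb) (h0 hnb hb))
        (Nat.Coprime.mul_left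
          (Nat.Coprime.mul_right ((h.coprime_dvd_left hma).coprime_dvd_right hmb)
            ((h.coprime_dvd_left hma).coprime_dvd_right hnb))
          (Nat.Coprime.mul_right ((h.coprime_dvd_left hna).coprime_dvd_right hmb)
            ((h.coprime_dvd_left hna).coprime_dvd_right hnb)))] at h2
      rw [Finset.mem_product, mem_lcmPairs ha, mem_lcmPairs hb]
      exact ⟨⟨e1, h2.1⟩, e2, h2.2⟩
    · rintro ⟨⟨m, n⟩, m', n'⟩ hx
      rw [Finset.mem_product, mem_lcmPairs ha, mem_lcmPairs hb] at hx
      obtain ⟨⟨h1, -⟩, h3, -⟩ := hx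
      have e1 := gcd_mul_of_coprime h (hdvd h1).1 (hdvd h3).1
      have e2 := gcd_mul_of_coprime h (hdvd h1).2 (hdvd h3).2
      simp only [e1, e2]
    · rintro ⟨m, n⟩ hx
      rw [mem_lcmPairs hab] at hx
      obtain ⟨hm, hn⟩ := hdvd hx.1
      simp only [← Nat.Coprime.gcd_mul _ h, Nat.gcd_eq_left hm, Nat.gcd_eq_left hn]
    · rintro ⟨⟨m, n⟩, m', n'⟩ hx
      rw [Finset.mem_product, mem_lcmPairs ha, mem_lcmPairs hb] at hx
      obtain ⟨⟨h1, -⟩, h3, -⟩ := hx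
      have h0 : ∀ {x y}, x ∣ y → y ≠ 0 → x ≠ 0 := fun hxy hy hx => by
        subst hx; exact hy (zero_dvd_iff.mp hxy)
      have hc : ∀ {x y}, x ∣ a → y ∣ b → x.Coprime y := fun hx hy =>
        (h.coprime_dvd_left hx).coprime_dvd_right hy
      simp only
      rw [hu.map_mul _ _ (h0 (hdvd h1).1 ha) (h0 (hdvd h3).1 hb) (hc (hdvd h1).1 (hdvd h3).1),
        hv.map_mul _ _ (h0 (hdvd h1).2 ha) (h0 (hdvd h3).2 hb) (hc (hdvd h1).2 (hdvd h3).2)]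
      ring

/-- The sum of `v (p ^ b)` over all `b < t` of the same parity as `t`. -/
def paritySum (v : ℕ → ℚ) (p t : ℕ) : ℚ :=
  ∑ b ∈ Finset.range t, if Even (t + b) then v (p ^ b) else 0

theorem paritySum_zero (v : ℕ → ℚ) (p : ℕ) : paritySum v p 0 = 0 := rfl

theorem paritySum_one (v : ℕ → ℚ) (p : ℕ) : paritySum v p 1 = 0 := by simp [paritySum]

theorem paritySum_add_two (v : ℕ → ℚ) (p t : ℕ) :
    paritySum v p (t + 2) = v (p ^ t) + paritySum v p t := by
  have e1 : ¬ Even (t + 2 + (t + 1)) := by rw [Nat.even_iff]; omega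
  have e2 : Even (t + 2 + t) := by rw [Nat.even_iff]; omega
  rw [paritySum, Finset.sum_range_succ, Finset.sum_range_succ, if_neg e1, if_pos e2, add_zero,
    add_comm, paritySum]
  congr 1
  refine Finset.sum_congr rfl fun b _ => ?_
  have : Even (t + 2 + b) ↔ Even (t + b) := by
    rw [Nat.even_iff, Nat.even_iff]; omega
  simp only [this]

/-- Exponents a, b contribute when their maximum is t and they have the same parity: either both
equal t, or exactly one is smaller. -/
theorem lcmSum_prime_pow {p : ℕ} (hp : p.Prime) (u v : ℕ → ℚ) (t : ℕ) :
    lcmSum u v (p ^ t) = u (p ^ t) * v (p ^ t) + u (p ^ t) * paritySum v p t +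
      v (p ^ t) * paritySum u p t := by
  have hcond : ∀ a b, (Nat.lcm (p ^ a) (p ^ b) = p ^ t ∧ IsSquare (p ^ a * p ^ b)) ↔
      (max a b = t ∧ Even (a + b)) := by
    intro a b
    refine and_congr ?_ ?_
    · have : Nat.lcm (p ^ a) (p ^ b) = p ^ max a b := by
        rcases le_total a b with h | h
        · rw [max_eq_right h]
          exact Nat.lcm_eq_right_iff_dvd.mpr (pow_dvd_pow p h)
        · rw [max_eq_left h]
          exact Nat.lcm_eq_left_iff_dvd.mpr (pow_dvd_pow p h)
      rw [this, Nat.pow_right_inj hp.two_le]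
    · rw [← pow_add, isSquare_iff_even_factorization (pow_ne_zero _ hp.ne_zero),
        hp.factorization_pow]
      constructor
      · intro h
        simpa using h p
      · intro h q
        by_cases hq : q = p
        · rw [hq, Finsupp.single_eq_same]; exact h
        · rw [Finsupp.single_eq_of_ne hq]; exact Even.zero
  rw [lcmSum, lcmPairs, Finset.sum_filter, Finset.sum_product, Nat.sum_divisors_prime_pow hp]
  simp only [Nat.sum_divisors_prime_pow hp, hcond]
  rw [Finset.sum_range_succ]
  have h1 : ∀ a ∈ Finset.range t, (∑ b ∈ Finset.range (t + 1),
      if max a b = t ∧ Even (a + b) then u (p ^ a) * v (p ^ b) else 0) =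
      v (p ^ t) * if Even (t + a) then u (p ^ a) else 0 := by
    intro a ha
    rw [Finset.mem_range] at ha
    rw [Finset.sum_range_succ, Finset.sum_eq_zero, zero_add, max_eq_right ha.le, add_comm a t]
    · by_cases he : Even (t + a) <;> simp [he, mul_comm]
    · intro b hb
      rw [Finset.mem_range] at hb
      rw [if_neg]
      rintro ⟨h, -⟩
      have := max_lt ha hb
      omega
  have h2 : (∑ b ∈ Finset.range (t + 1),
      if max t b = t ∧ Even (t + b) then u (p ^ t) * v (p ^ b) else 0) =
      u (p ^ t) * paritySum v p t + u (p ^ t) * v (p ^ t) := by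
    rw [Finset.sum_range_succ, max_self, if_pos ⟨rfl, t, rfl⟩, paritySum, Finset.mul_sum]
    congr 1
    refine Finset.sum_congr rfl fun b hb => ?_
    rw [Finset.mem_range] at hb
    rw [max_eq_left hb.le]
    by_cases he : Even (t + b) <;> simp [he]
  rw [Finset.sum_congr rfl h1, h2, ← Finset.mul_sum, paritySum, paritySum]
  ring

/-! ### Square roots modulo prime powers -/

theorem rootCount_mul {m n : ℕ} (h : m.Coprime n) (d : ℕ) :
    rootCount d (m * n) = rootCount d m * rootCount d n := by
  let e := ZMod.chineseRemainder h
  rw [rootCount, rootCount, rootCount, ← Set.ncard_prod,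
    ← Set.ncard_image_of_injective _ e.injective]
  congr 1
  ext ⟨x, y⟩
  simp only [Set.mem_image, Set.mem_ofPred_eq, Set.mem_prod]
  constructor
  · rintro ⟨z, hz, hzxy⟩
    have h1 := congrArg e hz
    rw [map_pow, hzxy, map_neg, map_natCast] at h1
    exact ⟨congrArg Prod.fst h1, congrArg Prod.snd h1⟩
  · rintro ⟨hx, hy⟩
    refine ⟨e.symm (x, y), e.injective ?_, e.apply_symm_apply _⟩
    rw [map_pow, e.apply_symm_apply, map_neg, map_natCast]
    exact Prod.ext hx hy

theorem isMult_rootCount (d : ℕ) : IsMult fun m => (rootCount d m : ℚ) :=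
  ⟨by simp [rootCount_one], fun m n _ _ h => by rw [rootCount_mul h, Nat.cast_mul]⟩

theorem isMult_cubicProd : IsMult fun m => cubicProd m m.primeFactors :=
  ⟨by simp [cubicProd], fun _ _ hm hn h => cubicProd_mul hm hn h⟩

theorem dvd_prime_pow_succ (p k : ℕ) : p ∣ p ^ (k + 1) := dvd_pow_self p (Nat.succ_ne_zero k)

theorem isUnit_of_castHom_ne_zero {p k : ℕ} (hp : p.Prime) {z : ZMod (p ^ (k + 1))}
    (hz : ZMod.castHom (dvd_prime_pow_succ p k) (ZMod p) z ≠ 0) : IsUnit z := by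
  have : NeZero (p ^ (k + 1)) := ⟨pow_ne_zero _ hp.ne_zero⟩
  obtain ⟨n, rfl⟩ := ZMod.natCast_zmod_surjective z
  rw [map_natCast, Ne, ZMod.natCast_eq_zero_iff] at hz
  rw [ZMod.isUnit_iff_coprime]
  exact (((Nat.Prime.coprime_iff_not_dvd hp).mpr hz).symm).pow_right _

/-- If a² ≡ -d modulo p, then raising to the power p^k gives a congruence modulo p^(k+1). As p^k =
2j + 1 is odd and -d is a unit, -d is the square of a^(p^k) (-d)^(-j). -/
theorem isSquare_neg_prime_pow_iff {p k d : ℕ} (hp : p.Prime) (hp2 : p ≠ 2) (hd : ¬ p ∣ d) :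
    IsSquare (-(d : ZMod (p ^ (k + 1)))) ↔ IsSquare (-(d : ZMod p)) := by
  constructor
  · intro h
    simpa using h.map (ZMod.castHom (dvd_prime_pow_succ p k) (ZMod p))
  · rintro ⟨x, hx⟩
    obtain ⟨a, rfl⟩ := ZMod.intCast_surjective x
    have h1 : ((p : ℕ) : ℤ) ∣ -(d : ℤ) - a ^ 2 := by
      rw [← ZMod.intCast_zmod_eq_zero_iff_dvd]
      push_cast
      rw [hx]
      ring
    have h2 := dvd_sub_pow_of_dvd_sub h1 k
    have h3 : (-(d : ZMod (p ^ (k + 1)))) ^ p ^ k = ((a : ZMod (p ^ (k + 1))) ^ 2) ^ p ^ k := by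
      have := (ZMod.intCast_zmod_eq_zero_iff_dvd _ (p ^ (k + 1))).mpr (by exact_mod_cast h2)
      push_cast at this
      exact sub_eq_zero.mp this
    obtain ⟨j, hj⟩ : Odd (p ^ k) := (hp.odd_of_ne_two hp2).pow
    have hu : IsUnit (-(d : ZMod (p ^ (k + 1)))) := by
      rw [IsUnit.neg_iff, ZMod.isUnit_iff_coprime]
      exact (((Nat.Prime.coprime_iff_not_dvd hp).mpr hd).symm).pow_right _
    obtain ⟨u, hu⟩ := hu
    rw [← hu] at h3 ⊢
    refine ⟨(a : ZMod (p ^ (k + 1))) ^ p ^ k * ((u⁻¹ ^ j : (ZMod (p ^ (k + 1)))ˣ) :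
      ZMod (p ^ (k + 1))), ?_⟩
    have h4 : (u : ZMod (p ^ (k + 1))) ^ p ^ k = u * ((u ^ j : (ZMod (p ^ (k + 1)))ˣ) :
        ZMod (p ^ (k + 1))) ^ 2 := by
      rw [hj]; push_cast; ring
    have h5 : ((u ^ j : (ZMod (p ^ (k + 1)))ˣ) : ZMod (p ^ (k + 1))) *
        ((u⁻¹ ^ j : (ZMod (p ^ (k + 1)))ˣ) : ZMod (p ^ (k + 1))) = 1 := by
      rw [← Units.val_mul, ← mul_pow, mul_inv_cancel, one_pow, Units.val_one]
    rw [h4] at h3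
    generalize ((u ^ j : (ZMod (p ^ (k + 1)))ˣ) : ZMod (p ^ (k + 1))) = b at *
    generalize ((u⁻¹ ^ j : (ZMod (p ^ (k + 1)))ˣ) : ZMod (p ^ (k + 1))) = c at *
    rw [← pow_mul, mul_comm 2, pow_mul] at h3
    linear_combination c ^ 2 * h3 - (u : ZMod (p ^ (k + 1))) * (b * c + 1) * h5

/-- From (y - x)(y + x) = 0 one factor is a unit, since p cannot divide both without dividing 2x. So
the roots are ±x, and they are different. -/
theorem rootCount_prime_pow {p d k : ℕ} (hp : p.Prime) (hp2 : p ≠ 2) (hd : ¬ p ∣ d)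
    [Decidable (IsSquare (-(d : ZMod p)))] : rootCount d (p ^ (k + 1)) = if IsSquare (-(d : ZMod p)) then 2 else 0 := by
  have : Fact p.Prime := ⟨hp⟩
  have hdp : (d : ZMod p) ≠ 0 := by rwa [Ne, ZMod.natCast_eq_zero_iff]
  have h2 : (2 : ZMod p) ≠ 0 := by
    intro h
    have : ((2 : ℕ) : ZMod p) = 0 := by exact_mod_cast h
    rw [ZMod.natCast_eq_zero_iff] at this
    exact hp2 ((Nat.prime_dvd_prime_iff_eq hp Nat.prime_two).mp this)
  simp only [← isSquare_neg_prime_pow_iff (k := k) hp hp2 hd, rootCount]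
  split_ifs with h
  · obtain ⟨x, hx⟩ := h
    let π := ZMod.castHom (dvd_prime_pow_succ p k) (ZMod p)
    have hπ : ∀ y, y ^ 2 = -(d : ZMod (p ^ (k + 1))) → π y ≠ 0 := by
      intro y hy h0
      have := congrArg π hy
      rw [map_pow, h0, map_neg, map_natCast] at this
      apply hdp
      linear_combination this
    have hx' : x ^ 2 = -(d : ZMod (p ^ (k + 1))) := by rw [hx, sq]
    have hset : {y | y ^ 2 = -(d : ZMod (p ^ (k + 1)))} = {x, -x} := by
      ext y
      simp only [Set.mem_ofPred_eq, Set.mem_insert_iff, Set.mem_singleton_iff]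
      constructor
      · intro hy
        have hprod : (y - x) * (y + x) = 0 := by linear_combination hy - hx'
        by_cases h1 : π (y - x) = 0
        · have h3 : π (y + x) ≠ 0 := by
            intro h3
            rw [map_sub] at h1
            rw [map_add] at h3
            have : 2 * π x = 0 := by linear_combination h3 - h1
            exact hπ x hx' ((mul_eq_zero.mp this).resolve_left h2)
          have h4 := (isUnit_of_castHom_ne_zero hp h3).mul_left_eq_zero.mp hprod
          exact Or.inl (sub_eq_zero.mp h4)
        · have h4 := (isUnit_of_castHom_ne_zero hp h1).mul_right_eq_zero.mp hprod
          exact Or.inr (eq_neg_of_add_eq_zero_left h4)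
      · rintro (rfl | rfl)
        · exact hx'
        · rw [neg_sq, hx']
    rw [hset, Set.ncard_pair]
    intro hxx
    have : 2 * π x = 0 := by
      have := congrArg π hxx
      rw [map_neg] at this
      linear_combination this
    exact hπ x hx' ((mul_eq_zero.mp this).resolve_left h2)
  · have : {y | y ^ 2 = -(d : ZMod (p ^ (k + 1)))} = ∅ := by
      rw [Set.eq_empty_iff_forall_notMem]
      intro y hy
      exact h ⟨y, by rw [← sq]; exact hy.symm⟩
    rw [this, Set.ncard_empty]

/-- -3 = (2w + 1)² for a root w of w² + w + 1, an element of order 3, which exists in the unit group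
exactly when 3 divides p - 1. -/
theorem isSquare_neg_three_iff {p : ℕ} (hp : p.Prime) (hp2 : p ≠ 2) (hp3 : p ≠ 3) :
    IsSquare (-3 : ZMod p) ↔ p % 6 = 1 := by
  have : Fact p.Prime := ⟨hp⟩
  have hne : ∀ q : ℕ, q.Prime → p ≠ q → (q : ZMod p) ≠ 0 := by
    intro q hq hpq h
    rw [ZMod.natCast_eq_zero_iff] at h
    exact hpq ((Nat.prime_dvd_prime_iff_eq hp hq).mp h)
  have h2 : (2 : ZMod p) ≠ 0 := by exact_mod_cast hne 2 Nat.prime_two hp2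
  have h3 : (3 : ZMod p) ≠ 0 := by exact_mod_cast hne 3 Nat.prime_three hp3
  have hodd := Nat.odd_iff.mp (hp.odd_of_ne_two hp2)
  have hmod3 : p % 3 ≠ 0 := fun h =>
    hp3 ((Nat.prime_dvd_prime_iff_eq Nat.prime_three hp).mp (Nat.dvd_of_mod_eq_zero h)).symm
  have hp1 := hp.one_lt
  constructor
  · rintro ⟨x, hx⟩
    obtain ⟨w, hw⟩ : ∃ w : ZMod p, 2 * w = x - 1 := ⟨(x - 1) / 2, by field_simp⟩
    have hw2 : w ^ 2 + w + 1 = 0 := by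
      have : (4 : ZMod p) * (w ^ 2 + w + 1) = 0 := by linear_combination (2 * w + x + 1) * hw - hx
      have h4 : (4 : ZMod p) ≠ 0 := by
        have : (4 : ZMod p) = 2 * 2 := by norm_num
        rw [this]
        exact mul_ne_zero h2 h2
      exact (mul_eq_zero.mp this).resolve_left h4
    have hord : orderOf w = 3 := by
      refine orderOf_eq_prime (by linear_combination (w - 1) * hw2) ?_
      rintro rfl
      apply h3
      linear_combination hw2
    have hdvd : 3 ∣ p - 1 := by
      rw [← hord]
      refine orderOf_dvd_of_pow_eq_one (ZMod.pow_card_sub_one_eq_one ?_)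
      rintro rfl
      simp at hw2
    omega
  · intro hmod
    have : Fact (Nat.Prime 3) := ⟨Nat.prime_three⟩
    obtain ⟨u, hu⟩ := exists_prime_orderOf_dvd_card (G := (ZMod p)ˣ) 3 (by
      rw [ZMod.card_units]; omega)
    have h1 : ((u : ZMod p)) ^ 3 = 1 := by
      rw [← Units.val_pow_eq_pow_val, ← hu, pow_orderOf_eq_one, Units.val_one]
    have hu1 : (u : ZMod p) ≠ 1 := by
      intro h
      rw [Units.val_eq_one] at h
      rw [h, orderOf_one] at hu
      omega
    have h4 : (u : ZMod p) ^ 2 + u + 1 = 0 := by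
      have : ((u : ZMod p) - 1) * ((u : ZMod p) ^ 2 + u + 1) = 0 := by linear_combination h1
      exact (mul_eq_zero.mp this).resolve_left (sub_ne_zero.mpr hu1)
    exact ⟨2 * u + 1, by linear_combination -4 * h4⟩

theorem rootCount_one_prime_pow {p t : ℕ} (hp : p.Prime) (hp2 : p ≠ 2) (ht : t ≠ 0) :
    rootCount 1 (p ^ t) = if p % 4 = 1 then 2 else 0 := by
  have : Fact p.Prime := ⟨hp⟩
  obtain ⟨k, rfl⟩ := Nat.exists_eq_succ_of_ne_zero ht
  have hodd := Nat.odd_iff.mp (hp.odd_of_ne_two hp2)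
  rw [rootCount_prime_pow hp hp2 hp.not_dvd_one, Nat.cast_one]
  refine if_congr (ZMod.exists_sq_eq_neg_one_iff.trans ?_) rfl rfl
  omega

theorem rootCount_two_prime_pow {p t : ℕ} (hp : p.Prime) (hp2 : p ≠ 2) (ht : t ≠ 0) :
    rootCount 2 (p ^ t) = if OneThreeModEight p then 2 else 0 := by
  have : Fact p.Prime := ⟨hp⟩
  obtain ⟨k, rfl⟩ := Nat.exists_eq_succ_of_ne_zero ht
  rw [rootCount_prime_pow hp hp2 fun h =>
    hp2 ((Nat.prime_dvd_prime_iff_eq hp Nat.prime_two).mp h)]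
  exact if_congr (ZMod.exists_sq_eq_neg_two_iff hp2) rfl rfl

theorem rootCount_three_prime_pow {p t : ℕ} (hp : p.Prime) (hp2 : p ≠ 2) (hp3 : p ≠ 3)
    (ht : t ≠ 0) : rootCount 3 (p ^ t) = if p % 6 = 1 then 2 else 0 := by
  obtain ⟨k, rfl⟩ := Nat.exists_eq_succ_of_ne_zero ht
  classical
  rw [rootCount_prime_pow hp hp2 fun h =>
    hp3 ((Nat.prime_dvd_prime_iff_eq hp Nat.prime_three).mp h)]
  exact if_congr (isSquare_neg_three_iff hp hp2 hp3) rfl rfl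

theorem rootCount_three_three_pow {t : ℕ} (ht : t ≠ 0) :
    rootCount 3 (3 ^ t) = if t = 1 then 1 else 0 := by
  split_ifs with h
  · rw [h, pow_one, rootCount_three.2.2]
  · have h9 : 9 ∣ 3 ^ t := pow_dvd_pow 3 (show 2 ≤ t by omega)
    have : {x : ZMod (3 ^ t) | x ^ 2 = -((3 : ℕ) : ZMod (3 ^ t))} = ∅ := by
      rw [Set.eq_empty_iff_forall_notMem]
      intro x hx
      have h1 := congrArg (ZMod.castHom h9 (ZMod 9)) hx
      rw [map_pow, map_neg, map_natCast] at h1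
      generalize ZMod.castHom h9 (ZMod 9) x = y at h1
      revert y
      decide
    rw [rootCount, this, Set.ncard_empty]

/-! ### The local sums -/

theorem two_step {P : ℕ → Prop} (h1 : P 1) (h2 : P 2) (h : ∀ t, t ≠ 0 → P t → P (t + 2)) :
    ∀ t, t ≠ 0 → P t
  | 0 => fun h => absurd rfl h
  | 1 => fun _ => h1
  | 2 => fun _ => h2
  | t + 3 => fun _ => h (t + 1) (Nat.succ_ne_zero t) (two_step h1 h2 h (t + 1) (Nat.succ_ne_zero t))

theorem paritySum_of_eq_two {u : ℕ → ℚ} {p : ℕ} (h1 : u 1 = 1)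
    (h : ∀ t, t ≠ 0 → u (p ^ t) = 2) : ∀ t, t ≠ 0 → paritySum u p t = t - 1 := by
  refine two_step ?_ ?_ ?_
  · rw [paritySum_one]; norm_num
  · rw [paritySum_add_two, pow_zero, h1, paritySum_zero]; norm_num
  · intro t ht ih
    rw [paritySum_add_two, h t ht, ih]
    push_cast
    ring

/-- Only the exponent 0 contributes, and it has the right parity when t is even. This is the origin
of the conditions on even exponents. -/
theorem paritySum_of_eq_zero {u : ℕ → ℚ} {p : ℕ} (h1 : u 1 = 1)
    (h : ∀ t, t ≠ 0 → u (p ^ t) = 0) : ∀ t, t ≠ 0 →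
    paritySum u p t = if Even t then 1 else 0 := by
  refine two_step ?_ ?_ ?_
  · rw [paritySum_one, if_neg (by decide)]
  · rw [paritySum_add_two, pow_zero, h1, paritySum_zero, if_pos (by decide)]; norm_num
  · intro t ht ih
    rw [paritySum_add_two, h t ht, ih, zero_add]
    exact if_congr (by rw [Nat.even_iff, Nat.even_iff]; omega) rfl rfl

theorem paritySum_cubicProd {p : ℕ} (hp : p.Prime) : ∀ t, t ≠ 0 →
    paritySum (fun m => cubicProd m m.primeFactors) p t = ((p : ℚ) ^ (t - 1) - 1) / (p - 1) := by
  have hp1 : (p : ℚ) - 1 ≠ 0 := by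
    have : (1 : ℚ) < p := by exact_mod_cast hp.one_lt
    linarith
  refine two_step ?_ ?_ ?_
  · rw [paritySum_one]; simp
  · rw [paritySum_add_two, pow_zero, paritySum_zero]
    simp [cubicProd, hp1]
  · intro t ht ih
    obtain ⟨k, rfl⟩ := Nat.exists_eq_succ_of_ne_zero ht
    rw [paritySum_add_two, ih, cubicProd_prime_pow hp]
    simp only [Nat.succ_eq_add_one, Nat.add_sub_cancel, show k + 1 + 2 - 1 = k + 2 by omega]
    field_simp
    ring

theorem paritySum_rootCount_three_three {t : ℕ} (ht : t ≠ 0) :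
    paritySum (fun m => (rootCount 3 m : ℚ)) 3 t = if t = 1 then 0 else 1 := by
  have key : ∀ t, t ≠ 0 → paritySum (fun m => (rootCount 3 m : ℚ)) 3 (t + 1) = 1 := by
    refine two_step ?_ ?_ ?_
    · rw [paritySum_add_two, pow_zero, paritySum_zero, rootCount_one]; norm_num
    · rw [show 2 + 1 = 1 + 2 from rfl, paritySum_add_two, paritySum_one,
        rootCount_three_three_pow one_ne_zero]
      norm_num
    · intro t ht ih
      rw [show t + 2 + 1 = t + 1 + 2 from rfl, paritySum_add_two, ih,
        rootCount_three_three_pow (Nat.succ_ne_zero t), if_neg (by omega)]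
      norm_num
  split_ifs with h
  · rw [h, paritySum_one]
  · obtain ⟨k, rfl⟩ := Nat.exists_eq_succ_of_ne_zero ht
    exact key k (by omega)

/-- The number of square roots of `-d` as a rational number. -/
noncomputable def rootFun (d : ℕ) : ℕ → ℚ := fun m => (rootCount d m : ℚ)

/-- The function `f` on odd numbers. -/
def cubicFun : ℕ → ℚ := fun m => cubicProd m m.primeFactors

theorem isMult_rootFun (d : ℕ) : IsMult (rootFun d) := isMult_rootCount d

theorem isMult_cubicFun : IsMult cubicFun := isMult_cubicProd

theorem cubicFun_prime_pow {p t : ℕ} (hp : p.Prime) (ht : t ≠ 0) :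
    cubicFun (p ^ t) = ((p : ℚ) + 1) * (p : ℚ) ^ (t - 1) := by
  obtain ⟨k, rfl⟩ := Nat.exists_eq_succ_of_ne_zero ht
  exact cubicProd_prime_pow hp

/-! ### Values at prime powers -/

section Local

variable {p t : ℕ} {u v : ℕ → ℚ}

/-- With two roots on both sides the value is 2·2 + 2(t - 1) + 2(t - 1) = 4t. If only one side has
roots, its value 2 is paired with the exponent 0 on the other side. -/
theorem lcmSum_prime_pow_of_ite (hp : p.Prime) (hu1 : u 1 = 1) (hv1 : v 1 = 1) {c c' : Prop}
    [Decidable c] [Decidable c'] (hu : ∀ t, t ≠ 0 → u (p ^ t) = if c then 2 else 0)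
    (hv : ∀ t, t ≠ 0 → v (p ^ t) = if c' then 2 else 0) (ht : t ≠ 0) :
    lcmSum u v (p ^ t) = if c ∧ c' then 4 * (t : ℚ) else if c ∨ c' then
      if Even t then 2 else 0 else 0 := by
  rw [lcmSum_prime_pow hp, hu t ht, hv t ht]
  by_cases hc : c <;> by_cases hc' : c'
  · simp only [hc, hc', if_true, and_self] at hu hv ⊢
    rw [paritySum_of_eq_two hu1 hu t ht, paritySum_of_eq_two hv1 hv t ht]
    ring
  · simp only [hc, hc', if_true, if_false, and_false, true_or] at hu hv ⊢
    rw [paritySum_of_eq_zero hv1 hv t ht]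
    split_ifs <;> ring
  · simp only [hc, hc', if_true, if_false, false_and, or_true] at hu hv ⊢
    rw [paritySum_of_eq_zero hu1 hu t ht]
    split_ifs <;> ring
  · simp [hc, hc']

theorem paritySum_cubicFun (hp : p.Prime) (ht : t ≠ 0) :
    paritySum cubicFun p t = ((p : ℚ) ^ (t - 1) - 1) / (p - 1) :=
  paritySum_cubicProd hp t ht

theorem lcmSum_prime_pow_cubicFun (hp : p.Prime) (hu1 : u 1 = 1) {c : Prop}
    [Decidable c] (hu : ∀ t, t ≠ 0 → u (p ^ t) = if c then 2 else 0) (ht : t ≠ 0) :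
    lcmSum u cubicFun (p ^ t) = if c then ((t : ℚ) + 1) * ((p : ℚ) + 1) * (p : ℚ) ^ (t - 1) +
      2 * ((p : ℚ) ^ (t - 1) - 1) / ((p : ℚ) - 1) else
      if Even t then ((p : ℚ) + 1) * (p : ℚ) ^ (t - 1) else 0 := by
  rw [lcmSum_prime_pow hp, hu t ht, cubicFun_prime_pow hp ht, paritySum_cubicFun hp ht]
  by_cases hc : c
  · simp only [hc, if_true] at hu ⊢
    rw [paritySum_of_eq_two hu1 hu t ht]
    ring
  · simp only [hc, if_false] at hu ⊢
    rw [paritySum_of_eq_zero hu1 hu t ht]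
    split_ifs <;> ring

theorem lcmSum_cubicFun_cubicFun_prime_pow (hp : p.Prime) (ht : t ≠ 0) :
    lcmSum cubicFun cubicFun (p ^ t) = ((p : ℚ) + 1) / ((p : ℚ) - 1) * (p : ℚ) ^ (t - 1) *
      ((p : ℚ) ^ (t + 1) + (p : ℚ) ^ (t - 1) - 2) := by
  have hp1 : (p : ℚ) - 1 ≠ 0 := by
    have : (1 : ℚ) < p := by exact_mod_cast hp.one_lt
    linarith
  obtain ⟨k, rfl⟩ := Nat.exists_eq_succ_of_ne_zero ht
  rw [lcmSum_prime_pow hp, cubicFun_prime_pow hp ht, paritySum_cubicFun hp ht]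
  simp only [Nat.succ_eq_add_one, Nat.add_sub_cancel]
  field_simp
  ring

theorem rootFun_three_three_pow (ht : t ≠ 0) : rootFun 3 (3 ^ t) = if t = 1 then 1 else 0 := by
  rw [rootFun, rootCount_three_three_pow ht]
  split_ifs <;> simp

theorem paritySum_rootFun_three_three (ht : t ≠ 0) :
    paritySum (rootFun 3) 3 t = if t = 1 then 0 else 1 := paritySum_rootCount_three_three ht

theorem rootFun_one_prime_pow (hp : p.Prime) (hp2 : p ≠ 2) (ht : t ≠ 0) :
    rootFun 1 (p ^ t) = if p % 4 = 1 then 2 else 0 := by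
  rw [rootFun, rootCount_one_prime_pow hp hp2 ht]
  split_ifs <;> simp

theorem rootFun_two_prime_pow (hp : p.Prime) (hp2 : p ≠ 2) (ht : t ≠ 0) :
    rootFun 2 (p ^ t) = if OneThreeModEight p then 2 else 0 := by
  rw [rootFun, rootCount_two_prime_pow hp hp2 ht]
  split_ifs <;> simp

theorem rootFun_three_prime_pow (hp : p.Prime) (hp2 : p ≠ 2) (hp3 : p ≠ 3) (ht : t ≠ 0) :
    rootFun 3 (p ^ t) = if p % 6 = 1 then 2 else 0 := by
  rw [rootFun, rootCount_three_prime_pow hp hp2 hp3 ht]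
  split_ifs <;> simp

theorem lcmSum_three_three_three_pow (ht : t ≠ 0) :
    lcmSum (rootFun 3) (rootFun 3) (3 ^ t) = if t = 1 then 1 else 0 := by
  rw [lcmSum_prime_pow Nat.prime_three, rootFun_three_three_pow ht,
    paritySum_rootFun_three_three ht]
  split_ifs <;> norm_num

theorem lcmSum_three_one_three_pow (ht : t ≠ 0) :
    lcmSum (rootFun 3) (rootFun 1) (3 ^ t) = 0 := by
  have h : ∀ t, t ≠ 0 → rootFun 1 (3 ^ t) = 0 := fun t ht => by
    rw [rootFun_one_prime_pow Nat.prime_three (by norm_num) ht, if_neg (by norm_num)]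
  rw [lcmSum_prime_pow Nat.prime_three, rootFun_three_three_pow ht, h t ht,
    paritySum_of_eq_zero (isMult_rootFun 1).map_one h t ht]
  by_cases h1 : t = 1
  · rw [h1]; norm_num
  · rw [if_neg h1]; ring

/-- For t = 1 the value comes from the product of the two functions, for t > 1 from the parity sum
of the first. It never vanishes, so the exponent of 3 is unrestricted for types 2 and 4. -/
theorem lcmSum_three_two_three_pow (ht : t ≠ 0) :
    lcmSum (rootFun 3) (rootFun 2) (3 ^ t) = 2 := by
  have h : ∀ t, t ≠ 0 → rootFun 2 (3 ^ t) = 2 := fun t ht => by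
    rw [rootFun_two_prime_pow Nat.prime_three (by norm_num) ht, if_pos (Or.inr rfl)]
  rw [lcmSum_prime_pow Nat.prime_three, rootFun_three_three_pow ht, h t ht,
    paritySum_of_eq_two (isMult_rootFun 2).map_one h t ht, paritySum_rootFun_three_three ht]
  by_cases h1 : t = 1
  · rw [h1]; norm_num
  · simp [h1]

theorem lcmSum_three_cubicFun_three_pow (ht : t ≠ 0) :
    lcmSum (rootFun 3) cubicFun (3 ^ t) = 4 * 3 ^ (t - 1) := by
  rw [lcmSum_prime_pow Nat.prime_three, rootFun_three_three_pow ht,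
    cubicFun_prime_pow Nat.prime_three ht, paritySum_cubicFun Nat.prime_three ht,
    paritySum_rootFun_three_three ht]
  by_cases h1 : t = 1
  · rw [h1]; norm_num
  · simp only [h1, if_false]
    push_cast
    ring

end Local

/-! ### Product formulas -/

theorem prod_two_classes (P : Finset ℕ) (c c' e : ℕ → Prop) [DecidablePred c] [DecidablePred c']
    [DecidablePred e] (t : ℕ → ℚ) :
    (∏ p ∈ P, if c p ∧ c' p then 4 * t p else if c p ∨ c' p then
      if e p then 2 else 0 else 0) =
    if (∀ p ∈ P, c p ∨ c' p) ∧ ∀ p ∈ P, ¬ (c p ∧ c' p) → e p then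
      2 ^ ((P.filter fun p => c p ∧ ¬ c' p).card + (P.filter fun p => c' p ∧ ¬ c p).card) *
        4 ^ (P.filter fun p => c p ∧ c' p).card * ∏ p ∈ P.filter fun p => c p ∧ c' p, t p
    else 0 := by
  split_ifs with h
  · rw [pow_add, ← Finset.prod_const, ← Finset.prod_const, ← Finset.prod_const,
      Finset.prod_filter, Finset.prod_filter, Finset.prod_filter, Finset.prod_filter,
      ← Finset.prod_mul_distrib, ← Finset.prod_mul_distrib, ← Finset.prod_mul_distrib]
    refine Finset.prod_congr rfl fun p hp => ?_
    have h1 := h.1 p hp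
    have h2 := h.2 p hp
    by_cases hc : c p <;> by_cases hc' : c' p <;> simp_all
  · rw [not_and_or] at h
    push Not at h
    obtain ⟨p, hp, h1, h2⟩ | ⟨p, hp, h1, h2⟩ := h
    · exact Finset.prod_eq_zero hp (by simp [h1, h2])
    · refine Finset.prod_eq_zero hp ?_
      rw [if_neg (fun h => h1 h.1 h.2)]
      simp [h2]

theorem prod_ite_two (P : Finset ℕ) (c : ℕ → Prop) [DecidablePred c] :
    (∏ p ∈ P, if c p then (2 : ℚ) else 0) = if ∀ p ∈ P, c p then 2 ^ P.card else 0 := by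
  split_ifs with h
  · rw [← Finset.prod_const]
    exact Finset.prod_congr rfl fun p hp => if_pos (h p hp)
  · push Not at h
    obtain ⟨p, hp, h1⟩ := h
    exact Finset.prod_eq_zero hp (if_neg h1)

theorem prod_ite_four (P : Finset ℕ) (c : ℕ → Prop) [DecidablePred c] (t : ℕ → ℚ) :
    (∏ p ∈ P, if c p then 4 * t p else 0) =
      if ∀ p ∈ P, c p then 4 ^ P.card * ∏ p ∈ P, t p else 0 := by
  split_ifs with h
  · rw [← Finset.prod_const, ← Finset.prod_mul_distrib]
    exact Finset.prod_congr rfl fun p hp => if_pos (h p hp)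
  · push Not at h
    obtain ⟨p, hp, h1⟩ := h
    exact Finset.prod_eq_zero hp (if_neg h1)

theorem prod_ite_even (P : Finset ℕ) (c e : ℕ → Prop) [DecidablePred c] [DecidablePred e]
    (a b : ℕ → ℚ) : (∏ p ∈ P, if c p then a p else if e p then b p else 0) =
      if ∀ p ∈ P.filter (fun p => ¬ c p), e p then
        (∏ p ∈ P.filter c, a p) * ∏ p ∈ P.filter (fun p => ¬ c p), b p else 0 := by
  rw [Finset.prod_ite]
  split_ifs with h
  · congr 1
    exact Finset.prod_congr rfl fun p hp => if_pos (h p hp)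
  · push Not at h
    obtain ⟨p, hp, h1⟩ := h
    rw [Finset.prod_eq_zero hp (if_neg h1), mul_zero]

section Global

variable {S : ℕ}

theorem prime_ne_two_of_mem (hodd : Odd S) {p : ℕ} (hp : p ∈ S.primeFactors) :
    p.Prime ∧ p ≠ 2 ∧ S.factorization p ≠ 0 := by
  have hpp := Nat.prime_of_mem_primeFactors hp
  have hd := Nat.dvd_of_mem_primeFactors hp
  refine ⟨hpp, ?_, ?_⟩
  · rintro rfl
    exact absurd (even_iff_two_dvd.mpr hd) (Nat.not_even_iff_odd.mpr hodd)
  · exact (hpp.factorization_pos_of_dvd hodd.pos.ne' hd).ne'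

theorem lcmSum_eq_prod {u v : ℕ → ℚ} (hu : IsMult u) (hv : IsMult v) (hodd : Odd S)
    {τ : ℕ → ℕ → ℚ} (h : ∀ p t, p.Prime → p ≠ 2 → t ≠ 0 → lcmSum u v (p ^ t) = τ p t) :
    lcmSum u v S = ∏ p ∈ S.primeFactors, τ p (S.factorization p) := by
  rw [(isMult_lcmSum hu hv).eq_prod hodd.pos.ne']
  refine Finset.prod_congr rfl fun p hp => ?_
  obtain ⟨h1, h2, h3⟩ := prime_ne_two_of_mem hodd hp
  exact h p _ h1 h2 h3

theorem rootFun_one_eq (hodd : Odd S) : rootFun 1 S =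
    if ∀ p ∈ S.primeFactors, p % 4 = 1 then 2 ^ S.primeFactors.card else 0 := by
  rw [(isMult_rootFun 1).eq_prod hodd.pos.ne', ← prod_ite_two]
  refine Finset.prod_congr rfl fun p hp => ?_
  obtain ⟨h1, h2, h3⟩ := prime_ne_two_of_mem hodd hp
  exact rootFun_one_prime_pow h1 h2 h3

theorem rootFun_two_eq (hodd : Odd S) : rootFun 2 S =
    if ∀ p ∈ S.primeFactors, OneThreeModEight p then 2 ^ S.primeFactors.card else 0 := by
  rw [(isMult_rootFun 2).eq_prod hodd.pos.ne', ← prod_ite_two]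
  refine Finset.prod_congr rfl fun p hp => ?_
  obtain ⟨h1, h2, h3⟩ := prime_ne_two_of_mem hodd hp
  exact rootFun_two_prime_pow h1 h2 h3

theorem primeFactors_eq_of_factorization_three (hodd : Odd S) (g : ℕ → ℚ) :
    ∏ p ∈ S.primeFactors, g p = (if S.factorization 3 = 0 then 1 else g 3) *
      ∏ p ∈ primesWith S (fun p => p ≠ 3), g p := by
  have hA : primesWith S (fun p => p ≠ 3) = S.primeFactors.erase 3 := by
    ext p
    simp [primesWith, and_comm]
  rw [hA]
  by_cases h : 3 ∈ S.primeFactors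
  · rw [if_neg (prime_ne_two_of_mem hodd h).2.2, Finset.mul_prod_erase _ _ h]
  · rw [if_pos (Nat.factorization_eq_zero_of_not_dvd fun h3 =>
      h (Nat.mem_primeFactors.mpr ⟨Nat.prime_three, h3, hodd.pos.ne'⟩)), one_mul,
      Finset.erase_eq_of_notMem h]

theorem rootFun_three_eq (hodd : Odd S) : rootFun 3 S =
    if S.factorization 3 ≤ 1 ∧ ∀ p ∈ primesWith S (fun p => p ≠ 3), p % 6 = 1 then
      2 ^ (primesWith S (fun p => p ≠ 3)).card else 0 := by
  rw [(isMult_rootFun 3).eq_prod hodd.pos.ne', primeFactors_eq_of_factorization_three hodd]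
  have h1 : ∏ p ∈ primesWith S (fun p => p ≠ 3), rootFun 3 (p ^ S.factorization p) =
      ∏ p ∈ primesWith S (fun p => p ≠ 3), if p % 6 = 1 then (2 : ℚ) else 0 := by
    refine Finset.prod_congr rfl fun p hp => ?_
    rw [primesWith, Finset.mem_filter] at hp
    obtain ⟨h1, h2, h3⟩ := prime_ne_two_of_mem hodd hp.1
    exact rootFun_three_prime_pow h1 h2 hp.2 h3
  rw [h1, prod_ite_two]
  by_cases h0 : S.factorization 3 = 0
  · rw [if_pos h0, one_mul, h0]
    simp
  · rw [if_neg h0, rootFun_three_three_pow h0]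
    by_cases h2 : S.factorization 3 = 1
    · simp [h2]
    · rw [if_neg h2, zero_mul, if_neg]
      rintro ⟨h3, -⟩
      omega

theorem lcmSum_three_three_eq (hodd : Odd S) : lcmSum (rootFun 3) (rootFun 3) S =
    if S.factorization 3 ≤ 1 ∧ ∀ p ∈ primesWith S (fun p => p ≠ 3), p % 6 = 1 then
      4 ^ (primesWith S (fun p => p ≠ 3)).card * expProd S (primesWith S fun p => p ≠ 3)
    else 0 := by
  rw [(isMult_lcmSum (isMult_rootFun 3) (isMult_rootFun 3)).eq_prod hodd.pos.ne',
    primeFactors_eq_of_factorization_three hodd]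
  have h1 : ∏ p ∈ primesWith S (fun p => p ≠ 3),
      lcmSum (rootFun 3) (rootFun 3) (p ^ S.factorization p) =
      ∏ p ∈ primesWith S (fun p => p ≠ 3),
        if p % 6 = 1 then 4 * (S.factorization p : ℚ) else 0 := by
    refine Finset.prod_congr rfl fun p hp => ?_
    rw [primesWith, Finset.mem_filter] at hp
    obtain ⟨h1, h2, h3⟩ := prime_ne_two_of_mem hodd hp.1
    rw [lcmSum_prime_pow_of_ite h1 (isMult_rootFun 3).map_one (isMult_rootFun 3).map_one
      (fun t ht => rootFun_three_prime_pow h1 h2 hp.2 ht)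
      (fun t ht => rootFun_three_prime_pow h1 h2 hp.2 ht) h3]
    by_cases hc : p % 6 = 1 <;> simp [hc]
  rw [h1, prod_ite_four, expProd]
  by_cases h0 : S.factorization 3 = 0
  · rw [if_pos h0, one_mul, h0]
    simp
  · rw [if_neg h0, lcmSum_three_three_three_pow h0]
    by_cases h2 : S.factorization 3 = 1
    · simp [h2]
    · rw [if_neg h2, zero_mul, if_neg]
      rintro ⟨h3, -⟩
      omega

theorem lcmSum_one_one_eq (hodd : Odd S) : lcmSum (rootFun 1) (rootFun 1) S =
    if ∀ p ∈ S.primeFactors, p % 4 = 1 then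
      4 ^ S.primeFactors.card * expProd S S.primeFactors else 0 := by
  rw [expProd, ← prod_ite_four]
  refine lcmSum_eq_prod (τ := fun p t => if p % 4 = 1 then 4 * (t : ℚ) else 0)
    (isMult_rootFun 1) (isMult_rootFun 1) hodd fun p t hp hp2 ht => ?_
  rw [lcmSum_prime_pow_of_ite hp (isMult_rootFun 1).map_one (isMult_rootFun 1).map_one
    (fun t ht => rootFun_one_prime_pow hp hp2 ht) (fun t ht => rootFun_one_prime_pow hp hp2 ht) ht]
  by_cases hc : p % 4 = 1 <;> simp [hc]

theorem lcmSum_two_two_eq (hodd : Odd S) : lcmSum (rootFun 2) (rootFun 2) S =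
    if ∀ p ∈ S.primeFactors, OneThreeModEight p then
      4 ^ S.primeFactors.card * expProd S S.primeFactors else 0 := by
  rw [expProd, ← prod_ite_four]
  refine lcmSum_eq_prod (τ := fun p t => if OneThreeModEight p then 4 * (t : ℚ) else 0)
    (isMult_rootFun 2) (isMult_rootFun 2) hodd fun p t hp hp2 ht => ?_
  rw [lcmSum_prime_pow_of_ite hp (isMult_rootFun 2).map_one (isMult_rootFun 2).map_one
    (fun t ht => rootFun_two_prime_pow hp hp2 ht) (fun t ht => rootFun_two_prime_pow hp hp2 ht) ht]
  by_cases hc : OneThreeModEight p <;> simp [hc]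

theorem lcmSum_three_one_eq (hodd : Odd S) : lcmSum (rootFun 3) (rootFun 1) S =
    if (∀ p ∈ S.primeFactors, p % 6 = 1 ∨ p % 4 = 1) ∧
      ∀ p ∈ S.primeFactors, ¬ (p % 6 = 1 ∧ p % 4 = 1) → Even (S.factorization p) then
      2 ^ ((primesWith S fun p => p % 6 = 1 ∧ ¬ p % 4 = 1).card +
        (primesWith S fun p => p % 4 = 1 ∧ ¬ p % 6 = 1).card) *
        4 ^ (primesWith S fun p => p % 6 = 1 ∧ p % 4 = 1).card *
        expProd S (primesWith S fun p => p % 6 = 1 ∧ p % 4 = 1)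
    else 0 := by
  rw [lcmSum_eq_prod (τ := fun p t => if p % 6 = 1 ∧ p % 4 = 1 then 4 * (t : ℚ) else
    if p % 6 = 1 ∨ p % 4 = 1 then if Even t then 2 else 0 else 0)
    (isMult_rootFun 3) (isMult_rootFun 1) hodd fun p t hp hp2 ht => ?_]
  · exact prod_two_classes S.primeFactors _ _ (fun p => Even (S.factorization p)) _
  by_cases hp3 : p = 3
  · rw [hp3, lcmSum_three_one_three_pow ht]
    simp
  · exact lcmSum_prime_pow_of_ite hp (isMult_rootFun 3).map_one (isMult_rootFun 1).map_one
      (fun t ht => rootFun_three_prime_pow hp hp2 hp3 ht)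
      (fun t ht => rootFun_one_prime_pow hp hp2 ht) ht

theorem lcmSum_one_two_eq (hodd : Odd S) : lcmSum (rootFun 1) (rootFun 2) S =
    if (∀ p ∈ S.primeFactors, p % 4 = 1 ∨ OneThreeModEight p) ∧
      ∀ p ∈ S.primeFactors, ¬ (p % 4 = 1 ∧ OneThreeModEight p) → Even (S.factorization p) then
      2 ^ ((primesWith S fun p => p % 4 = 1 ∧ ¬ OneThreeModEight p).card +
        (primesWith S fun p => OneThreeModEight p ∧ ¬ p % 4 = 1).card) *
        4 ^ (primesWith S fun p => p % 4 = 1 ∧ OneThreeModEight p).card *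
        expProd S (primesWith S fun p => p % 4 = 1 ∧ OneThreeModEight p)
    else 0 := by
  rw [lcmSum_eq_prod (τ := fun p t => if p % 4 = 1 ∧ OneThreeModEight p then 4 * (t : ℚ) else
    if p % 4 = 1 ∨ OneThreeModEight p then if Even t then 2 else 0 else 0)
    (isMult_rootFun 1) (isMult_rootFun 2) hodd fun p t hp hp2 ht => ?_]
  · exact prod_two_classes S.primeFactors _ _ (fun p => Even (S.factorization p)) _
  · exact lcmSum_prime_pow_of_ite hp (isMult_rootFun 1).map_one (isMult_rootFun 2).map_one
      (fun t ht => rootFun_one_prime_pow hp hp2 ht)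
      (fun t ht => rootFun_two_prime_pow hp hp2 ht) ht

theorem lcmSum_three_two_eq (hodd : Odd S) : lcmSum (rootFun 3) (rootFun 2) S =
    if (∀ p ∈ S.primeFactors, p % 6 = 1 ∨ OneThreeModEight p) ∧
      ∀ p ∈ S.primeFactors, ¬ (p % 6 = 1 ∧ OneThreeModEight p) →
        Even (S.factorization p) ∨ p = 3 then
      2 ^ ((primesWith S fun p => p % 6 = 1 ∧ ¬ OneThreeModEight p).card +
        (primesWith S fun p => OneThreeModEight p ∧ ¬ p % 6 = 1).card) *
        4 ^ (primesWith S fun p => p % 6 = 1 ∧ OneThreeModEight p).card *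
        expProd S (primesWith S fun p => p % 6 = 1 ∧ OneThreeModEight p)
    else 0 := by
  rw [lcmSum_eq_prod (τ := fun p t => if p % 6 = 1 ∧ OneThreeModEight p then 4 * (t : ℚ) else
    if p % 6 = 1 ∨ OneThreeModEight p then if Even t ∨ p = 3 then 2 else 0 else 0)
    (isMult_rootFun 3) (isMult_rootFun 2) hodd fun p t hp hp2 ht => ?_]
  -- The parity predicate is weakened at 3, where the local factor is 2 for every exponent.
  · exact prod_two_classes S.primeFactors _ _ (fun p => Even (S.factorization p) ∨ p = 3) _
  by_cases hp3 : p = 3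
  · rw [hp3, lcmSum_three_two_three_pow ht]
    simp
  · rw [lcmSum_prime_pow_of_ite hp (isMult_rootFun 3).map_one (isMult_rootFun 2).map_one
      (fun t ht => rootFun_three_prime_pow hp hp2 hp3 ht)
      (fun t ht => rootFun_two_prime_pow hp hp2 ht) ht]
    simp only [hp3, or_false]

theorem lcmSum_one_cubicFun_eq (hodd : Odd S) : lcmSum (rootFun 1) cubicFun S =
    if AllEven S (primesWith S fun p => p % 4 ≠ 1) then
      pairProd S (primesWith S fun p => p % 4 = 1) *
        cubicProd S (primesWith S fun p => p % 4 ≠ 1) else 0 := by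
  rw [lcmSum_eq_prod (isMult_rootFun 1) isMult_cubicFun hodd fun p t hp hp2 ht =>
    lcmSum_prime_pow_cubicFun hp (isMult_rootFun 1).map_one
      (fun t ht => rootFun_one_prime_pow hp hp2 ht) ht]
  exact prod_ite_even S.primeFactors _ (fun p => Even (S.factorization p)) _ _

theorem lcmSum_two_cubicFun_eq (hodd : Odd S) : lcmSum (rootFun 2) cubicFun S =
    if AllEven S (primesWith S fun p => ¬ OneThreeModEight p) then
      pairProd S (primesWith S OneThreeModEight) *
        cubicProd S (primesWith S fun p => ¬ OneThreeModEight p) else 0 := by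
  rw [lcmSum_eq_prod (isMult_rootFun 2) isMult_cubicFun hodd fun p t hp hp2 ht =>
    lcmSum_prime_pow_cubicFun hp (isMult_rootFun 2).map_one
      (fun t ht => rootFun_two_prime_pow hp hp2 ht) ht]
  exact prod_ite_even S.primeFactors _ (fun p => Even (S.factorization p)) _ _

theorem filter_primesWith (S : ℕ) (P Q : ℕ → Prop) [DecidablePred P] [DecidablePred Q] :
    (primesWith S P).filter Q = primesWith S fun p => P p ∧ Q p := by
  rw [primesWith, primesWith, Finset.filter_filter]

theorem primesWith_congr {S : ℕ} {P Q : ℕ → Prop} [DecidablePred P] [DecidablePred Q]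
    (h : ∀ p ∈ S.primeFactors, P p ↔ Q p) : primesWith S P = primesWith S Q :=
  Finset.filter_congr h

theorem lcmSum_three_cubicFun_eq (hodd : Odd S) : lcmSum (rootFun 3) cubicFun S =
    if AllEven S (primesWith S fun p => p % 6 ≠ 1 ∧ p ≠ 3) then
      (if S.factorization 3 = 0 then 1 else 4 * 3 ^ (S.factorization 3 - 1)) *
      (pairProd S (primesWith S fun p => p % 6 = 1) *
        cubicProd S (primesWith S fun p => p % 6 ≠ 1 ∧ p ≠ 3)) else 0 := by
  rw [(isMult_lcmSum (isMult_rootFun 3) isMult_cubicFun).eq_prod hodd.pos.ne',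
    primeFactors_eq_of_factorization_three hodd]
  have h0 : (if S.factorization 3 = 0 then (1 : ℚ)
      else lcmSum (rootFun 3) cubicFun (3 ^ S.factorization 3)) =
      if S.factorization 3 = 0 then 1 else 4 * 3 ^ (S.factorization 3 - 1) := by
    split_ifs with h
    · rfl
    · exact lcmSum_three_cubicFun_three_pow h
  rw [h0]
  have h1 := prod_ite_even (primesWith S fun p => p ≠ 3) (fun p => p % 6 = 1)
    (fun p => Even (S.factorization p))
    (fun p => ((S.factorization p : ℚ) + 1) * ((p : ℚ) + 1) * (p : ℚ) ^ (S.factorization p - 1) +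
      2 * ((p : ℚ) ^ (S.factorization p - 1) - 1) / ((p : ℚ) - 1))
    (fun p => ((p : ℚ) + 1) * (p : ℚ) ^ (S.factorization p - 1))
  have hI : (primesWith S fun p => p ≠ 3).filter (fun p => p % 6 = 1) =
      primesWith S fun p => p % 6 = 1 := by
    rw [filter_primesWith]
    refine primesWith_congr fun p _ => and_iff_right_of_imp ?_
    rintro h rfl
    norm_num at h
  have hJ : (primesWith S fun p => p ≠ 3).filter (fun p => ¬ p % 6 = 1) =
      primesWith S fun p => p % 6 ≠ 1 ∧ p ≠ 3 := by
    rw [filter_primesWith]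
    exact primesWith_congr fun p _ => and_comm
  rw [hI, hJ] at h1
  rw [Finset.prod_congr rfl fun p hp => ?_, h1]
  · rw [pairProd, cubicProd, mul_ite, mul_zero]
  · rw [primesWith, Finset.mem_filter] at hp
    obtain ⟨h1, h2, h3⟩ := prime_ne_two_of_mem hodd hp.1
    exact lcmSum_prime_pow_cubicFun h1 (isMult_rootFun 3).map_one
      (fun t ht => rootFun_three_prime_pow h1 h2 hp.2 ht) h3

theorem lcmSum_cubicFun_cubicFun_eq (hodd : Odd S) : lcmSum cubicFun cubicFun S = fF S := by
  rw [fF, if_pos hodd]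
  exact lcmSum_eq_prod isMult_cubicFun isMult_cubicFun hodd fun p t hp _ ht =>
    lcmSum_cubicFun_cubicFun_prime_pow hp ht

end Global

/-! ### The numbers of pairs of given types -/

/-- The number of ideals of norm `m` whose generator has type `i`. -/
noncomputable def typeCount (i : Fin 6) : ℕ → ℚ := fun m => ((typeIdeals i m).ncard : ℚ)

theorem ncard_leftClasses_eq_lcmSum {S : ℕ} (hS : S ≠ 0) (i j : Fin 6) :
    ((leftClasses i j S).ncard : ℚ) = lcmSum (typeCount i) (typeCount j) S := by
  rw [(finite_leftClasses_and_ncard hS i j).2, lcmSum]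
  push_cast
  rfl

/-- Counts the left cosets of a type in two ways: by double cosets, and by pairs of ideals. -/
theorem gF_mul_nF {S : ℕ} (hS : S ≠ 0) (i j : Fin 6) :
    gF i j * nF i j S = lcmSum (typeCount i) (typeCount j) S := by
  rw [← ncard_leftClasses_eq_lcmSum hS, ncard_leftClasses (finite_leftClasses_and_ncard hS i j).1]

/-- This argues by emptiness of the set of cosets, because division by g is impossible for the types
(0,1) and (1,0). -/
theorem nF_eq_zero_of_lcmSum_eq_zero {S : ℕ} (hS : S ≠ 0) {i j : Fin 6}
    (h : lcmSum (typeCount i) (typeCount j) S = 0) : nF i j S = 0 := by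
  have h0 := finite_leftClasses_and_ncard hS i j
  rw [← ncard_leftClasses_eq_lcmSum hS, Nat.cast_eq_zero, Set.ncard_eq_zero h0.1] at h
  rw [nF, classes_eq_image, h, Set.image_empty, Set.ncard_empty, Nat.cast_zero]

theorem lcmSum_typeCount_of_not_odd {S : ℕ} (hS : S ≠ 0) (hodd : ¬ Odd S) (i j : Fin 6) :
    lcmSum (typeCount i) (typeCount j) S = 0 := by
  refine Finset.sum_eq_zero fun x hx => ?_
  have h := ((mem_lcmPairs hS).mp hx).1
  by_cases h1 : Odd x.1
  · have h2 : ¬ Odd x.2 := fun h2 => hodd (h ▸ (h1.mul h2).of_dvd_nat (Nat.lcm_dvd_mul x.1 x.2))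
    rw [typeCount, typeCount, typeIdeals_eq_empty h2, Set.ncard_empty, Nat.cast_zero, mul_zero]
  · rw [typeCount, typeIdeals_eq_empty h1, Set.ncard_empty, Nat.cast_zero, zero_mul]

theorem nF_eq_zero_of_not_odd {S : ℕ} (hS : S ≠ 0) (hodd : ¬ Odd S) (i j : Fin 6) :
    nF i j S = 0 :=
  nF_eq_zero_of_lcmSum_eq_zero hS (lcmSum_typeCount_of_not_odd hS hodd i j)

/-! ### Convolution with the type-counting functions -/

section Odd

variable {S : ℕ} (hodd : Odd S) (v : ℕ → ℚ)
include hodd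

theorem lcmSum_typeCount_zero : lcmSum v (typeCount 0) S = if IsSquare S then v S else 0 := by
  rw [← lcmSum_ite_one hodd.pos.ne']
  exact lcmSum_congr (fun _ _ => rfl) fun m _ => ncard_typeIdeals_zero m

theorem lcmSum_typeCount_one :
    lcmSum v (typeCount 1) S = 4 * if 3 ∣ S ∧ IsSquare (S / 3) then v S else 0 := by
  rw [← lcmSum_ite_three hodd.pos.ne', ← lcmSum_const_mul]
  exact lcmSum_congr (fun _ _ => rfl) fun m _ =>
    (ncard_typeIdeals_one m).trans (by split_ifs <;> norm_num)

theorem lcmSum_typeCount_two : lcmSum v (typeCount 2) S =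
    4 * (lcmSum v (rootFun 3) S - (if IsSquare S then v S else 0) -
      if 3 ∣ S ∧ IsSquare (S / 3) then v S else 0) := by
  rw [← lcmSum_ite_three hodd.pos.ne', ← lcmSum_ite_one hodd.pos.ne', ← lcmSum_sub, ← lcmSum_sub,
    ← lcmSum_const_mul]
  exact lcmSum_congr (fun _ _ => rfl) fun m hm => ncard_typeIdeals_two (hodd.of_dvd_nat hm)

theorem lcmSum_typeCount_three : lcmSum v (typeCount 3) S =
    3 * (lcmSum v (rootFun 1) S - if IsSquare S then v S else 0) := by
  rw [← lcmSum_ite_one hodd.pos.ne', ← lcmSum_sub, ← lcmSum_const_mul]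
  exact lcmSum_congr (fun _ _ => rfl) fun m hm => ncard_typeIdeals_three (hodd.of_dvd_nat hm)

theorem lcmSum_typeCount_four : lcmSum v (typeCount 4) S =
    6 * (lcmSum v (rootFun 2) S - (if IsSquare S then v S else 0) -
      2 * if 3 ∣ S ∧ IsSquare (S / 3) then v S else 0) := by
  rw [← lcmSum_ite_three hodd.pos.ne', ← lcmSum_ite_one hodd.pos.ne', ← lcmSum_const_mul 2,
    ← lcmSum_sub, ← lcmSum_sub, ← lcmSum_const_mul]
  exact lcmSum_congr (fun _ _ => rfl) fun m hm => ncard_typeIdeals_four (hodd.of_dvd_nat hm)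

theorem sum_lcmSum_typeCount : ∑ i, lcmSum v (typeCount i) S = lcmSum v cubicFun S := by
  simp only [lcmSum]
  rw [Finset.sum_comm]
  refine Finset.sum_congr rfl fun x hx => ?_
  rw [lcmPairs, Finset.mem_filter, Finset.mem_product] at hx
  rw [← Finset.mul_sum, cubicFun,
    ← sum_ncard_typeIdeals (hodd.of_dvd_nat (Nat.dvd_of_mem_divisors hx.1.2))]
  rfl

theorem sum_gF_mul_nF (i : Fin 6) :
    ∑ j, gF i j * nF i j S = lcmSum (typeCount i) cubicFun S := by
  rw [← sum_lcmSum_typeCount hodd]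
  exact Finset.sum_congr rfl fun j _ => gF_mul_nF hodd.pos.ne' i j

theorem sum_sum_gF_mul_nF : ∑ i, ∑ j, gF i j * nF i j S = fF S := by
  rw [← lcmSum_cubicFun_cubicFun_eq hodd, ← sum_lcmSum_typeCount hodd]
  refine Finset.sum_congr rfl fun i _ => ?_
  rw [sum_gF_mul_nF hodd, lcmSum_comm]

end Odd

theorem gF_symm (i j : Fin 6) : gF i j = gF j i := by
  fin_cases i <;> fin_cases j <;> rfl

theorem gF_ne_zero {i j : Fin 6} (h : ¬ (i = 0 ∧ j = 1)) (h' : ¬ (i = 1 ∧ j = 0)) :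
    gF i j ≠ 0 := by
  fin_cases i <;> fin_cases j <;> simp [gF] at h h' ⊢

theorem not_isSquare_of_isSquare_div_three {S : ℕ} (hS : S ≠ 0) (h : IsSquare S) :
    ¬ (3 ∣ S ∧ IsSquare (S / 3)) := by
  rw [← isSquare_three_mul_iff, isSquare_iff_even_factorization (by positivity)]
  intro h1
  have h2 := h1 3
  rw [Nat.factorization_mul (by norm_num) hS, Finsupp.add_apply,
    Nat.prime_three.factorization_self, Nat.even_add] at h2
  exact absurd (h2.mpr ((isSquare_iff_even_factorization hS).mp h 3)) (by decide)

theorem nF_zero_one {S : ℕ} (hS : S ≠ 0) : nF 0 1 S = 0 := by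
  by_cases hodd : Odd S
  · refine nF_eq_zero_of_lcmSum_eq_zero hS ?_
    rw [lcmSum_typeCount_one hodd, typeCount, ncard_typeIdeals_zero]
    rcases eq_or_ne S 1 with rfl | h
    · norm_num
    · simp [h]
  · exact nF_eq_zero_of_not_odd hS hodd 0 1

theorem nF_symm {S : ℕ} (hS : S ≠ 0) (i j : Fin 6) : nF i j S = nF j i S := by
  have h := gF_mul_nF hS i j
  rw [lcmSum_comm, ← gF_mul_nF hS j i, gF_symm] at h
  have h01 : nF 1 0 S = 0 := by
    refine nF_eq_zero_of_lcmSum_eq_zero hS ?_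
    rw [lcmSum_comm, ← gF_mul_nF hS, nF_zero_one hS, mul_zero]
  by_cases h1 : i = 0 ∧ j = 1
  · rw [h1.1, h1.2, h01, nF_zero_one hS]
  by_cases h2 : i = 1 ∧ j = 0
  · rw [h2.1, h2.2, h01, nF_zero_one hS]
  · exact mul_left_cancel₀ (gF_ne_zero (fun h => h2 h.symm) fun h => h1 h.symm) h

/-! ### Squares and their triples -/

section Square

variable {S : ℕ}

theorem allEven_primeFactors_iff {p : ℕ → Prop} [DecidablePred p] :
    AllEven S (primesWith S p) ↔ ∀ q, p q → Even (S.factorization q) := by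
  constructor
  · intro h q hq
    by_cases hS : q ∈ S.primeFactors
    · exact h q (Finset.mem_filter.mpr ⟨hS, hq⟩)
    · rw [← Nat.support_factorization, Finsupp.notMem_support_iff] at hS
      rw [hS]
      exact Even.zero
  · exact fun h q hq => h q (Finset.mem_filter.mp hq).2

theorem isSquare_iff_allEven (hS : S ≠ 0) : IsSquare S ↔ AllEven S S.primeFactors := by
  rw [isSquare_iff_even_factorization hS]
  refine ⟨fun h p _ => h p, fun h p => ?_⟩
  by_cases hp : p ∈ S.primeFactors
  · exact h p hp
  · rw [← Nat.support_factorization, Finsupp.notMem_support_iff] at hp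
    rw [hp]
    exact Even.zero

theorem isSquare_iff_even_three (hS : S ≠ 0) :
    IsSquare S ↔ Even (S.factorization 3) ∧ AllEven S (primesWith S fun p => p ≠ 3) := by
  rw [isSquare_iff_even_factorization hS, allEven_primeFactors_iff]
  refine ⟨fun h => ⟨h 3, fun q _ => h q⟩, fun h p => ?_⟩
  by_cases hp : p = 3
  · exact hp ▸ h.1
  · exact h.2 p hp

theorem isSquare_div_three_iff (hS : S ≠ 0) : 3 ∣ S ∧ IsSquare (S / 3) ↔
    ¬ Even (S.factorization 3) ∧ AllEven S (primesWith S fun p => p ≠ 3) := by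
  rw [← isSquare_three_mul_iff, isSquare_iff_even_factorization (by positivity),
    allEven_primeFactors_iff]
  have h3 : ∀ q, (3 * S).factorization q = (if q = 3 then 1 else 0) + S.factorization q := by
    intro q
    rw [Nat.factorization_mul (by norm_num) hS, Finsupp.add_apply,
      Nat.prime_three.factorization, Finsupp.single_apply]
    simp only [eq_comm]
  constructor
  · refine fun h => ⟨fun h1 => ?_, fun q hq => ?_⟩
    · have := h 3
      rw [h3, if_pos rfl, Nat.even_add] at this
      exact absurd (this.mpr h1) (by decide)
    · have := h q
      rwa [h3, if_neg hq, zero_add] at this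
  · rintro ⟨h1, h2⟩ q
    rw [h3]
    by_cases hq : q = 3
    · rw [if_pos hq, Nat.even_add, hq]
      exact ⟨fun h => absurd h (by decide), fun h => absurd h h1⟩
    · rw [if_neg hq, zero_add]
      exact h2 q hq

end Square

/-! ### The numbers of classes in terms of root-counting functions -/

section Values

variable {S : ℕ}

theorem rootFun_at_one (d : ℕ) : rootFun d 1 = 1 := (isMult_rootFun d).map_one

theorem rootFun_at_three : rootFun 1 3 = 0 ∧ rootFun 2 3 = 2 ∧ rootFun 3 3 = 1 := by
  obtain ⟨h1, h2, h3⟩ := rootCount_three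
  simp [rootFun, h1, h2, h3]

theorem rootFun_one_of_three_dvd (hodd : Odd S) (h : 3 ∣ S) : rootFun 1 S = 0 := by
  rw [rootFun_one_eq hodd, if_neg]
  exact fun h1 => absurd (h1 3 (Nat.mem_primeFactors.mpr ⟨Nat.prime_three, h, hodd.pos.ne'⟩))
    (by decide)

/-- A positive number is `1`, `3`, another square, three times another square, or none of these. -/
theorem square_cases (hS : S ≠ 0) : S = 1 ∨ S = 3 ∨
    (S ≠ 1 ∧ S ≠ 3 ∧ IsSquare S ∧ ¬ (3 ∣ S ∧ IsSquare (S / 3))) ∨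
    (S ≠ 1 ∧ S ≠ 3 ∧ ¬ IsSquare S ∧ 3 ∣ S ∧ IsSquare (S / 3)) ∨
    (S ≠ 1 ∧ S ≠ 3 ∧ ¬ IsSquare S ∧ ¬ (3 ∣ S ∧ IsSquare (S / 3))) := by
  have := not_isSquare_of_isSquare_div_three hS
  tauto

theorem square_values_one :
    IsSquare 1 ∧ ¬ (3 ∣ 1 ∧ IsSquare (1 / 3)) ∧ ¬ IsSquare 3 ∧ 3 ∣ 3 ∧ IsSquare (3 / 3) := by
  decide +kernel

theorem typeCount_zero (S : ℕ) : typeCount 0 S = if S = 1 then 1 else 0 := ncard_typeIdeals_zero S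

theorem typeCount_one (S : ℕ) : typeCount 1 S = if S = 3 then 4 else 0 := ncard_typeIdeals_one S

theorem typeCount_two (hodd : Odd S) : typeCount 2 S =
    4 * (rootFun 3 S - (if S = 1 then 1 else 0) - if S = 3 then 1 else 0) :=
  ncard_typeIdeals_two hodd

theorem typeCount_three (hodd : Odd S) :
    typeCount 3 S = 3 * (rootFun 1 S - if S = 1 then 1 else 0) :=
  ncard_typeIdeals_three hodd

theorem typeCount_four (hodd : Odd S) : typeCount 4 S =
    6 * (rootFun 2 S - (if S = 1 then 1 else 0) - 2 * if S = 3 then 1 else 0) :=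
  ncard_typeIdeals_four hodd

theorem nF_zero_zero_eq (hodd : Odd S) : nF 0 0 S = if S = 1 then 1 else 0 := by
  have h := gF_mul_nF hodd.pos.ne' 0 0
  rw [lcmSum_typeCount_zero hodd, typeCount_zero, show gF 0 0 = 1 from rfl, one_mul] at h
  rw [h]
  rcases eq_or_ne S 1 with rfl | h1
  · decide
  · simp [h1]

theorem nF_one_one_eq (hodd : Odd S) : nF 1 1 S = if S = 3 then 1 else 0 := by
  have h := gF_mul_nF hodd.pos.ne' 1 1
  rw [lcmSum_typeCount_one hodd, typeCount_one, show gF 1 1 = 16 from rfl] at h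
  rcases eq_or_ne S 3 with rfl | h1
  · norm_num at h ⊢
    linarith
  · simpa [h1] using h

theorem nF_zero_two_eq (hodd : Odd S) : nF 0 2 S =
    if IsSquare S then (rootFun 3 S - if S = 1 then 1 else 0) / 2 else 0 := by
  have h := gF_mul_nF hodd.pos.ne' 0 2
  rw [lcmSum_comm, lcmSum_typeCount_zero hodd, typeCount_two hodd, show gF 0 2 = 8 from rfl] at h
  split_ifs at h ⊢ with h1 h2 h3 h3 <;> first | linarith | skip
  -- The correction at 3 cannot interfere with the square case.
  subst h3
  exact absurd h1 square_values_one.2.2.1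

theorem nF_zero_three_eq (hodd : Odd S) : nF 0 3 S =
    if IsSquare S then (rootFun 1 S - if S = 1 then 1 else 0) / 2 else 0 := by
  have h := gF_mul_nF hodd.pos.ne' 0 3
  rw [lcmSum_comm, lcmSum_typeCount_zero hodd, typeCount_three hodd, show gF 0 3 = 6 from rfl] at h
  split_ifs at h ⊢ <;> linarith

theorem nF_zero_four_eq (hodd : Odd S) : nF 0 4 S =
    if IsSquare S then (rootFun 2 S - if S = 1 then 1 else 0) / 2 else 0 := by
  have h := gF_mul_nF hodd.pos.ne' 0 4
  rw [lcmSum_comm, lcmSum_typeCount_zero hodd, typeCount_four hodd, show gF 0 4 = 12 from rfl] at h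
  split_ifs at h ⊢ with h1 h2 h3 h3 <;> first | linarith | skip
  subst h3
  exact absurd h1 square_values_one.2.2.1

theorem nF_one_two_eq (hodd : Odd S) : nF 1 2 S =
    if 3 ∣ S ∧ IsSquare (S / 3) then (rootFun 3 S - if S = 3 then 1 else 0) / 2 else 0 := by
  have h := gF_mul_nF hodd.pos.ne' 1 2
  rw [lcmSum_comm, lcmSum_typeCount_one hodd, typeCount_two hodd, show gF 1 2 = 32 from rfl] at h
  split_ifs at h ⊢ with h1 h2 h3 h3 <;> first | linarith | skip
  subst h3
  exact absurd h1.1 (by decide)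

theorem nF_one_three_eq (hodd : Odd S) : nF 1 3 S = 0 := by
  have h := gF_mul_nF hodd.pos.ne' 1 3
  rw [lcmSum_comm, lcmSum_typeCount_one hodd, typeCount_three hodd,
    show gF 1 3 = 24 from rfl] at h
  split_ifs at h with h1 h2
  · subst h2
    exact absurd h1.1 (by decide)
  · rw [rootFun_one_of_three_dvd hodd h1.1] at h
    linarith
  · linarith

theorem nF_one_four_eq (hodd : Odd S) : nF 1 4 S =
    if 3 ∣ S ∧ IsSquare (S / 3) then (rootFun 2 S - 2 * if S = 3 then 1 else 0) / 2 else 0 := by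
  have h := gF_mul_nF hodd.pos.ne' 1 4
  rw [lcmSum_comm, lcmSum_typeCount_one hodd, typeCount_four hodd, show gF 1 4 = 48 from rfl] at h
  split_ifs at h ⊢ with h1 h2 h3 h3 <;> first | linarith | skip
  subst h3
  exact absurd h1.1 (by decide)

/-- Expands the convolution square of the root count minus the indicators of 1 and 3. The mixed
indicator term vanishes because 3 is not a square. -/
theorem nF_two_two_eq (hodd : Odd S) : nF 2 2 S =
    (lcmSum (rootFun 3) (rootFun 3) S - 2 * (if IsSquare S then rootFun 3 S else 0) -
      2 * (if 3 ∣ S ∧ IsSquare (S / 3) then rootFun 3 S else 0) + (if S = 1 then 1 else 0) +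
      if S = 3 then 1 else 0) / 2 := by
  have h := gF_mul_nF hodd.pos.ne' 2 2
  rw [lcmSum_typeCount_two hodd, lcmSum_comm (typeCount 2), lcmSum_typeCount_two hodd,
    typeCount_two hodd, show gF 2 2 = 32 from rfl] at h
  rcases square_cases hodd.pos.ne' with rfl | rfl | ⟨h1, h2, h3, h4⟩ | ⟨h1, h2, h3, h4⟩ |
    ⟨h1, h2, h3, h4⟩
  · simp [rootFun_at_one] at h ⊢
    linarith
  · simp [square_values_one, rootFun_at_three] at h ⊢
    linarith
  all_goals
    simp only [h1, h2, h3, h4, if_true, if_false, and_self] at h ⊢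
    linarith

theorem nF_two_three_eq (hodd : Odd S) : nF 2 3 S =
    (lcmSum (rootFun 3) (rootFun 1) S - (if IsSquare S then rootFun 3 S else 0) -
      (if IsSquare S then rootFun 1 S else 0) + if S = 1 then 1 else 0) / 4 := by
  have h := gF_mul_nF hodd.pos.ne' 2 3
  rw [lcmSum_typeCount_three hodd, lcmSum_comm (typeCount 2), lcmSum_typeCount_two hodd,
    typeCount_two hodd, lcmSum_comm (rootFun 1), show gF 2 3 = 48 from rfl] at h
  rcases square_cases hodd.pos.ne' with rfl | rfl | ⟨h1, h2, h3, h4⟩ | ⟨h1, h2, h3, h4⟩ |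
    ⟨h1, h2, h3, h4⟩
  · simp [rootFun_at_one] at h ⊢
    linarith
  · simp [square_values_one, rootFun_at_three] at h ⊢
    linarith
  · simp only [h1, h2, h3, h4, if_true, if_false, and_self] at h ⊢
    linarith
  · simp only [h1, h2, h3, h4, if_true, if_false, and_self,
      rootFun_one_of_three_dvd hodd h4.1] at h ⊢
    linarith
  · simp only [h1, h2, h3, h4, if_true, if_false, and_self] at h ⊢
    linarith

theorem nF_two_four_eq (hodd : Odd S) : nF 2 4 S =
    (lcmSum (rootFun 3) (rootFun 2) S - (if IsSquare S then rootFun 3 S + rootFun 2 S else 0) -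
      (if 3 ∣ S ∧ IsSquare (S / 3) then 2 * rootFun 3 S + rootFun 2 S else 0) +
      (if S = 1 then 1 else 0) + 2 * if S = 3 then 1 else 0) / 4 := by
  have h := gF_mul_nF hodd.pos.ne' 2 4
  rw [lcmSum_typeCount_four hodd, lcmSum_comm (typeCount 2), lcmSum_typeCount_two hodd,
    typeCount_two hodd, lcmSum_comm (rootFun 2), show gF 2 4 = 96 from rfl] at h
  rcases square_cases hodd.pos.ne' with rfl | rfl | ⟨h1, h2, h3, h4⟩ | ⟨h1, h2, h3, h4⟩ |
    ⟨h1, h2, h3, h4⟩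
  · simp [rootFun_at_one] at h ⊢
    linarith
  · simp [square_values_one, rootFun_at_three] at h ⊢
    linarith
  all_goals
    simp only [h1, h2, h3, h4, if_true, if_false, and_self] at h ⊢
    linarith

theorem nF_three_three_eq (hodd : Odd S) : nF 3 3 S =
    (lcmSum (rootFun 1) (rootFun 1) S - 2 * (if IsSquare S then rootFun 1 S else 0) +
      if S = 1 then 1 else 0) / 4 := by
  have h := gF_mul_nF hodd.pos.ne' 3 3
  rw [lcmSum_typeCount_three hodd, lcmSum_comm (typeCount 3), lcmSum_typeCount_three hodd,
    typeCount_three hodd, show gF 3 3 = 36 from rfl] at h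
  rcases square_cases hodd.pos.ne' with rfl | rfl | ⟨h1, h2, h3, h4⟩ | ⟨h1, h2, h3, h4⟩ |
    ⟨h1, h2, h3, h4⟩
  · simp [rootFun_at_one] at h ⊢
    linarith
  · simp [square_values_one, rootFun_at_three] at h ⊢
    linarith
  all_goals
    simp only [h1, h2, h3, h4, if_true, if_false, and_self] at h ⊢
    linarith

theorem nF_three_four_eq (hodd : Odd S) : nF 3 4 S =
    (lcmSum (rootFun 1) (rootFun 2) S - (if IsSquare S then rootFun 1 S + rootFun 2 S else 0) +
      if S = 1 then 1 else 0) / 4 := by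
  have h := gF_mul_nF hodd.pos.ne' 3 4
  rw [lcmSum_typeCount_four hodd, lcmSum_comm (typeCount 3), lcmSum_typeCount_three hodd,
    typeCount_three hodd, lcmSum_comm (rootFun 2), show gF 3 4 = 72 from rfl] at h
  rcases square_cases hodd.pos.ne' with rfl | rfl | ⟨h1, h2, h3, h4⟩ | ⟨h1, h2, h3, h4⟩ |
    ⟨h1, h2, h3, h4⟩
  · simp [rootFun_at_one] at h ⊢
    linarith
  · simp [square_values_one, rootFun_at_three] at h ⊢
    linarith
  · simp only [h1, h2, h3, h4, if_true, if_false, and_self] at h ⊢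
    linarith
  · simp only [h1, h2, h3, h4, if_true, if_false, and_self,
      rootFun_one_of_three_dvd hodd h4.1] at h ⊢
    linarith
  · simp only [h1, h2, h3, h4, if_true, if_false, and_self] at h ⊢
    linarith

theorem nF_four_four_eq (hodd : Odd S) : nF 4 4 S =
    (lcmSum (rootFun 2) (rootFun 2) S - 2 * (if IsSquare S then rootFun 2 S else 0) -
      4 * (if 3 ∣ S ∧ IsSquare (S / 3) then rootFun 2 S else 0) + (if S = 1 then 1 else 0) +
      4 * if S = 3 then 1 else 0) / 4 := by
  have h := gF_mul_nF hodd.pos.ne' 4 4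
  rw [lcmSum_typeCount_four hodd, lcmSum_comm (typeCount 4), lcmSum_typeCount_four hodd,
    typeCount_four hodd, show gF 4 4 = 144 from rfl] at h
  rcases square_cases hodd.pos.ne' with rfl | rfl | ⟨h1, h2, h3, h4⟩ | ⟨h1, h2, h3, h4⟩ |
    ⟨h1, h2, h3, h4⟩
  · simp [rootFun_at_one] at h ⊢
    linarith
  · simp [square_values_one, rootFun_at_three] at h ⊢
    linarith
  all_goals
    simp only [h1, h2, h3, h4, if_true, if_false, and_self] at h ⊢
    linarith

end Values

/-! ### Closed formulas for pairs of special types -/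

section Formulas

variable {S : ℕ}

theorem two_mem_primeFactors (hS : S ≠ 0) (hodd : ¬ Odd S) : 2 ∈ S.primeFactors :=
  Nat.mem_primeFactors.mpr ⟨Nat.prime_two, even_iff_two_dvd.mp (Nat.not_odd_iff_even.mp hodd), hS⟩

theorem two_pow_pred {k : ℕ} (hk : k ≠ 0) : (2 : ℚ) ^ (k - 1) = 2 ^ k / 2 := by
  obtain ⟨n, rfl⟩ := Nat.exists_eq_succ_of_ne_zero hk
  rw [Nat.succ_sub_one, pow_succ]
  ring

theorem four_pow_pred {k : ℕ} (hk : k ≠ 0) : (4 : ℚ) ^ (k - 1) = 4 ^ k / 4 := by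
  obtain ⟨n, rfl⟩ := Nat.exists_eq_succ_of_ne_zero hk
  rw [Nat.succ_sub_one, pow_succ]
  ring

theorem four_zpow_pred (k : ℕ) : (4 : ℚ) ^ ((k : ℤ) - 1) = 4 ^ k / 4 := by
  rw [zpow_sub₀ (by norm_num), zpow_natCast, zpow_one]

theorem two_zpow_add_sub_two (k l : ℕ) : (2 : ℚ) ^ ((k : ℤ) + l - 2) = 2 ^ (k + l) / 4 := by
  rw [zpow_sub₀ (by norm_num), ← Nat.cast_add, zpow_natCast]
  norm_num

theorem card_primeFactors_ne_zero (hS : S ≠ 0) (h1 : S ≠ 1) : S.primeFactors.card ≠ 0 := by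
  rw [Ne, Finset.card_eq_zero, Nat.primeFactors_eq_empty]
  omega

theorem squareFormula_eq (hS : S ≠ 0) (P : ℕ → Prop) [DecidablePred P] :
    squareFormula P S = if IsSquare S then
      ((if ∀ p ∈ S.primeFactors, P p then 2 ^ S.primeFactors.card else 0) -
        if S = 1 then 1 else 0) / 2 else 0 := by
  rw [squareFormula]
  rcases eq_or_ne S 1 with rfl | h1
  · simp
  · have h2 : 1 < S := by omega
    rw [two_pow_pred (card_primeFactors_ne_zero hS h1)]
    simp only [h1, h2, true_and, if_false, sub_zero]
    split_ifs <;> first | rfl | tauto | norm_num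

theorem squareFormula_of_not_odd (hS : S ≠ 0) (hodd : ¬ Odd S) {P : ℕ → Prop} [DecidablePred P]
    (h2 : ¬ P 2) : squareFormula P S = 0 :=
  if_neg fun h => h2 (h.2.2 2 (two_mem_primeFactors hS hodd))

theorem primesWith_ne_three_of_not_dvd (h : ¬ 3 ∣ S) :
    primesWith S (fun p => p ≠ 3) = S.primeFactors := by
  refine Finset.filter_true_of_mem fun p hp => ?_
  rintro rfl
  exact h (Nat.dvd_of_mem_primeFactors hp)

/-- A square has an even exponent of 3, so the bound 1 on this exponent means that 3 does not divide
it. -/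
theorem rootFun_three_of_isSquare (hodd : Odd S) (h : IsSquare S) : rootFun 3 S =
    if ∀ p ∈ S.primeFactors, p % 6 = 1 then 2 ^ S.primeFactors.card else 0 := by
  rw [rootFun_three_eq hodd]
  by_cases h3 : 3 ∣ S
  · have h0 : S.factorization 3 ≠ 0 :=
      (Nat.prime_three.factorization_pos_of_dvd hodd.pos.ne' h3).ne'
    have he := ((isSquare_iff_even_three hodd.pos.ne').mp h).1
    rw [if_neg, if_neg]
    · exact fun h1 => absurd
        (h1 3 (Nat.mem_primeFactors.mpr ⟨Nat.prime_three, h3, hodd.pos.ne'⟩)) (by decide)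
    · rintro ⟨h1, -⟩
      rw [show S.factorization 3 = 1 by omega] at he
      exact absurd he (by decide)
  · rw [primesWith_ne_three_of_not_dvd h3, Nat.factorization_eq_zero_of_not_dvd h3]
    exact if_congr (and_iff_right zero_le_one) rfl rfl

theorem rootFun_three_of_isSquare_div_three (hodd : Odd S) (h3 : 3 ∣ S) : rootFun 3 S =
    if ∀ p ∈ (S / 3).primeFactors, p % 6 = 1 then 2 ^ (S / 3).primeFactors.card else 0 := by
  obtain ⟨n, rfl⟩ := h3
  have hn : n ≠ 0 := by
    rintro rfl
    exact absurd hodd (by decide)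
  rw [rootFun_three_eq hodd, Nat.mul_div_cancel_left n (by norm_num),
    Nat.factorization_mul (by norm_num) hn, Finsupp.add_apply,
    Nat.prime_three.factorization_self]
  by_cases h3 : 3 ∣ n
  · have h0 := Nat.prime_three.factorization_pos_of_dvd hn h3
    rw [if_neg (fun h => by omega), if_neg]
    exact fun h1 => absurd (h1 3 (Nat.mem_primeFactors.mpr ⟨Nat.prime_three, h3, hn⟩)) (by decide)
  · have h1 : primesWith (3 * n) (fun p => p ≠ 3) = n.primeFactors := by
      rw [primesWith, Nat.primeFactors_mul (by norm_num) hn, Nat.prime_three.primeFactors,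
        Finset.filter_union]
      rw [show n.primeFactors.filter (fun p => p ≠ 3) = n.primeFactors from
        primesWith_ne_three_of_not_dvd h3, show ({3} : Finset ℕ).filter (fun p => p ≠ 3) = ∅ by
          decide, Finset.empty_union]
    rw [h1, Nat.factorization_eq_zero_of_not_dvd h3]
    exact if_congr (and_iff_right le_rfl) rfl rfl

theorem formula12_eq (hodd : Odd S) : formula12 S = if 3 ∣ S ∧ IsSquare (S / 3) then
    (rootFun 3 S - if S = 3 then 1 else 0) / 2 else 0 := by
  rw [formula12]
  by_cases h : 3 ∣ S ∧ IsSquare (S / 3)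
  · rw [if_pos h, rootFun_three_of_isSquare_div_three hodd h.1]
    rcases eq_or_ne S 3 with rfl | h3
    · simp
    · obtain ⟨⟨n, rfl⟩, hsq⟩ := h
      rw [Nat.mul_div_cancel_left n (by norm_num)] at hsq ⊢
      have hn : n ≠ 0 := by
        rintro rfl
        exact absurd hodd (by decide)
      have hlt : 3 < 3 * n := by omega
      rw [two_pow_pred (card_primeFactors_ne_zero hn (by omega))]
      by_cases h4 : ∀ p ∈ n.primeFactors, p % 6 = 1
      · rw [if_pos ⟨hlt, dvd_mul_right 3 n, hsq, h4⟩, if_pos h4, if_neg h3, sub_zero]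
      · rw [if_neg (fun h => h4 h.2.2.2), if_neg h4, if_neg h3]
        norm_num
  · rw [if_neg (fun h' => h ⟨h'.2.1, h'.2.2.1⟩), if_neg h]

theorem formula12_of_not_odd (hodd : ¬ Odd S) : formula12 S = 0 := by
  refine if_neg ?_
  rintro ⟨h1, ⟨n, rfl⟩, -, h⟩
  rw [Nat.mul_div_cancel_left n (by norm_num)] at h
  rw [Nat.odd_mul, not_and] at hodd
  exact absurd (h 2 (two_mem_primeFactors (by omega) (hodd (by decide)))) (by decide)

theorem formula14_eq (hodd : Odd S) : formula14 S = if 3 ∣ S ∧ IsSquare (S / 3) then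
    (rootFun 2 S - 2 * if S = 3 then 1 else 0) / 2 else 0 := by
  rw [formula14, rootFun_two_eq hodd]
  by_cases h : 3 ∣ S ∧ IsSquare (S / 3)
  · rw [if_pos h]
    have h1 : S ≠ 1 := by
      rintro rfl
      exact absurd h.1 (by decide)
    have h0 := hodd.pos.ne'
    have h2 := Nat.le_of_dvd hodd.pos h.1
    rw [two_pow_pred (card_primeFactors_ne_zero h0 h1)]
    rcases eq_or_ne S 3 with rfl | h3
    · rw [Nat.prime_three.primeFactors]
      simp [if_pos (show OneThreeModEight 3 from Or.inr rfl)]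
    · have hlt : 3 < S := by omega
      by_cases h4 : ∀ p ∈ S.primeFactors, OneThreeModEight p
      · rw [if_pos ⟨hlt, h.1, h.2, h4⟩, if_pos h4, if_neg h3, mul_zero, sub_zero]
      · rw [if_neg (fun h => h4 h.2.2.2), if_neg h4, if_neg h3]
        norm_num
  · rw [if_neg (fun h' => h ⟨h'.2.1, h'.2.2.1⟩), if_neg h]

theorem formula14_of_not_odd (hodd : ¬ Odd S) : formula14 S = 0 := by
  refine if_neg ?_
  rintro ⟨h1, -, -, h⟩
  exact absurd (h 2 (two_mem_primeFactors (by omega) hodd)) (by decide)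

theorem nF_two_two_eq_formula (hodd : Odd S) : nF 2 2 S = formula22 S := by
  have hS := hodd.pos.ne'
  rw [nF_two_two_eq hodd, formula22, lcmSum_three_three_eq hodd, rootFun_three_eq hodd]
  simp only [isSquare_iff_even_three hS, isSquare_div_three_iff hS]
  by_cases hA : primesWith S (fun p => p ≠ 3) = ∅
  -- Here S is a power of 3. For 1 and 3 the terms cancel, and for higher powers all of them vanish,
  -- in accordance with the requirement a > 1.
  · have h1 : S ∈ ({1, 3} : Finset ℕ) ∨ 1 < S.factorization 3 := by
      by_contra! h
      obtain ⟨h1, h2⟩ := h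
      have h3 := Nat.prod_factorization_pow_eq_self hS
      rw [Finsupp.prod, Nat.support_factorization] at h3
      have h4 : ∀ p ∈ S.primeFactors, p = 3 := fun p hp => by
        by_contra h
        exact Finset.notMem_empty p (hA ▸ Finset.mem_filter.mpr ⟨hp, h⟩)
      rcases Finset.subset_singleton_iff.mp (fun p hp => Finset.mem_singleton.mpr (h4 p hp)) with
        h5 | h5
      · rw [Nat.primeFactors_eq_empty] at h5
        rcases h5 with h5 | h5 <;> simp [h5] at h1 hS
      · rw [h5, Finset.prod_singleton] at h3
        interval_cases h6 : S.factorization 3 <;> simp [← h3] at h1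
    rw [hA]
    rcases h1 with h1 | h1
    · simp only [Finset.mem_insert, Finset.mem_singleton] at h1
      rcases h1 with rfl | rfl
      · simp [expProd, if_pos (show AllEven 1 ∅ from fun p hp => absurd hp (Finset.notMem_empty p))]
        norm_num
      · simp [expProd, Nat.prime_three.factorization_self,
          if_pos (show AllEven 3 ∅ from fun p hp => absurd hp (Finset.notMem_empty p))]
        norm_num
    · have h2 : S ≠ 1 := by rintro rfl; simp at h1
      have h3 : S ≠ 3 := by rintro rfl; simp [Nat.prime_three.factorization_self] at h1
      simp [h2, h3, h1.not_ge]
  · have hne := Finset.nonempty_iff_ne_empty.mpr hA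
    have h1 : S ≠ 1 := by rintro rfl; simp [primesWith] at hA
    have h3 : S ≠ 3 := by
      rintro rfl
      rw [primesWith, Nat.prime_three.primeFactors] at hA
      exact hA (by decide)
    rw [four_pow_pred (Finset.card_ne_zero.mpr hne)]
    by_cases hC : S.factorization 3 ≤ 1 ∧ ∀ p ∈ primesWith S (fun p => p ≠ 3), p % 6 = 1
    · rw [if_pos (show _ ∧ _ ∧ _ from ⟨hC.1, hne, hC.2⟩)]
      simp only [if_pos hC, h1, h3, if_false]
      by_cases h5 : AllEven S (primesWith S fun p => p ≠ 3)
      · simp only [if_pos h5, and_iff_left h5]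
        by_cases h6 : Even (S.factorization 3) <;>
          simp only [h6, if_true, if_false, not_true, not_false_iff] <;> ring
      · simp only [if_neg h5, if_neg fun h : _ ∧ _ => h5 h.2]
        ring
    · rw [if_neg (fun h : _ ∧ _ ∧ _ => hC ⟨h.1, h.2.2⟩)]
      simp [if_neg hC, h1, h3]

theorem formula22_of_not_odd (hS : S ≠ 0) (hodd : ¬ Odd S) : formula22 S = 0 :=
  if_neg fun h => absurd (h.2.2 2 (Finset.mem_filter.mpr
    ⟨two_mem_primeFactors hS hodd, by decide⟩)) (by decide)

theorem nF_three_three_eq_formula (hodd : Odd S) : nF 3 3 S = formula33 S := by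
  have hS := hodd.pos.ne'
  rw [nF_three_three_eq hodd, formula33, lcmSum_one_one_eq hodd, rootFun_one_eq hodd]
  rcases eq_or_ne S 1 with rfl | h1
  · simp [expProd]
    norm_num
  · have hlt : 1 < S := by omega
    have hc := card_primeFactors_ne_zero hS h1
    simp only [two_pow_pred hc, four_pow_pred hc]
    simp only [h1, hlt, true_and, if_false]
    by_cases hC : ∀ p ∈ S.primeFactors, p % 4 = 1
    · simp only [if_pos hC]
      split_ifs <;> ring
    · simp only [if_neg hC]
      norm_num

theorem formula33_of_not_odd (hS : S ≠ 0) (hodd : ¬ Odd S) : formula33 S = 0 :=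
  if_neg fun h => absurd (h.2 2 (two_mem_primeFactors hS hodd)) (by decide)

theorem nF_four_four_eq_formula (hodd : Odd S) : nF 4 4 S = formula44 S := by
  have hS := hodd.pos.ne'
  rw [nF_four_four_eq hodd, formula44, lcmSum_two_two_eq hodd, rootFun_two_eq hodd]
  rcases eq_or_ne S 1 with rfl | h1
  · simp [expProd]
    norm_num
  rcases eq_or_ne S 3 with rfl | h3
  · rw [Nat.prime_three.primeFactors]
    simp [expProd, square_values_one, Nat.prime_three.factorization_self,
      if_pos (show OneThreeModEight 3 from Or.inr rfl)]
    norm_num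
  · have hlt : 1 < S := by omega
    have hc := card_primeFactors_ne_zero hS h1
    have hns := not_isSquare_of_isSquare_div_three hS
    simp only [two_pow_pred hc, four_pow_pred hc]
    by_cases hC : ∀ p ∈ S.primeFactors, OneThreeModEight p
    · rw [if_pos (show _ ∧ _ ∧ _ from ⟨hlt, h3, hC⟩), if_neg h1, if_neg h3]
      simp only [if_pos hC]
      by_cases hsq : IsSquare S
      · rw [if_pos hsq, if_pos hsq, if_neg (hns hsq)]
        ring
      · rw [if_neg hsq, if_neg hsq]
        split_ifs <;> ring
    · rw [if_neg (fun h : _ ∧ _ ∧ _ => hC h.2.2), if_neg h1, if_neg h3]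
      simp only [if_neg hC]
      norm_num

theorem formula44_of_not_odd (hS : S ≠ 0) (hodd : ¬ Odd S) : formula44 S = 0 :=
  if_neg fun h => absurd (h.2.2 2 (two_mem_primeFactors hS hodd)) (by decide)

end Formulas

/-! ### Closed formulas for mixed types 2, 3, 4 -/

section Formulas

variable {S : ℕ}

theorem AllEven.mono {A B : Finset ℕ} (h : AllEven S B) (hAB : A ⊆ B) : AllEven S A :=
  fun p hp => h p (hAB hp)

theorem primesWith_subset (S : ℕ) (P : ℕ → Prop) [DecidablePred P] :
    primesWith S P ⊆ S.primeFactors :=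
  Finset.filter_subset _ _

theorem mem_primesWith {P : ℕ → Prop} [DecidablePred P] {p : ℕ} :
    p ∈ primesWith S P ↔ p ∈ S.primeFactors ∧ P p :=
  Finset.mem_filter

theorem primesWith_eq_empty {P : ℕ → Prop} [DecidablePred P] (h : ∀ p ∈ S.primeFactors, ¬ P p) :
    primesWith S P = ∅ :=
  Finset.filter_false_of_mem h

theorem primesWith_eq_primeFactors {P : ℕ → Prop} [DecidablePred P]
    (h : ∀ p ∈ S.primeFactors, P p) : primesWith S P = S.primeFactors :=
  Finset.filter_true_of_mem h

theorem ite_forall_eq_zero {c : ℕ → Prop} [DecidablePred c] {P : Finset ℕ} {x : ℚ}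
    (hP : P.Nonempty) (h : ∀ p ∈ P, ¬ c p) : (if ∀ p ∈ P, c p then x else 0) = 0 := by
  obtain ⟨p, hp⟩ := hP
  exact if_neg fun h1 => h p hp (h1 p hp)

/-- When the primes satisfying only c have even exponents, "S is a square with all primes of kind c"
means that no prime is of kind c' only and that those of both kinds have even exponents. -/
theorem ite_isSquare_eq (hS : S ≠ 0) (c c' : ℕ → Prop) [DecidablePred c] [DecidablePred c']
    (hC : ∀ p ∈ S.primeFactors, c p ∨ c' p) (h1 : AllEven S (primesWith S fun p => c p ∧ ¬ c' p)) :
    (if IsSquare S then if ∀ p ∈ S.primeFactors, c p then (2 : ℚ) ^ S.primeFactors.card else 0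
      else 0) =
    if AllEven S (primesWith S fun p => c p ∧ c' p) ∧
      (primesWith S fun p => c' p ∧ ¬ c p).card = 0 then
      2 ^ ((primesWith S fun p => c p ∧ ¬ c' p).card + (primesWith S fun p => c p ∧ c' p).card)
    else 0 := by
  rw [← ite_and]
  have hcard : (∀ p ∈ S.primeFactors, c p) → S.primeFactors.card =
      (primesWith S fun p => c p ∧ ¬ c' p).card + (primesWith S fun p => c p ∧ c' p).card := by
    intro h
    rw [primesWith_congr (Q := fun p => ¬ c' p) fun p hp => and_iff_right (h p hp),
      primesWith_congr (Q := c') fun p hp => and_iff_right (h p hp), add_comm]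
    exact (Finset.card_filter_add_card_filter_not _).symm
  have hiff : (IsSquare S ∧ ∀ p ∈ S.primeFactors, c p) ↔
      AllEven S (primesWith S fun p => c p ∧ c' p) ∧
        (primesWith S fun p => c' p ∧ ¬ c p).card = 0 := by
    rw [isSquare_iff_allEven hS, Finset.card_eq_zero]
    constructor
    · rintro ⟨h2, h3⟩
      exact ⟨h2.mono (primesWith_subset S _), primesWith_eq_empty fun p hp h => h.2 (h3 p hp)⟩
    · rintro ⟨h2, h3⟩
      have h4 : ∀ p ∈ S.primeFactors, c p := fun p hp => by
        by_contra h
        exact Finset.notMem_empty p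
          (h3 ▸ mem_primesWith.mpr ⟨hp, (hC p hp).resolve_left h, h⟩)
      refine ⟨fun p hp => ?_, h4⟩
      by_cases h : c' p
      · exact h2 p (mem_primesWith.mpr ⟨hp, h4 p hp, h⟩)
      · exact h1 p (mem_primesWith.mpr ⟨hp, h4 p hp, h⟩)
  by_cases h : IsSquare S ∧ ∀ p ∈ S.primeFactors, c p
  · rw [if_pos h, if_pos (hiff.mp h), hcard h.2]
  · rw [if_neg h, if_neg fun h' => h (hiff.mpr h')]

theorem nF_two_three_eq_formula (hodd : Odd S) : nF 2 3 S = formula23 S := by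
  have hS := hodd.pos.ne'
  rw [nF_two_three_eq hodd, lcmSum_three_one_eq hodd, rootFun_one_eq hodd]
  have h3 : (if IsSquare S then rootFun 3 S else 0) = if IsSquare S then
      if ∀ p ∈ S.primeFactors, p % 6 = 1 then 2 ^ S.primeFactors.card else 0 else 0 := by
    split_ifs with h1 h2 <;> first | rfl | rw [rootFun_three_of_isSquare hodd h1]
    · rw [if_pos h2]
    · rw [if_neg h2]
  have hK : (primesWith S fun p => p % 4 = 1 ∧ p % 6 = 1) =
      primesWith S fun p => p % 6 = 1 ∧ p % 4 = 1 := primesWith_congr fun p _ => and_comm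
  rw [h3]
  rcases eq_or_ne S 1 with rfl | h1
  · simp [formula23, expProd, primesWith]
  have hlt : 1 < S := by omega
  by_cases hC : (∀ p ∈ S.primeFactors, p % 6 = 1 ∨ p % 4 = 1) ∧
      ∀ p ∈ S.primeFactors, ¬ (p % 6 = 1 ∧ p % 4 = 1) → Even (S.factorization p)
  · have hE1 : AllEven S (primesWith S fun p => p % 6 = 1 ∧ ¬ p % 4 = 1) := fun p hp =>
      hC.2 p (mem_primesWith.mp hp).1 fun h => (mem_primesWith.mp hp).2.2 h.2
    have hE2 : AllEven S (primesWith S fun p => p % 4 = 1 ∧ ¬ p % 6 = 1) := fun p hp =>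
      hC.2 p (mem_primesWith.mp hp).1 fun h => (mem_primesWith.mp hp).2.2 h.1
    rw [ite_isSquare_eq hS _ _ hC.1 hE1, ite_isSquare_eq hS _ _ (fun p hp => (hC.1 p hp).symm) hE2,
      if_pos hC, if_neg h1,
      show formula23 S = _ from if_pos ⟨hlt, fun p hp => (hC.1 p hp).symm, hE2, hE1⟩,
      hK, four_zpow_pred, two_zpow_add_sub_two, two_zpow_add_sub_two,
      add_comm (primesWith S fun p => p % 6 = 1 ∧ ¬ p % 4 = 1).card]
    simp only [ne_eq]
    split_ifs <;> ring
  · rw [if_neg hC, if_neg h1, show formula23 S = 0 from if_neg ?_]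
    · have hz : ∀ c : ℕ → Prop, ∀ [DecidablePred c],
          (∀ p, c p → p % 6 = 1 ∨ p % 4 = 1) → (if IsSquare S then
          if ∀ p ∈ S.primeFactors, c p then (2 : ℚ) ^ S.primeFactors.card else 0 else 0) = 0 := by
        intro c _ hc
        split_ifs with h4 h5
        · exact absurd ⟨fun p hp => hc p (h5 p hp), fun p hp _ =>
            (isSquare_iff_allEven hS).mp h4 p hp⟩ hC
        · rfl
        · rfl
      rw [hz _ fun p h => Or.inl h, hz _ fun p h => Or.inr h]
      norm_num
    · rintro ⟨-, h4, h5, h6⟩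
      refine hC ⟨fun p hp => (h4 p hp).symm, fun p hp h => ?_⟩
      rcases h4 p hp with h7 | h7
      · exact h5 p (mem_primesWith.mpr ⟨hp, h7, fun h8 => h ⟨h8, h7⟩⟩)
      · exact h6 p (mem_primesWith.mpr ⟨hp, h7, fun h8 => h ⟨h7, h8⟩⟩)

theorem formula23_of_not_odd (hS : S ≠ 0) (hodd : ¬ Odd S) : formula23 S = 0 :=
  if_neg fun h => absurd (h.2.1 2 (two_mem_primeFactors hS hodd)) (by decide)

/-- If every prime is of one kind only, S is a square and the main term 2^k cancels against the
correction, so the value 0 prescribed in that case is correct. -/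
theorem nF_three_four_eq_formula (hodd : Odd S) : nF 3 4 S = formula34 S := by
  have hS := hodd.pos.ne'
  rw [nF_three_four_eq hodd, lcmSum_one_two_eq hodd]
  have hsf1 := squareFormula_eq hS fun p => p % 4 = 1
  have hsf2 := squareFormula_eq hS OneThreeModEight
  rw [← rootFun_one_eq hodd] at hsf1
  rw [← rootFun_two_eq hodd] at hsf2
  rcases eq_or_ne S 1 with rfl | h1
  · simp [formula34, expProd, primesWith, rootFun_at_one]
  have hne := Nat.nonempty_primeFactors.mpr (show 1 < S by omega)
  have hK2 : (primesWith S fun p => p % 8 = 3) =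
      primesWith S fun p => OneThreeModEight p ∧ ¬ p % 4 = 1 :=
    primesWith_congr fun p _ => by unfold OneThreeModEight; omega
  have hK3 : (primesWith S fun p => p % 8 = 1) =
      primesWith S fun p => p % 4 = 1 ∧ OneThreeModEight p :=
    primesWith_congr fun p _ => by unfold OneThreeModEight; omega
  by_cases hC : (∀ p ∈ S.primeFactors, p % 4 = 1 ∨ OneThreeModEight p) ∧
      ∀ p ∈ S.primeFactors, ¬ (p % 4 = 1 ∧ OneThreeModEight p) → Even (S.factorization p)
  · rw [if_pos hC, if_neg h1]
    by_cases h3 : ∃ p ∈ S.primeFactors, p % 4 = 1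
    · by_cases h4 : ∃ p ∈ S.primeFactors, OneThreeModEight p
      · have hE1 : AllEven S (primesWith S fun p => p % 4 = 1 ∧ ¬ OneThreeModEight p) :=
          fun p hp => hC.2 p (mem_primesWith.mp hp).1 fun h => (mem_primesWith.mp hp).2.2 h.2
        have hE2 : AllEven S (primesWith S fun p => p % 8 = 3) := by
          rw [hK2]
          exact fun p hp =>
            hC.2 p (mem_primesWith.mp hp).1 fun h => (mem_primesWith.mp hp).2.2 h.1
        rw [show formula34 S = _ from if_pos ⟨hC.1, hE1, hE2, h3, h4⟩, hsf1, hsf2, hK2, hK3,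
          four_zpow_pred, if_neg h1]
        split_ifs <;> ring
      · rw [show formula34 S = 0 from if_neg fun h => h4 h.2.2.2.2]
        replace h4 : ∀ p ∈ S.primeFactors, ¬ OneThreeModEight p := fun p hp h => h4 ⟨p, hp, h⟩
        have h5 : ∀ p ∈ S.primeFactors, p % 4 = 1 := fun p hp =>
          (hC.1 p hp).resolve_right (h4 p hp)
        have hsq : IsSquare S := (isSquare_iff_allEven hS).mpr fun p hp =>
          hC.2 p hp fun h => h4 p hp h.2
        rw [if_pos hsq, rootFun_one_eq hodd, rootFun_two_eq hodd, if_pos h5,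
          ite_forall_eq_zero hne h4, primesWith_eq_primeFactors fun p hp => ⟨h5 p hp, h4 p hp⟩,
          primesWith_eq_empty fun p hp h => h4 p hp h.1,
          primesWith_eq_empty fun p hp h => h4 p hp h.2]
        simp [expProd]
    · rw [show formula34 S = 0 from if_neg fun h => h3 h.2.2.2.1]
      push Not at h3
      have h5 : ∀ p ∈ S.primeFactors, OneThreeModEight p := fun p hp =>
        (hC.1 p hp).resolve_left (h3 p hp)
      have hsq : IsSquare S := (isSquare_iff_allEven hS).mpr fun p hp =>
        hC.2 p hp fun h => h3 p hp h.1
      rw [if_pos hsq, rootFun_one_eq hodd, rootFun_two_eq hodd, if_pos h5,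
        ite_forall_eq_zero hne h3, primesWith_eq_empty fun p hp h => h3 p hp h.1,
        primesWith_eq_primeFactors (P := fun p => OneThreeModEight p ∧ ¬ p % 4 = 1)
          fun p hp => ⟨h5 p hp, h3 p hp⟩,
        primesWith_eq_empty fun p hp h => h3 p hp h.1]
      simp [expProd]
  · rw [if_neg hC, if_neg h1, show formula34 S = 0 from if_neg ?_]
    · have hz : IsSquare S → rootFun 1 S = 0 ∧ rootFun 2 S = 0 := by
        intro hsq
        have he := (isSquare_iff_allEven hS).mp hsq
        rw [rootFun_one_eq hodd, rootFun_two_eq hodd]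
        exact ⟨if_neg fun h => hC ⟨fun p hp => Or.inl (h p hp), fun p hp _ => he p hp⟩,
          if_neg fun h => hC ⟨fun p hp => Or.inr (h p hp), fun p hp _ => he p hp⟩⟩
      split_ifs with hsq
      · rw [(hz hsq).1, (hz hsq).2]
        norm_num
      · norm_num
    · rintro ⟨h4, h5, h6, -, -⟩
      rw [hK2] at h6
      refine hC ⟨h4, fun p hp h => ?_⟩
      rcases h4 p hp with h7 | h7
      · exact h5 p (mem_primesWith.mpr ⟨hp, h7, fun h8 => h ⟨h7, h8⟩⟩)
      · exact h6 p (mem_primesWith.mpr ⟨hp, h7, fun h8 => h ⟨h8, h7⟩⟩)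

theorem formula34_of_not_odd (hS : S ≠ 0) (hodd : ¬ Odd S) : formula34 S = 0 :=
  if_neg fun h => absurd (h.1 2 (two_mem_primeFactors hS hodd)) (by decide)

theorem nF_two_four_eq_formula (hodd : Odd S) : nF 2 4 S = formula24 S := by
  have hS := hodd.pos.ne'
  rw [nF_two_four_eq hodd, lcmSum_three_two_eq hodd]
  have hf12 := formula12_eq hodd
  have hf14 := formula14_eq hodd
  have h13 : OneThreeModEight 3 := Or.inr rfl
  have hsf : squareFormula (fun p => p % 6 = 1) S =
      if IsSquare S then (rootFun 3 S - if S = 1 then 1 else 0) / 2 else 0 := by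
    rw [squareFormula_eq hS]
    by_cases h1 : IsSquare S
    · rw [if_pos h1, if_pos h1, rootFun_three_of_isSquare hodd h1]
    · rw [if_neg h1, if_neg h1]
  have hsf2 := squareFormula_eq hS OneThreeModEight
  rw [← rootFun_two_eq hodd] at hsf2
  rcases eq_or_ne S 1 with rfl | h1
  · simp [formula24, expProd, primesWith, rootFun_at_one]
  rcases eq_or_ne S 3 with rfl | h3
  · simp [formula24, expProd, primesWith, rootFun_at_three, Nat.prime_three.primeFactors,
      square_values_one, Finset.filter_singleton, h13]
  have hne := Nat.nonempty_primeFactors.mpr (show 1 < S by omega)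
  have hns := not_isSquare_of_isSquare_div_three hS
  rw [if_neg h1] at hsf hsf2 ⊢
  rw [if_neg h3] at hf12 hf14 ⊢
  by_cases hC : (∀ p ∈ S.primeFactors, p % 6 = 1 ∨ OneThreeModEight p) ∧
      ∀ p ∈ S.primeFactors, ¬ (p % 6 = 1 ∧ OneThreeModEight p) →
        Even (S.factorization p) ∨ p = 3
  · rw [if_pos hC]
    by_cases h4 : ∃ p ∈ S.primeFactors, p % 6 = 1
    · by_cases h5 : ∃ p ∈ S.primeFactors, OneThreeModEight p
      · have hE1 : AllEven S (primesWith S fun p => p % 6 = 1 ∧ ¬ OneThreeModEight p) := by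
          intro p hp
          obtain ⟨hp, h6, h7⟩ := mem_primesWith.mp hp
          refine (hC.2 p hp fun h => h7 h.2).resolve_right ?_
          rintro rfl
          exact h7 h13
        have hE2 : AllEven S ((primesWith S fun p => OneThreeModEight p ∧ p % 6 ≠ 1).erase 3) := by
          intro p hp
          obtain ⟨hp3, hp⟩ := Finset.mem_erase.mp hp
          obtain ⟨hp, h6, h7⟩ := mem_primesWith.mp hp
          exact (hC.2 p hp fun h => h7 h.1).resolve_right hp3
        rw [show formula24 S = _ from if_pos ⟨hC.1, hE1, hE2, h4, h5⟩, hsf, hsf2, hf12, hf14,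
          four_zpow_pred]
        simp only [ne_eq]
        split_ifs <;> ring
      · rw [show formula24 S = 0 from if_neg fun h => h5 h.2.2.2.2]
        replace h5 : ∀ p ∈ S.primeFactors, ¬ OneThreeModEight p := fun p hp h => h5 ⟨p, hp, h⟩
        have h6 : ∀ p ∈ S.primeFactors, p % 6 = 1 := fun p hp =>
          (hC.1 p hp).resolve_right (h5 p hp)
        have hsq : IsSquare S := (isSquare_iff_allEven hS).mpr fun p hp => by
          refine (hC.2 p hp fun h => h5 p hp h.2).resolve_right ?_
          rintro rfl
          exact h5 3 hp h13
        rw [if_pos hsq, if_neg (hns hsq), rootFun_three_of_isSquare hodd hsq,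
          rootFun_two_eq hodd, if_pos h6,
          ite_forall_eq_zero hne h5, primesWith_eq_primeFactors fun p hp => ⟨h6 p hp, h5 p hp⟩,
          primesWith_eq_empty fun p hp h => h5 p hp h.1,
          primesWith_eq_empty fun p hp h => h5 p hp h.2]
        simp [expProd]
    · rw [show formula24 S = 0 from if_neg fun h => h4 h.2.2.2.1]
      push Not at h4
      have h5 : ∀ p ∈ S.primeFactors, OneThreeModEight p := fun p hp =>
        (hC.1 p hp).resolve_left (h4 p hp)
      have hE : AllEven S (primesWith S fun p => p ≠ 3) := fun p hp => by
        obtain ⟨hp, hp3⟩ := mem_primesWith.mp hp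
        exact (hC.2 p hp fun h => h4 p hp h.1).resolve_right hp3
      rw [primesWith_eq_empty fun p hp h => h4 p hp h.1,
        primesWith_eq_primeFactors (P := fun p => OneThreeModEight p ∧ ¬ p % 6 = 1)
          fun p hp => ⟨h5 p hp, h4 p hp⟩,
        primesWith_eq_empty fun p hp h => h4 p hp h.1]
      by_cases h6 : Even (S.factorization 3)
      · have hsq := (isSquare_iff_even_three hS).mpr ⟨h6, hE⟩
        rw [if_pos hsq, if_neg (hns hsq), rootFun_three_of_isSquare hodd hsq,
          ite_forall_eq_zero hne h4, rootFun_two_eq hodd, if_pos h5]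
        simp [expProd]
      -- S = 3a² with a > 1: no prime is ≡ 1 (mod 6), so the root count for -3 vanishes and the main
      -- term 2^k cancels against the root count for -2.
      · have hdia := (isSquare_div_three_iff hS).mpr ⟨h6, hE⟩
        have hlt : 1 < S / 3 := by
          obtain ⟨n, rfl⟩ := hdia.1
          omega
        rw [if_neg fun h => hns h hdia, if_pos hdia,
          rootFun_three_of_isSquare_div_three hodd hdia.1,
          ite_forall_eq_zero (Nat.nonempty_primeFactors.mpr hlt) fun p hp => h4 p
            (Nat.primeFactors_mono (Nat.div_dvd_of_dvd hdia.1) hS hp),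
          rootFun_two_eq hodd, if_pos h5]
        simp [expProd]
  · rw [if_neg hC, show formula24 S = 0 from if_neg ?_]
    · have hE : AllEven S (primesWith S fun p => p ≠ 3) → rootFun 2 S = 0 := fun he => by
        rw [rootFun_two_eq hodd]
        refine if_neg fun h => hC ⟨fun p hp => Or.inr (h p hp), fun p hp _ => ?_⟩
        rw [or_iff_not_imp_right]
        exact fun hp3 => he p (mem_primesWith.mpr ⟨hp, hp3⟩)
      have hE3 : AllEven S (primesWith S fun p => p ≠ 3) → rootFun 3 S = 0 := fun he => by
        rw [rootFun_three_eq hodd]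
        refine if_neg fun h => hC ⟨fun p hp => ?_, fun p hp _ => ?_⟩
        · by_cases hp3 : p = 3
          · exact Or.inr (hp3 ▸ h13)
          · exact Or.inl (h.2 p (mem_primesWith.mpr ⟨hp, hp3⟩))
        · rw [or_iff_not_imp_right]
          exact fun hp3 => he p (mem_primesWith.mpr ⟨hp, hp3⟩)
      split_ifs with h4 h5 h5
      · exact absurd h5 (hns h4)
      · have he := ((isSquare_iff_even_three hS).mp h4).2
        rw [hE he, hE3 he]
        norm_num
      · have he := ((isSquare_div_three_iff hS).mp h5).2
        rw [hE he, hE3 he]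
        norm_num
      · norm_num
    · rintro ⟨h4, h5, h6, -, -⟩
      refine hC ⟨h4, fun p hp h => ?_⟩
      rw [or_iff_not_imp_right]
      intro hp3
      rcases h4 p hp with h7 | h7
      · exact h5 p (mem_primesWith.mpr ⟨hp, h7, fun h8 => h ⟨h7, h8⟩⟩)
      · exact h6 p (Finset.mem_erase.mpr ⟨hp3, mem_primesWith.mpr ⟨hp, h7, fun h8 => h ⟨h8, h7⟩⟩⟩)

theorem formula24_of_not_odd (hS : S ≠ 0) (hodd : ¬ Odd S) : formula24 S = 0 :=
  if_neg fun h => absurd (h.1 2 (two_mem_primeFactors hS hodd)) (by decide)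

end Formulas

/-! ### Total numbers and the general type -/

section Totals

variable {S : ℕ}

theorem cubicCount_eq (hodd : Odd S) : cubicCount S = cubicFun S := if_pos hodd

theorem cubicProd_eq_mul (S : ℕ) (c : ℕ → Prop) [DecidablePred c] : cubicProd S S.primeFactors =
    cubicProd S (primesWith S c) * cubicProd S (primesWith S fun p => ¬ c p) :=
  (Finset.prod_filter_mul_prod_filter_not _ _ _).symm

theorem allEven_primeFactors_eq (S : ℕ) (c : ℕ → Prop) [DecidablePred c] :
    AllEven S S.primeFactors ↔
      AllEven S (primesWith S c) ∧ AllEven S (primesWith S fun p => ¬ c p) := by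
  refine ⟨fun h => ⟨fun p hp => h p (Finset.mem_filter.mp hp).1,
    fun p hp => h p (Finset.mem_filter.mp hp).1⟩, fun h p hp => ?_⟩
  by_cases hc : c p
  · exact h.1 p (Finset.mem_filter.mpr ⟨hp, hc⟩)
  · exact h.2 p (Finset.mem_filter.mpr ⟨hp, hc⟩)

theorem lcmSum_typeCount_zero_cubicFun (hodd : Odd S) :
    lcmSum (typeCount 0) cubicFun S = mF0 S := by
  rw [lcmSum_comm, lcmSum_typeCount_zero hodd, mF0, cubicCount_eq hodd]

theorem lcmSum_typeCount_one_cubicFun (hodd : Odd S) :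
    lcmSum (typeCount 1) cubicFun S = mF1 S := by
  rw [lcmSum_comm, lcmSum_typeCount_one hodd, mF1, cubicCount_eq hodd, mul_ite, mul_zero]

theorem lcmSum_typeCount_three_cubicFun (hodd : Odd S) :
    lcmSum (typeCount 3) cubicFun S = mF3 S := by
  rw [lcmSum_comm, lcmSum_typeCount_three hodd, lcmSum_comm, lcmSum_one_cubicFun_eq hodd,
    cubicFun, cubicProd_eq_mul S fun p => p % 4 = 1]
  simp only [isSquare_iff_allEven hodd.pos.ne', allEven_primeFactors_eq S fun p => p % 4 = 1]
  by_cases hJ : AllEven S (primesWith S fun p => p % 4 ≠ 1)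
  · rw [if_pos hJ, show mF3 S = _ from if_pos ⟨hodd, hJ⟩]
    by_cases hI : AllEven S (primesWith S fun p => p % 4 = 1)
    · rw [if_pos ⟨hI, hJ⟩, if_pos hI]
      simp only [ne_eq]
      ring
    · rw [if_neg (fun h => hI h.1), if_neg hI]
      ring
  · rw [if_neg hJ, show mF3 S = 0 from if_neg fun h => hJ h.2, if_neg fun h => hJ h.2]
    norm_num

theorem lcmSum_typeCount_four_cubicFun (hodd : Odd S) :
    lcmSum (typeCount 4) cubicFun S = mF4 S := by
  have hS := hodd.pos.ne'
  rw [lcmSum_comm, lcmSum_typeCount_four hodd, lcmSum_comm, lcmSum_two_cubicFun_eq hodd]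
  by_cases hJ : AllEven S (primesWith S fun p => ¬ OneThreeModEight p)
  · rw [if_pos hJ, show mF4 S = _ from if_pos ⟨hodd, hJ⟩, cubicCount_eq hodd]
    split_ifs <;> ring
  -- An odd exponent at a prime that is not ≡ 1, 3 (mod 8), hence different from 3, prevents S from
  -- being a square or three times a square, so both corrections vanish too.
  · rw [if_neg hJ, show mF4 S = 0 from if_neg fun h => hJ h.2, if_neg ?_, if_neg ?_]
    · norm_num
    · rw [isSquare_div_three_iff hS]
      rintro ⟨-, h⟩
      refine hJ fun p hp => h p ?_
      rw [mem_primesWith] at hp ⊢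
      refine ⟨hp.1, ?_⟩
      rintro rfl
      exact hp.2 (Or.inr rfl)
    · rw [isSquare_iff_allEven hS]
      exact fun h => hJ (h.mono (primesWith_subset S _))

theorem lcmSum_typeCount_two_cubicFun (hodd : Odd S) :
    lcmSum (typeCount 2) cubicFun S = mF2 S := by
  have hS := hodd.pos.ne'
  rw [lcmSum_comm, lcmSum_typeCount_two hodd, lcmSum_comm, lcmSum_three_cubicFun_eq hodd]
  have hI : (primesWith S fun p => p % 6 = 1) =
      (primesWith S fun p => p ≠ 3).filter (fun p => p % 6 = 1) := by
    rw [filter_primesWith]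
    refine primesWith_congr fun p _ => (and_iff_right_of_imp ?_).symm
    rintro h rfl
    norm_num at h
  have hJ : (primesWith S fun p => p % 6 ≠ 1 ∧ p ≠ 3) =
      (primesWith S fun p => p ≠ 3).filter (fun p => ¬ p % 6 = 1) := by
    rw [filter_primesWith]
    exact primesWith_congr fun p _ => and_comm
  have hF : cubicFun S = (if S.factorization 3 = 0 then 1 else 4 * 3 ^ (S.factorization 3 - 1)) *
      (cubicProd S (primesWith S fun p => p % 6 = 1) *
        cubicProd S (primesWith S fun p => p % 6 ≠ 1 ∧ p ≠ 3)) := by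
    rw [cubicFun, cubicProd, primeFactors_eq_of_factorization_three hodd, hI, hJ, cubicProd,
      cubicProd, Finset.prod_filter_mul_prod_filter_not]
    norm_num
  have hE : AllEven S (primesWith S fun p => p ≠ 3) ↔
      AllEven S (primesWith S fun p => p % 6 = 1) ∧
        AllEven S (primesWith S fun p => p % 6 ≠ 1 ∧ p ≠ 3) := by
    rw [hI, hJ]
    refine ⟨fun h => ⟨fun p hp => h p (Finset.mem_filter.mp hp).1,
      fun p hp => h p (Finset.mem_filter.mp hp).1⟩, fun h p hp => ?_⟩
    by_cases hc : p % 6 = 1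
    · exact h.1 p (Finset.mem_filter.mpr ⟨hp, hc⟩)
    · exact h.2 p (Finset.mem_filter.mpr ⟨hp, hc⟩)
  -- The corrections at 1 and at 3 occur for even and for odd exponents of 3 respectively. Together
  -- they depend only on the other exponents, so `mF2` needs a single δ.
  have hsum : (if IsSquare S then cubicFun S else 0) +
      (if 3 ∣ S ∧ IsSquare (S / 3) then cubicFun S else 0) =
      if AllEven S (primesWith S fun p => p ≠ 3) then cubicFun S else 0 := by
    simp only [isSquare_div_three_iff hS, isSquare_iff_even_three hS]
    by_cases h1 : Even (S.factorization 3) <;> simp only [h1, not_true, not_false_iff, true_and,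
      false_and, if_false, add_zero, zero_add]
  rw [sub_sub, hsum]
  by_cases hJe : AllEven S (primesWith S fun p => p % 6 ≠ 1 ∧ p ≠ 3)
  · rw [if_pos hJe, show mF2 S = _ from if_pos ⟨hodd, hJe⟩]
    by_cases hIe : AllEven S (primesWith S fun p => p % 6 = 1)
    · rw [if_pos (hE.mpr ⟨hIe, hJe⟩), if_pos hIe, hF]
      ring
    · rw [if_neg (fun h => hIe (hE.mp h).1), if_neg hIe]
      ring
  · rw [if_neg hJe, if_neg fun h => hJe (hE.mp h).2,
      show mF2 S = 0 from if_neg fun h => hJe h.2]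
    norm_num

theorem sum_castSucc_add (hodd : Odd S) (i : Fin 6) :
    ∑ j : Fin 5, gF i j.castSucc * nF i j.castSucc S + gF i 5 * nF i 5 S =
      lcmSum (typeCount i) cubicFun S := by
  rw [← sum_gF_mul_nF hodd]
  exact (Fin.sum_univ_castSucc fun j : Fin 6 => gF i j * nF i j S).symm

/-- The number of classes with exactly one general quaternion, from the total `m`. -/
theorem nF_five_eq (hS : S ≠ 0) (i : Fin 6) {m : ℕ → ℚ}
    (hm : ∀ {S}, Odd S → lcmSum (typeCount i) cubicFun S = m S) (hm' : ¬ Odd S → m S = 0)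
    (hg : gF i 5 ≠ 0) : nF i 5 S =
      1 / gF i 5 * (m S - ∑ j : Fin 5, gF i j.castSucc * nF i j.castSucc S) := by
  by_cases hodd : Odd S
  · rw [← hm hodd, ← sum_castSucc_add hodd, add_sub_cancel_left, ← mul_assoc, one_div_mul_cancel hg,
      one_mul]
  · rw [hm' hodd]
    simp [nF_eq_zero_of_not_odd hS hodd]

theorem nF_zero_five_eq_zero (hS : S ≠ 0) (h : ¬ IsSquare S) : nF 0 5 S = 0 := by
  by_cases hodd : Odd S
  · refine nF_eq_zero_of_lcmSum_eq_zero hS ?_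
    rw [lcmSum_comm, lcmSum_typeCount_zero hodd, if_neg h]
  · exact nF_eq_zero_of_not_odd hS hodd 0 5

theorem nF_one_five_eq_zero (hS : S ≠ 0) (h : ¬ ∃ a, S = 3 * a ^ 2) : nF 1 5 S = 0 := by
  by_cases hodd : Odd S
  · refine nF_eq_zero_of_lcmSum_eq_zero hS ?_
    rw [lcmSum_comm, lcmSum_typeCount_one hodd, if_neg, mul_zero]
    rintro ⟨h3, a, ha⟩
    exact h ⟨a, by rw [pow_two, ← ha, Nat.mul_div_cancel' h3]⟩
  · exact nF_eq_zero_of_not_odd hS hodd 1 5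

theorem fF_eq_sum (hS : S ≠ 0) : fF S = ∑ i : Fin 6, ∑ j : Fin 6, gF i j * nF i j S := by
  by_cases hodd : Odd S
  · exact (sum_sum_gF_mul_nF hodd).symm
  · rw [fF, if_neg hodd]
    simp [nF_eq_zero_of_not_odd hS hodd]

theorem ncard_rotationClasses_eq (hS : S ≠ 0) : ((rotationClasses S).ncard : ℚ) = fF S := by
  rw [ncard_rotationClasses hS, fF_eq_sum hS]
  push_cast
  exact Finset.sum_congr rfl fun i _ => Finset.sum_congr rfl fun j _ =>
    ncard_leftClasses (finite_leftClasses_and_ncard hS i j).1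

theorem finite_rotationClasses (hS : S ≠ 0) : (rotationClasses S).Finite := by
  rw [rotationClasses_eq]
  exact Set.finite_iUnion fun x => (finite_leftClasses_and_ncard hS x.1 x.2).1

theorem finite_classes (hS : S ≠ 0) (i j : Fin 6) : (classes i j S).Finite := by
  rw [classes_eq_image]
  exact (finite_leftClasses_and_ncard hS i j).1.image _

end Totals

end HypercubicCSL

/-! ### Assembly of the main theorem -/

theorem mainTheorem5 (S : ℕ) (hS : 0 < S) :
    -- all the sets that are counted are finite, and the numbers are symmetric
    (HypercubicCSL.rotationClasses S).Finite ∧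
    (∀ i j : Fin 6, (HypercubicCSL.classes i j S).Finite ∧
      HypercubicCSL.nF i j S = HypercubicCSL.nF j i S) ∧
    -- meaning of the numbers `g i j`: size of the equivalence classes
    (∀ i j : Fin 6, ∀ R : HypercubicCSL.SO4, HypercubicCSL.IsCoincidence R →
      HypercubicCSL.RotHasType i j R →
      ((DoubleCoset.doubleCoset R (HypercubicCSL.GF : Set HypercubicCSL.SO4)
        (HypercubicCSL.GF : Set HypercubicCSL.SO4)).ncard : ℚ) = 576 * HypercubicCSL.gF i j) ∧
    -- pairs of special types
    HypercubicCSL.nF 0 0 S = (if S = 1 then 1 else 0) ∧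
    HypercubicCSL.nF 0 1 S = 0 ∧
    HypercubicCSL.nF 0 2 S = HypercubicCSL.squareFormula (fun p => p % 6 = 1) S ∧
    HypercubicCSL.nF 0 3 S = HypercubicCSL.squareFormula (fun p => p % 4 = 1) S ∧
    HypercubicCSL.nF 0 4 S = HypercubicCSL.squareFormula (fun p => p % 8 = 1 ∨ p % 8 = 3) S ∧
    HypercubicCSL.nF 1 1 S = (if S = 3 then 1 else 0) ∧
    HypercubicCSL.nF 1 2 S = HypercubicCSL.formula12 S ∧
    HypercubicCSL.nF 1 3 S = 0 ∧
    HypercubicCSL.nF 1 4 S = HypercubicCSL.formula14 S ∧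
    HypercubicCSL.nF 2 2 S = HypercubicCSL.formula22 S ∧
    HypercubicCSL.nF 2 3 S = HypercubicCSL.formula23 S ∧
    HypercubicCSL.nF 2 4 S = HypercubicCSL.formula24 S ∧
    HypercubicCSL.nF 3 3 S = HypercubicCSL.formula33 S ∧
    HypercubicCSL.nF 3 4 S = HypercubicCSL.formula34 S ∧
    HypercubicCSL.nF 4 4 S = HypercubicCSL.formula44 S ∧
    -- pairs with exactly one general quaternion
    (¬ IsSquare S → HypercubicCSL.nF 0 5 S = 0) ∧
    (¬ (∃ a : ℕ, S = 3 * a ^ 2) → HypercubicCSL.nF 1 5 S = 0) ∧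
    HypercubicCSL.nF 0 5 S = 1 / 24 * (HypercubicCSL.mF0 S -
      ∑ i : Fin 5, HypercubicCSL.gF 0 i.castSucc * HypercubicCSL.nF 0 i.castSucc S) ∧
    HypercubicCSL.nF 1 5 S = 1 / 96 * (HypercubicCSL.mF1 S -
      ∑ i : Fin 5, HypercubicCSL.gF 1 i.castSucc * HypercubicCSL.nF 1 i.castSucc S) ∧
    HypercubicCSL.nF 2 5 S = 1 / 96 * (HypercubicCSL.mF2 S -
      ∑ i : Fin 5, HypercubicCSL.gF 2 i.castSucc * HypercubicCSL.nF 2 i.castSucc S) ∧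
    HypercubicCSL.nF 3 5 S = 1 / 144 * (HypercubicCSL.mF3 S -
      ∑ i : Fin 5, HypercubicCSL.gF 3 i.castSucc * HypercubicCSL.nF 3 i.castSucc S) ∧
    HypercubicCSL.nF 4 5 S = 1 / 288 * (HypercubicCSL.mF4 S -
      ∑ i : Fin 5, HypercubicCSL.gF 4 i.castSucc * HypercubicCSL.nF 4 i.castSucc S) ∧
    -- the total number, which determines the number of pairs with two general quaternions
    ((HypercubicCSL.rotationClasses S).ncard : ℚ) = HypercubicCSL.fF S ∧
    HypercubicCSL.fF S =
      ∑ i : Fin 6, ∑ j : Fin 6, HypercubicCSL.gF i j * HypercubicCSL.nF i j S := by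
  have hS0 : S ≠ 0 := hS.ne'
  -- Every index is an lcm of odd numbers, so for even S both sides of each formula are 0 and only
  -- odd S needs an argument.
  open HypercubicCSL in
  have hne : ∀ {i j : Fin 6} {x : ℚ}, (Odd S → nF i j S = x) → (¬ Odd S → x = 0) →
      nF i j S = x := fun {i j x} h h' => by
    by_cases hodd : Odd S
    · exact h hodd
    · rw [nF_eq_zero_of_not_odd hS0 hodd, h' hodd]
  have hsq : ∀ {P : ℕ → Prop} [DecidablePred P], ¬ P 2 → ¬ Odd S →
      HypercubicCSL.squareFormula P S = 0 :=
    fun h hodd => HypercubicCSL.squareFormula_of_not_odd hS0 hodd h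
  refine ⟨HypercubicCSL.finite_rotationClasses hS0, fun i j =>
    ⟨HypercubicCSL.finite_classes hS0 i j, HypercubicCSL.nF_symm hS0 i j⟩, ?_, ?_⟩
  · rintro i j R - ⟨p, q, hpq, hi, hj, hR⟩
    rw [HypercubicCSL.ncard_doubleCoset, Nat.cast_mul, HypercubicCSL.ncard_cosetOrbit hpq hi hj hR]
    norm_num
  refine ⟨hne HypercubicCSL.nF_zero_zero_eq fun h => if_neg ?_, HypercubicCSL.nF_zero_one hS0,
    hne (fun h => ?_) (hsq (by decide)), hne (fun h => ?_) (hsq (by decide)),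
    hne (fun h => ?_) (hsq (by decide)), hne HypercubicCSL.nF_one_one_eq fun h => if_neg ?_,
    hne (fun h => ?_) HypercubicCSL.formula12_of_not_odd,
    hne HypercubicCSL.nF_one_three_eq fun _ => rfl,
    hne (fun h => ?_) HypercubicCSL.formula14_of_not_odd,
    hne HypercubicCSL.nF_two_two_eq_formula (HypercubicCSL.formula22_of_not_odd hS0),
    hne HypercubicCSL.nF_two_three_eq_formula (HypercubicCSL.formula23_of_not_odd hS0),
    hne HypercubicCSL.nF_two_four_eq_formula (HypercubicCSL.formula24_of_not_odd hS0),
    hne HypercubicCSL.nF_three_three_eq_formula (HypercubicCSL.formula33_of_not_odd hS0),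
    hne HypercubicCSL.nF_three_four_eq_formula (HypercubicCSL.formula34_of_not_odd hS0),
    hne HypercubicCSL.nF_four_four_eq_formula (HypercubicCSL.formula44_of_not_odd hS0),
    HypercubicCSL.nF_zero_five_eq_zero hS0, HypercubicCSL.nF_one_five_eq_zero hS0,
    HypercubicCSL.nF_five_eq hS0 0 HypercubicCSL.lcmSum_typeCount_zero_cubicFun (fun h => ?_) ?_,
    HypercubicCSL.nF_five_eq hS0 1 HypercubicCSL.lcmSum_typeCount_one_cubicFun (fun h => ?_) ?_,
    HypercubicCSL.nF_five_eq hS0 2 HypercubicCSL.lcmSum_typeCount_two_cubicFun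
      (fun h => if_neg fun h' => h h'.1) ?_,
    HypercubicCSL.nF_five_eq hS0 3 HypercubicCSL.lcmSum_typeCount_three_cubicFun
      (fun h => if_neg fun h' => h h'.1) ?_,
    HypercubicCSL.nF_five_eq hS0 4 HypercubicCSL.lcmSum_typeCount_four_cubicFun
      (fun h => if_neg fun h' => h h'.1) ?_,
    HypercubicCSL.ncard_rotationClasses_eq hS0, HypercubicCSL.fF_eq_sum hS0⟩
  · rintro rfl
    exact h odd_one
  · rw [HypercubicCSL.nF_zero_two_eq h, HypercubicCSL.squareFormula_eq hS0]
    by_cases h1 : IsSquare S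
    · rw [if_pos h1, if_pos h1, HypercubicCSL.rootFun_three_of_isSquare h h1]
    · rw [if_neg h1, if_neg h1]
  · rw [HypercubicCSL.nF_zero_three_eq h, HypercubicCSL.squareFormula_eq hS0,
      HypercubicCSL.rootFun_one_eq h]
  · rw [HypercubicCSL.nF_zero_four_eq h, HypercubicCSL.squareFormula_eq hS0,
      HypercubicCSL.rootFun_two_eq h]
  · rintro rfl
    exact h (by decide)
  · rw [HypercubicCSL.nF_one_two_eq h, HypercubicCSL.formula12_eq h]
  · rw [HypercubicCSL.nF_one_four_eq h, HypercubicCSL.formula14_eq h]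
  · rw [HypercubicCSL.mF0, HypercubicCSL.cubicCount, if_neg h, ite_self]
  · exact HypercubicCSL.gF_ne_zero (by decide) (by decide)
  · rw [HypercubicCSL.mF1, HypercubicCSL.cubicCount, if_neg h, mul_zero, ite_self]
  all_goals exact HypercubicCSL.gF_ne_zero (by decide) (by decide)
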